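/- **Setting.** Let $\mathcal O\mapsto\mathfrak A(\mathcal O)$ be a local net of von Neumann algebras on a Hilbert space $\mathcal H$, indexed by the bounded open regions of Minkowski space $\mathbb R^{1+s}$, in the vacuum sector: there is a strongly continuous unitary representation $U(x,\Lambda)$ of the proper orthochronous Poincaré group with an invariant unit vector $\Omega$, and isotony, locality, covariance, positivity of energy (the joint spectrum of the $P_\mu$, $U(x,1)=e^{iP_\mu x^\mu}$, lies in the closed forward light cone) and uniqueness of $\Omega$ up to a phase as a translation-invariant unit vector hold. Let $U(t)=e^{itH}$ be the time translations, $R=(1+H)^{-1}$, $P(E)$ the spectral projector of $H$ for $[0,E]$, $\mathcal O_r$ the double cone of radius $r$ centred at $0$ and $\mathfrak A(r)=\mathfrak A(\mathcal O_r)$. Let $\Sigma$ be the space of ultraweakly continuous functionals on $\mathfrak B(\mathcal H)$, $\Sigma(E)=\{\sigma(P(E)\,\cdot\,P(E)) : \sigma\in\Sigma\}$, $\Sigma_\ell=\{\sigma\in\Sigma : \|\sigma\|_\ell:=\|\sigma((1+H)^\ell\cdot(1+H)^\ell)\|<\infty\}$, and $C^\infty(\Sigma)=\bigcap_\ell\Sigma_\ell$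 with the Fréchet topology of these norms. Its dual $C^\infty(\Sigma)^*=\bigcup_\ell\Sigma_\ell^*$ contains $\mathfrak B(\mathcal H)$ and carries the weak-$*$ topology, the conjugation $\phi^*(\sigma)=\overline{\phi(\sigma^*)}$, where $\sigma^*(A)=\overline{\sigma(A^*)}$, and the dual norms $\|\phi\|_{-\ell}=\|R^\ell\phi R^\ell\|$. Assume the microscopic phase space condition: for each $\gamma\ge0$ there is a continuous linear map $\psi:C^\infty(\Sigma)\to\Sigma$ of finite rank such that for all sufficiently large $\ell$ $$ r^{-\gamma}\,\|(\Xi-\psi)\lceil\mathfrak A(r)\|_\ell\to0\quad\text{as } r\to0, \qquad (*)$$ where $\Xi:C^\infty(\Sigma)\to\Sigma$ is the inclusion. Let $\Phi_\gamma\subset C^\infty(\Sigma)^*$ be the image of the dual map $\psi^*:\mathfrak B(\mathcal H)\to C^\infty(\Sigma)^*$ of a $\psi$ of minimal rank with $(*)$, and let $\Phi_{\mathrm{FH}}=\bigcup_{\gamma\ge0}\Phi_\gamma$, the space of pointlike fields. Let $\mathcal K$ be the space of analytic functions $F$ on the open lower half plane such that $\sup_{-1\le\operatorname{Im}z<0}|F(z)||\operatorname{Im}z|^\ell<\infty$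 for some $\ell>0$, and $\mathcal K_+$ the subset of those $F$ whose boundary value $F(x-i0)$ is a distribution of positive type, that is, $\int du\,dt\,F(t-i0)\,\overline{g(u+t/2)}\,g(u-t/2)\ge0$ for all Schwartz functions $g$. To $\Pi=\sum_jK_j\otimes\phi_j\otimes\phi_j'\in\mathcal K\otimes C^\infty(\Sigma)^*\otimes C^\infty(\Sigma)^*$ belongs the unique $C^\infty(\Sigma)^*$-valued distribution on $\mathbb R$ (a linear map $T:\mathcal D(\mathbb R)\to C^\infty(\Sigma)^*$ that has, for some $\ell$ and $m$ and every $d>0$, a bound $\|T(f)\|_{-\ell}\le c_d\max_{n\le m}d^n\|f^{(n)}\|_1$ for all $f\in\mathcal D(-d,d)$), also denoted $\Pi$, with $$\sigma(\Pi(f))=\sum_j\int ds'\,f(s')\,K_j(s'-i0)\,\sigma\big(\phi_j(s'/2-i0)\,\phi_j'(-s'/2+i0)\big)\qquad\text{for }\sigma\in\bigcup_{E>0}\Sigma(E),$$ where $\sigma(\phi(s'/2-i0)\phi'(-s'/2+i0))$ is the boundary value at the real line of $z\mapsto\sigma(e^{izH/2}\phi\,e^{-izH}\phi'\,e^{izH/2})$,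 $\operatorname{Im}z<0$. The product $\Pi$ is called *classically positive* if $\Pi=\sum_jK_j\otimes\phi_j^*\otimes\phi_j$ (a finite sum) with $K_j\in\mathcal K_+$ and $\phi_j\in\Phi_{\mathrm{FH}}$. Suppose moreover that there is a strongly continuous unitary representation $\lambda\mapsto U(\lambda)$ of the dilation group $(0,\infty)$ on $\mathcal H$ with $U(\lambda)U(x,\Lambda)U(\lambda)^*=U(\lambda x,\Lambda)$ and $U(\lambda)\mathfrak A(\mathcal O)U(\lambda)^*=\mathfrak A(\lambda\mathcal O)$; put $\delta_\lambda\phi=U(\lambda)\phi U(\lambda)^*$ for $\phi\in C^\infty(\Sigma)^*$. A form $\phi\in C^\infty(\Sigma)^*$ is *dilation covariant* if for some $\beta\in\mathbb R$, $\delta_\lambda\phi=\lambda^\beta\phi$ for all $\lambda>0$; a product $\Pi$ is *dilation covariant* if for some $\beta\in\mathbb R$, $\delta_\lambda\Pi(s)=\lambda^\beta\Pi(\lambda s)$ for all $\lambda>0$ in the sense of distributions; a projector $p$ in $C^\infty(\Sigma)^*$ is *dilation covariant* if $\delta_{1/\lambda}(p(\delta_\lambda A))=p(A)$ for all $A\in\mathfrak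 A(\mathcal O_1)$ and $0<\lambda\le1$. **Proposition.** Let $\Pi$ be a dilation covariant classically positive product. Let $p$ be a one-dimensional dilation covariant projector in $C^\infty(\Sigma)^*$ that is continuous and hermitean ($p(\phi^*)=p(\phi)^*$) and has its image in $\Phi_{\mathrm{FH}}$. Then there exist a dilation covariant field $\phi\in\Phi_{\mathrm{FH}}$ and $\beta\in\mathbb R$ such that $$p\,\Pi(s')=\big(i(s'-i0)\big)^\beta\,\phi\qquad\text{on the interval }(-1,1),$$ that is, when evaluated on test functions $f\in\mathcal D(-1,1)$, where $(i(s'-i0))^\beta$ is the boundary value of $z\mapsto(iz)^\beta$ (principal branch) from the lower half plane. -/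

import Mathlib

open Filter Topology
open scoped InnerProductSpace TensorProduct ContDiff ComplexConjugate

namespace DilQFT

noncomputable section

/-! ### Minkowski space -/

/-- Minkowski space `ℝ^{1+s}`; the coordinate `0` is time. -/
abbrev Mink (s : ℕ) := Fin (s + 1) → ℝ

/-- The Minkowski form, with signature `(+, -, ..., -)`. -/
def minkForm {s : ℕ} (x y : Mink s) : ℝ := x 0 * y 0 - ∑ i : Fin s, x i.succ * y i.succ

abbrev LMatrix (s : ℕ) := Matrix (Fin (s + 1)) (Fin (s + 1)) ℝ

/-- Proper orthochronous Lorentz transformations. -/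
def IsLorentz {s : ℕ} (L : LMatrix s) : Prop :=
  (∀ x y : Mink s, minkForm (L.mulVec x) (L.mulVec y) = minkForm x y) ∧ L.det = 1 ∧ 0 < L 0 0

/-- The standard double cone of radius `r` centred at the origin. -/
def doubleCone (s : ℕ) (r : ℝ) : Set (Mink s) :=
  {x | |x 0| + √(∑ i : Fin s, x i.succ ^ 2) < r}

def Spacelike {s : ℕ} (O₁ O₂ : Set (Mink s)) : Prop :=
  ∀ x ∈ O₁, ∀ y ∈ O₂, minkForm (x - y) (x - y) < 0

def IsRegion {s : ℕ} (O : Set (Mink s)) : Prop := IsOpen O ∧ Bornology.IsBounded O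

/-! ### Normal functionals on `B(𝓗)` -/

section Functionals

variable {𝓗 : Type*} [NormedAddCommGroup 𝓗] [InnerProductSpace ℂ 𝓗]

/-- The predicate of being ultraweakly continuous: `σ(A) = ∑ₙ ⟪xₙ, A yₙ⟫` with
square-summable sequences of vectors. -/
def IsNormal (σ : StrongDual ℂ (𝓗 →L[ℂ] 𝓗)) : Prop :=
  ∃ x y : ℕ → 𝓗, (Summable fun n => ‖x n‖ ^ 2) ∧ (Summable fun n => ‖y n‖ ^ 2) ∧
    ∀ A : 𝓗 →L[ℂ] 𝓗, HasSum (fun n => ⟪x n, A (y n)⟫_ℂ) (σ A)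

theorem hasSum_interleave {M : Type*} [AddCommMonoid M] [TopologicalSpace M] [ContinuousAdd M]
    {X : Type*} (g : X → M) {u v : ℕ → X} {a b : M} (hu : HasSum (fun n => g (u n)) a)
    (hv : HasSum (fun n => g (v n)) b) :
    HasSum (fun n => g (Sum.elim u v (Equiv.natSumNatEquivNat.symm n))) (a + b) := by
  generalize (Equiv.natSumNatEquivNat.symm : ℕ ≃ ℕ ⊕ ℕ) = e
  have h : HasSum (fun i : ℕ ⊕ ℕ => g (Sum.elim u v i)) (a + b) :=
    HasSum.sum (f := fun i : ℕ ⊕ ℕ => g (Sum.elim u v i)) (by simpa [Function.comp_def] using hu)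
      (by simpa [Function.comp_def] using hv)
  exact (Equiv.hasSum_iff (f := fun i : ℕ ⊕ ℕ => g (Sum.elim u v i)) e).2 h

theorem IsNormal.add {σ τ : StrongDual ℂ (𝓗 →L[ℂ] 𝓗)} (hσ : IsNormal σ) (hτ : IsNormal τ) :
    IsNormal (σ + τ) := by
  obtain ⟨x, y, hx, hy, h⟩ := hσ
  obtain ⟨x', y', hx', hy', h'⟩ := hτ
  let u : ℕ → 𝓗 × 𝓗 := fun n => (x n, y n)
  let v : ℕ → 𝓗 × 𝓗 := fun n => (x' n, y' n)
  refine ⟨fun n => (Sum.elim u v (Equiv.natSumNatEquivNat.symm n)).1,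
    fun n => (Sum.elim u v (Equiv.natSumNatEquivNat.symm n)).2, ?_, ?_, fun A => ?_⟩
  · exact (hasSum_interleave (fun q : 𝓗 × 𝓗 => ‖q.1‖ ^ 2) (u := u) (v := v)
      hx.hasSum hx'.hasSum).summable
  · exact (hasSum_interleave (fun q : 𝓗 × 𝓗 => ‖q.2‖ ^ 2) (u := u) (v := v)
      hy.hasSum hy'.hasSum).summable
  · exact hasSum_interleave (fun q : 𝓗 × 𝓗 => ⟪q.1, A q.2⟫_ℂ) (u := u) (v := v) (h A) (h' A)

theorem IsNormal.smul {σ : StrongDual ℂ (𝓗 →L[ℂ] 𝓗)} (c : ℂ) (hσ : IsNormal σ) :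
    IsNormal (c • σ) := by
  obtain ⟨x, y, hx, hy, h⟩ := hσ
  refine ⟨x, fun n => c • y n, hx, ?_, fun A => ?_⟩
  · simp only [norm_smul, mul_pow]
    exact hy.mul_left _
  · simpa [inner_smul_right] using (h A).mul_left c

variable [CompleteSpace 𝓗]

/-- The space `Σ` of ultraweakly continuous functionals on `B(𝓗)`. -/
def Normal (𝓗 : Type*) [NormedAddCommGroup 𝓗] [InnerProductSpace ℂ 𝓗] [CompleteSpace 𝓗] :
    Submodule ℂ (StrongDual ℂ (𝓗 →L[ℂ] 𝓗)) where
  carrier := {σ | IsNormal σ}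
  add_mem' := IsNormal.add
  zero_mem' := ⟨0, 0, by simp [summable_zero], by simp [summable_zero], by simp [hasSum_zero]⟩
  smul_mem' c _ h := h.smul c

/-- `sandwich S T σ = σ(S · T)`. -/
def sandwich (S T : 𝓗 →L[ℂ] 𝓗) :
    StrongDual ℂ (𝓗 →L[ℂ] 𝓗) →ₗ[ℂ] StrongDual ℂ (𝓗 →L[ℂ] 𝓗) where
  toFun σ := σ.comp (ContinuousLinearMap.mulLeftRight ℂ (𝓗 →L[ℂ] 𝓗) S T)
  map_add' _ _ := rfl
  map_smul' _ _ := rfl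

theorem sandwich_apply (S T A : 𝓗 →L[ℂ] 𝓗) (σ : StrongDual ℂ (𝓗 →L[ℂ] 𝓗)) :
    sandwich S T σ A = σ (S * A * T) := rfl

theorem sandwich_mem (S T : 𝓗 →L[ℂ] 𝓗) {σ : StrongDual ℂ (𝓗 →L[ℂ] 𝓗)} (hσ : σ ∈ Normal 𝓗) :
    sandwich S T σ ∈ Normal 𝓗 := by
  obtain ⟨x, y, hx, hy, h⟩ := hσ
  refine ⟨fun n => S.adjoint (x n), fun n => T (y n), ?_, ?_, fun A => ?_⟩
  · refine Summable.of_nonneg_of_le (fun _ => by positivity) (fun n => ?_)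
      (hx.mul_left (‖S.adjoint‖ ^ 2))
    rw [← mul_pow]
    gcongr
    exact S.adjoint.le_opNorm _
  · refine Summable.of_nonneg_of_le (fun _ => by positivity) (fun n => ?_)
      (hy.mul_left (‖T‖ ^ 2))
    rw [← mul_pow]
    gcongr
    exact T.le_opNorm _
  · simpa [sandwich_apply, ContinuousLinearMap.adjoint_inner_left] using h (S * A * T)

theorem norm_sandwich_le (S T : 𝓗 →L[ℂ] 𝓗) (σ : StrongDual ℂ (𝓗 →L[ℂ] 𝓗)) :
    ‖sandwich S T σ‖ ≤ ‖S‖ * ‖T‖ * ‖σ‖ := by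
  refine ContinuousLinearMap.opNorm_le_bound _ (by positivity) fun A => ?_
  calc ‖σ (S * A * T)‖ ≤ ‖σ‖ * ‖S * A * T‖ := σ.le_opNorm _
    _ ≤ ‖σ‖ * (‖S‖ * ‖A‖ * ‖T‖) := by
        gcongr
        exact (norm_mul_le _ _).trans (by gcongr; exact norm_mul_le _ _)
    _ = _ := by ring

/-- Hermitean conjugation of functionals, `σ^*(A) = conj (σ (A^*))`. -/
def conjF (σ : StrongDual ℂ (𝓗 →L[ℂ] 𝓗)) : StrongDual ℂ (𝓗 →L[ℂ] 𝓗) :=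
  LinearMap.mkContinuous
    { toFun := fun A => conj (σ (star A))
      map_add' := fun A B => by simp
      map_smul' := fun c A => by simp }
    ‖σ‖ (fun A => by simpa using σ.le_opNorm (star A))

theorem conjF_apply (σ : StrongDual ℂ (𝓗 →L[ℂ] 𝓗)) (A : 𝓗 →L[ℂ] 𝓗) :
    conjF σ A = conj (σ (star A)) := rfl

theorem norm_conjF_le (σ : StrongDual ℂ (𝓗 →L[ℂ] 𝓗)) : ‖conjF σ‖ ≤ ‖σ‖ :=
  LinearMap.mkContinuous_norm_le _ (norm_nonneg _) _

theorem conjF_mem {σ : StrongDual ℂ (𝓗 →L[ℂ] 𝓗)} (hσ : σ ∈ Normal 𝓗) :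
    conjF σ ∈ Normal 𝓗 := by
  obtain ⟨x, y, hx, hy, h⟩ := hσ
  refine ⟨y, x, hy, hx, fun A => ?_⟩
  have h1 := Complex.hasSum_conj'.2 (h (star A))
  refine h1.congr_fun fun n => ?_
  rw [inner_conj_symm, ContinuousLinearMap.star_eq_adjoint,
    ContinuousLinearMap.adjoint_inner_left]


end Functionals

/-! ### The net of local algebras -/

/-- A local net of von Neumann algebras on Minkowski space `ℝ^{1+s}` in the vacuum sector.
Only the values of `alg` on bounded open regions and those of `U` on proper orthochronous
Lorentz matrices are meaningful. -/
structure LocalNet (s : ℕ) (𝓗 : Type*) [NormedAddCommGroup 𝓗] [InnerProductSpace ℂ 𝓗]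
    [CompleteSpace 𝓗] where
  alg : Set (Mink s) → VonNeumannAlgebra 𝓗
  U : Mink s → LMatrix s → unitary (𝓗 →L[ℂ] 𝓗)
  Ω : 𝓗
  U_mul : ∀ x y L M, IsLorentz L → IsLorentz M → U x L * U y M = U (x + L.mulVec y) (L * M)
  U_continuous : ∀ ψ : 𝓗, ContinuousOn
    (fun g : Mink s × LMatrix s => (U g.1 g.2 : 𝓗 →L[ℂ] 𝓗) ψ) {g | IsLorentz g.2}
  norm_vacuum : ‖Ω‖ = 1
  vacuum_invariant : ∀ x L, IsLorentz L → (U x L : 𝓗 →L[ℂ] 𝓗) Ω = Ω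
  isotony : ∀ O₁ O₂, IsRegion O₁ → IsRegion O₂ → O₁ ⊆ O₂ → ∀ A ∈ alg O₁, A ∈ alg O₂
  locality : ∀ O₁ O₂, IsRegion O₁ → IsRegion O₂ → Spacelike O₁ O₂ →
    ∀ A ∈ alg O₁, ∀ B ∈ alg O₂, A * B = B * A
  covariance : ∀ O, IsRegion O → ∀ x L, IsLorentz L →
    (fun A : 𝓗 →L[ℂ] 𝓗 => (U x L : 𝓗 →L[ℂ] 𝓗) * A * star (U x L : 𝓗 →L[ℂ] 𝓗)) ''
      (alg O : Set (𝓗 →L[ℂ] 𝓗)) = (alg ((fun y => L.mulVec y + x) '' O) : Set (𝓗 →L[ℂ] 𝓗))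
  /-- The joint spectrum of the generators `P_μ`, `U(x,1) = exp(i P_μ x^μ)`, lies in the closed
  forward light cone, that is, `P_μ a^μ ≥ 0` for each `a` in the closed forward light cone.
  Here `P_μ a^μ ψ = η` means that `t ↦ U(ta,1) ψ` has derivative `i η` at `0`. -/
  positivity : ∀ a : Mink s, 0 ≤ minkForm a a → 0 ≤ a 0 → ∀ ψ η : 𝓗,
    HasDerivAt (fun t : ℝ => (U (t • a) 1 : 𝓗 →L[ℂ] 𝓗) ψ) (Complex.I • η) 0 →
      0 ≤ (⟪ψ, η⟫_ℂ).re
  vacuum_unique : ∀ ψ : 𝓗, (∀ x, (U x 1 : 𝓗 →L[ℂ] 𝓗) ψ = ψ) → ∃ c : ℂ, ψ = c • Ω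

variable {s : ℕ} {𝓗 : Type*} [NormedAddCommGroup 𝓗] [InnerProductSpace ℂ 𝓗] [CompleteSpace 𝓗]

namespace LocalNet

variable (N : LocalNet s 𝓗)

/-- The algebra `𝔄(r)` of the standard double cone of radius `r`. -/
def algR (r : ℝ) : VonNeumannAlgebra 𝓗 := N.alg (doubleCone s r)

/-- The time translations `U(t) = exp(i t H)`. -/
def timeU (t : ℝ) : 𝓗 →L[ℂ] 𝓗 := (N.U (Pi.single 0 t) 1 : 𝓗 →L[ℂ] 𝓗)

/-- `x` lies in the domain of the Hamiltonian `H` and `H x = y`. -/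
def HamiltonianEq (x y : 𝓗) : Prop :=
  HasDerivAt (fun t : ℝ => N.timeU t x) (Complex.I • y) 0

/-- `(1 + H) R = 1`. -/
def IsEnergyResolvent (R : 𝓗 →L[ℂ] 𝓗) : Prop := ∀ ψ, N.HamiltonianEq (R ψ) (ψ - R ψ)

open Classical in
/-- `R = (1 + H)⁻¹`. -/
def resolvent : 𝓗 →L[ℂ] 𝓗 :=
  if h : ∃ R, N.IsEnergyResolvent R then h.choose else 0

theorem isLorentz_one : IsLorentz (1 : LMatrix s) :=
  ⟨fun x y => by simp, by simp, by simp⟩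

theorem timeU_zero : N.timeU 0 = 1 := by
  have h := N.U_mul 0 0 1 1 isLorentz_one isLorentz_one
  simp only [Matrix.one_mulVec, add_zero, mul_one] at h
  have h1 : N.U 0 1 = 1 := mul_eq_left.1 h
  simp [timeU, h1]

theorem timeU_inner (t : ℝ) (x y : 𝓗) : ⟪N.timeU t x, N.timeU t y⟫_ℂ = ⟪x, y⟫_ℂ := by
  have h : star (N.timeU t) * N.timeU t = 1 := (N.U (Pi.single 0 t) 1).2.1
  rw [← ContinuousLinearMap.adjoint_inner_right, ← ContinuousLinearMap.star_eq_adjoint]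
  have h2 := congrArg (fun A : 𝓗 →L[ℂ] 𝓗 => A y) h
  simp only [mul_apply_eq_comp, one_apply_eq_self] at h2
  rw [h2]

theorem HamiltonianEq.symm {x y a b : 𝓗} (h : N.HamiltonianEq x a) (h' : N.HamiltonianEq y b) :
    ⟪a, y⟫_ℂ = ⟪x, b⟫_ℂ := by
  have h1 := HasDerivAt.inner ℂ h h'
  simp only [N.timeU_inner, N.timeU_zero, one_apply_eq_self] at h1
  have h2 := h1.unique (hasDerivAt_const (0 : ℝ) ⟪x, y⟫_ℂ)
  rw [inner_smul_left, inner_smul_right, Complex.conj_I] at h2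
  have h3 : Complex.I * (⟪x, b⟫_ℂ - ⟪a, y⟫_ℂ) = 0 := by rw [← h2]; ring
  have h4 := (mul_eq_zero.1 h3).resolve_left Complex.I_ne_zero
  exact (sub_eq_zero.1 h4).symm

theorem HamiltonianEq.nonneg {x a : 𝓗} (h : N.HamiltonianEq x a) : 0 ≤ (⟪x, a⟫_ℂ).re := by
  refine N.positivity (Pi.single 0 1) (by simp [minkForm]) (by simp) x a ?_
  have : ∀ t : ℝ, t • (Pi.single 0 1 : Mink s) = Pi.single 0 t := fun t => by
    rw [← Pi.single_smul]; simp
  simpa only [this, HamiltonianEq, timeU] using h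

theorem HamiltonianEq.sub {x y a b : 𝓗} (h : N.HamiltonianEq x a) (h' : N.HamiltonianEq y b) :
    N.HamiltonianEq (x - y) (a - b) := by
  have h1 := HasDerivAt.sub h h'
  unfold HamiltonianEq
  rw [smul_sub]
  refine h1.congr_of_eventuallyEq (Eventually.of_forall fun t => ?_)
  simp

/-- `1 + H` is injective. -/
theorem IsEnergyResolvent.unique {R : 𝓗 →L[ℂ] 𝓗} (hR : N.IsEnergyResolvent R) {x y : 𝓗}
    (h : N.HamiltonianEq x (y - x)) : x = R y := by
  have h1 := HamiltonianEq.nonneg N (HamiltonianEq.sub N h (hR y))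
  have h2 : y - x - (y - R y) = -(x - R y) := by abel
  rw [h2, inner_neg_right, Complex.neg_re, inner_self_eq_norm_sq_to_K] at h1
  have h3 : ((↑‖x - R y‖ : ℂ) ^ 2).re = ‖x - R y‖ ^ 2 := by norm_cast
  have h4 : ‖x - R y‖ ^ 2 ≤ 0 := by
    have : 0 ≤ -((↑‖x - R y‖ : ℂ) ^ 2).re := h1
    rw [h3] at this
    linarith
  have h5 : ‖x - R y‖ = 0 := by nlinarith [norm_nonneg (x - R y)]
  exact sub_eq_zero.1 (norm_eq_zero.1 h5)

theorem resolvent_selfAdjoint : IsSelfAdjoint N.resolvent := by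
  unfold resolvent
  split_ifs with h
  · have hR := h.choose_spec
    rw [ContinuousLinearMap.isSelfAdjoint_iff_isSymmetric]
    intro x y
    have h1 := HamiltonianEq.symm N (hR x) (hR y)
    simp only [inner_sub_left, inner_sub_right] at h1
    exact (sub_left_inj.1 h1).symm
  · exact IsSelfAdjoint.zero _

/-! ### Smooth functionals and quadratic forms -/

/-- `σ = τ(R^ℓ · R^ℓ)` with `τ ∈ Σ`; that is, `τ = σ((1+H)^ℓ · (1+H)^ℓ)` is bounded, and
`‖σ‖_ℓ = ‖τ‖`. -/
def IsLift (l : ℕ) (σ τ : StrongDual ℂ (𝓗 →L[ℂ] 𝓗)) : Prop :=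
  τ ∈ Normal 𝓗 ∧ σ = sandwich (N.resolvent ^ l) (N.resolvent ^ l) τ

/-- The space `Σ_ℓ` of all `σ ∈ Σ` with `‖σ‖_ℓ < ∞`. -/
def SigmaL (l : ℕ) : Submodule ℂ (StrongDual ℂ (𝓗 →L[ℂ] 𝓗)) :=
  (Normal 𝓗).map (sandwich (N.resolvent ^ l) (N.resolvent ^ l))

/-- The space `C^∞(Σ) = ⋂ Σ_ℓ` of smooth functionals. -/
def Smooth : Submodule ℂ (StrongDual ℂ (𝓗 →L[ℂ] 𝓗)) := ⨅ l : ℕ, N.SigmaL l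

theorem mem_smooth {σ : StrongDual ℂ (𝓗 →L[ℂ] 𝓗)} :
    σ ∈ N.Smooth ↔ ∀ l, ∃ τ, N.IsLift l σ τ := by
  simp only [Smooth, Submodule.mem_iInf, SigmaL, Submodule.mem_map, IsLift]
  exact forall_congr' fun l => exists_congr fun τ => and_congr_right fun _ => eq_comm

/-- `‖φ‖_{-ℓ} ≤ C`. -/
def DualBound (l : ℕ) (φ : Module.Dual ℂ N.Smooth) (C : ℝ) : Prop :=
  ∀ (σ : N.Smooth) (τ : StrongDual ℂ (𝓗 →L[ℂ] 𝓗)), N.IsLift l σ τ → ‖φ σ‖ ≤ C * ‖τ‖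

variable {N} in
theorem DualBound.mono {l l' : ℕ} (h : l ≤ l') {φ : Module.Dual ℂ N.Smooth} {C : ℝ}
    (hφ : N.DualBound l φ C) : ∃ C', 0 ≤ C' ∧ N.DualBound l' φ C' := by
  obtain ⟨k, rfl⟩ := Nat.exists_eq_add_of_le h
  refine ⟨|C| * (‖N.resolvent ^ k‖ * ‖N.resolvent ^ k‖), by positivity, fun σ τ hτ => ?_⟩
  have h1 : N.IsLift l σ (sandwich (N.resolvent ^ k) (N.resolvent ^ k) τ) := by
    refine ⟨sandwich_mem _ _ hτ.1, ?_⟩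
    rw [hτ.2]
    ext A
    simp only [sandwich_apply]
    congr 1
    rw [pow_add, (Commute.pow_pow (Commute.refl N.resolvent) l k).eq]
    simp only [mul_assoc]
    rw [(Commute.pow_pow (Commute.refl N.resolvent) k l).eq]
  calc ‖φ σ‖ ≤ C * ‖sandwich (N.resolvent ^ k) (N.resolvent ^ k) τ‖ := hφ σ _ h1
    _ ≤ |C| * (‖N.resolvent ^ k‖ * ‖N.resolvent ^ k‖ * ‖τ‖) := by
        gcongr
        · exact le_abs_self C
        · exact norm_sandwich_le _ _ _
    _ = _ := by ring

/-- The dual space `C^∞(Σ)^*`: linear forms on `C^∞(Σ)` that are continuous in the Fréchet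
topology, that is, bounded in some norm `‖·‖_ℓ`. -/
def CDual : Submodule ℂ (Module.Dual ℂ N.Smooth) where
  carrier := {φ | ∃ l C, N.DualBound l φ C}
  add_mem' := by
    rintro φ φ' ⟨l, C, h⟩ ⟨l', C', h'⟩
    obtain ⟨D, -, hD⟩ := h.mono (le_max_left l l')
    obtain ⟨D', -, hD'⟩ := h'.mono (le_max_right l l')
    refine ⟨max l l', D + D', fun σ τ hτ => ?_⟩
    rw [add_mul]
    exact (norm_add_le _ _).trans (add_le_add (hD σ τ hτ) (hD' σ τ hτ))
  zero_mem' := ⟨0, 0, fun σ τ _ => by simp⟩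
  smul_mem' := by
    rintro c φ ⟨l, C, h⟩
    refine ⟨l, ‖c‖ * C, fun σ τ hτ => ?_⟩
    rw [LinearMap.smul_apply, norm_smul, mul_assoc]
    exact mul_le_mul_of_nonneg_left (h σ τ hτ) (norm_nonneg c)

/-- The weak-* topology on `C^∞(Σ)^*`. -/
@[reducible] def weakStar : TopologicalSpace N.CDual :=
  TopologicalSpace.induced (fun (φ : N.CDual) (σ : N.Smooth) => φ.1 σ) inferInstance

/-- Bounded operators as elements of `C^∞(Σ)^*`. -/
def ofOp (A : 𝓗 →L[ℂ] 𝓗) : N.CDual :=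
  ⟨{ toFun := fun σ => σ.1 A
     map_add' := fun _ _ => rfl
     map_smul' := fun _ _ => rfl },
    0, ‖A‖, fun σ τ hτ => by
      have h : (σ : StrongDual ℂ (𝓗 →L[ℂ] 𝓗)) = τ := by
        rw [hτ.2]; ext B; simp [sandwich_apply]
      rw [← h, mul_comm]
      exact σ.1.le_opNorm A⟩

theorem isLift_conjF {l : ℕ} {σ τ : StrongDual ℂ (𝓗 →L[ℂ] 𝓗)} (h : N.IsLift l σ τ) :
    N.IsLift l (conjF σ) (conjF τ) := by
  refine ⟨conjF_mem h.1, ?_⟩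
  rw [h.2]
  ext A
  have hR : star (N.resolvent ^ l) = N.resolvent ^ l := (N.resolvent_selfAdjoint.pow l).star_eq
  simp only [conjF_apply, sandwich_apply, star_mul, hR, mul_assoc]

theorem conjF_smooth {σ : StrongDual ℂ (𝓗 →L[ℂ] 𝓗)} (h : σ ∈ N.Smooth) :
    conjF σ ∈ N.Smooth := by
  rw [mem_smooth] at h ⊢
  intro l
  obtain ⟨τ, hτ⟩ := h l
  exact ⟨_, N.isLift_conjF hτ⟩

/-- The conjugate linear form `σ ↦ conj (φ (σ^*))`. -/
def conjLin (φ : Module.Dual ℂ N.Smooth) : Module.Dual ℂ N.Smooth where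
  toFun σ := conj (φ ⟨conjF σ.1, N.conjF_smooth σ.2⟩)
  map_add' σ σ' := by
    have h : (⟨conjF (σ + σ').1, N.conjF_smooth (σ + σ').2⟩ : N.Smooth) =
        ⟨conjF σ.1, N.conjF_smooth σ.2⟩ + ⟨conjF σ'.1, N.conjF_smooth σ'.2⟩ := by
      ext A
      exact map_add (starRingEnd ℂ) _ _
    rw [h, map_add, map_add]
  map_smul' c σ := by
    have h : (⟨conjF (c • σ).1, N.conjF_smooth (c • σ).2⟩ : N.Smooth) =
        conj c • ⟨conjF σ.1, N.conjF_smooth σ.2⟩ := by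
      ext A
      exact map_mul (starRingEnd ℂ) _ _
    rw [h, map_smul, smul_eq_mul, map_mul, Complex.conj_conj]
    rfl

variable {N} in
theorem DualBound.conjLin {l : ℕ} {φ : Module.Dual ℂ N.Smooth} {C : ℝ} (hC : 0 ≤ C)
    (h : N.DualBound l φ C) : N.DualBound l (N.conjLin φ) C := by
  intro σ τ hτ
  have h1 := h ⟨conjF σ.1, N.conjF_smooth σ.2⟩ (conjF τ) (N.isLift_conjF hτ)
  calc ‖N.conjLin φ σ‖ = ‖φ ⟨conjF σ.1, N.conjF_smooth σ.2⟩‖ := RCLike.norm_conj _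
    _ ≤ C * ‖conjF τ‖ := h1
    _ ≤ C * ‖τ‖ := mul_le_mul_of_nonneg_left (norm_conjF_le τ) hC

/-- Hermitean conjugation on `C^∞(Σ)^*`, `φ^*(σ) = conj (φ (σ^*))`. -/
def conjD (φ : N.CDual) : N.CDual :=
  ⟨N.conjLin φ.1, by
    obtain ⟨l, C, h⟩ := φ.2
    obtain ⟨C', hC', h'⟩ := h.mono le_rfl
    exact ⟨l, C', h'.conjLin hC'⟩⟩

/-! ### The microscopic phase space condition and pointlike fields -/

/-- `ψ : C^∞(Σ) → Σ` is linear, continuous, of finite rank, and for all sufficiently large `ℓ`,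
`r^{-γ} ‖(Ξ - ψ)⌈𝔄(r)‖_ℓ → 0` as `r → 0`, where `Ξ` is the inclusion. -/
def IsApproximating (γ : ℝ) (ψ : N.Smooth →ₗ[ℂ] StrongDual ℂ (𝓗 →L[ℂ] 𝓗)) : Prop :=
  (∀ σ, ψ σ ∈ Normal 𝓗) ∧
  (∃ (l : ℕ) (C : ℝ), ∀ (σ : N.Smooth) (τ : StrongDual ℂ (𝓗 →L[ℂ] 𝓗)), N.IsLift l σ τ →
    ‖ψ σ‖ ≤ C * ‖τ‖) ∧
  FiniteDimensional ℂ (LinearMap.range ψ) ∧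
  ∃ l₀ : ℕ, ∀ l ≥ l₀, ∀ ε > 0, ∀ᶠ r : ℝ in 𝓝[>] 0, ∀ A ∈ N.algR r,
    ∀ (σ : N.Smooth) (τ : StrongDual ℂ (𝓗 →L[ℂ] 𝓗)), N.IsLift l σ τ →
      ‖σ.1 A - ψ σ A‖ ≤ ε * r ^ γ * ‖τ‖ * ‖A‖

/-- The microscopic phase space condition. -/
def MicroscopicPhaseSpace : Prop :=
  ∀ γ : ℝ, 0 ≤ γ → ∃ ψ, N.IsApproximating γ ψ

/-- The space `Φ_γ`: the image of the dual map `ψ^* : B(𝓗) → C^∞(Σ)^*` of an approximating map `ψ`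
of minimal rank. -/
def Phi (γ : ℝ) : Set N.CDual :=
  {φ | ∃ ψ, N.IsApproximating γ ψ ∧
    (∀ ψ', N.IsApproximating γ ψ' →
      Module.finrank ℂ (LinearMap.range ψ) ≤ Module.finrank ℂ (LinearMap.range ψ')) ∧
    ∃ A : 𝓗 →L[ℂ] 𝓗, ∀ σ : N.Smooth, φ.1 σ = ψ σ A}

/-- The field content `Φ_FH = ⋃ Φ_γ`. -/
def Fields : Set N.CDual := {φ | ∃ γ : ℝ, 0 ≤ γ ∧ φ ∈ N.Phi γ}

end LocalNet

/-! ### Boundary values of analytic functions -/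

/-- The space `𝒦` of analytic functions on the open lower half plane that are regular at the
boundary; they are extended by `0` to the rest of `ℂ`. -/
def Kern : Submodule ℂ (ℂ → ℂ) where
  carrier := {F | DifferentiableOn ℂ F {z | z.im < 0} ∧ (∀ z, 0 ≤ z.im → F z = 0) ∧
    ∃ (l : ℕ) (C : ℝ), ∀ z : ℂ, -1 ≤ z.im → z.im < 0 → ‖F z‖ * |z.im| ^ l ≤ C}
  add_mem' := by
    rintro F G ⟨hF, hF0, l, C, h⟩ ⟨hG, hG0, l', C', h'⟩
    refine ⟨hF.add hG, fun z hz => by simp [hF0 z hz, hG0 z hz], max l l', C + C',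
      fun z h1 h2 => ?_⟩
    have h3 : |z.im| ≤ 1 := by rw [abs_of_neg h2]; linarith
    have h4 : |z.im| ^ max l l' ≤ |z.im| ^ l :=
      pow_le_pow_of_le_one (abs_nonneg _) h3 (le_max_left _ _)
    have h5 : |z.im| ^ max l l' ≤ |z.im| ^ l' :=
      pow_le_pow_of_le_one (abs_nonneg _) h3 (le_max_right _ _)
    calc ‖F z + G z‖ * |z.im| ^ max l l'
        ≤ (‖F z‖ + ‖G z‖) * |z.im| ^ max l l' := by gcongr; exact norm_add_le _ _
      _ = ‖F z‖ * |z.im| ^ max l l' + ‖G z‖ * |z.im| ^ max l l' := by ring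
      _ ≤ ‖F z‖ * |z.im| ^ l + ‖G z‖ * |z.im| ^ l' := by gcongr
      _ ≤ C + C' := add_le_add (h z h1 h2) (h' z h1 h2)
  zero_mem' := ⟨differentiableOn_const 0, fun _ _ => rfl, 0, 0, fun z _ _ => by simp⟩
  smul_mem' := by
    rintro c F ⟨hF, hF0, l, C, h⟩
    refine ⟨hF.const_smul c, fun z hz => by simp [hF0 z hz], l, ‖c‖ * C, fun z h1 h2 => ?_⟩
    rw [Pi.smul_apply, norm_smul, mul_assoc]
    exact mul_le_mul_of_nonneg_left (h z h1 h2) (norm_nonneg c)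

/-- `∫ f(x) F(x - i0) dx = c`. -/
def BoundaryValue (F : ℂ → ℂ) (f : ℝ → ℂ) (c : ℂ) : Prop :=
  Tendsto (fun ε : ℝ => ∫ x : ℝ, f x * F (x - ε * Complex.I)) (𝓝[>] 0) (𝓝 c)

/-- `F(x - i0)` is a distribution of positive type. -/
def IsPositiveType (F : ℂ → ℂ) : Prop :=
  ∀ g : SchwartzMap ℝ ℂ, ∃ c : ℝ, 0 ≤ c ∧
    BoundaryValue F (fun t => ∫ u : ℝ, conj (g (u + t / 2)) * g (u - t / 2)) c

/-- The space `𝒟(ℝ)` of test functions. -/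
def TestFn : Submodule ℂ (ℝ → ℂ) where
  carrier := {f | ContDiff ℝ ∞ f ∧ HasCompactSupport f}
  add_mem' h h' := ⟨h.1.add h'.1, h.2.add h'.2⟩
  zero_mem' := ⟨contDiff_const, HasCompactSupport.zero⟩
  smul_mem' c _ h := ⟨h.1.const_smul c, h.2.smul_left (f := fun _ => c)⟩

/-- `f ∈ 𝒟(-d, d)`. -/
def SupportedIn (f : TestFn) (d : ℝ) : Prop := tsupport f.1 ⊆ Set.Ioo (-d) d

/-- `max_{n ≤ m} d^n ‖f^{(n)}‖_1`. -/
def sobNorm (d : ℝ) (m : ℕ) (f : TestFn) : ℝ :=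
  (Finset.range (m + 1)).sup' Finset.nonempty_range_add_one
    fun n => d ^ n * ∫ x : ℝ, ‖iteratedDeriv n f.1 x‖

/-- `f_a(t) = a⁻¹ f(t / a)`. -/
def rescale (a : ℝ) (ha : 0 < a) (f : TestFn) : TestFn :=
  ⟨fun t => (a⁻¹ : ℂ) * f.1 (a⁻¹ * t), by
    refine ⟨contDiff_const.mul (f.2.1.comp (contDiff_const.mul contDiff_id)), ?_⟩
    have h : HasCompactSupport (f.1 ∘ (Homeomorph.mulLeft₀ a⁻¹ (inv_ne_zero ha.ne'))) :=
      f.2.2.comp_homeomorph _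
    exact HasCompactSupport.mul_left (f := fun _ => (a⁻¹ : ℂ)) h⟩

namespace LocalNet

variable (N : LocalNet s 𝓗)

/-! ### Operator products -/

/-- `𝒦 ⊗ C^∞(Σ)^* ⊗ C^∞(Σ)^*`. -/
abbrev Product := Kern ⊗[ℂ] (N.CDual ⊗[ℂ] N.CDual)

/-- The classically positive products `∑ⱼ Kⱼ ⊗ φⱼ^* ⊗ φⱼ`. -/
def PositiveProducts : Set N.Product :=
  {P | ∃ (n : ℕ) (K : Fin n → Kern) (φ : Fin n → N.CDual),
    (∀ j, IsPositiveType (K j).1) ∧ (∀ j, φ j ∈ N.Fields) ∧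
      P = ∑ j, K j ⊗ₜ[ℂ] (N.conjD (φ j) ⊗ₜ[ℂ] φ j)}

/-- The function `g` of the resolvent `R`, in the continuous functional calculus. The function
`E ↦ h(E)` of the Hamiltonian is obtained for `g(x) = h(x⁻¹ - 1)`. -/
def funR (g : ℝ → ℂ) : 𝓗 →L[ℂ] 𝓗 := cfc (fun z : ℂ => g z.re) N.resolvent

/-- The spectral projector `P(E)` of `H` for the interval `[0, E]`, which projects onto the kernel
of the negative part of `R - (1 + E)⁻¹`. -/
def energyProj (E : ℝ) : 𝓗 →L[ℂ] 𝓗 :=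
  (N.funR fun x => ((max ((1 + E)⁻¹ - x) 0 : ℝ) : ℂ)).ker.starProjection

/-- `exp(w H_E) (1 + H_E)^ℓ` with `H_E = min(H, E)`. -/
def boost (l : ℕ) (E : ℝ) (w : ℂ) : 𝓗 →L[ℂ] 𝓗 :=
  N.funR fun x => Complex.exp (w * ((max x (1 + E)⁻¹)⁻¹ - 1 : ℝ)) *
    ((max x (1 + E)⁻¹)⁻¹ : ℝ) ^ l

/-- `exp(-w H) (1 + H)^k`, for `Re w > 0`. -/
def damp (k : ℕ) (w : ℂ) : 𝓗 →L[ℂ] 𝓗 :=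
  N.funR fun x => if x = 0 then 0 else Complex.exp (-w * (x⁻¹ - 1 : ℝ)) * (x⁻¹ : ℝ) ^ k

/-- `B` is the bounded operator `R^ℓ φ R^ℓ`. -/
def IsReduced (l : ℕ) (φ : N.CDual) (B : 𝓗 →L[ℂ] 𝓗) : Prop :=
  ∀ (σ : N.Smooth) (τ : StrongDual ℂ (𝓗 →L[ℂ] 𝓗)), N.IsLift l σ τ → φ.1 σ = τ B

/-- `σ ∈ Σ(E)`. -/
def EnergyBounded (E : ℝ) (σ : N.Smooth) : Prop :=
  ∃ ρ ∈ Normal 𝓗, (σ : StrongDual ℂ (𝓗 →L[ℂ] 𝓗)) = sandwich (N.energyProj E) (N.energyProj E) ρ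

/-- For `σ ∈ Σ(E)`, `B = R^ℓ φ R^ℓ` and `B' = R^ℓ φ' R^ℓ` the function
`z ↦ σ(exp(izH/2) φ exp(-izH) φ' exp(izH/2))` on the lower half plane, whose boundary value is
`σ(φ(t/2) φ'(-t/2))`. -/
def correlation (σ : N.Smooth) (E : ℝ) (l : ℕ) (B B' : 𝓗 →L[ℂ] 𝓗) (z : ℂ) : ℂ :=
  σ.1 (N.boost l E (Complex.I * z / 2) * B * N.damp (2 * l) (Complex.I * z) * B' *
    N.boost l E (Complex.I * z / 2))

/-- `C^∞(Σ)^*`-valued distributions. -/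
def IsDistribution (T : TestFn →ₗ[ℂ] N.CDual) : Prop :=
  ∃ l m : ℕ, ∀ d > 0, ∃ c : ℝ, ∀ f : TestFn, SupportedIn f d →
    N.DualBound l (T f).1 (c * sobNorm d m f)

/-- `T` is the distribution associated with the product `P`: for `P = ∑ⱼ Kⱼ ⊗ φⱼ ⊗ φⱼ'`
and all energy-bounded `σ`,
`σ(T(f)) = ∑ⱼ ∫ f(t) Kⱼ(t - i0) σ(φⱼ(t/2 - i0) φⱼ'(-t/2 + i0)) dt`. -/
def IsProductDistribution (P : N.Product) (T : TestFn →ₗ[ℂ] N.CDual) : Prop :=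
  N.IsDistribution T ∧
  ∀ (n : ℕ) (K : Fin n → Kern) (φ φ' : Fin n → N.CDual),
    P = ∑ j, K j ⊗ₜ[ℂ] (φ j ⊗ₜ[ℂ] φ' j) →
    ∀ (l : ℕ) (B B' : Fin n → 𝓗 →L[ℂ] 𝓗),
      (∀ j, N.IsReduced l (φ j) (B j)) → (∀ j, N.IsReduced l (φ' j) (B' j)) →
    ∀ E > 0, ∀ σ : N.Smooth, N.EnergyBounded E σ → ∀ f : TestFn,
      BoundaryValue (fun z => ∑ j, (K j).1 z * N.correlation σ E l (B j) (B' j) z) f.1 ((T f).1 σ)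

open Classical in
/-- The unique `C^∞(Σ)^*`-valued distribution associated with the product `P`. -/
def opd (P : N.Product) : TestFn →ₗ[ℂ] N.CDual :=
  if h : ∃ T, N.IsProductDistribution P T then h.choose else 0

/-- Hermitean projectors in `C^∞(Σ)^*`, continuous in the weak-* topology, whose image consists of
pointlike fields. -/
structure IsFieldProjector (p : N.CDual →ₗ[ℂ] N.CDual) : Prop where
  continuous : Continuous[N.weakStar, N.weakStar] p
  idempotent : ∀ φ, p (p φ) = p φ
  hermitean : ∀ φ, p (N.conjD φ) = N.conjD (p φ)
  image : ∀ φ, p φ ∈ N.Fields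

end LocalNet

/-! ### Dilations -/

/-- A strongly continuous unitary representation of the dilation group that is compatible with
the Poincaré group representation and acts geometrically on the local algebras. Only the values
`D a` with `a > 0` are meaningful. -/
structure Dilations (N : LocalNet s 𝓗) where
  D : ℝ → unitary (𝓗 →L[ℂ] 𝓗)
  D_mul : ∀ a b, 0 < a → 0 < b → D (a * b) = D a * D b
  D_continuous : ∀ ψ : 𝓗, ContinuousOn (fun a => (D a : 𝓗 →L[ℂ] 𝓗) ψ) (Set.Ioi 0)
  D_poincare : ∀ a, 0 < a → ∀ x L, IsLorentz L → D a * N.U x L * star (D a) = N.U (a • x) L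
  D_local : ∀ a, 0 < a → ∀ O, IsRegion O →
    (fun A : 𝓗 →L[ℂ] 𝓗 => (D a : 𝓗 →L[ℂ] 𝓗) * A * star (D a : 𝓗 →L[ℂ] 𝓗)) ''
      (N.alg O : Set (𝓗 →L[ℂ] 𝓗)) = (N.alg ((fun y => a • y) '' O) : Set (𝓗 →L[ℂ] 𝓗))

namespace Dilations

variable {N : LocalNet s 𝓗} (Δ : Dilations N)

/-- The dilation operator `U(a)`. -/
def op (a : ℝ) : 𝓗 →L[ℂ] 𝓗 := (Δ.D a : 𝓗 →L[ℂ] 𝓗)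

/-- `δ_a A = U(a) A U(a)^*` for bounded operators. -/
def actOp (a : ℝ) (A : 𝓗 →L[ℂ] 𝓗) : 𝓗 →L[ℂ] 𝓗 := Δ.op a * A * star (Δ.op a)

theorem star_op_mul (a : ℝ) : star (Δ.op a) * Δ.op a = 1 := (Δ.D a).2.1

theorem op_mul_star (a : ℝ) : Δ.op a * star (Δ.op a) = 1 := (Δ.D a).2.2

/-- The rescaled resolvent `U(a)^* R U(a)`. -/
def scaledResolvent (a : ℝ) : 𝓗 →L[ℂ] 𝓗 := star (Δ.op a) * N.resolvent * Δ.op a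

theorem timeU_star_op {a : ℝ} (ha : 0 < a) (t : ℝ) :
    N.timeU t * star (Δ.op a) = star (Δ.op a) * N.timeU (a * t) := by
  have h := congrArg (fun u : unitary (𝓗 →L[ℂ] 𝓗) => (u : 𝓗 →L[ℂ] 𝓗))
    (Δ.D_poincare a ha (Pi.single 0 t) 1 LocalNet.isLorentz_one)
  have h1 : a • (Pi.single 0 t : Mink s) = Pi.single 0 (a * t) := by
    rw [← Pi.single_smul]; simp
  rw [h1] at h
  have h2 : Δ.op a * N.timeU t * star (Δ.op a) = N.timeU (a * t) := h
  rw [← h2, ← mul_assoc, ← mul_assoc, star_op_mul, one_mul]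

theorem scaledResolvent_eq {a : ℝ} (ha : 0 < a) :
    Δ.scaledResolvent a =
      N.resolvent * ((a : ℂ) • 1 + (1 - a : ℂ) • Δ.scaledResolvent a) := by
  by_cases h : ∃ R, N.IsEnergyResolvent R
  · have hR : N.IsEnergyResolvent N.resolvent := by
      rw [LocalNet.resolvent, dif_pos h]; exact h.choose_spec
    ext ψ
    refine LocalNet.IsEnergyResolvent.unique N hR ?_
    have h1 : HasDerivAt (fun t : ℝ => N.timeU t (N.resolvent (Δ.op a ψ)))
        (Complex.I • (Δ.op a ψ - N.resolvent (Δ.op a ψ))) (a * 0) := by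
      rw [mul_zero]; exact hR _
    have h2 := HasDerivAt.scomp (0 : ℝ) h1 ((hasDerivAt_id (0 : ℝ)).const_mul a)
    have h3 := ((star (Δ.op a)).restrictScalars ℝ).hasFDerivAt.comp_hasDerivAt (0 : ℝ) h2
    have h4 : HasDerivAt (fun t : ℝ => N.timeU t (Δ.scaledResolvent a ψ))
        (star (Δ.op a) ((a * 1 : ℝ) • (Complex.I • (Δ.op a ψ - N.resolvent (Δ.op a ψ))))) 0 := by
      refine HasDerivAt.congr_of_eventuallyEq h3 (Eventually.of_forall fun t => ?_)
      exact congrArg (fun A : 𝓗 →L[ℂ] 𝓗 => A (N.resolvent (Δ.op a ψ)))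
        (Δ.timeU_star_op ha t)
    have h5 : star (Δ.op a) (Δ.op a ψ) = ψ :=
      congrArg (fun A : 𝓗 →L[ℂ] 𝓗 => A ψ) (Δ.star_op_mul a)
    have h6 : star (Δ.op a) (N.resolvent (Δ.op a ψ)) = Δ.scaledResolvent a ψ := rfl
    have h7 : star (Δ.op a) ((a * 1 : ℝ) • (Complex.I • (Δ.op a ψ - N.resolvent (Δ.op a ψ)))) =
        Complex.I • ((((a : ℂ) • (1 : 𝓗 →L[ℂ] 𝓗) + (1 - a : ℂ) • Δ.scaledResolvent a) ψ) -
          Δ.scaledResolvent a ψ) := by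
      rw [← Complex.coe_smul, map_smul, map_smul, map_sub, h5, h6]
      simp only [add_apply, smul_apply, one_apply_eq_self]
      push_cast
      module
    rw [h7] at h4
    exact h4
  · have hR : N.resolvent = 0 := by rw [LocalNet.resolvent, dif_neg h]
    simp [scaledResolvent, hR]

theorem scaledResolvent_selfAdjoint (a : ℝ) : IsSelfAdjoint (Δ.scaledResolvent a) := by
  rw [IsSelfAdjoint, scaledResolvent, star_mul, star_mul, star_star,
    N.resolvent_selfAdjoint.star_eq, mul_assoc]

theorem scaledResolvent_eq' {a : ℝ} (ha : 0 < a) :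
    Δ.scaledResolvent a =
      ((a : ℂ) • 1 + (1 - a : ℂ) • Δ.scaledResolvent a) * N.resolvent := by
  have h := congrArg star (Δ.scaledResolvent_eq ha)
  simpa [star_mul, (Δ.scaledResolvent_selfAdjoint a).star_eq,
    N.resolvent_selfAdjoint.star_eq] using h

/-- `τ ↦ τ(U T^ℓ · T^ℓ U^*)`, with `T = a + (1 - a) U^* R U`. -/
def liftAct (l : ℕ) (a : ℝ) :
    StrongDual ℂ (𝓗 →L[ℂ] 𝓗) →ₗ[ℂ] StrongDual ℂ (𝓗 →L[ℂ] 𝓗) :=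
  sandwich (Δ.op a * ((a : ℂ) • 1 + (1 - a : ℂ) • Δ.scaledResolvent a) ^ l)
    (((a : ℂ) • 1 + (1 - a : ℂ) • Δ.scaledResolvent a) ^ l * star (Δ.op a))

/-- `σ ↦ σ ∘ δ_a`. -/
def actF (a : ℝ) : StrongDual ℂ (𝓗 →L[ℂ] 𝓗) →ₗ[ℂ] StrongDual ℂ (𝓗 →L[ℂ] 𝓗) :=
  sandwich (Δ.op a) (star (Δ.op a))

theorem actF_apply (a : ℝ) (σ : StrongDual ℂ (𝓗 →L[ℂ] 𝓗)) (A : 𝓗 →L[ℂ] 𝓗) :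
    Δ.actF a σ A = σ (Δ.actOp a A) := rfl

theorem isLift_actF {a : ℝ} (ha : 0 < a) {l : ℕ} {σ τ : StrongDual ℂ (𝓗 →L[ℂ] 𝓗)}
    (h : N.IsLift l σ τ) : N.IsLift l (Δ.actF a σ) (Δ.liftAct l a τ) := by
  refine ⟨sandwich_mem _ _ h.1, ?_⟩
  rw [h.2]
  ext A
  simp only [actF, liftAct, sandwich_apply]
  congr 1
  set T : 𝓗 →L[ℂ] 𝓗 := (a : ℂ) • 1 + (1 - a : ℂ) • Δ.scaledResolvent a with hT
  have e1 : Δ.scaledResolvent a = N.resolvent * T := Δ.scaledResolvent_eq ha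
  have e2 : Δ.scaledResolvent a = T * N.resolvent := Δ.scaledResolvent_eq' ha
  have hc : Commute N.resolvent T := e1.symm.trans e2
  have p1 : N.resolvent ^ l * Δ.op a = Δ.op a * Δ.scaledResolvent a ^ l := by
    have : SemiconjBy (Δ.op a) (Δ.scaledResolvent a) N.resolvent := by
      rw [SemiconjBy, scaledResolvent, ← mul_assoc, ← mul_assoc, op_mul_star, one_mul]
    exact (this.pow_right l).eq.symm
  have p2 : star (Δ.op a) * N.resolvent ^ l = Δ.scaledResolvent a ^ l * star (Δ.op a) := by
    have := congrArg star p1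
    simpa [star_mul, star_pow, (Δ.scaledResolvent_selfAdjoint a).star_eq,
      N.resolvent_selfAdjoint.star_eq] using this
  have p3 : Δ.scaledResolvent a ^ l = T ^ l * N.resolvent ^ l := by
    rw [e2, hc.symm.mul_pow]
  have p4 : Δ.scaledResolvent a ^ l = N.resolvent ^ l * T ^ l := by
    rw [e1, hc.mul_pow]
  calc N.resolvent ^ l * (Δ.op a * A * star (Δ.op a)) * N.resolvent ^ l
      = (N.resolvent ^ l * Δ.op a) * A * (star (Δ.op a) * N.resolvent ^ l) := by
        simp only [mul_assoc]
    _ = (Δ.op a * (T ^ l * N.resolvent ^ l)) * A * (N.resolvent ^ l * T ^ l * star (Δ.op a)) := by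
        rw [p1, p2, ← p3, ← p4]
    _ = _ := by simp only [mul_assoc]

theorem actF_smooth {a : ℝ} (ha : 0 < a) {σ : StrongDual ℂ (𝓗 →L[ℂ] 𝓗)} (h : σ ∈ N.Smooth) :
    Δ.actF a σ ∈ N.Smooth := by
  rw [LocalNet.mem_smooth] at h ⊢
  intro l
  obtain ⟨τ, hτ⟩ := h l
  exact ⟨_, Δ.isLift_actF ha hτ⟩

/-- `σ ↦ σ ∘ δ_a` on `C^∞(Σ)`. -/
def actSmooth (a : ℝ) (ha : 0 < a) : N.Smooth →ₗ[ℂ] N.Smooth :=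
  (Δ.actF a).restrict fun _ h => Δ.actF_smooth ha h

/-- `δ_a φ = U(a) φ U(a)^*` on `C^∞(Σ)^*`. -/
def act (a : ℝ) (ha : 0 < a) (φ : N.CDual) : N.CDual :=
  ⟨φ.1 ∘ₗ Δ.actSmooth a ha, by
    obtain ⟨l, C, h⟩ := φ.2
    obtain ⟨C', hC', h'⟩ := h.mono le_rfl
    set T : 𝓗 →L[ℂ] 𝓗 := (a : ℂ) • 1 + (1 - a : ℂ) • Δ.scaledResolvent a with hT
    refine ⟨l, C' * (‖Δ.op a * T ^ l‖ * ‖T ^ l * star (Δ.op a)‖), fun σ τ hτ => ?_⟩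
    have h1 := h' (Δ.actSmooth a ha σ) (Δ.liftAct l a τ) (Δ.isLift_actF ha hτ)
    rw [mul_assoc]
    exact h1.trans (mul_le_mul_of_nonneg_left (norm_sandwich_le _ _ _) hC')⟩

theorem act_ofOp (a : ℝ) (ha : 0 < a) (A : 𝓗 →L[ℂ] 𝓗) :
    Δ.act a ha (N.ofOp A) = N.ofOp (Δ.actOp a A) := rfl

/-- `δ_a φ = a^β φ` for all `a > 0`, with some `β ∈ ℝ`. -/
def FieldCovariant (φ : N.CDual) : Prop :=
  ∃ β : ℝ, ∀ (a : ℝ) (ha : 0 < a), Δ.act a ha φ = ((a ^ β : ℝ) : ℂ) • φ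

/-- `δ_a Π(t) = a^β Π(a t)` for all `a > 0`, with some `β ∈ ℝ`, in the sense of distributions. -/
def ProductCovariant (P : N.Product) : Prop :=
  ∃ β : ℝ, ∀ (a : ℝ) (ha : 0 < a) (f : TestFn),
    Δ.act a ha (N.opd P f) = ((a ^ β : ℝ) : ℂ) • N.opd P (rescale a ha f)

/-- `δ_{1/a} ∘ p ∘ δ_a = p` on `𝔄(1)`, for all `0 < a ≤ 1`. -/
def ProjectorCovariant (p : N.CDual →ₗ[ℂ] N.CDual) : Prop :=
  ∀ (a : ℝ) (ha : 0 < a), a ≤ 1 → ∀ A ∈ N.algR 1,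
    Δ.act a⁻¹ (inv_pos.2 ha) (p (Δ.act a ha (N.ofOp A))) = p (N.ofOp A)

end Dilations
end
end DilQFT

/-! Reduction to a scalar distribution. A weak-* continuous linear form on `C^∞(Σ)^*` is evaluation
at a smooth functional, so the rank-one projector is `p φ = φ(σ₀) φ₀` (`exists_rank_one_form`). The
field `φ₀` is localized at the origin, because an approximating map of minimal rank admits no
further reduction (`pointLike_of_mem_phi`); as `φ₀(σ₀) = 1`, the functional `σ₀` does not vanish on
`𝔄(1)`. Covariance of `p` reads `σ₀(δ_a A) φ₀ = σ₀(A) δ_a φ₀` on `𝔄(1)`. It makes `φ₀` an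
eigenvector of the dilations, with a multiplicative, real and continuous eigenvalue `a^β₀`, and it
makes `σ₀ ∘ δ_a - a^β₀ σ₀` vanish on `𝔄(1)` for `a ≤ 1` (`exists_covariant`).

Homogeneity. For `f` supported in `(-1, 1)` the form `Π(f)` annihilates every smooth functional that
vanishes on `𝔄(1)` (`product_local`): bounded local operators are translated by at most `1/2`, and
pointlike forms inherit this by duality. Therefore `T₀(f) = σ₀(Π(f))` satisfies `T₀(f_a) = a^κ
T₀(f)` with `κ = β₀ - β` (`product_rescale`).

Selecting the boundary value from below. Homogeneity alone leaves a free constant on each half line.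
Positivity of the energy has to tie them together, but `σ₀` is not energy-bounded and `T₀` is not
itself the boundary value of an analytic function. What holds is `T₀(f) = lim ∫ f(t) g(t)(X(t - iη))
dt` with a fixed operator-valued analytic `X` and a functional-valued `g` as smooth as desired
(`exists_representation`). Replacing `g` by a Taylor polynomial at `0` and real powers of `t` by
complex ones yields an analytic `S` whose rescaled pairings reproduce `a^κ T₀(f)` up to a high power
of `a` (`exists_scaling_approximation`).

Averaging `S` over dilations turns this weak statement into a pointwise one on the real axis: the
failure of homogeneity is of high order in `|x|`. A Phragmén–Lindelöf argument on half annuli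
transports it to the lower half plane (`smear_defect_bound`), and a function that is scale invariant
up to a positive power of `|z|` is asymptotically constant (`exists_const_of_scaling_bound`). The
average is therefore `c (iz)^κ` plus a term of higher order. Pairing with `f` at scale `a`, letting
the height tend to `0` and then `a → 0`, identifies `T₀` as a multiple of `(i(t - i0))^κ`
(`exists_homogeneous_boundaryValue`). -/

namespace DilQFT

noncomputable section

/-! ### Boundary values of analytic functions of polynomial growth, with rates. -/

section BoundaryPrinciple

variable {F : Type*} [NormedAddCommGroup F] [NormedSpace ℝ F]

theorem norm_sub_le_of_deriv_le {f f' : ℝ → F} {g g' : ℝ → ℝ} {a b : ℝ} (hab : a ≤ b)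
    (hf : ∀ x ∈ Set.Icc a b, HasDerivAt f (f' x) x)
    (hg : ∀ x ∈ Set.Icc a b, HasDerivAt g (g' x) x)
    (h : ∀ x ∈ Set.Icc a b, ‖f' x‖ ≤ g' x) : ‖f b - f a‖ ≤ g b - g a := by
  have := image_norm_le_of_norm_deriv_right_le_deriv_boundary' (f := fun x => f x - f a)
    (f' := f') (a := a) (b := b) (B := fun x => g x - g a) (B' := g')
    (fun x hx => ((hf x hx).sub_const _).continuousAt.continuousWithinAt)
    (fun x hx => ((hf x (Set.Ico_subset_Icc_self hx)).sub_const _).hasDerivWithinAt) (by simp)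
    (fun x hx => ((hg x hx).sub_const _).continuousAt.continuousWithinAt)
    (fun x hx => ((hg x (Set.Ico_subset_Icc_self hx)).sub_const _).hasDerivWithinAt)
    (fun x hx => h x (Set.Ico_subset_Icc_self hx))
  exact this ⟨hab, le_rfl⟩

/-- Integration from `x` up to `1/2` against the antiderivative of `x^(-s)` lowers the order of the
singularity by one, as long as it is not integrable. -/
theorem norm_le_of_deriv_le_rpow {f f' : ℝ → F} {D B s : ℝ} (hs : 1 < s)
    (hf : ∀ x ∈ Set.Ioo (0 : ℝ) 1, HasDerivAt f (f' x) x)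
    (h : ∀ x ∈ Set.Ioc (0 : ℝ) (1 / 2), ‖f' x‖ ≤ D * x ^ (-s)) (hB : ‖f (1 / 2)‖ ≤ B)
    (hD : 0 ≤ D) {x : ℝ} (hx : x ∈ Set.Ioc (0 : ℝ) (1 / 2)) :
    ‖f x‖ ≤ B + D / (s - 1) * x ^ (1 - s) := by
  have h1 := norm_sub_le_of_deriv_le (f := f) (f' := f') (a := x) (b := 1 / 2)
    (g := fun y => -(D / (s - 1) * y ^ (1 - s))) (g' := fun y => D * y ^ (-s)) hx.2
    (fun y hy => hf y ⟨hx.1.trans_le hy.1, by linarith [hy.2]⟩)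
    (fun y hy => by
      have hy0 : 0 < y := hx.1.trans_le hy.1
      have := ((Real.hasDerivAt_rpow_const (p := 1 - s) (Or.inl hy0.ne')).const_mul
        (D / (s - 1))).neg
      refine this.congr_deriv ?_
      have : s - 1 ≠ 0 := by linarith
      have e : (1 - s - 1) = -s := by ring
      rw [e]
      field_simp
      ring)
    (fun y hy => h y ⟨hx.1.trans_le hy.1, hy.2⟩)
  have h2 : 0 ≤ D / (s - 1) * (1 / 2 : ℝ) ^ (1 - s) :=
    mul_nonneg (div_nonneg hD (by linarith)) (Real.rpow_nonneg (by norm_num) _)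
  have h3 : ‖f x‖ ≤ ‖f (1 / 2)‖ + ‖f (1 / 2) - f x‖ := by
    calc ‖f x‖ = ‖f (1 / 2) - (f (1 / 2) - f x)‖ := by congr 1; abel
      _ ≤ _ := norm_sub_le _ _
  linarith

/-- The last integration: `x^(-1/2)` is integrable at `0`, and its integral is the source of every
`√y` below. -/
theorem norm_sub_le_of_deriv_le_rpow {f f' : ℝ → F} {D : ℝ}
    (hf : ∀ x ∈ Set.Ioo (0 : ℝ) 1, HasDerivAt f (f' x) x)
    (h : ∀ x ∈ Set.Ioc (0 : ℝ) (1 / 2), ‖f' x‖ ≤ D * x ^ (-(1 / 2) : ℝ)) (hD : 0 ≤ D)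
    {x y : ℝ} (hx : 0 < x) (hxy : x ≤ y) (hy : y ≤ 1 / 2) :
    ‖f y - f x‖ ≤ 2 * D * √y := by
  have h1 := norm_sub_le_of_deriv_le (f := f) (f' := f') (a := x) (b := y)
    (g := fun y => 2 * D * y ^ (1 / 2 : ℝ)) (g' := fun y => D * y ^ (-(1 / 2) : ℝ)) hxy
    (fun z hz => hf z ⟨hx.trans_le hz.1, by linarith [hz.2]⟩)
    (fun z hz => by
      have hy0 : 0 < z := hx.trans_le hz.1
      have := ((Real.hasDerivAt_rpow_const (p := 1 / 2) (Or.inl hy0.ne')).const_mul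
        (2 * D))
      refine this.congr_deriv ?_
      have e : ((1 / 2 : ℝ) - 1) = -(1 / 2) := by norm_num
      rw [e]
      ring)
    (fun z hz => h z ⟨hx.trans_le hz.1, hz.2.trans hy⟩)
  have h2 : 0 ≤ 2 * D * x ^ (1 / 2 : ℝ) := by positivity
  rw [Real.sqrt_eq_rpow]
  linarith

/-- A function on `(0, 1/2]` with `m + 1` derivatives of growth at most `η ^ (-m)` has a limit
at `0`, with a uniform rate. -/
theorem exists_sqrt_bound (m : ℕ) : ∃ c : ℝ, 0 ≤ c ∧ ∀ (φ : ℕ → ℝ → F) (C : ℝ), 0 ≤ C →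
    (∀ n ≤ m, ∀ x ∈ Set.Ioo (0 : ℝ) 1, HasDerivAt (φ n) (φ (n + 1) x) x) →
    (∀ n ≤ m + 1, ∀ x ∈ Set.Ioc (0 : ℝ) (1 / 2), ‖φ n x‖ * x ^ m ≤ C) →
    ∀ x y : ℝ, 0 < x → x ≤ y → y ≤ 1 / 2 → ‖φ 0 y - φ 0 x‖ ≤ c * C * √y := by
  -- Starting from `x^(-m) ≤ x^(-(m + 1/2))`, each of `q` integrations lowers the exponent by one,
  -- and costs one derivative. The shift by `1/2` avoids the exponent `1`, hence logarithms; `q = m`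
  -- leaves `x^(-1/2)` for the first derivative.
  have key : ∀ q ≤ m, ∃ c : ℝ, 0 ≤ c ∧ ∀ (φ : ℕ → ℝ → F) (C : ℝ), 0 ≤ C →
      (∀ n ≤ m, ∀ x ∈ Set.Ioo (0 : ℝ) 1, HasDerivAt (φ n) (φ (n + 1) x) x) →
      (∀ n ≤ m + 1, ∀ x ∈ Set.Ioc (0 : ℝ) (1 / 2), ‖φ n x‖ * x ^ m ≤ C) →
      ∀ n, n + q ≤ m + 1 → ∀ x ∈ Set.Ioc (0 : ℝ) (1 / 2),
        ‖φ n x‖ ≤ c * C * x ^ (-(m - q + 1 / 2 : ℝ)) := by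
    intro q
    induction q with
    | zero =>
      intro _
      refine ⟨1, zero_le_one, fun φ C hC _ hb n hn x hx => ?_⟩
      have h1 := hb n (by omega) x hx
      have hxm : 0 < x ^ m := pow_pos hx.1 m
      have h2 : ‖φ n x‖ ≤ C * (x ^ m)⁻¹ := by
        rw [← div_eq_mul_inv]; exact (le_div_iff₀ hxm).2 h1
      refine h2.trans ?_
      rw [one_mul, ← Real.rpow_natCast, ← Real.rpow_neg hx.1.le]
      refine mul_le_mul_of_nonneg_left ?_ hC
      refine Real.rpow_le_rpow_of_exponent_ge hx.1 (by linarith [hx.2]) ?_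
      push_cast
      linarith
    | succ q ih =>
      intro hq
      obtain ⟨c, hc, H⟩ := ih (by omega)
      refine ⟨2 ^ m + c / (m - q - 1 / 2), ?_, fun φ C hC hd hb n hn x hx => ?_⟩
      · have : (q : ℝ) + 1 ≤ m := by exact_mod_cast hq
        exact add_nonneg (by positivity) (div_nonneg hc (by linarith))
      have hqm : (q : ℝ) + 1 ≤ m := by exact_mod_cast hq
      have hB : ‖φ n (1 / 2)‖ ≤ 2 ^ m * C := by
        have := hb n (by omega) (1 / 2) ⟨by norm_num, le_rfl⟩
        rw [one_div, inv_pow] at this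
        have h2 : (0 : ℝ) < 2 ^ m := by positivity
        rw [← div_eq_mul_inv, div_le_iff₀ h2] at this
        linarith [mul_comm C (2 ^ m)]
      have h1 := norm_le_of_deriv_le_rpow (f := φ n) (f' := φ (n + 1)) (D := c * C)
        (s := m - q + 1 / 2) (by linarith) (hd n (by omega))
        (fun y hy => H φ C hC hd hb (n + 1) (by omega) y hy) hB (by positivity) hx
      have e1 : (1 - (m - q + 1 / 2) : ℝ) = -(m - (q + 1 : ℕ) + 1 / 2) := by push_cast; ring
      rw [e1] at h1
      have h3 : (1 : ℝ) ≤ x ^ (-(m - (q + 1 : ℕ) + 1 / 2) : ℝ) := by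
        refine Real.one_le_rpow_of_pos_of_le_one_of_nonpos hx.1 (by linarith [hx.2]) ?_
        push_cast; linarith
      have h4 : 2 ^ m * C ≤ 2 ^ m * C * x ^ (-(m - (q + 1 : ℕ) + 1 / 2) : ℝ) :=
        le_mul_of_one_le_right (by positivity) h3
      have e2 : ((m : ℝ) - q + 1 / 2 - 1) = m - q - 1 / 2 := by ring
      rw [e2] at h1
      calc ‖φ n x‖ ≤ _ := h1
        _ ≤ 2 ^ m * C * x ^ (-(m - (q + 1 : ℕ) + 1 / 2) : ℝ) + _ := by gcongr
        _ = _ := by ring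
  obtain ⟨c, hc, H⟩ := key m le_rfl
  refine ⟨2 * c, by positivity, fun φ C hC hd hb x y hx hxy hy => ?_⟩
  have h1 := norm_sub_le_of_deriv_le_rpow (f := φ 0) (f' := φ 1) (D := c * C)
    (hd 0 (Nat.zero_le _))
    (fun z hz => by
      have := H φ C hC hd hb 1 (by omega) z hz
      rwa [show ((m : ℝ) - m + 1 / 2) = 1 / 2 by ring] at this) (by positivity) hx hxy hy
  linarith


theorem continuousOn_shift {Y : Type*} [TopologicalSpace Y] {X : ℂ → Y} (hX : ContinuousOn X {z | z.im < 0}) :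
    ContinuousOn (fun q : ℝ × ℝ => X (q.1 - q.2 * Complex.I)) {q | 0 < q.2} :=
  hX.comp (by fun_prop) fun q hq => by simpa using hq

theorem continuous_shift {Y : Type*} [TopologicalSpace Y] {X : ℂ → Y} (hX : ContinuousOn X {z | z.im < 0}) {η : ℝ} (hη : 0 < η) :
    Continuous fun t : ℝ => X (t - η * Complex.I) := by
  rw [continuous_iff_continuousAt]
  intro t
  have h1 : ContinuousAt X (t - η * Complex.I) :=
    hX.continuousAt ((isOpen_lt Complex.continuous_im continuous_const).mem_nhds
      (by simpa using hη))
  exact ContinuousAt.comp (f := fun t : ℝ => (t : ℂ) - η * Complex.I) h1 (by fun_prop)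

variable {E : Type*} [NormedAddCommGroup E] [NormedSpace ℂ E]
variable {G : Type*} [NormedAddCommGroup G] [NormedSpace ℂ G]

theorem hasDerivAt_integral_shift {P : ℝ → E →L[ℂ] G} (hP : Continuous P)
    (hc : HasCompactSupport P) {X : ℂ → E} [CompleteSpace E]
    (hX : DifferentiableOn ℂ X {z | z.im < 0}) {η : ℝ} (hη : 0 < η) :
    HasDerivAt (fun y : ℝ => ∫ t : ℝ, P t (X (t - y * Complex.I)))
      (∫ t : ℝ, P t (-Complex.I • deriv X (t - η * Complex.I))) η := by
  have hopen : IsOpen {z : ℂ | z.im < 0} := isOpen_lt Complex.continuous_im continuous_const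
  have hX' : ContinuousOn (deriv X) {z | z.im < 0} :=
    (hX.deriv hopen).continuousOn
  have hint : ∀ Y : ℂ → E, ContinuousOn Y {z | z.im < 0} → ∀ y : ℝ, 0 < y →
      Continuous fun t : ℝ => P t (Y (t - y * Complex.I)) := fun Y hY y hy =>
    hP.clm_apply (continuous_shift hY hy)
  have hsupp : ∀ v : ℝ → E, HasCompactSupport fun t : ℝ => P t (v t) := fun v =>
    hc.mono fun t ht h => ht (by simp [h])
  have hcomp : IsCompact (tsupport P ×ˢ Set.Icc (η / 2) (2 * η)) := hc.prod isCompact_Icc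
  have hsub : tsupport P ×ˢ Set.Icc (η / 2) (2 * η) ⊆ {q : ℝ × ℝ | 0 < q.2} := fun q hq => by
    have := hq.2.1
    simp only [Set.mem_ofPred_eq]
    linarith
  have hcont : ContinuousOn (fun q : ℝ × ℝ =>
      P q.1 (-Complex.I • deriv X (q.1 - q.2 * Complex.I)))
      (tsupport P ×ˢ Set.Icc (η / 2) (2 * η)) :=
    (hP.comp continuous_fst).continuousOn.clm_apply
      (((continuousOn_shift hX').mono hsub).const_smul _)
  obtain ⟨D, hD⟩ := hcomp.exists_bound_of_continuousOn hcont
  refine (hasDerivAt_integral_of_dominated_loc_of_deriv_le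
    (F' := fun y t => P t (-Complex.I • deriv X (t - y * Complex.I)))
    (bound := (tsupport P).indicator fun _ => D) (s := Set.Icc (η / 2) (2 * η))
    (Icc_mem_nhds (by linarith) (by linarith)) ?_ ?_ ?_ ?_ ?_ ?_).2
  · filter_upwards [lt_mem_nhds hη] with y hy
    exact (hint X hX.continuousOn y hy).aestronglyMeasurable
  · exact (hint X hX.continuousOn η hη).integrable_of_hasCompactSupport (hsupp _)
  · exact (hint (fun z => -Complex.I • deriv X z) (hX'.const_smul _) η hη).aestronglyMeasurable
  · refine Eventually.of_forall fun t y hy => ?_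
    by_cases ht : t ∈ tsupport P
    · rw [Set.indicator_of_mem ht]
      exact hD (t, y) ⟨ht, hy⟩
    · rw [Set.indicator_of_notMem ht, image_eq_zero_of_notMem_tsupport ht]
      simp
  · exact (MeasureTheory.integrable_indicator_iff hc.measurableSet).2
      (MeasureTheory.integrableOn_const hc.measure_lt_top.ne)
  · refine Eventually.of_forall fun t y hy => ?_
    have hy0 : 0 < y := by linarith [hy.1]
    have h1 : HasDerivAt X (deriv X (t - y * Complex.I)) (t - y * Complex.I) :=
      (hX.differentiableAt (hopen.mem_nhds (by simpa using hy0))).hasDerivAt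
    have h2 : HasDerivAt (fun y : ℝ => (t : ℂ) - y * Complex.I) (-Complex.I) y := by
      have := ((Complex.ofRealCLM.hasDerivAt (x := y)).mul_const Complex.I).const_sub (t : ℂ)
      simpa using this
    have h3 := HasDerivAt.scomp y h1 h2
    exact ((P t).restrictScalars ℝ).hasFDerivAt.comp_hasDerivAt y h3

theorem integral_deriv_pairing {P P' : ℝ → E →L[ℂ] G} (hP : ∀ t, HasDerivAt P (P' t) t)
    (hP' : Continuous P') (hc : HasCompactSupport P) {v v' : ℝ → E}
    (hv : ∀ t, HasDerivAt v (v' t) t) (hv' : Continuous v') :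
    ∫ t : ℝ, P t (v' t) = -∫ t : ℝ, P' t (v t) := by
  have hPc : Continuous P := continuous_iff_continuousAt.2 fun t => (hP t).continuousAt
  have hvc : Continuous v := continuous_iff_continuousAt.2 fun t => (hv t).continuousAt
  have hc' : HasCompactSupport P' := by
    have : P' = deriv P := funext fun t => (hP t).deriv.symm
    rw [this]; exact hc.deriv
  have i1 : MeasureTheory.Integrable fun t => P t (v' t) :=
    (hPc.clm_apply hv').integrable_of_hasCompactSupport (hc.mono fun t ht h => ht (by simp [h]))
  have i2 : MeasureTheory.Integrable fun t => P' t (v t) :=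
    (hP'.clm_apply hvc).integrable_of_hasCompactSupport (hc'.mono fun t ht h => ht (by simp [h]))
  have i3 : MeasureTheory.Integrable fun t => P t (v t) :=
    (hPc.clm_apply hvc).integrable_of_hasCompactSupport (hc.mono fun t ht h => ht (by simp [h]))
  have h : ∀ t, HasDerivAt (fun t => P t (v t)) (P' t (v t) + P t (v' t)) t := fun t => by
    have h1 : HasDerivAt (fun t => (P t).restrictScalars ℝ) ((P' t).restrictScalars ℝ) t :=
      (ContinuousLinearMap.restrictScalarsL ℂ E G ℝ ℝ).hasFDerivAt.comp_hasDerivAt t (hP t)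
    exact h1.clm_apply (hv t)
  have h0 := MeasureTheory.integral_eq_zero_of_hasDerivAt_of_integrable h (i2.add i1) i3
  rw [MeasureTheory.integral_add i2 i1] at h0
  exact (neg_eq_of_add_eq_zero_right h0).symm

/-- For analytic `X` an `η`-derivative is `-i` times a `t`-derivative, which integration by parts
moves onto `P`. All `η`-derivatives of the pairing thus have the same order of growth as the pairing
itself, so the singularity can be integrated away. -/
theorem hasDerivAt_integral_shift' {P P' : ℝ → E →L[ℂ] G} (hP : ∀ t, HasDerivAt P (P' t) t)
    (hP' : Continuous P') (hc : HasCompactSupport P) {X : ℂ → E} [CompleteSpace E]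
    (hX : DifferentiableOn ℂ X {z | z.im < 0}) {η : ℝ} (hη : 0 < η) :
    HasDerivAt (fun y : ℝ => ∫ t : ℝ, P t (X (t - y * Complex.I)))
      (Complex.I • ∫ t : ℝ, P' t (X (t - η * Complex.I))) η := by
  have hopen : IsOpen {z : ℂ | z.im < 0} := isOpen_lt Complex.continuous_im continuous_const
  have hPc : Continuous P := continuous_iff_continuousAt.2 fun t => (hP t).continuousAt
  refine (hasDerivAt_integral_shift hPc hc hX hη).congr_deriv ?_
  simp only [map_smul]
  rw [MeasureTheory.integral_smul, integral_deriv_pairing (P' := P')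
    (v := fun t : ℝ => X (t - η * Complex.I)) hP hP' hc (fun t => ?_)
    (continuous_shift (hX.deriv hopen).continuousOn hη), smul_neg, neg_smul, neg_neg]
  have h1 : HasDerivAt X (deriv X (t - η * Complex.I)) (t - η * Complex.I) :=
    (hX.differentiableAt (hopen.mem_nhds (by simpa using hη))).hasDerivAt
  have h2 : HasDerivAt (fun t : ℝ => (t : ℂ) - η * Complex.I) 1 t := by
    simpa using (Complex.ofRealCLM.hasDerivAt (x := t)).sub_const (η * Complex.I)
  have h3 := HasDerivAt.scomp t h1 h2
  rw [one_smul] at h3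
  exact h3

/-- Pairings `∫ P(t) (X (t - iη)) dt` of a smooth function of compact support with an analytic
function of polynomial growth converge as `η → 0`, with a uniform rate. -/
theorem exists_boundary_bound (m : ℕ) [CompleteSpace E] : ∃ c : ℝ, 0 ≤ c ∧
    ∀ (P : ℝ → E →L[ℂ] G) (X : ℂ → E) (A C : ℝ), 0 ≤ C →
    ContDiff ℝ (m + 1 : ℕ) P → HasCompactSupport P → DifferentiableOn ℂ X {z | z.im < 0} →
    (∀ n ≤ m + 1, ∫ t : ℝ, ‖iteratedDeriv n P t‖ ≤ A) →
    (∀ t ∈ tsupport P, ∀ x ∈ Set.Ioc (0 : ℝ) (1 / 2), ‖X (t - x * Complex.I)‖ * x ^ m ≤ C) →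
    ∀ x y : ℝ, 0 < x → x ≤ y → y ≤ 1 / 2 →
      ‖(∫ t : ℝ, P t (X (t - y * Complex.I))) - ∫ t : ℝ, P t (X (t - x * Complex.I))‖ ≤
        c * (A * C) * √y := by
  obtain ⟨c, hc0, H⟩ := exists_sqrt_bound (F := G) m
  refine ⟨c, hc0, fun P X A C hC hP hc hX hA hXb x y hx hxy hy => ?_⟩
  have hA0 : 0 ≤ A := (MeasureTheory.integral_nonneg fun _ => norm_nonneg _).trans (hA 0 (by omega))
  have hcs : ∀ n, tsupport (iteratedDeriv n P) ⊆ tsupport P := by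
    intro n
    induction n with
    | zero => simp
    | succ n ih =>
      rw [iteratedDeriv_succ]
      exact (tsupport_deriv_subset ).trans ih
  have hcs' : ∀ n, HasCompactSupport (iteratedDeriv n P) := fun n =>
    hc.of_isClosed_subset (isClosed_tsupport _) (hcs n)
  have hcont : ∀ n ≤ m + 1, Continuous (iteratedDeriv n P) := fun n hn =>
    hP.continuous_iteratedDeriv n (by exact_mod_cast hn)
  have hder : ∀ n ≤ m, ∀ t, HasDerivAt (iteratedDeriv n P) (iteratedDeriv (n + 1) P t) t := by
    intro n hn t
    rw [iteratedDeriv_succ]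
    exact ((hP.differentiable_iteratedDeriv n (by exact_mod_cast Nat.lt_succ_of_le hn)) t).hasDerivAt
  -- The `n`-th `η`-derivative of the pairing is `i^n` times the pairing with the `n`-th derivative
  -- of `P`.
  have key := H (fun n η => Complex.I ^ n • ∫ t : ℝ, iteratedDeriv n P t (X (t - η * Complex.I)))
    (A * C) (by positivity) ?_ ?_ x y hx hxy hy
  · simpa using key
  · intro n hn z hz
    have := (hasDerivAt_integral_shift' (hder n hn) (hcont (n + 1) (by omega)) (hcs' n) hX
      hz.1).const_smul (Complex.I ^ n)
    refine this.congr_deriv ?_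
    rw [smul_smul, pow_succ]
  · intro n hn z hz
    have hzm : 0 < z ^ m := pow_pos hz.1 m
    rw [norm_smul, norm_pow, Complex.norm_I, one_pow, one_mul, ← le_div_iff₀ hzm]
    have hi : MeasureTheory.Integrable fun t => ‖iteratedDeriv n P t‖ * (C / z ^ m) :=
      (((hcont n hn).norm).integrable_of_hasCompactSupport (hcs' n).norm).mul_const _
    refine (MeasureTheory.norm_integral_le_of_norm_le hi (Eventually.of_forall fun t => ?_)).trans ?_
    · refine ((iteratedDeriv n P t).le_opNorm _).trans ?_
      by_cases ht : t ∈ tsupport P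
      · exact mul_le_mul_of_nonneg_left ((le_div_iff₀ hzm).2 (hXb t ht z hz)) (norm_nonneg _)
      · rw [image_eq_zero_of_notMem_tsupport fun h => ht (hcs n h)]
        simp
    · rw [MeasureTheory.integral_mul_const, mul_div_assoc]
      exact mul_le_mul_of_nonneg_right (hA n hn) (by positivity)

/-- The uniform rate makes the pairings Cauchy. In the bound for the limit, `2^m` accounts for the
value at height `1/2`, where the growth condition reads `‖X‖ ≤ 2^m C`, and `c` for the distance from
there to the limit. The constant depends on `m` only, which matters for families of kernels and for
rescaled functions. -/
theorem exists_boundary_limit (m : ℕ) [CompleteSpace E] [CompleteSpace G] : ∃ c : ℝ, 0 ≤ c ∧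
    ∀ (P : ℝ → E →L[ℂ] G) (X : ℂ → E) (A C : ℝ), 0 ≤ C →
    ContDiff ℝ (m + 1 : ℕ) P → HasCompactSupport P → DifferentiableOn ℂ X {z | z.im < 0} →
    (∀ n ≤ m + 1, ∫ t : ℝ, ‖iteratedDeriv n P t‖ ≤ A) →
    (∀ t ∈ tsupport P, ∀ x ∈ Set.Ioc (0 : ℝ) (1 / 2), ‖X (t - x * Complex.I)‖ * x ^ m ≤ C) →
    ∃ I₀ : G, Tendsto (fun y : ℝ => ∫ t : ℝ, P t (X (t - y * Complex.I))) (𝓝[>] 0) (𝓝 I₀) ∧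
      (∀ y ∈ Set.Ioc (0 : ℝ) (1 / 2),
        ‖(∫ t : ℝ, P t (X (t - y * Complex.I))) - I₀‖ ≤ c * (A * C) * √y) ∧
      ‖I₀‖ ≤ (c + 2 ^ m) * (A * C) := by
  obtain ⟨c, hc0, H⟩ := exists_boundary_bound (E := E) (G := G) m
  refine ⟨c, hc0, fun P X A C hC hP hc hX hA hXb => ?_⟩
  have h := H P X A C hC hP hc hX hA hXb
  have hA0 : 0 ≤ A := (MeasureTheory.integral_nonneg fun _ => norm_nonneg _).trans (hA 0 (by omega))
  set I := fun y : ℝ => ∫ t : ℝ, P t (X (t - y * Complex.I)) with hI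
  have hsq : Tendsto (fun y : ℝ => c * (A * C) * √y) (𝓝[>] 0) (𝓝 0) := by
    have : Continuous fun y : ℝ => c * (A * C) * √y := by fun_prop
    simpa using (this.tendsto 0).mono_left nhdsWithin_le_nhds
  have hcauchy : Cauchy (map I (𝓝[>] 0)) := by
    rw [Metric.cauchy_iff]
    refine ⟨inferInstance, fun ε hε => ?_⟩
    obtain ⟨y, hy1, hy⟩ := ((hsq.eventually (gt_mem_nhds (half_pos hε))).and
      (Ioc_mem_nhdsGT (show (0 : ℝ) < 1 / 2 by norm_num))).exists
    refine ⟨I '' Set.Ioc 0 y, image_mem_map (Ioc_mem_nhdsGT hy.1), ?_⟩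
    rintro _ ⟨a, ha, rfl⟩ _ ⟨b, hb, rfl⟩
    have h1 := h a y ha.1 ha.2 hy.2
    have h2 := h b y hb.1 hb.2 hy.2
    rw [dist_eq_norm]
    calc ‖I a - I b‖ = ‖(I y - I b) - (I y - I a)‖ := by congr 1; abel
      _ ≤ ‖I y - I b‖ + ‖I y - I a‖ := norm_sub_le _ _
      _ < ε := by linarith
  obtain ⟨I₀, hI₀⟩ := CompleteSpace.complete hcauchy
  have hlim : Tendsto I (𝓝[>] 0) (𝓝 I₀) := hI₀
  have hrate : ∀ y ∈ Set.Ioc (0 : ℝ) (1 / 2), ‖I y - I₀‖ ≤ c * (A * C) * √y := fun y hy =>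
    le_of_tendsto ((tendsto_const_nhds.sub hlim).norm)
      (by filter_upwards [Ioc_mem_nhdsGT hy.1] with x hx using h x y hx.1 hx.2 hy.2)
  refine ⟨I₀, hlim, hrate, ?_⟩
  have h1 := hrate (1 / 2) ⟨by norm_num, le_rfl⟩
  have h2 : ‖I (1 / 2)‖ ≤ 2 ^ m * (A * C) := by
    have hi : MeasureTheory.Integrable fun t => ‖P t‖ * (2 ^ m * C) :=
      ((hP.continuous.norm).integrable_of_hasCompactSupport hc.norm).mul_const _
    refine (MeasureTheory.norm_integral_le_of_norm_le hi (Eventually.of_forall fun t => ?_)).trans ?_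
    · refine ((P t).le_opNorm _).trans ?_
      by_cases ht : t ∈ tsupport P
      · refine mul_le_mul_of_nonneg_left ?_ (norm_nonneg _)
        have := hXb t ht (1 / 2) ⟨by norm_num, le_rfl⟩
        rw [one_div, inv_pow, ← div_eq_mul_inv, div_le_iff₀ (by positivity)] at this
        rw [one_div]
        linarith [mul_comm C (2 ^ m)]
      · rw [image_eq_zero_of_notMem_tsupport ht]
        simp
    · rw [MeasureTheory.integral_mul_const]
      have := mul_le_mul_of_nonneg_right (hA 0 (by omega)) (show 0 ≤ 2 ^ m * C by positivity)
      simp only [iteratedDeriv_zero] at this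
      linarith
  have h3 : √(1 / 2 : ℝ) ≤ 1 := Real.sqrt_le_iff.2 ⟨by norm_num, by norm_num⟩
  have h4 : c * (A * C) * √(1 / 2 : ℝ) ≤ c * (A * C) := mul_le_of_le_one_right (by positivity) h3
  calc ‖I₀‖ = ‖I (1 / 2) - (I (1 / 2) - I₀)‖ := by congr 1; abel
    _ ≤ ‖I (1 / 2)‖ + ‖I (1 / 2) - I₀‖ := norm_sub_le _ _
    _ ≤ _ := by linarith

end BoundaryPrinciple
end
end DilQFT

/-! ### The resolvent of the Hamiltonian and its functional calculus. -/

namespace DilQFT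

noncomputable section

namespace LocalNet

variable {s : ℕ} {𝓗 : Type*} [NormedAddCommGroup 𝓗] [InnerProductSpace ℂ 𝓗] [CompleteSpace 𝓗]
variable (N : LocalNet s 𝓗)

/-- `(1 + H)⁻¹` exists. -/
def HasResolvent : Prop := N.IsEnergyResolvent N.resolvent

/-- The definition of `resolvent` has the default value `0`. That case is excluded at the very end,
since it leaves no nonzero smooth functional and hence no projector of rank one. -/
theorem hasResolvent_or : N.HasResolvent ∨ N.resolvent = 0 := by
  by_cases h : ∃ R, N.IsEnergyResolvent R
  · left
    rw [HasResolvent, resolvent, dif_pos h]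
    exact h.choose_spec
  · right
    rw [resolvent, dif_neg h]

section Resolvent

variable {N} (hR : N.HasResolvent)
include hR

/-- Positivity of the energy in the vector `R ψ`, for which `H R ψ = ψ - R ψ`. It yields `0 ≤ R ≤
1`, so that all functions of `H` can be treated as functions on `[0, 1]`. -/
theorem HasResolvent.inner_nonneg (ψ : 𝓗) : ‖N.resolvent ψ‖ ^ 2 ≤ (⟪N.resolvent ψ, ψ⟫_ℂ).re := by
  have h := HamiltonianEq.nonneg N (hR ψ)
  rw [inner_sub_right, Complex.sub_re, inner_self_eq_norm_sq_to_K] at h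
  have h3 : ((↑‖N.resolvent ψ‖ : ℂ) ^ 2).re = ‖N.resolvent ψ‖ ^ 2 := by norm_cast
  have : 0 ≤ (⟪N.resolvent ψ, ψ⟫_ℂ).re - ((↑‖N.resolvent ψ‖ : ℂ) ^ 2).re := h
  linarith

theorem HasResolvent.norm_le : ‖N.resolvent‖ ≤ 1 := by
  refine ContinuousLinearMap.opNorm_le_bound _ zero_le_one fun ψ => ?_
  have h1 := hR.inner_nonneg ψ
  have h2 : (⟪N.resolvent ψ, ψ⟫_ℂ).re ≤ ‖N.resolvent ψ‖ * ‖ψ‖ :=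
    (Complex.re_le_norm _).trans (norm_inner_le_norm _ _)
  rcases (norm_nonneg (N.resolvent ψ)).eq_or_lt with h | h
  · rw [← h]; positivity
  · nlinarith

theorem HasResolvent.injective {ψ : 𝓗} (h : N.resolvent ψ = 0) : ψ = 0 := by
  have h1 := hR ψ
  rw [HamiltonianEq, h] at h1
  simp only [map_zero, sub_zero] at h1
  have := h1.unique (hasDerivAt_const (0 : ℝ) (0 : 𝓗))
  simpa using this

theorem HasResolvent.nonneg : 0 ≤ N.resolvent := by
  rw [ContinuousLinearMap.nonneg_iff_isPositive, ContinuousLinearMap.isPositive_def]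
  refine ⟨(ContinuousLinearMap.isSelfAdjoint_iff_isSymmetric).1 N.resolvent_selfAdjoint,
    fun ψ => ?_⟩
  rw [ContinuousLinearMap.reApplyInnerSelf_apply]
  exact (sq_nonneg _).trans (hR.inner_nonneg ψ)

theorem HasResolvent.spectrum_subset {z : ℂ} (hz : z ∈ spectrum ℂ N.resolvent) :
    (z.re : ℂ) = z ∧ z.re ∈ Set.Icc (0 : ℝ) 1 := by
  have h1 : z = z.re := N.resolvent_selfAdjoint.mem_spectrum_eq_re hz
  have h2 : ‖z‖ ≤ 1 := by
    refine (spectrum.norm_le_norm_mul_of_mem hz).trans ?_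
    calc _ ≤ (1 : ℝ) * 1 := mul_le_mul hR.norm_le ContinuousLinearMap.norm_id_le (norm_nonneg _) zero_le_one
      _ = 1 := one_mul 1
  refine ⟨h1.symm, ?_, (Complex.re_le_norm z).trans h2⟩
  have h3 : z.re ∈ spectrum ℝ N.resolvent := by
    rw [h1] at hz
    exact spectrum.of_algebraMap_mem ℂ hz
  exact spectrum_nonneg_of_nonneg hR.nonneg h3

theorem HasResolvent.continuousOn_spectrum {g : ℝ → ℂ} (hg : ContinuousOn g (Set.Icc 0 1)) :
    ContinuousOn (fun z : ℂ => g z.re) (spectrum ℂ N.resolvent) :=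
  hg.comp Complex.continuous_re.continuousOn fun _ hz => (hR.spectrum_subset hz).2

theorem HasResolvent.funR_congr {g h : ℝ → ℂ} (e : ∀ x ∈ Set.Icc (0 : ℝ) 1, g x = h x) :
    N.funR g = N.funR h :=
  cfc_congr fun _ hz => e _ (hR.spectrum_subset hz).2

theorem HasResolvent.funR_mul {g h : ℝ → ℂ} (hg : ContinuousOn g (Set.Icc 0 1))
    (hh : ContinuousOn h (Set.Icc 0 1)) :
    N.funR (fun x => g x * h x) = N.funR g * N.funR h :=
  cfc_mul _ _ _ (hR.continuousOn_spectrum hg) (hR.continuousOn_spectrum hh)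

theorem HasResolvent.funR_sub {g h : ℝ → ℂ} (hg : ContinuousOn g (Set.Icc 0 1))
    (hh : ContinuousOn h (Set.Icc 0 1)) :
    N.funR (fun x => g x - h x) = N.funR g - N.funR h :=
  cfc_sub _ _ _ (hR.continuousOn_spectrum hg) (hR.continuousOn_spectrum hh)

theorem HasResolvent.funR_smul {g : ℝ → ℂ} (c : ℂ) (hg : ContinuousOn g (Set.Icc 0 1)) :
    N.funR (fun x => c * g x) = c • N.funR g :=
  cfc_const_mul _ _ _ (hR.continuousOn_spectrum hg)

theorem HasResolvent.norm_funR_le {g : ℝ → ℂ} {C : ℝ} (hC : 0 ≤ C)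
    (h : ∀ x ∈ Set.Icc (0 : ℝ) 1, ‖g x‖ ≤ C) : ‖N.funR g‖ ≤ C :=
  norm_cfc_le hC fun _ hz => h _ (hR.spectrum_subset hz).2

theorem HasResolvent.funR_pow (k : ℕ) : N.funR (fun x => (x : ℂ) ^ k) = N.resolvent ^ k := by
  have h1 : IsStarNormal N.resolvent := N.resolvent_selfAdjoint.isStarNormal
  rw [← cfc_pow_id (R := ℂ) N.resolvent k]
  exact cfc_congr fun z hz => congrArg (· ^ k) (hR.spectrum_subset hz).1

theorem HasResolvent.funR_one : N.funR (fun _ => 1) = 1 := by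
  simpa using hR.funR_pow 0

omit hR in
theorem funR_selfAdjoint {g : ℝ → ℝ} : star (N.funR fun x => (g x : ℂ)) = N.funR fun x => (g x : ℂ) := by
  rw [funR, ← cfc_star]
  simp

omit hR in
theorem funR_commute (g h : ℝ → ℂ) : Commute (N.funR g) (N.funR h) :=
  cfc_commute_cfc _ _ _

theorem HasResolvent.commute_pow (g : ℝ → ℂ) (k : ℕ) : Commute (N.funR g) (N.resolvent ^ k) := by
  rw [← hR.funR_pow]
  exact funR_commute _ _

end Resolvent


/-! ### The operators `exp(-vH) (1 + H)^(-k)` and their analyticity. -/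

section Exponential

/-- The function `x ↦ exp(-v (x⁻¹ - 1)) x ^ k`, extended by `0` to `x = 0`. -/
def expFun (k : ℤ) (v : ℂ) (x : ℝ) : ℂ :=
  if x = 0 then 0 else Complex.exp (-v * (x⁻¹ - 1 : ℝ)) * (x : ℂ) ^ k

theorem expFun_mul (k j : ℤ) (v u : ℂ) (x : ℝ) :
    expFun k v x * expFun j u x = expFun (k + j) (v + u) x := by
  unfold expFun
  split_ifs with h
  · simp
  · have hx : (x : ℂ) ≠ 0 := by exact_mod_cast h
    rw [zpow_add₀ hx, neg_add, add_mul, Complex.exp_add]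
    ring

theorem norm_expFun {k : ℤ} {v : ℂ} {x : ℝ} (hx : 0 < x) :
    ‖expFun k v x‖ = Real.exp (-v.re * (x⁻¹ - 1)) * x ^ k := by
  rw [expFun, if_neg hx.ne', norm_mul, Complex.norm_exp, norm_zpow, Complex.norm_real,
    Real.norm_of_nonneg hx.le, Complex.re_mul_ofReal, Complex.neg_re]

/-- This is `u^n ≤ n! e^u` at `u = r / x`. The power `r^(-n)` becomes the growth of `exp(-izH) (1 +
H)^n` near the real line. -/
theorem inv_pow_mul_exp_le {r x : ℝ} (hr : 0 < r) (hx : 0 < x) (n : ℕ) :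
    Real.exp (-r * (x⁻¹ - 1)) * x⁻¹ ^ n ≤ n.factorial * Real.exp r * r⁻¹ ^ n := by
  have h := Real.pow_div_factorial_le_exp (r * x⁻¹) (by positivity) n
  rw [div_le_iff₀ (by positivity)] at h
  have e : -r * (x⁻¹ - 1) = r - r * x⁻¹ := by ring
  have e2 : x⁻¹ ^ n = (r * x⁻¹) ^ n * r⁻¹ ^ n := by
    rw [← mul_pow]; congr 1; field_simp
  rw [e, Real.exp_sub, e2]
  have : 0 < Real.exp (r * x⁻¹) := Real.exp_pos _
  calc Real.exp r / Real.exp (r * x⁻¹) * ((r * x⁻¹) ^ n * r⁻¹ ^ n)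
      ≤ Real.exp r / Real.exp (r * x⁻¹) * ((Real.exp (r * x⁻¹) * n.factorial) * r⁻¹ ^ n) := by gcongr
    _ = _ := by field_simp

/-- The parameters for which `expFun` is continuous. -/
def ExpAdm (k : ℤ) (v : ℂ) : Prop := 0 ≤ v.re ∧ (0 < v.re ∨ 1 ≤ k)

/-- A linear bound gives continuity at `x = 0`, which stands for infinite energy. Either the power
`x^k` provides it, or the exponential damping beats `x^(k - 1)`. -/
theorem ExpAdm.exists_bound {k : ℤ} {v : ℂ} (h : ExpAdm k v) :
    ∃ C : ℝ, 0 ≤ C ∧ ∀ x ∈ Set.Icc (0 : ℝ) 1, ‖expFun k v x‖ ≤ C * x := by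
  by_cases hk : 1 ≤ k
  · refine ⟨1, zero_le_one, fun x hx => ?_⟩
    rcases hx.1.eq_or_lt with rfl | hx0
    · simp [expFun]
    rw [norm_expFun hx0]
    have h1 : 1 ≤ x⁻¹ := (one_le_inv₀ hx0).2 hx.2
    have h2 : Real.exp (-v.re * (x⁻¹ - 1)) ≤ 1 :=
      Real.exp_le_one_iff.2 (by have := h.1; nlinarith)
    have h3 : x ^ k ≤ x ^ (1 : ℤ) := zpow_le_zpow_right_of_le_one₀ hx0 hx.2 hk
    rw [zpow_one] at h3
    exact mul_le_mul h2 h3 (by positivity) zero_le_one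
  · have hv : 0 < v.re := h.2.resolve_right hk
    obtain ⟨n, hn⟩ : ∃ n : ℕ, 1 - k = n := ⟨(1 - k).toNat, by omega⟩
    refine ⟨n.factorial * Real.exp v.re * v.re⁻¹ ^ n, by positivity, fun x hx => ?_⟩
    rcases hx.1.eq_or_lt with rfl | hx0
    · simp [expFun]
    rw [norm_expFun hx0]
    have e : x ^ k = x⁻¹ ^ n * x := by
      have : k = -(n : ℤ) + 1 := by omega
      rw [this, zpow_add₀ hx0.ne', zpow_neg, zpow_natCast, zpow_one, inv_pow]
    rw [e, ← mul_assoc]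
    exact mul_le_mul_of_nonneg_right (inv_pow_mul_exp_le hv hx0 n) hx.1

theorem ExpAdm.continuousOn {k : ℤ} {v : ℂ} (h : ExpAdm k v) :
    ContinuousOn (expFun k v) (Set.Icc 0 1) := by
  intro x hx
  rcases hx.1.eq_or_lt with rfl | hx0
  · obtain ⟨C, -, hC⟩ := h.exists_bound
    have h0 : expFun k v 0 = 0 := by simp [expFun]
    rw [ContinuousWithinAt, h0]
    refine squeeze_zero_norm' (a := fun x => C * x)
      (eventually_mem_nhdsWithin.mono fun x hx => hC x hx) ?_
    have : Continuous fun x : ℝ => C * x := by fun_prop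
    simpa using (this.tendsto 0).mono_left nhdsWithin_le_nhds
  · refine ContinuousAt.continuousWithinAt ?_
    have : ContinuousAt (fun x : ℝ => Complex.exp (-v * (x⁻¹ - 1 : ℝ)) * (x : ℂ) ^ k) x := by
      refine ContinuousAt.mul ?_ ?_
      · refine Complex.continuous_exp.continuousAt.comp ?_
        refine continuousAt_const.mul (Complex.continuous_ofReal.continuousAt.comp ?_)
        exact (continuousAt_inv₀ hx0.ne').sub continuousAt_const
      · exact (Complex.continuous_ofReal.continuousAt).zpow₀ k (Or.inl (by exact_mod_cast hx0.ne'))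
    refine this.congr ?_
    filter_upwards [lt_mem_nhds hx0] with y hy
    rw [expFun, if_neg hy.ne']

/-- The segment from `v` to `v'` stays in the closed right half plane, where the exponential has
modulus at most `1`; hence the second derivative along it is bounded. Purely imaginary `v`, that is
real times, are included. -/
theorem norm_exp_taylor_le {v v' : ℂ} (hv : 0 ≤ v.re) (hv' : 0 ≤ v'.re) {r : ℝ} (hr : 0 ≤ r) :
    ‖Complex.exp (-v' * r) - Complex.exp (-v * r) + (v' - v) * r * Complex.exp (-v * r)‖ ≤
      ‖v' - v‖ ^ 2 * r ^ 2 := by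
  obtain ⟨w, hw⟩ : ∃ w : ℂ, w = -(v' - v) * r := ⟨_, rfl⟩
  have hd : ∀ θ : ℝ, HasDerivAt (fun θ : ℝ => Complex.exp (-v * r + θ * w))
      (w * Complex.exp (-v * r + θ * w)) θ := fun θ => by
    have h1 : HasDerivAt (fun θ : ℝ => -v * r + θ * w) w θ := by
      simpa using ((Complex.ofRealCLM.hasDerivAt (x := θ)).mul_const w).const_add (-v * r)
    exact h1.cexp.congr_deriv (mul_comm _ _)
  have hb : ∀ θ ∈ Set.Icc (0 : ℝ) 1, ‖Complex.exp (-v * r + θ * w)‖ ≤ 1 := fun θ hθ => by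
    rw [Complex.norm_exp, Real.exp_le_one_iff]
    have : (-v * r + θ * w).re = -((1 - θ) * v.re + θ * v'.re) * r := by
      simp [hw]; ring
    rw [this, neg_mul, neg_nonpos]
    have := hθ.1; have := hθ.2
    exact mul_nonneg (add_nonneg (mul_nonneg (by linarith) hv) (mul_nonneg hθ.1 hv')) hr
  have h1 : ∀ θ ∈ Set.Icc (0 : ℝ) 1,
      ‖w * Complex.exp (-v * r + θ * w) - w * Complex.exp (-v * r)‖ ≤ ‖w‖ ^ 2 := fun θ hθ => by
    have := norm_image_sub_le_of_norm_deriv_le_segment' (f := fun θ : ℝ =>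
      w * Complex.exp (-v * r + θ * w)) (f' := fun θ : ℝ => w * (w * Complex.exp (-v * r + θ * w)))
      (C := ‖w‖ ^ 2) (a := 0) (b := 1) (fun x _ => ((hd x).const_mul w).hasDerivWithinAt)
      (fun x hx => by
        rw [norm_mul, norm_mul, ← mul_assoc, ← sq]
        exact mul_le_of_le_one_right (sq_nonneg _) (hb x (Set.Ico_subset_Icc_self hx))) θ hθ
    simp only [Complex.ofReal_zero, zero_mul, add_zero, sub_zero] at this
    exact this.trans (mul_le_of_le_one_right (sq_nonneg _) hθ.2)
  have h2 := norm_image_sub_le_of_norm_deriv_le_segment' (f := fun θ : ℝ =>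
      Complex.exp (-v * r + θ * w) - θ * (w * Complex.exp (-v * r)))
      (f' := fun θ : ℝ => w * Complex.exp (-v * r + θ * w) - w * Complex.exp (-v * r))
      (C := ‖w‖ ^ 2) (a := 0) (b := 1)
      (fun x _ => ((hd x).sub (by
        simpa using (Complex.ofRealCLM.hasDerivAt (x := x)).mul_const
          (w * Complex.exp (-v * r)))).hasDerivWithinAt)
      (fun x hx => h1 x (Set.Ico_subset_Icc_self hx)) 1 ⟨zero_le_one, le_rfl⟩
  have e1 : -v * r + w = -v' * r := by rw [hw]; ring
  simp only [Complex.ofReal_zero, Complex.ofReal_one, zero_mul, one_mul, add_zero, sub_zero,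
    mul_one, e1] at h2
  have e2 : ‖w‖ ^ 2 = ‖v' - v‖ ^ 2 * r ^ 2 := by
    rw [hw, norm_mul, norm_neg, Complex.norm_real, mul_pow, Real.norm_eq_abs, sq_abs]
  rw [e2] at h2
  refine le_of_eq_of_le ?_ h2
  congr 1
  rw [hw]
  ring

/-- The operator `exp(-v H) (1 + H) ^ (-k)`. -/
def expR (k : ℤ) (v : ℂ) : 𝓗 →L[ℂ] 𝓗 := N.funR (expFun k v)

theorem damp_eq (k : ℕ) (w : ℂ) : N.damp k w = N.expR (-k) w := by
  unfold damp expR expFun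
  congr 1
  ext x
  split_ifs
  · rfl
  · rw [zpow_neg, zpow_natCast, Complex.ofReal_inv, inv_pow]

variable {N}

section
variable (hR : N.HasResolvent)
include hR

theorem HasResolvent.expR_mul {k j : ℤ} {v u : ℂ} (h1 : ExpAdm k v) (h2 : ExpAdm j u) :
    N.expR k v * N.expR j u = N.expR (k + j) (v + u) := by
  unfold expR
  rw [← hR.funR_mul h1.continuousOn h2.continuousOn]
  exact hR.funR_congr fun x _ => expFun_mul k j v u x

theorem HasResolvent.expR_zero {k : ℕ} (hk : 1 ≤ k) : N.expR k 0 = N.resolvent ^ k := by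
  rw [← hR.funR_pow]
  refine hR.funR_congr fun x _ => ?_
  unfold expFun
  split_ifs with h
  · rw [h]; simp [show k ≠ 0 by omega]
  · simp

theorem HasResolvent.pow_mul_expR {k : ℤ} {v : ℂ} (h : ExpAdm k v) (n : ℕ) :
    N.resolvent ^ n * N.expR k v = N.expR (k + n) v := by
  rcases Nat.eq_zero_or_pos n with rfl | hn
  · simp
  · rw [← hR.expR_zero hn, hR.expR_mul ⟨le_rfl, Or.inr (by exact_mod_cast hn)⟩ h, zero_add,
      add_comm]

theorem HasResolvent.expR_mul_pow {k : ℤ} {v : ℂ} (h : ExpAdm k v) (n : ℕ) :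
    N.expR k v * N.resolvent ^ n = N.expR (k + n) v := by
  rw [← hR.pow_mul_expR h n]
  exact hR.commute_pow _ n

theorem HasResolvent.norm_expR_le (n : ℕ) {v : ℂ} (h0 : 0 < v.re) (h1 : v.re ≤ 1) :
    ‖N.expR (-n) v‖ ≤ n.factorial * Real.exp 1 * v.re⁻¹ ^ n := by
  refine hR.norm_funR_le (by positivity) fun x hx => ?_
  rcases hx.1.eq_or_lt with rfl | hx0
  · simp only [expFun, if_true, norm_zero]; positivity
  rw [norm_expFun hx0, zpow_neg, zpow_natCast, ← inv_pow]
  refine (inv_pow_mul_exp_le h0 hx0 n).trans ?_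
  gcongr

/-- The derivative in `v` is multiplication by `-H = 1 - (1 + H)`, which explains the two terms with
`k` and `k - 1`. The unbounded factor `H²` in the remainder is absorbed by two powers of the
resolvent. -/
theorem HasResolvent.norm_expR_taylor_le {k : ℤ} (hk : 3 ≤ k) {v v' : ℂ} (hv : 0 ≤ v.re)
    (hv' : 0 ≤ v'.re) :
    ‖N.expR k v' - N.expR k v - (v' - v) • (N.expR k v - N.expR (k - 1) v)‖ ≤ ‖v' - v‖ ^ 2 := by
  have c1 := (show ExpAdm k v from ⟨hv, Or.inr (by omega)⟩).continuousOn
  have c2 := (show ExpAdm k v' from ⟨hv', Or.inr (by omega)⟩).continuousOn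
  have c3 := (show ExpAdm (k - 1) v from ⟨hv, Or.inr (by omega)⟩).continuousOn
  unfold expR
  rw [← hR.funR_sub c2 c1, ← hR.funR_sub c1 c3, ← hR.funR_smul (g := fun x => expFun k v x - expFun (k - 1) v x) _ (c1.sub c3),
    ← hR.funR_sub (g := fun x => expFun k v' x - expFun k v x)
      (h := fun x => (v' - v) * (expFun k v x - expFun (k - 1) v x)) (c2.sub c1)
      (continuousOn_const.mul (c1.sub c3))]
  refine hR.norm_funR_le (sq_nonneg _) fun x hx => ?_
  rcases hx.1.eq_or_lt with rfl | hx0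
  · simp [expFun]
  have h1 : 1 ≤ x⁻¹ := (one_le_inv₀ hx0).2 hx.2
  have hxc : (x : ℂ) ≠ 0 := by exact_mod_cast hx0.ne'
  simp only [expFun, if_neg hx0.ne']
  have h := norm_exp_taylor_le hv hv' (r := x⁻¹ - 1) (by linarith)
  have e : Complex.exp (-v' * (x⁻¹ - 1 : ℝ)) * (x : ℂ) ^ k -
      Complex.exp (-v * (x⁻¹ - 1 : ℝ)) * (x : ℂ) ^ k -
      (v' - v) * (Complex.exp (-v * (x⁻¹ - 1 : ℝ)) * (x : ℂ) ^ k -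
        Complex.exp (-v * (x⁻¹ - 1 : ℝ)) * (x : ℂ) ^ (k - 1)) =
      (Complex.exp (-v' * (x⁻¹ - 1 : ℝ)) - Complex.exp (-v * (x⁻¹ - 1 : ℝ)) +
        (v' - v) * (x⁻¹ - 1 : ℝ) * Complex.exp (-v * (x⁻¹ - 1 : ℝ))) * (x : ℂ) ^ k := by
    rw [zpow_sub_one₀ hxc]
    push_cast
    ring
  rw [e, norm_mul, norm_zpow, Complex.norm_real, Real.norm_of_nonneg hx0.le]
  calc _ ≤ ‖v' - v‖ ^ 2 * (x⁻¹ - 1) ^ 2 * x ^ k := by gcongr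
    _ ≤ ‖v' - v‖ ^ 2 * (x⁻¹ - 1) ^ 2 * x ^ (2 : ℤ) := by
        gcongr 1
        exact zpow_le_zpow_right_of_le_one₀ hx0 hx.2 (by omega)
    _ = ‖v' - v‖ ^ 2 * (1 - x) ^ 2 := by
        rw [mul_assoc]; congr 1
        rw [show (2 : ℤ) = (2 : ℕ) from rfl, zpow_natCast, ← mul_pow]; congr 1; field_simp
    _ ≤ ‖v' - v‖ ^ 2 := by
        refine mul_le_of_le_one_right (sq_nonneg _) (pow_le_one₀ (by linarith [hx.2]) (by linarith))

theorem HasResolvent.hasDerivWithinAt_expR {k : ℤ} (hk : 3 ≤ k) {v : ℂ} (hv : 0 ≤ v.re) :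
    HasDerivWithinAt (N.expR k) (N.expR k v - N.expR (k - 1) v) {v | 0 ≤ v.re} v := by
  rw [hasDerivWithinAt_iff_isLittleO]
  have hO : (fun v' : ℂ => N.expR k v' - N.expR k v - (v' - v) • (N.expR k v - N.expR (k - 1) v))
      =O[𝓝[{v | 0 ≤ v.re}] v] fun v' => ‖v' - v‖ ^ 2 := by
    refine Asymptotics.IsBigO.of_bound 1 (eventually_mem_nhdsWithin.mono fun v' hv' => ?_)
    have := hR.norm_expR_taylor_le hk hv hv'
    simpa using this
  refine hO.trans_isLittleO ?_
  have h1 : (fun v' : ℂ => ‖v' - v‖ ^ 2) =o[𝓝 v] fun v' => v' - v := by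
    have := (Asymptotics.isLittleO_norm_pow_id (E' := ℂ) (n := 2) (by norm_num)).comp_tendsto
      (show Tendsto (fun v' => v' - v) (𝓝 v) (𝓝 0) by
        have : Continuous fun v' : ℂ => v' - v := by fun_prop
        simpa using this.tendsto v)
    exact this
  exact h1.mono nhdsWithin_le_nhds

/-- In the open half plane no condition on `k` is needed: half of the damping, `exp(-rH)` with `r =
Re v / 2`, absorbs any power of `1 + H`, and the remaining factor `exp(-(v - r)H) R³` is covered by
the previous result. -/
theorem HasResolvent.hasDerivAt_expR (k : ℤ) {v : ℂ} (hv : 0 < v.re) :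
    HasDerivAt (N.expR k) (N.expR k v - N.expR (k - 1) v) v := by
  set r : ℂ := ((v.re / 2 : ℝ) : ℂ) with hr
  have hrre : r.re = v.re / 2 := by rw [hr, Complex.ofReal_re]
  have hr0 : 0 < r.re := by rw [hrre]; linarith
  have hvr : 0 ≤ (v - r).re := by rw [Complex.sub_re, hrre]; linarith
  have hopen : {u : ℂ | 0 ≤ u.re} ∈ 𝓝 (v - r) :=
    mem_of_superset ((isOpen_lt continuous_const Complex.continuous_re).mem_nhds
      (show (0 : ℝ) < (v - r).re by rw [Complex.sub_re, hrre]; linarith)) fun u (hu : 0 < u.re) => (show 0 ≤ u.re from hu.le)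
  have h1 : HasDerivAt (N.expR 3) (N.expR 3 (v - r) - N.expR (3 - 1) (v - r)) (v - r) :=
    (hR.hasDerivWithinAt_expR le_rfl hvr).hasDerivAt hopen
  have h2 : HasDerivAt (fun u => N.expR 3 (u - r))
      (N.expR 3 (v - r) - N.expR (3 - 1) (v - r)) v := by
    have := HasDerivAt.scomp v h1 ((hasDerivAt_id v).sub_const r)
    rw [one_smul] at this
    exact this
  have h3 := h2.const_mul (N.expR (k - 3) r)
  have a1 : ExpAdm (k - 3) r := ⟨hr0.le, Or.inl hr0⟩
  have a2 : ∀ j, 1 ≤ j → ExpAdm j (v - r) := fun j hj => ⟨hvr, Or.inr hj⟩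
  rw [mul_sub, hR.expR_mul a1 (a2 3 (by norm_num)), hR.expR_mul a1 (a2 _ (by norm_num))] at h3
  have e1 : k - 3 + 3 = k := by ring
  have e2 : k - 3 + (3 - 1) = k - 1 := by ring
  rw [e1, e2, add_sub_cancel] at h3
  refine h3.congr_of_eventuallyEq ?_
  have hcont : Tendsto (fun u => u - r) (𝓝 v) (𝓝 (v - r)) :=
    (continuous_id.sub continuous_const).tendsto v
  filter_upwards [hcont hopen] with u hu
  rw [hR.expR_mul a1 ⟨hu, Or.inr (by norm_num)⟩, e1, add_sub_cancel]

end

end Exponential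

end LocalNet
end
end DilQFT

/-! ### Time translations as functions of the Hamiltonian. -/

namespace DilQFT

noncomputable section

theorem hasDerivAt_neg_mul_I (t : ℝ) :
    HasDerivAt (fun u : ℝ => -((u : ℂ) * Complex.I)) (-Complex.I) t := by
  have h := ((Complex.ofRealCLM.hasDerivAt (x := t)).mul_const Complex.I).neg
  rw [Complex.ofRealCLM_apply, Complex.ofReal_one, one_mul] at h
  exact h

namespace LocalNet

variable {s : ℕ} {𝓗 : Type*} [NormedAddCommGroup 𝓗] [InnerProductSpace ℂ 𝓗] [CompleteSpace 𝓗]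
variable (N : LocalNet s 𝓗)

/-- `exp(itH) (1 + H) ^ (-k)`. -/
def flow (k : ℕ) (t : ℝ) : 𝓗 →L[ℂ] 𝓗 := N.timeU t * N.resolvent ^ k

section TimeTranslations

theorem timeU_add (a b : ℝ) : N.timeU (a + b) = N.timeU a * N.timeU b := by
  have h := N.U_mul (Pi.single 0 a) (Pi.single 0 b) 1 1 isLorentz_one isLorentz_one
  rw [Matrix.one_mulVec, mul_one, ← Pi.single_add] at h
  exact (congrArg (fun u : unitary (𝓗 →L[ℂ] 𝓗) => (u : 𝓗 →L[ℂ] 𝓗)) h).symm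

theorem timeU_mul_neg (t : ℝ) : N.timeU t * N.timeU (-t) = 1 := by
  rw [← timeU_add, add_neg_cancel, timeU_zero]

theorem timeU_commute (a b : ℝ) : Commute (N.timeU a) (N.timeU b) := by
  rw [Commute, SemiconjBy, ← timeU_add, ← timeU_add, add_comm]

theorem star_timeU (t : ℝ) : star (N.timeU t) = N.timeU (-t) := by
  have h : star (N.timeU t) * N.timeU t = 1 := (N.U (Pi.single 0 t) 1).2.1
  calc star (N.timeU t) = star (N.timeU t) * (N.timeU t * N.timeU (-t)) := by
        rw [timeU_mul_neg, mul_one]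
    _ = _ := by rw [← mul_assoc, h, one_mul]

theorem norm_timeU_apply (t : ℝ) (x : 𝓗) : ‖N.timeU t x‖ = ‖x‖ := by
  rw [@norm_eq_sqrt_re_inner ℂ, timeU_inner, ← norm_eq_sqrt_re_inner]

theorem norm_timeU_le (t : ℝ) : ‖N.timeU t‖ ≤ 1 :=
  ContinuousLinearMap.opNorm_le_bound _ zero_le_one fun x => by rw [norm_timeU_apply, one_mul]

variable {N} (hR : N.HasResolvent)
include hR

theorem HasResolvent.timeU_commute (t : ℝ) : Commute (N.timeU t) N.resolvent := by
  ext x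
  refine IsEnergyResolvent.unique N hR ?_
  have h : HasDerivAt (fun u : ℝ => N.timeU u (N.resolvent x)) (Complex.I • (x - N.resolvent x)) 0 :=
    hR x
  have h1 := ((N.timeU t).restrictScalars ℝ).hasFDerivAt.comp_hasDerivAt (0 : ℝ) h
  have h2 : ((N.timeU t).restrictScalars ℝ) (Complex.I • (x - N.resolvent x)) =
      Complex.I • (N.timeU t x - (N.timeU t * N.resolvent) x) := by
    simp [map_smul, map_sub]
  rw [h2] at h1
  refine HasDerivAt.congr_of_eventuallyEq h1 (Eventually.of_forall fun u => ?_)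
  exact congrArg (fun A : 𝓗 →L[ℂ] 𝓗 => A (N.resolvent x)) (N.timeU_commute u t)

theorem HasResolvent.timeU_commute_pow (t : ℝ) (k : ℕ) : Commute (N.timeU t) (N.resolvent ^ k) :=
  (hR.timeU_commute t).pow_right k

theorem HasResolvent.hasDerivAt_timeU (x : 𝓗) (t : ℝ) :
    HasDerivAt (fun u : ℝ => N.timeU u (N.resolvent x))
      (Complex.I • N.timeU t (x - N.resolvent x)) t := by
  have h : HasDerivAt (fun u : ℝ => N.timeU u (N.resolvent x)) (Complex.I • (x - N.resolvent x))
      (t - t) := by rw [sub_self]; exact hR x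
  have h1 := ((N.timeU t).restrictScalars ℝ).hasFDerivAt.comp_hasDerivAt t
    (h.comp_sub_const t t)
  have h2 : ((N.timeU t).restrictScalars ℝ) (Complex.I • (x - N.resolvent x)) =
      Complex.I • N.timeU t (x - N.resolvent x) := by
    simp [map_smul]
  rw [h2] at h1
  refine HasDerivAt.congr_of_eventuallyEq h1 (Eventually.of_forall fun u => ?_)
  have := congrArg (fun A : 𝓗 →L[ℂ] 𝓗 => A (N.resolvent x)) (N.timeU_add t (u - t))
  simpa using this

/-- A substitute for Stone's theorem: it links `U(t)`, known through its generator, with the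
functional calculus of `R`. The inner product of `U(t) R x` with `exp(itH) R^k y` is constant in
`t`, since both curves solve the same equation and `R` is symmetric. Unitarity and injectivity of
`R` then identify the operators. -/
theorem HasResolvent.timeU_eq_expR {k : ℕ} (hk : 3 ≤ k) (t : ℝ) :
    N.timeU t * N.resolvent ^ k = N.expR k (-(t * Complex.I)) := by
  have hre : ∀ u : ℝ, 0 ≤ (-(u * Complex.I)).re := fun u => by simp
  have hk' : (3 : ℤ) ≤ k := by exact_mod_cast hk
  have adm : ∀ (j : ℤ) (u : ℝ), 1 ≤ j → ExpAdm j (-(u * Complex.I)) := fun j u hj => ⟨hre u, Or.inr hj⟩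
  have hd : ∀ (y : 𝓗) (u : ℝ), HasDerivAt (fun u : ℝ => N.expR k (-(u * Complex.I)) y)
      (Complex.I • (N.expR (k - 1) (-(u * Complex.I)) y - N.expR k (-(u * Complex.I)) y)) u := by
    intro y u
    have h1 := hR.hasDerivWithinAt_expR hk' (hre u)
    have h2 : HasDerivAt (fun u : ℝ => -((u : ℂ) * Complex.I)) (-Complex.I) u := by
      exact hasDerivAt_neg_mul_I u
    have h3 := (h1.scomp u h2.hasDerivWithinAt (s := Set.univ) fun w _ => hre w)
    have h4 : HasDerivAt (fun u : ℝ => N.expR k (-(u * Complex.I)))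
        (-Complex.I • (N.expR k (-(u * Complex.I)) - N.expR (k - 1) (-(u * Complex.I)))) u :=
      h3.hasDerivAt univ_mem
    have h5 := ((ContinuousLinearMap.apply ℂ 𝓗 y).restrictScalars ℝ).hasFDerivAt.comp_hasDerivAt u h4
    refine h5.congr_deriv ?_
    simp [sub_eq_add_neg, add_comm]
  have hconst : ∀ x y : 𝓗, ⟪N.timeU t (N.resolvent x), N.expR k (-(t * Complex.I)) y⟫_ℂ =
      ⟪N.resolvent x, (N.resolvent ^ k) y⟫_ℂ := by
    intro x y
    have h0 : ∀ u : ℝ, HasDerivAt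
        (fun u : ℝ => ⟪N.timeU u (N.resolvent x), N.expR k (-(u * Complex.I)) y⟫_ℂ) 0 u := by
      intro u
      refine ((hR.hasDerivAt_timeU x u).inner ℂ (hd y u)).congr_deriv ?_
      have hsa : ∀ a b : 𝓗, ⟪N.resolvent a, b⟫_ℂ = ⟪a, N.resolvent b⟫_ℂ := fun a b =>
        (ContinuousLinearMap.isSelfAdjoint_iff_isSymmetric.1 N.resolvent_selfAdjoint) a b
      have hc : N.timeU u (N.resolvent x) = N.resolvent (N.timeU u x) :=
        congrArg (fun A : 𝓗 →L[ℂ] 𝓗 => A x) (hR.timeU_commute u)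
      have hm : N.resolvent (N.expR (k - 1) (-(u * Complex.I)) y) =
          N.expR k (-(u * Complex.I)) y := by
        have := hR.pow_mul_expR (adm (k - 1) u (by omega)) 1
        rw [pow_one] at this
        have h2 := congrArg (fun A : 𝓗 →L[ℂ] 𝓗 => A y) this
        simpa using h2
      rw [inner_smul_left, inner_smul_right, inner_sub_right, map_sub, inner_sub_left, hc, hsa, hm,
        Complex.conj_I]
      ring
    have h1 := is_const_of_deriv_eq_zero (fun u => (h0 u).differentiableAt) (fun u => (h0 u).deriv) t 0
    rw [h1, timeU_zero, Complex.ofReal_zero, zero_mul, neg_zero, ← hR.expR_zero (by omega)]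
    rfl
  ext y
  have h2 : N.expR k (-(t * Complex.I)) y - N.timeU t ((N.resolvent ^ k) y) = 0 := by
    refine hR.injective ?_
    refine ext_inner_left ℂ fun x => ?_
    have hsa : ∀ a b : 𝓗, ⟪N.resolvent a, b⟫_ℂ = ⟪a, N.resolvent b⟫_ℂ := fun a b =>
        (ContinuousLinearMap.isSelfAdjoint_iff_isSymmetric.1 N.resolvent_selfAdjoint) a b
    have h3 := hconst (N.timeU (-t) x) y
    have h4 : N.timeU t (N.resolvent (N.timeU (-t) x)) = N.resolvent x := by
      have := congrArg (fun A : 𝓗 →L[ℂ] 𝓗 => A (N.timeU (-t) x)) (hR.timeU_commute t)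
      simp only [mul_apply_eq_comp] at this
      rw [this]
      have h6 := congrArg (fun A : 𝓗 →L[ℂ] 𝓗 => A x) (N.timeU_mul_neg t)
      simp only [mul_apply_eq_comp, one_apply_eq_self] at h6
      rw [h6]
    have h5 : ⟪N.resolvent (N.timeU (-t) x), (N.resolvent ^ k) y⟫_ℂ =
        ⟪N.resolvent x, N.timeU t ((N.resolvent ^ k) y)⟫_ℂ := by
      rw [← h4, timeU_inner]
    rw [h4, h5] at h3
    rw [inner_zero_right, ← hsa, inner_sub_right, h3, sub_self]
  exact (sub_eq_zero.1 h2).symm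

theorem HasResolvent.hasDerivAt_flow {k : ℕ} (hk : 3 ≤ k) (t : ℝ) :
    HasDerivAt (N.flow (k + 1)) (Complex.I • (N.flow k t - N.flow (k + 1) t)) t := by
  have h1 := hR.hasDerivWithinAt_expR (k := (k + 1 : ℕ)) (by push_cast; omega)
    (show 0 ≤ (-(t * Complex.I)).re by simp)
  have h2 : HasDerivAt (fun u : ℝ => -((u : ℂ) * Complex.I)) (-Complex.I) t := by
    exact hasDerivAt_neg_mul_I t
  have h3 := (h1.scomp t h2.hasDerivWithinAt (s := Set.univ) fun w _ => by simp)
  have e1 : N.flow (k + 1) = N.expR (k + 1 : ℕ) ∘ fun u : ℝ => -((u : ℂ) * Complex.I) :=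
    funext fun u => hR.timeU_eq_expR (by omega) u
  rw [e1]
  refine (h3.hasDerivAt univ_mem).congr_deriv ?_
  have e2 : N.flow k t = N.expR ((k + 1 : ℕ) - 1) (-(t * Complex.I)) := by
    rw [Nat.cast_succ, add_sub_cancel_right]
    exact hR.timeU_eq_expR hk t
  rw [e2]
  simp only [Function.comp_apply, neg_smul, smul_sub]
  abel

/-- Every additional power of the resolvent pays for one derivative in norm; the offset `4` comes
from the condition `3 ≤ k` in `hasDerivAt_flow`. -/
theorem HasResolvent.contDiff_flow (n : ℕ) : ∀ k, n + 4 ≤ k → ContDiff ℝ n (N.flow k) := by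
  induction n with
  | zero =>
    intro k hk
    obtain ⟨j, rfl⟩ : ∃ j, k = j + 1 := ⟨k - 1, by omega⟩
    exact contDiff_zero.2 (continuous_iff_continuousAt.2 fun t =>
      (hR.hasDerivAt_flow (by omega) t).continuousAt)
  | succ n ih =>
    intro k hk
    obtain ⟨j, rfl⟩ : ∃ j, k = j + 1 := ⟨k - 1, by omega⟩
    have hd := fun t => hR.hasDerivAt_flow (k := j) (by omega) t
    rw [Nat.cast_succ, contDiff_succ_iff_deriv]
    refine ⟨fun t => (hd t).differentiableAt, by simp, ?_⟩
    have : deriv (N.flow (j + 1)) = fun t => Complex.I • (N.flow j t - N.flow (j + 1) t) :=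
      funext fun t => (hd t).deriv
    rw [this]
    exact ((ih j (by omega)).sub (ih (j + 1) (by omega))).const_smul _

end TimeTranslations

end LocalNet
end
end DilQFT

/-! ### Normal functionals, and forms as bounded operators. -/

namespace DilQFT

noncomputable section

theorem hasSum_functional_apply {V ι : Type*} [NormedAddCommGroup V] [NormedSpace ℂ V]
    {f : ι → StrongDual ℂ V} {τ : StrongDual ℂ V} (h : HasSum f τ) (A : V) :
    HasSum (fun n => f n A) (τ A) :=
  (ContinuousLinearMap.apply ℂ ℂ A).hasSum h

theorem hasSum_of_hasSum_apply {V : Type*} [NormedAddCommGroup V] [NormedSpace ℂ V]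
    {f : ℕ → StrongDual ℂ V} {τ : StrongDual ℂ V} {b : ℕ → ℝ} (hb : Summable b)
    (hf : ∀ n, ‖f n‖ ≤ b n)
    (h : ∀ A, HasSum (fun n => f n A) (τ A)) : HasSum f τ := by
  have hs : Summable f := Summable.of_norm_bounded hb hf
  have h2 : ∑' n, f n = τ :=
    ContinuousLinearMap.ext fun A => (hasSum_functional_apply hs.hasSum A).unique (h A)
  exact h2 ▸ hs.hasSum

theorem summable_norm_mul_norm {V : Type*} [NormedAddCommGroup V] {x y : ℕ → V}
    (hx : Summable fun n => ‖x n‖ ^ 2)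
    (hy : Summable fun n => ‖y n‖ ^ 2) : Summable fun n => ‖x n‖ * ‖y n‖ := by
  refine Summable.of_nonneg_of_le (fun _ => by positivity) (fun n => ?_) (hx.add hy)
  have := two_mul_le_add_sq ‖x n‖ ‖y n‖
  have h0 : 0 ≤ ‖x n‖ * ‖y n‖ := by positivity
  linarith

section NormalFunctionals

variable {𝓗 : Type*} [NormedAddCommGroup 𝓗] [InnerProductSpace ℂ 𝓗]

/-- The functional `A ↦ ⟪x, A y⟫`. -/
def rankF (x y : 𝓗) : StrongDual ℂ (𝓗 →L[ℂ] 𝓗) :=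
  LinearMap.mkContinuous
    { toFun := fun A => ⟪x, A y⟫_ℂ
      map_add' := fun A B => by simp
      map_smul' := fun c A => by simp }
    (‖x‖ * ‖y‖) (fun A => by
      have h : ‖⟪x, A y⟫_ℂ‖ ≤ ‖x‖ * (‖A‖ * ‖y‖) :=
        (norm_inner_le_norm _ _).trans (by gcongr; exact A.le_opNorm y)
      calc _ ≤ ‖x‖ * (‖A‖ * ‖y‖) := h
        _ = _ := by ring)

theorem rankF_apply (x y : 𝓗) (A : 𝓗 →L[ℂ] 𝓗) : rankF x y A = ⟪x, A y⟫_ℂ := rfl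

theorem norm_rankF_le (x y : 𝓗) : ‖rankF x y‖ ≤ ‖x‖ * ‖y‖ :=
  LinearMap.mkContinuous_norm_le _ (by positivity) _

theorem IsNormal.exists_hasSum {τ : StrongDual ℂ (𝓗 →L[ℂ] 𝓗)} (h : IsNormal τ) :
    ∃ x y : ℕ → 𝓗, (Summable fun n => ‖x n‖ * ‖y n‖) ∧ HasSum (fun n => rankF (x n) (y n)) τ := by
  obtain ⟨x, y, hx, hy, h⟩ := h
  have hs := summable_norm_mul_norm hx hy
  exact ⟨x, y, hs, hasSum_of_hasSum_apply hs (fun n => norm_rankF_le (x n) (y n)) h⟩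

/-- Dominated convergence in the expansion of `τ` into rank-one functionals; this is how strong
limits of operators pass through `τ`. -/
theorem IsNormal.tendsto {τ : StrongDual ℂ (𝓗 →L[ℂ] 𝓗)} (h : IsNormal τ) {ι : Type*}
    {L : Filter ι} {A : ι → 𝓗 →L[ℂ] 𝓗} {A₀ : 𝓗 →L[ℂ] 𝓗} {C : ℝ} (hC : ∀ᶠ i in L, ‖A i‖ ≤ C)
    (hA : ∀ x, Tendsto (fun i => A i x) L (𝓝 (A₀ x))) :
    Tendsto (fun i => τ (A i)) L (𝓝 (τ A₀)) := by
  obtain ⟨x, y, hs, hsum⟩ := h.exists_hasSum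
  have h1 : ∀ A : 𝓗 →L[ℂ] 𝓗, τ A = ∑' n, ⟪x n, A (y n)⟫_ℂ := fun A =>
    (hasSum_functional_apply hsum A).tsum_eq.symm
  simp only [h1]
  refine tendsto_tsum_of_dominated_convergence (hs.mul_left C)
    (fun n => tendsto_const_nhds.inner (hA (y n))) ?_
  filter_upwards [hC] with i hi n
  calc ‖⟪x n, A i (y n)⟫_ℂ‖ ≤ ‖x n‖ * ‖A i (y n)‖ := norm_inner_le_norm _ _
    _ ≤ ‖x n‖ * (C * ‖y n‖) := by
        gcongr
        exact ((A i).le_opNorm _).trans (by gcongr)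
    _ = _ := by ring

variable [CompleteSpace 𝓗]

/-- Although `S i` converges only strongly, the functionals converge in norm: each rank-one term
does, and the terms are dominated by a summable sequence. -/
theorem IsNormal.tendsto_sandwich {τ : StrongDual ℂ (𝓗 →L[ℂ] 𝓗)} (h : IsNormal τ) {ι : Type*}
    {L : Filter ι} {S : ι → 𝓗 →L[ℂ] 𝓗} (hsa : ∀ i, star (S i) = S i)
    (hC : ∀ i, ‖S i‖ ≤ 1) (hS : ∀ x, Tendsto (fun i => S i x) L (𝓝 x)) :
    Tendsto (fun i => sandwich (S i) (S i) τ) L (𝓝 τ) := by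
  obtain ⟨x, y, hs, hsum⟩ := h.exists_hasSum
  set b : ι → ℕ → ℝ := fun i n => ‖x n‖ * ‖S i (y n) - y n‖ + ‖S i (x n) - x n‖ * ‖y n‖ with hb
  have hSle : ∀ i v, ‖S i v‖ ≤ ‖v‖ := fun i v =>
    ((S i).le_opNorm v).trans (mul_le_of_le_one_left (norm_nonneg _) (hC i))
  have hSle' : ∀ i v, ‖S i v - v‖ ≤ 2 * ‖v‖ := fun i v =>
    (norm_sub_le _ _).trans (by linarith [hSle i v])
  have hb0 : ∀ i n, 0 ≤ b i n := fun i n => by positivity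
  have hbs : ∀ i n, b i n ≤ 4 * (‖x n‖ * ‖y n‖) := fun i n => by
    have h1 := mul_le_mul_of_nonneg_left (hSle' i (y n)) (norm_nonneg (x n))
    have h2 := mul_le_mul_of_nonneg_right (hSle' i (x n)) (norm_nonneg (y n))
    simp only [hb]
    linarith
  have hlim : Tendsto (fun i => ∑' n, b i n) L (𝓝 (∑' _ : ℕ, (0 : ℝ))) := by
    refine tendsto_tsum_of_dominated_convergence (hs.mul_left 4) (fun n => ?_)
      (Eventually.of_forall fun i n => ?_)
    · have t1 : ∀ v, Tendsto (fun i => ‖S i v - v‖) L (𝓝 0) := fun v =>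
        tendsto_iff_norm_sub_tendsto_zero.1 (hS v)
      simpa using ((t1 (y n)).const_mul ‖x n‖).add ((t1 (x n)).mul_const ‖y n‖)
    · rw [Real.norm_of_nonneg (hb0 i n)]
      exact hbs i n
  rw [tsum_zero] at hlim
  rw [tendsto_iff_norm_sub_tendsto_zero]
  refine squeeze_zero (fun _ => norm_nonneg _) (fun i => ?_) hlim
  have hbsum : Summable (b i) := Summable.of_nonneg_of_le (hb0 i) (hbs i) (hs.mul_left 4)
  refine ContinuousLinearMap.opNorm_le_bound _ (tsum_nonneg (hb0 i)) fun A => ?_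
  have h1 := hasSum_functional_apply hsum A
  have h2 := hasSum_functional_apply hsum (S i * A * S i)
  have h3 : HasSum (fun n => ⟪x n, (S i * A * S i) (y n)⟫_ℂ - ⟪x n, A (y n)⟫_ℂ)
      ((sandwich (S i) (S i) τ - τ) A) := h2.sub h1
  rw [← h3.tsum_eq, mul_comm, ← tsum_mul_left]
  refine tsum_of_norm_bounded (hbsum.mul_left ‖A‖).hasSum fun n => ?_
  have e : ⟪x n, (S i * A * S i) (y n)⟫_ℂ - ⟪x n, A (y n)⟫_ℂ =
      ⟪S i (x n) - x n, A (S i (y n))⟫_ℂ + ⟪x n, A (S i (y n) - y n)⟫_ℂ := by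
    have e1 : ⟪x n, (S i * A * S i) (y n)⟫_ℂ = ⟪S i (x n), A (S i (y n))⟫_ℂ := by
      conv_lhs => rw [← hsa i]
      rw [ContinuousLinearMap.star_eq_adjoint, mul_assoc]
      simp only [mul_apply_eq_comp]
      rw [ContinuousLinearMap.adjoint_inner_right, ← ContinuousLinearMap.star_eq_adjoint, hsa i]
    rw [e1, inner_sub_left, map_sub, inner_sub_right]
    ring
  rw [e]
  calc _ ≤ ‖S i (x n) - x n‖ * (‖A‖ * ‖y n‖) + ‖x n‖ * (‖A‖ * ‖S i (y n) - y n‖) := by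
        refine (norm_add_le _ _).trans (add_le_add ?_ ?_)
        · refine (norm_inner_le_norm _ _).trans ?_
          gcongr
          exact (A.le_opNorm _).trans (by gcongr; exact hSle i _)
        · refine (norm_inner_le_norm _ _).trans ?_
          gcongr
          exact A.le_opNorm _
    _ = ‖A‖ * b i n := by simp only [hb]; ring

end NormalFunctionals

namespace LocalNet

variable {s : ℕ} {𝓗 : Type*} [NormedAddCommGroup 𝓗] [InnerProductSpace ℂ 𝓗] [CompleteSpace 𝓗]
variable (N : LocalNet s 𝓗)

/-- A form that is bounded in `‖·‖_{-l}` defines a bounded sesquilinear form through rank-one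
functionals, hence an operator by the Riesz theorem. Norm convergence of the rank-one expansion
recovers the form on every lift. -/
theorem exists_isReduced {φ : N.CDual} {l : ℕ} {C : ℝ} (h : N.DualBound l φ.1 C) :
    ∃ B, N.IsReduced l φ B := by
  set q : Submodule ℂ (StrongDual ℂ (𝓗 →L[ℂ] 𝓗)) :=
    Normal 𝓗 ⊓ N.Smooth.comap (sandwich (N.resolvent ^ l) (N.resolvent ^ l)) with hq
  let f₀ : q →ₗ[ℂ] ℂ := φ.1 ∘ₗ
    ((sandwich (N.resolvent ^ l) (N.resolvent ^ l)).restrict (p := q) (q := N.Smooth)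
      fun τ hτ => hτ.2)
  let f : StrongDual ℂ q := LinearMap.mkContinuous f₀ C fun τ : q => h _ τ.1 ⟨τ.2.1, rfl⟩
  -- Rank-one functionals sandwiched by `R^l` need not be smooth, so the form is first extended to
  -- all functionals by Hahn–Banach.
  obtain ⟨g, hg, -⟩ := exists_extension_norm_eq q f
  let b₀ : 𝓗 →ₗ⋆[ℂ] 𝓗 →ₗ[ℂ] ℂ := LinearMap.mk₂'ₛₗ (starRingEnd ℂ) (RingHom.id ℂ)
    (fun x y => g (rankF x y))
    (fun x x' y => by rw [← map_add]; congr 1; ext A; simp [rankF_apply])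
    (fun c x y => by
      rw [← map_smul]; congr 1; ext A; simp [rankF_apply, mul_comm])
    (fun x y y' => by rw [← map_add]; congr 1; ext A; simp [rankF_apply])
    (fun c x y => by
      rw [← map_smul]; congr 1; ext A; simp [rankF_apply])
  let b : 𝓗 →L⋆[ℂ] 𝓗 →L[ℂ] ℂ := b₀.mkContinuous₂ ‖g‖ fun x y => by
    calc ‖g (rankF x y)‖ ≤ ‖g‖ * ‖rankF x y‖ := g.le_opNorm _
      _ ≤ ‖g‖ * (‖x‖ * ‖y‖) := by gcongr; exact norm_rankF_le x y
      _ = _ := by ring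
  refine ⟨(InnerProductSpace.continuousLinearMapOfBilin b).adjoint, fun σ τ hτ => ?_⟩
  have hmem : τ ∈ q := ⟨hτ.1, by
    show sandwich _ _ τ ∈ N.Smooth
    rw [← hτ.2]; exact σ.2⟩
  have h1 : φ.1 σ = g τ := by
    have h2 := hg ⟨τ, hmem⟩
    rw [h2]
    change φ.1 σ = φ.1 _
    congr 1
    exact Subtype.ext hτ.2
  rw [h1]
  obtain ⟨x, y, -, hsum⟩ := IsNormal.exists_hasSum hτ.1
  refine (g.hasSum hsum).unique ?_
  refine (hasSum_functional_apply hsum _).congr_fun fun n => ?_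
  change g (rankF (x n) (y n)) = ⟪x n, _⟫_ℂ
  rw [ContinuousLinearMap.adjoint_inner_right, InnerProductSpace.continuousLinearMapOfBilin_apply]
  rfl

end LocalNet
end
end DilQFT

/-! ### Energy cutoffs. -/

namespace DilQFT

noncomputable section

/-- A continuous cutoff function that vanishes on `(-∞, a]` and is `1` on `[2a, ∞)`. -/
def cutFun (a x : ℝ) : ℝ := min 1 (max 0 (x / a - 1))

theorem continuous_cutFun (a : ℝ) : Continuous (cutFun a) := by
  unfold cutFun; fun_prop

theorem cutFun_nonneg (a x : ℝ) : 0 ≤ cutFun a x := le_min zero_le_one (le_max_left _ _)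

theorem cutFun_le_one (a x : ℝ) : cutFun a x ≤ 1 := min_le_left _ _

theorem cutFun_eq_zero {a x : ℝ} (ha : 0 < a) (h : x ≤ a) : cutFun a x = 0 := by
  have : x / a - 1 ≤ 0 := by
    have := (div_le_one ha).2 h
    linarith
  rw [cutFun, max_eq_left this, min_eq_right zero_le_one]

theorem cutFun_eq_one {a x : ℝ} (ha : 0 < a) (h : 2 * a ≤ x) : cutFun a x = 1 := by
  have : 1 ≤ x / a - 1 := by
    have := (le_div_iff₀ ha).2 h
    linarith
  rw [cutFun, min_eq_left (this.trans (le_max_right _ _))]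

namespace LocalNet

variable {s : ℕ} {𝓗 : Type*} [NormedAddCommGroup 𝓗] [InnerProductSpace ℂ 𝓗] [CompleteSpace 𝓗]
variable (N : LocalNet s 𝓗)

/-- A smooth energy cutoff at `H = a⁻¹ - 1`. -/
def cutoff (a : ℝ) : 𝓗 →L[ℂ] 𝓗 := N.funR fun x => (cutFun a x : ℂ)

/-- `exp((η / 2) H_E)` with `H_E = min(H, a⁻¹ - 1)`. -/
def growth (a η : ℝ) : 𝓗 →L[ℂ] 𝓗 :=
  N.funR fun x => (Real.exp (η / 2 * ((max x a)⁻¹ - 1)) : ℂ)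

theorem star_cutoff (a : ℝ) : star (N.cutoff a) = N.cutoff a := N.funR_selfAdjoint

theorem continuousOn_cutFun (a : ℝ) :
    ContinuousOn (fun x => (cutFun a x : ℂ)) (Set.Icc 0 1) :=
  (Complex.continuous_ofReal.comp (continuous_cutFun a)).continuousOn

theorem continuous_max_inv {a : ℝ} (ha : 0 < a) : Continuous fun x : ℝ => (max x a)⁻¹ :=
  (continuous_id.max continuous_const).inv₀ fun _ => (lt_max_of_lt_right ha).ne'

theorem continuousOn_growth {a : ℝ} (ha : 0 < a) (η : ℝ) :
    ContinuousOn (fun x => (Real.exp (η / 2 * ((max x a)⁻¹ - 1)) : ℂ)) (Set.Icc 0 1) := by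
  have h := continuous_max_inv ha
  have h2 : Continuous fun x : ℝ => Real.exp (η / 2 * ((max x a)⁻¹ - 1)) := by fun_prop
  exact (Complex.continuous_ofReal.comp h2).continuousOn

variable {N} (hR : N.HasResolvent)
include hR

theorem HasResolvent.norm_cutoff_le (a : ℝ) : ‖N.cutoff a‖ ≤ 1 :=
  HasResolvent.norm_funR_le hR zero_le_one fun x _ => by
    rw [Complex.norm_real, Real.norm_of_nonneg (cutFun_nonneg a x)]
    exact cutFun_le_one a x

/-- On the support of the cutoff function `x` is at least `a`, so division by `x^n` is harmless.
Functionals sandwiched by cutoffs are therefore smooth. -/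
theorem HasResolvent.exists_cutoff_eq (n : ℕ) {a : ℝ} (ha : 0 < a) :
    ∃ D, N.cutoff a = N.resolvent ^ n * D ∧ N.cutoff a = D * N.resolvent ^ n := by
  set g : ℝ → ℂ := fun x => (cutFun a x : ℂ) * ((max x a)⁻¹ : ℝ) ^ n with hg
  have hgc : ContinuousOn g (Set.Icc 0 1) := by
    have := continuous_max_inv ha
    have := continuous_cutFun a
    fun_prop
  have h1 : N.cutoff a = N.resolvent ^ n * N.funR g := by
    rw [← hR.funR_pow, ← hR.funR_mul (by fun_prop) hgc]
    refine hR.funR_congr fun x hx => ?_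
    rcases le_or_gt x a with h | h
    · simp [hg, cutFun_eq_zero ha h]
    · have hx0 : (x : ℂ) ≠ 0 := by exact_mod_cast (ha.trans h).ne'
      simp only [hg, max_eq_left h.le, Complex.ofReal_inv]
      rw [mul_left_comm, ← mul_pow, mul_inv_cancel₀ hx0, one_pow, mul_one]
  exact ⟨N.funR g, h1, h1.trans (hR.commute_pow g n).symm.eq⟩

theorem HasResolvent.norm_cutoff_sub_le {a : ℝ} (ha : 0 < a) (y : 𝓗) :
    ‖N.cutoff a (N.resolvent y) - N.resolvent y‖ ≤ 2 * a * ‖y‖ := by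
  have h1 : N.cutoff a * N.resolvent - N.resolvent =
      N.funR fun x => (cutFun a x : ℂ) * (x : ℂ) - (x : ℂ) := by
    have e : N.resolvent = N.funR fun x => (x : ℂ) := by simpa using (hR.funR_pow 1).symm
    have c1 : ContinuousOn (fun x : ℝ => (x : ℂ)) (Set.Icc 0 1) := by fun_prop
    rw [hR.funR_sub ((continuousOn_cutFun a).fun_mul c1) c1, hR.funR_mul (continuousOn_cutFun a) c1,
      ← e, cutoff]
  have h2 : ‖N.cutoff a * N.resolvent - N.resolvent‖ ≤ 2 * a := by
    rw [h1]
    refine hR.norm_funR_le (by positivity) fun x hx => ?_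
    rcases le_or_gt (2 * a) x with h | h
    · rw [cutFun_eq_one ha h]; simp; positivity
    · rw [show (cutFun a x : ℂ) * x - x = ((-(1 - cutFun a x) * x : ℝ) : ℂ) by push_cast; ring,
        Complex.norm_real, norm_mul, norm_neg, Real.norm_of_nonneg hx.1,
        Real.norm_of_nonneg (sub_nonneg.2 (cutFun_le_one a x))]
      have := cutFun_nonneg a x
      nlinarith [hx.1]
  exact ((N.cutoff a * N.resolvent - N.resolvent).le_opNorm y).trans (by gcongr)

theorem HasResolvent.dense_range : Dense (Set.range N.resolvent) := by
  have h1 : (LinearMap.range (N.resolvent : 𝓗 →ₗ[ℂ] 𝓗)).topologicalClosure = ⊤ := by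
    rw [Submodule.topologicalClosure_eq_top_iff, eq_bot_iff]
    intro x hx
    refine (Submodule.mem_bot ℂ).2 (hR.injective ?_)
    refine ext_inner_left ℂ fun y => ?_
    have h2 := (Submodule.mem_orthogonal _ x).1 hx (N.resolvent y) ⟨y, rfl⟩
    rw [inner_zero_right, ← h2]
    exact ((ContinuousLinearMap.isSelfAdjoint_iff_isSymmetric).1 N.resolvent_selfAdjoint y x).symm
  have h3 := (Submodule.dense_iff_topologicalClosure_eq_top).2 h1
  exact h3

/-- On the range of `R`, which is dense because `R` is injective and self-adjoint, convergence has
the rate `2a`; the bound `‖χ_a‖ ≤ 1` extends it to all vectors. -/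
theorem HasResolvent.cutoff_tendsto (y : 𝓗) :
    Tendsto (fun a => N.cutoff a y) (𝓝[>] 0) (𝓝 y) := by
  rw [Metric.tendsto_nhds]
  intro ε hε
  obtain ⟨_, ⟨x, rfl⟩, hx⟩ := hR.dense_range.exists_dist_lt y (show 0 < ε / 3 by positivity)
  have h1 : ∀ᶠ a : ℝ in 𝓝[>] 0, 2 * a * ‖x‖ < ε / 3 := by
    have : Tendsto (fun a : ℝ => 2 * a * ‖x‖) (𝓝[>] 0) (𝓝 (2 * 0 * ‖x‖)) :=
      ((continuous_const.mul continuous_id).mul continuous_const).continuousAt.tendsto.mono_left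
        nhdsWithin_le_nhds
    exact this.eventually (gt_mem_nhds (by simpa using by positivity))
  filter_upwards [h1, self_mem_nhdsWithin] with a ha ha0
  have h2 := hR.norm_cutoff_sub_le ha0 x
  have h3 : ‖N.cutoff a (y - N.resolvent x)‖ ≤ ‖y - N.resolvent x‖ :=
    ((N.cutoff a).le_opNorm _).trans (mul_le_of_le_one_left (norm_nonneg _) (hR.norm_cutoff_le a))
  rw [dist_eq_norm] at hx ⊢
  have e : N.cutoff a y - y = N.cutoff a (y - N.resolvent x) +
      (N.cutoff a (N.resolvent x) - N.resolvent x) - (y - N.resolvent x) := by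
    rw [map_sub]; abel
  rw [e]
  calc _ ≤ _ := norm_sub_le _ _
    _ ≤ _ := add_le_add_left (norm_add_le _ _) _
    _ < ε := by linarith

/-- The energy `E = a⁻¹ - 1` corresponds to the value `a` of the resolvent, and the cutoff function
vanishes exactly where the negative part of `x - a` may be nonzero. -/
theorem HasResolvent.energyProj_mul_cutoff {a : ℝ} (ha : 0 < a) :
    N.energyProj (a⁻¹ - 1) * N.cutoff a = N.cutoff a := by
  ext y
  refine Submodule.starProjection_eq_self_iff.2 ?_
  rw [show (1 + (a⁻¹ - 1))⁻¹ = a by rw [add_sub_cancel, inv_inv]]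
  have c1 : ContinuousOn (fun x : ℝ => ((max (a - x) 0 : ℝ) : ℂ)) (Set.Icc 0 1) := by fun_prop
  have h : (N.funR fun x => ((max (a - x) 0 : ℝ) : ℂ)) * N.cutoff a = 0 := by
    rw [cutoff, ← hR.funR_mul c1 (continuousOn_cutFun a)]
    have : N.funR (fun _ => 0) = 0 := by
      simpa using hR.funR_smul (g := fun _ => 1) 0 continuousOn_const
    rw [← this]
    refine hR.funR_congr fun x hx => ?_
    rcases le_or_gt x a with h | h
    · simp [cutFun_eq_zero ha h]
    · rw [max_eq_right (by linarith)]; simp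
  exact congrArg (fun A : 𝓗 →L[ℂ] 𝓗 => A y) h

theorem HasResolvent.cutoff_mul_energyProj {a : ℝ} (ha : 0 < a) :
    N.cutoff a * N.energyProj (a⁻¹ - 1) = N.cutoff a := by
  have h := congrArg star (hR.energyProj_mul_cutoff ha)
  have hE : star (N.energyProj (a⁻¹ - 1)) = N.energyProj (a⁻¹ - 1) :=
    (isSelfAdjoint_starProjection _).star_eq
  rwa [star_mul, star_cutoff, hE] at h

theorem HasResolvent.cutoff_smooth {τ : StrongDual ℂ (𝓗 →L[ℂ] 𝓗)} (hτ : τ ∈ Normal 𝓗) {a : ℝ}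
    (ha : 0 < a) : sandwich (N.cutoff a) (N.cutoff a) τ ∈ N.Smooth := by
  rw [mem_smooth]
  intro l
  obtain ⟨D, h1, h2⟩ := hR.exists_cutoff_eq l ha
  refine ⟨sandwich D D τ, sandwich_mem _ _ hτ, ?_⟩
  ext A
  simp only [sandwich_apply]
  conv_lhs => rw [h2]
  conv_lhs => enter [2, 2]; rw [← h2, h1]
  simp only [mul_assoc]

theorem HasResolvent.cutoff_energyBounded {τ : StrongDual ℂ (𝓗 →L[ℂ] 𝓗)} (hτ : τ ∈ Normal 𝓗)
    {a : ℝ} (ha : 0 < a) :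
    N.EnergyBounded (a⁻¹ - 1) ⟨sandwich (N.cutoff a) (N.cutoff a) τ, hR.cutoff_smooth hτ ha⟩ := by
  refine ⟨_, sandwich_mem (N.cutoff a) (N.cutoff a) hτ, ?_⟩
  ext A
  simp only [sandwich_apply]
  conv_lhs => rw [← hR.cutoff_mul_energyProj ha]
  conv_lhs => enter [2, 2]; rw [hR.cutoff_mul_energyProj ha, ← hR.energyProj_mul_cutoff ha]
  simp only [mul_assoc]

/-- At `z = t - iη` the factor `exp(izH/2)` contains the growing part `exp(ηH/2)`. On bounded
energies it tends to `1` in norm, so it does not influence boundary values. -/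
theorem HasResolvent.growth_tendsto {a : ℝ} (ha : 0 < a) (ha1 : a ≤ 1) :
    Tendsto (N.growth a) (𝓝[>] 0) (𝓝 1) := by
  rw [tendsto_iff_norm_sub_tendsto_zero]
  set b := a⁻¹ - 1 with hb
  have hb0 : 0 ≤ b := by rw [hb, sub_nonneg]; exact (one_le_inv₀ ha).2 ha1
  have h0 : Tendsto (fun η : ℝ => Real.exp (η / 2 * b) - 1) (𝓝[>] 0) (𝓝 0) := by
    have : ContinuousAt (fun η : ℝ => Real.exp (η / 2 * b) - 1) 0 := by fun_prop
    have h := this.tendsto.mono_left (nhdsWithin_le_nhds (s := Set.Ioi 0))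
    simpa using h
  refine squeeze_zero' (Eventually.of_forall fun _ => norm_nonneg _) ?_ h0
  filter_upwards [self_mem_nhdsWithin] with η hη
  have hη : 0 < η := hη
  rw [growth, ← hR.funR_one, ← hR.funR_sub (continuousOn_growth ha η) continuousOn_const]
  refine hR.norm_funR_le (by rw [sub_nonneg]; exact Real.one_le_exp (by positivity)) fun x hx => ?_
  have h1 : 0 ≤ (max x a)⁻¹ - 1 := by
    rw [sub_nonneg]
    exact (one_le_inv₀ (lt_max_of_lt_right ha)).2 (max_le hx.2 ha1)
  have h2 : (max x a)⁻¹ - 1 ≤ b := by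
    rw [hb]; gcongr; exact le_max_right _ _
  rw [show (Real.exp (η / 2 * ((max x a)⁻¹ - 1)) : ℂ) - 1 =
    ((Real.exp (η / 2 * ((max x a)⁻¹ - 1)) - 1 : ℝ) : ℂ) by push_cast; ring, Complex.norm_real,
    Real.norm_of_nonneg (by rw [sub_nonneg]; exact Real.one_le_exp (by positivity))]
  gcongr

/-- On the support of the cutoff `H_E` agrees with `H`. There `l` of the resolvents cancel the
powers of `1 + H` in the boost, and `exp(i(t - iη)H/2)` splits into a time translation, smoothed by
the other `M` resolvents, and the factor `exp(ηH/2)`. -/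
theorem HasResolvent.cutoff_mul_boost {a : ℝ} (ha : 0 < a) {M : ℕ} (hM : 3 ≤ M) (l : ℕ)
    (t η : ℝ) :
    N.resolvent ^ (M + l) * N.cutoff a *
        N.boost l (a⁻¹ - 1) (Complex.I * (t - η * Complex.I) / 2) =
      N.growth a η * N.cutoff a * N.flow M (t / 2) := by
  have cb : ContinuousOn (fun x : ℝ => Complex.exp (Complex.I * (t - η * Complex.I) / 2 *
      ((max x a)⁻¹ - 1 : ℝ)) * ((max x a)⁻¹ : ℝ) ^ l) (Set.Icc 0 1) := by
    have := continuous_max_inv ha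
    fun_prop
  have hadm : ExpAdm M (-((t / 2 : ℝ) * Complex.I)) :=
    ⟨by simp, Or.inr (by exact_mod_cast (by omega : 1 ≤ M))⟩
  have cf := hadm.continuousOn
  have cp : ContinuousOn (fun x : ℝ => (x : ℂ) ^ (M + l)) (Set.Icc 0 1) := by fun_prop
  rw [flow, hR.timeU_eq_expR hM, boost, cutoff, growth, expR, ← hR.funR_pow,
    show (1 + (a⁻¹ - 1))⁻¹ = a by rw [add_sub_cancel, inv_inv], ← hR.funR_mul cp (continuousOn_cutFun a),
    ← hR.funR_mul (cp.fun_mul (continuousOn_cutFun a)) cb,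
    ← hR.funR_mul (continuousOn_growth ha η) (continuousOn_cutFun a),
    ← hR.funR_mul ((continuousOn_growth ha η).fun_mul (continuousOn_cutFun a)) cf]
  refine hR.funR_congr fun x hx => ?_
  rcases le_or_gt x a with h | h
  · simp [cutFun_eq_zero ha h]
  · have hx0 : (x : ℂ) ≠ 0 := by exact_mod_cast (ha.trans h).ne'
    rw [expFun, if_neg (ha.trans h).ne', max_eq_left h.le]
    have e : Complex.exp (Complex.I * (t - η * Complex.I) / 2 * (x⁻¹ - 1 : ℝ)) =
        (Real.exp (η / 2 * (x⁻¹ - 1)) : ℂ) *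
          Complex.exp (- -((t / 2 : ℝ) * Complex.I) * (x⁻¹ - 1 : ℝ)) := by
      rw [Complex.ofReal_exp, ← Complex.exp_add]
      congr 1
      push_cast
      linear_combination (-(η : ℂ) / 2 * ((x : ℂ)⁻¹ - 1)) * Complex.I_sq
    have e2 : (x : ℂ) ^ l * (x : ℂ)⁻¹ ^ l = 1 := by
      rw [← mul_pow, mul_inv_cancel₀ hx0, one_pow]
    rw [e, pow_add, zpow_natCast, Complex.ofReal_inv]
    generalize Complex.exp (- -((t / 2 : ℝ) * Complex.I) * (x⁻¹ - 1 : ℝ)) = u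
    linear_combination ((Real.exp (η / 2 * (x⁻¹ - 1)) : ℂ) * cutFun a x * u * (x : ℂ) ^ M) * e2

theorem HasResolvent.boost_mul_cutoff {a : ℝ} (ha : 0 < a) {M : ℕ} (hM : 3 ≤ M) (l : ℕ)
    (t η : ℝ) :
    N.boost l (a⁻¹ - 1) (Complex.I * (t - η * Complex.I) / 2) *
        (N.cutoff a * N.resolvent ^ (M + l)) =
      N.flow M (t / 2) * (N.cutoff a * N.growth a η) := by
  have c1 : N.growth a η * N.cutoff a = N.cutoff a * N.growth a η := (N.funR_commute _ _).eq
  have c2 : N.cutoff a * N.growth a η * N.flow M (t / 2) =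
      N.flow M (t / 2) * (N.cutoff a * N.growth a η) := by
    have hf : N.flow M (t / 2) = N.funR _ := hR.timeU_eq_expR hM (t / 2)
    rw [hf]
    exact ((N.funR_commute _ _).mul_left (N.funR_commute _ _)).eq
  rw [← c2, ← c1, ← hR.cutoff_mul_boost ha hM l]
  have d1 : N.resolvent ^ (M + l) * N.cutoff a = N.cutoff a * N.resolvent ^ (M + l) :=
    (hR.commute_pow _ _).symm.eq
  rw [d1]
  exact ((N.funR_commute _ _).mul_right (hR.commute_pow _ _)).eq

end LocalNet
end
end DilQFT

/-! ### Products evaluated on smooth functionals. -/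

namespace DilQFT

noncomputable section

theorem Kern.exists_bound {n : ℕ} (K : Fin n → Kern) : ∃ (m : ℕ) (C : ℝ), 0 ≤ C ∧
    ∀ j, ∀ z : ℂ, -1 ≤ z.im → z.im < 0 → ‖(K j).1 z‖ * |z.im| ^ m ≤ C := by
  choose l C h using fun j => (K j).2.2.2
  refine ⟨∑ j, l j, ∑ j, |C j|, Finset.sum_nonneg fun _ _ => abs_nonneg _, fun j z h1 h2 => ?_⟩
  have h3 : |z.im| ≤ 1 := by rw [abs_of_neg h2]; linarith
  calc ‖(K j).1 z‖ * |z.im| ^ (∑ j, l j) ≤ ‖(K j).1 z‖ * |z.im| ^ l j := by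
        gcongr ?_ * ?_
        exact pow_le_pow_of_le_one (abs_nonneg _) h3
          (Finset.single_le_sum (fun _ _ => Nat.zero_le _) (Finset.mem_univ j))
    _ ≤ C j := h j z h1 h2
    _ ≤ |C j| := le_abs_self _
    _ ≤ _ := Finset.single_le_sum (f := fun j => |C j|) (fun _ _ => abs_nonneg _) (Finset.mem_univ j)

theorem Kern.differentiableOn (K : Kern) : DifferentiableOn ℂ K.1 {z | z.im < 0} := K.2.1

section BanachAlgebra

variable {𝔸 : Type*} [NormedRing 𝔸] [NormedAlgebra ℂ 𝔸]

theorem contDiff_mulLeftRight {V W : ℝ → 𝔸}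
    {n : ℕ} (hV : ContDiff ℝ n V) (hW : ContDiff ℝ n W) :
    ContDiff ℝ n fun t => ContinuousLinearMap.mulLeftRight ℂ 𝔸 (V t) (W t) := by
  have h1 : ContDiff ℝ n fun t => ContinuousLinearMap.mul ℂ 𝔸 (V t) :=
    ((ContinuousLinearMap.mul ℂ 𝔸).restrictScalars ℝ).contDiff.comp hV
  have h2 : ContDiff ℝ n fun t => (ContinuousLinearMap.mul ℂ 𝔸).flip (W t) :=
    ((ContinuousLinearMap.mul ℂ 𝔸).flip.restrictScalars ℝ).contDiff.comp hW
  have hb : ContDiff ℝ n (fun q : (𝔸 →L[ℂ] 𝔸) × (𝔸 →L[ℂ] 𝔸) => q.1.comp q.2) :=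
    (isBoundedBilinearMap_comp (𝕜 := ℂ) (E := 𝔸) (F := 𝔸) (G := 𝔸)).contDiff.restrict_scalars ℝ
  have h3 := hb.comp (h1.prodMk h2)
  have e : (fun t => ContinuousLinearMap.mulLeftRight ℂ 𝔸 (V t) (W t)) =
      (fun q : (𝔸 →L[ℂ] 𝔸) × (𝔸 →L[ℂ] 𝔸) => q.1.comp q.2) ∘ fun t =>
        (ContinuousLinearMap.mul ℂ 𝔸 (V t), (ContinuousLinearMap.mul ℂ 𝔸).flip (W t)) := by
    funext t
    ext A
    simp [mul_assoc]
  rw [e]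
  exact h3

/-- The family of maps `A ↦ f(t) V(t) A W(t)`. -/
def sandwichCurve (f : ℝ → ℂ) (V W : ℝ → 𝔸) (t : ℝ) : 𝔸 →L[ℂ] 𝔸 :=
  f t • ContinuousLinearMap.mulLeftRight ℂ 𝔸 (V t) (W t)

theorem sandwichCurve_apply (f : ℝ → ℂ) (V W : ℝ → 𝔸) (t : ℝ) (A : 𝔸) :
    sandwichCurve f V W t A = f t • (V t * A * W t) := rfl

theorem contDiff_sandwichCurve {f : ℝ → ℂ} {V W : ℝ → 𝔸} {n : ℕ} (hf : ContDiff ℝ n f)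
    (hV : ContDiff ℝ n V) (hW : ContDiff ℝ n W) : ContDiff ℝ n (sandwichCurve f V W) :=
  hf.smul (contDiff_mulLeftRight hV hW)

theorem hasCompactSupport_sandwichCurve {f : ℝ → ℂ} (hf : HasCompactSupport f)
    (V W : ℝ → 𝔸) : HasCompactSupport (sandwichCurve f V W) :=
  hf.mono fun t ht h => ht (by simp [sandwichCurve, h])

end BanachAlgebra

theorem integrable_clm_apply {E G : Type*} [NormedAddCommGroup E] [NormedSpace ℂ E]
    [NormedAddCommGroup G] [NormedSpace ℂ G] {P : ℝ → E →L[ℂ] G} (hP : Continuous P)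
    (hc : HasCompactSupport P) {v : ℝ → E} (hv : Continuous v) :
    MeasureTheory.Integrable fun t => P t (v t) :=
  (hP.clm_apply hv).integrable_of_hasCompactSupport (hc.mono fun t ht h => ht (by simp [h]))

theorem exists_iteratedDeriv_bound {G : Type*} [NormedAddCommGroup G] [NormedSpace ℝ G] (n : ℕ)
    (P : ℝ → G) : ∃ A : ℝ, ∀ k ≤ n, ∫ t : ℝ, ‖iteratedDeriv k P t‖ ≤ A :=
  ⟨∑ k ∈ Finset.range (n + 1), ∫ t : ℝ, ‖iteratedDeriv k P t‖, fun k hk =>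
    Finset.single_le_sum (f := fun k => ∫ t : ℝ, ‖iteratedDeriv k P t‖)
      (fun _ _ => MeasureTheory.integral_nonneg fun _ => norm_nonneg _)
      (Finset.mem_range.2 (by omega))⟩

theorem exists_sandwich_limit {𝔸 : Type*} [NormedRing 𝔸] [NormedAlgebra ℂ 𝔸] [CompleteSpace 𝔸]
    {f : ℝ → ℂ} {V W : ℝ → 𝔸} {X : ℂ → 𝔸} {m : ℕ} {C : ℝ} (hC : 0 ≤ C)
    (hf : ContDiff ℝ (m + 1 : ℕ) f) (hfs : HasCompactSupport f) (hV : ContDiff ℝ (m + 1 : ℕ) V)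
    (hW : ContDiff ℝ (m + 1 : ℕ) W) (hX : DifferentiableOn ℂ X {z | z.im < 0})
    (hb : ∀ z : ℂ, -1 ≤ z.im → z.im < 0 → ‖X z‖ * |z.im| ^ m ≤ C) :
    (∃ I₀ : 𝔸, Tendsto (fun y : ℝ => ∫ t : ℝ, sandwichCurve f V W t (X (t - y * Complex.I)))
      (𝓝[>] 0) (𝓝 I₀)) ∧
    ∀ y : ℝ, 0 < y →
      MeasureTheory.Integrable fun t : ℝ => sandwichCurve f V W t (X (t - y * Complex.I)) := by
  have hG := contDiff_sandwichCurve hf hV hW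
  have hGs := hasCompactSupport_sandwichCurve hfs V W
  refine ⟨?_, fun y hy => integrable_clm_apply hG.continuous hGs (continuous_shift hX.continuousOn hy)⟩
  obtain ⟨A, hA⟩ := exists_iteratedDeriv_bound (m + 1) (sandwichCurve f V W)
  obtain ⟨c, -, hc⟩ := exists_boundary_limit (E := 𝔸) (G := 𝔸) m
  obtain ⟨I₀, hI₀, -, -⟩ := hc (sandwichCurve f V W) X A C hC hG hGs hX hA (fun t _ x hx => by
    have him : ((t : ℂ) - x * Complex.I).im = -x := by simp
    have h1 := hb (t - x * Complex.I) (by rw [him]; linarith [hx.2]) (by rw [him]; linarith [hx.1])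
    rwa [him, abs_neg, abs_of_pos hx.1] at h1)
  exact ⟨I₀, hI₀⟩

namespace LocalNet

variable {s : ℕ} {𝓗 : Type*} [NormedAddCommGroup 𝓗] [InnerProductSpace ℂ 𝓗] [CompleteSpace 𝓗]
variable (N : LocalNet s 𝓗)

/-- `w ↦ ∑ⱼ Kⱼ(w) Bⱼ exp(-iwH) (1 + H)^(2ℓ) Bⱼ'`. -/
def kernSum {n : ℕ} (l : ℕ) (K : Fin n → ℂ → ℂ) (B B' : Fin n → 𝓗 →L[ℂ] 𝓗) (w : ℂ) :
    𝓗 →L[ℂ] 𝓗 :=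
  ∑ j, K j w • (B j * N.expR (-(2 * l : ℕ)) (Complex.I * w) * B' j)

variable {N} (hR : N.HasResolvent)
include hR

theorem HasResolvent.differentiableOn_kernSum {n : ℕ} (l : ℕ) {K : Fin n → ℂ → ℂ}
    (hK : ∀ j, DifferentiableOn ℂ (K j) {z | z.im < 0}) (B B' : Fin n → 𝓗 →L[ℂ] 𝓗) :
    DifferentiableOn ℂ (N.kernSum l K B B') {z | z.im < 0} := by
  have h1 : DifferentiableOn ℂ (fun w => N.expR (-(2 * l : ℕ)) (Complex.I * w)) {z | z.im < 0} := by
    intro w hw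
    have hw : w.im < 0 := hw
    have h2 := hR.hasDerivAt_expR (-(2 * l : ℕ)) (v := Complex.I * w) (by simpa using hw)
    have h3 := HasDerivAt.scomp w h2 ((hasDerivAt_id w).const_mul Complex.I)
    exact h3.differentiableAt.differentiableWithinAt
  unfold kernSum
  refine DifferentiableOn.fun_sum fun j _ => (hK j).smul ?_
  exact ((differentiableOn_const _).mul h1).mul (differentiableOn_const _)

/-- The order of growth is `m` from the kernels plus `2l` from `exp(-iwH) (1 + H)^(2l)`, whose
damping parameter is `Re(iw) = |Im w|`. -/
theorem HasResolvent.norm_kernSum_le {n : ℕ} (l : ℕ) {K : Fin n → ℂ → ℂ} {m : ℕ} {C : ℝ}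
    (B B' : Fin n → 𝓗 →L[ℂ] 𝓗) {w : ℂ} (hK : ∀ j, ‖K j w‖ * |w.im| ^ m ≤ C)
    (h1 : -1 ≤ w.im) (h2 : w.im < 0) :
    ‖N.kernSum l K B B' w‖ * |w.im| ^ (m + 2 * l) ≤
      C * ((2 * l).factorial * Real.exp 1) * ∑ j, ‖B j‖ * ‖B' j‖ := by
  have hre : (Complex.I * w).re = |w.im| := by simp [abs_of_neg h2]
  have hpos : 0 < |w.im| := abs_pos.2 h2.ne
  have h3 := hR.norm_expR_le (2 * l) (v := Complex.I * w) (by rw [hre]; exact hpos)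
    (by rw [hre, abs_of_neg h2]; linarith)
  rw [hre] at h3
  have h4 : ‖N.expR (-(2 * l : ℕ)) (Complex.I * w)‖ * |w.im| ^ (2 * l) ≤
      (2 * l).factorial * Real.exp 1 := by
    calc _ ≤ ((2 * l).factorial * Real.exp 1 * |w.im|⁻¹ ^ (2 * l)) * |w.im| ^ (2 * l) := by gcongr
      _ = _ := by rw [mul_assoc, ← mul_pow, inv_mul_cancel₀ hpos.ne', one_pow, mul_one]
  calc _ ≤ (∑ j, ‖K j w‖ * (‖B j‖ * ‖N.expR (-(2 * l : ℕ)) (Complex.I * w)‖ * ‖B' j‖)) *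
        |w.im| ^ (m + 2 * l) := by
        gcongr
        refine (norm_sum_le _ _).trans (Finset.sum_le_sum fun j _ => ?_)
        rw [norm_smul]
        gcongr
        exact (norm_mul_le _ _).trans (by gcongr; exact norm_mul_le _ _)
    _ = ∑ j, (‖K j w‖ * |w.im| ^ m) *
          (‖N.expR (-(2 * l : ℕ)) (Complex.I * w)‖ * |w.im| ^ (2 * l)) * (‖B j‖ * ‖B' j‖) := by
        rw [Finset.sum_mul]
        refine Finset.sum_congr rfl fun j _ => ?_
        rw [pow_add]; ring
    _ ≤ ∑ j, C * ((2 * l).factorial * Real.exp 1) * (‖B j‖ * ‖B' j‖) := by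
        refine Finset.sum_le_sum fun j _ => ?_
        have h5 : 0 ≤ C := le_trans (by positivity) (hK j)
        gcongr
        exact hK j
    _ = _ := by rw [Finset.mul_sum]

theorem HasResolvent.contDiff_flow_half {n k : ℕ} (h : n + 4 ≤ k) :
    ContDiff ℝ n fun t => N.flow k (t / 2) :=
  (hR.contDiff_flow n k h).comp (contDiff_id.div_const 2)

/-- The functional `σ(χ_a · χ_a)` evaluated on the correlation functions. -/
theorem HasResolvent.cutoff_correlation {M l : ℕ} (hM : 3 ≤ M)
    {σ : N.Smooth} {τ : StrongDual ℂ (𝓗 →L[ℂ] 𝓗)} (hτ : N.IsLift (M + l) σ τ) {a : ℝ} (ha : 0 < a)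
    {σ' : N.Smooth} (hσ' : σ'.1 = sandwich (N.cutoff a) (N.cutoff a) σ.1) (B B' : 𝓗 →L[ℂ] 𝓗)
    (t η : ℝ) :
    N.correlation σ' (a⁻¹ - 1) l B B' (t - η * Complex.I) =
      sandwich (N.growth a η * N.cutoff a) (N.cutoff a * N.growth a η) τ
        (N.flow M (t / 2) * (B * N.expR (-(2 * l : ℕ)) (Complex.I * (t - η * Complex.I)) * B') *
          N.flow M (t / 2)) := by
  rw [correlation, hσ', hτ.2, damp_eq]
  simp only [sandwich_apply]
  congr 1
  have e1 := hR.cutoff_mul_boost ha hM l t η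
  have e2 := hR.boost_mul_cutoff ha hM l t η
  generalize N.boost l (a⁻¹ - 1) (Complex.I * (t - η * Complex.I) / 2) = b at *
  generalize N.expR (-(2 * l : ℕ)) (Complex.I * (t - η * Complex.I)) = x
  calc _ = (N.resolvent ^ (M + l) * N.cutoff a * b) * (B * x * B') *
        (b * (N.cutoff a * N.resolvent ^ (M + l))) := by simp only [mul_assoc]
    _ = _ := by rw [e1, e2]; simp only [mul_assoc]

theorem HasResolvent.cutoff_lift_tendsto {τ : StrongDual ℂ (𝓗 →L[ℂ] 𝓗)} (hτ : τ ∈ Normal 𝓗) :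
    Tendsto (fun a => sandwich (N.cutoff a) (N.cutoff a) τ) (𝓝[>] 0) (𝓝 τ) :=
  IsNormal.tendsto_sandwich hτ N.star_cutoff hR.norm_cutoff_le hR.cutoff_tendsto

theorem HasResolvent.isLift_cutoff {L : ℕ} {σ τ : StrongDual ℂ (𝓗 →L[ℂ] 𝓗)}
    (hτ : N.IsLift L σ τ) (a : ℝ) : N.IsLift L (sandwich (N.cutoff a) (N.cutoff a) σ)
      (sandwich (N.cutoff a) (N.cutoff a) τ) := by
  refine ⟨sandwich_mem _ _ hτ.1, ?_⟩
  rw [hτ.2]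
  ext A
  have hcom : N.cutoff a * N.resolvent ^ L = N.resolvent ^ L * N.cutoff a :=
    (hR.commute_pow _ _).eq
  simp only [sandwich_apply]
  congr 1
  calc _ = (N.resolvent ^ L * N.cutoff a) * A * (N.cutoff a * N.resolvent ^ L) := by
        simp only [mul_assoc]
    _ = (N.cutoff a * N.resolvent ^ L) * A * (N.resolvent ^ L * N.cutoff a) := by rw [hcom]
    _ = _ := by simp only [mul_assoc]

omit hR in
theorem IsLift.sub {L : ℕ} {σ τ σ' τ' : StrongDual ℂ (𝓗 →L[ℂ] 𝓗)} (h : N.IsLift L σ τ)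
    (h' : N.IsLift L σ' τ') : N.IsLift L (σ - σ') (τ - τ') :=
  ⟨Submodule.sub_mem _ h.1 h'.1, by rw [map_sub, ← h.2, ← h'.2]⟩

theorem HasResolvent.cutoff_dual_tendsto {L : ℕ} {φ : Module.Dual ℂ N.Smooth} {C : ℝ}
    (hφ : N.DualBound L φ C) {σ : N.Smooth} {τ : StrongDual ℂ (𝓗 →L[ℂ] 𝓗)}
    (hτ : N.IsLift L σ τ) {ψ : ℝ → N.Smooth}
    (hψ : ∀ a > 0, (ψ a).1 = sandwich (N.cutoff a) (N.cutoff a) σ.1) :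
    Tendsto (fun a => φ (ψ a)) (𝓝[>] 0) (𝓝 (φ σ)) := by
  have hb : Tendsto (fun a => C * ‖sandwich (N.cutoff a) (N.cutoff a) τ - τ‖) (𝓝[>] 0) (𝓝 0) := by
    simpa using (tendsto_iff_norm_sub_tendsto_zero.1 (hR.cutoff_lift_tendsto hτ.1)).const_mul C
  rw [tendsto_iff_norm_sub_tendsto_zero]
  refine squeeze_zero' (Eventually.of_forall fun _ => norm_nonneg _) ?_ hb
  filter_upwards [self_mem_nhdsWithin] with a ha
  rw [← map_sub]
  refine hφ (ψ a - σ) _ ?_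
  have h1 : (ψ a - σ).1 = sandwich (N.cutoff a) (N.cutoff a) σ.1 - σ.1 := by
    rw [← hψ a ha]; rfl
  rw [h1]
  exact (hR.isLift_cutoff hτ a).sub hτ

/-- The definition prescribes `T` on energy-bounded functionals only. A smooth functional supplies
`M + l` resolvents on either side: `l` are used up by the boosts, and `M` make the time translations
differentiable in norm. The boundary value then exists as an operator that does not depend on the
cutoff, and removing the cutoff carries the formula over to all smooth functionals. -/
theorem HasResolvent.smoothed_product {P : N.Product} {T : TestFn →ₗ[ℂ] N.CDual}
    (hT : N.IsProductDistribution P T) {n : ℕ} {K : Fin n → Kern} {φ φ' : Fin n → N.CDual}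
    (hP : P = ∑ j, K j ⊗ₜ[ℂ] (φ j ⊗ₜ[ℂ] φ' j)) {l : ℕ} {B B' : Fin n → 𝓗 →L[ℂ] 𝓗}
    (hB : ∀ j, N.IsReduced l (φ j) (B j)) (hB' : ∀ j, N.IsReduced l (φ' j) (B' j)) :
    ∃ M₀ : ℕ, ∀ M ≥ M₀, ∀ (f : TestFn) (σ : N.Smooth) (τ : StrongDual ℂ (𝓗 →L[ℂ] 𝓗)),
      N.IsLift (M + l) σ τ → Tendsto (fun η : ℝ => τ (∫ t : ℝ,
        sandwichCurve f.1 (fun t => N.flow M (t / 2)) (fun t => N.flow M (t / 2)) t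
          (N.kernSum l (fun j => (K j).1) B B' (t - η * Complex.I))))
        (𝓝[>] 0) (𝓝 ((T f).1 σ)) := by
  obtain ⟨mK, CK, hCK, hK⟩ := Kern.exists_bound K
  obtain ⟨⟨lT, mT, hD⟩, hT⟩ := hT
  set m := mK + 2 * l with hm
  -- `m + 5` resolvents give the `m + 1` derivatives needed for the boundary value; `lT` makes `T f`
  -- bounded in the norm of order `M + l`.
  refine ⟨m + 5 + lT, fun M hM f σ τ hτ => ?_⟩
  obtain ⟨X, hX⟩ : ∃ X, X = N.kernSum l (fun j => (K j).1) B B' := ⟨_, rfl⟩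
  have hXd : DifferentiableOn ℂ X {z | z.im < 0} := by
    rw [hX]; exact hR.differentiableOn_kernSum l (fun j => Kern.differentiableOn (K j)) B B'
  have hfc : ContDiff ℝ (m + 1 : ℕ) f.1 := f.2.1.of_le (by exact_mod_cast le_top)
  have hflow : ContDiff ℝ (m + 1 : ℕ) fun t => N.flow M (t / 2) := hR.contDiff_flow_half (by omega)
  have hXb : ∀ z : ℂ, -1 ≤ z.im → z.im < 0 → ‖X z‖ * |z.im| ^ m ≤
      CK * ((2 * l).factorial * Real.exp 1) * ∑ j, ‖B j‖ * ‖B' j‖ := fun z h1 h2 => by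
    rw [hX, hm]
    exact hR.norm_kernSum_le l (K := fun j => (K j).1) B B' (fun j => hK j z h1 h2) h1 h2
  obtain ⟨⟨I₀, hI₀⟩, hint⟩ := exists_sandwich_limit
    (mul_nonneg (by positivity) (Finset.sum_nonneg fun _ _ => by positivity)) hfc f.2.2 hflow hflow
    hXd hXb
  rw [← hX]
  suffices hmain : (T f).1 σ = τ I₀ by
    rw [hmain]
    exact (τ.continuous.tendsto I₀).comp hI₀
  have hσn : σ.1 ∈ Normal 𝓗 := by
    rw [hτ.2]; exact sandwich_mem _ _ hτ.1
  -- At fixed cutoff the defining limit and the norm limit `I₀` are compared; the growth factors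
  -- tend to `1`, so the two limits agree.
  have key : ∀ a : ℝ, 0 < a → a < 1 → ∀ σ' : N.Smooth,
      σ'.1 = sandwich (N.cutoff a) (N.cutoff a) σ.1 →
      (T f).1 σ' = sandwich (N.cutoff a) (N.cutoff a) τ I₀ := by
    intro a ha ha1 σ' hσ'
    have hE : 0 < a⁻¹ - 1 := by rw [sub_pos]; exact (one_lt_inv₀ ha).2 ha1
    have hEB : N.EnergyBounded (a⁻¹ - 1) σ' := by
      have := hR.cutoff_energyBounded hσn ha
      obtain ⟨ρ, hρ, h⟩ := this
      exact ⟨ρ, hρ, hσ'.trans h⟩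
    have h1 := hT n K φ φ' hP l B B' hB hB' (a⁻¹ - 1) hE σ' hEB f
    refine tendsto_nhds_unique h1 ?_
    have h2 : Tendsto (fun η : ℝ => τ ((N.growth a η * N.cutoff a) *
        (∫ t : ℝ, sandwichCurve f.1 (fun t => N.flow M (t / 2)) (fun t => N.flow M (t / 2)) t
          (X (t - η * Complex.I))) * (N.cutoff a * N.growth a η))) (𝓝[>] 0)
        (𝓝 (τ ((1 * N.cutoff a) * I₀ * (N.cutoff a * 1)))) := by
      have hg := hR.growth_tendsto ha ha1.le
      exact (τ.continuous.tendsto _).comp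
        (((hg.mul_const _).mul hI₀).mul (hg.const_mul _))
    rw [one_mul, mul_one] at h2
    refine h2.congr' ?_
    filter_upwards [self_mem_nhdsWithin] with η hη
    have h3 := (sandwich (N.growth a η * N.cutoff a) (N.cutoff a * N.growth a η) τ).integral_comp_comm
      (hint η hη)
    rw [sandwich_apply] at h3
    rw [← h3]
    congr 1
    ext t
    rw [sandwichCurve_apply, map_smul, smul_eq_mul]
    congr 1
    rw [hX, kernSum, Finset.mul_sum, Finset.sum_mul, map_sum]
    refine Finset.sum_congr rfl fun j _ => ?_
    rw [mul_smul_comm, smul_mul_assoc, map_smul, smul_eq_mul,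
      hR.cutoff_correlation (M := M) (by omega) hτ ha hσ']
  have hDM : ∃ C', 0 ≤ C' ∧ N.DualBound (M + l) (T f).1 C' := by
    obtain ⟨r, hr⟩ := f.2.2.isCompact.isBounded.subset_closedBall 0
    obtain ⟨c, hc⟩ := hD (|r| + 1) (by positivity)
    exact (hc f (fun x hx => by
      have h1 := hr hx
      rw [mem_closedBall_zero_iff, Real.norm_eq_abs] at h1
      have h2 := le_abs_self r
      exact abs_lt.1 (by linarith))).mono (by omega)
  obtain ⟨C', hC', hDM⟩ := hDM
  have hlim2 : Tendsto (fun a => sandwich (N.cutoff a) (N.cutoff a) τ I₀) (𝓝[>] 0) (𝓝 (τ I₀)) :=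
    ((ContinuousLinearMap.apply ℂ ℂ I₀).continuous.tendsto τ).comp (hR.cutoff_lift_tendsto hτ.1)
  let ψ : ℝ → N.Smooth := fun a => if h : 0 < a then
    ⟨sandwich (N.cutoff a) (N.cutoff a) σ.1, hR.cutoff_smooth hσn h⟩ else 0
  have hψ : ∀ a > 0, (ψ a).1 = sandwich (N.cutoff a) (N.cutoff a) σ.1 := fun a ha => by
    simp only [ψ, dif_pos ha]
  refine tendsto_nhds_unique (hR.cutoff_dual_tendsto hDM hτ hψ) (hlim2.congr' ?_)
  filter_upwards [Ioo_mem_nhdsGT (show (0 : ℝ) < 1 by norm_num)] with a ha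
  exact (key a ha.1 ha.2 _ (hψ a ha.1)).symm

end LocalNet
end
end DilQFT

/-! ### Minimal rank implies localization at the origin. -/

namespace DilQFT

noncomputable section

theorem isRegion_doubleCone (s : ℕ) (r : ℝ) : IsRegion (doubleCone s r) := by
  constructor
  · exact isOpen_lt (by fun_prop) continuous_const
  · refine (Metric.isBounded_iff_subset_closedBall 0).2 ⟨|r|, fun x hx => ?_⟩
    have hx : |x 0| + √(∑ i : Fin s, x i.succ ^ 2) < r := hx
    have hs := Real.sqrt_nonneg (∑ i : Fin s, x i.succ ^ 2)
    rw [mem_closedBall_zero_iff]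
    refine (pi_norm_le_iff_of_nonneg (abs_nonneg r)).2 fun i => ?_
    refine le_trans ?_ (le_abs_self r)
    rw [Real.norm_eq_abs]
    refine Fin.cases ?_ (fun i => ?_) i
    · linarith
    · have h1 : |x i.succ| ≤ √(∑ i : Fin s, x i.succ ^ 2) := by
        rw [← Real.sqrt_sq_eq_abs]
        exact Real.sqrt_le_sqrt (Finset.single_le_sum (f := fun i : Fin s => x i.succ ^ 2)
          (fun _ _ => sq_nonneg _) (Finset.mem_univ i))
      linarith [abs_nonneg (x 0)]

theorem doubleCone_mono (s : ℕ) {r r' : ℝ} (h : r ≤ r') : doubleCone s r ⊆ doubleCone s r' :=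
  fun _ hx => lt_of_lt_of_le (show _ < r from hx) h

/-- The norm closure of the space of normal functionals. -/
def NormalClosure (𝓗 : Type*) [NormedAddCommGroup 𝓗] [InnerProductSpace ℂ 𝓗] [CompleteSpace 𝓗] :
    Submodule ℂ (StrongDual ℂ (𝓗 →L[ℂ] 𝓗)) :=
  (Normal 𝓗).topologicalClosure

namespace LocalNet

variable {s : ℕ} {𝓗 : Type*} [NormedAddCommGroup 𝓗] [InnerProductSpace ℂ 𝓗] [CompleteSpace 𝓗]
variable (N : LocalNet s 𝓗)

theorem algR_mono {r r' : ℝ} (h : r ≤ r') {A : 𝓗 →L[ℂ] 𝓗} (hA : A ∈ N.algR r) : A ∈ N.algR r' :=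
  N.isotony _ _ (isRegion_doubleCone s r) (isRegion_doubleCone s r') (doubleCone_mono s h) A hA

/-- `B` is a bounded operator of the form `R^ℓ φ R^ℓ` with a form `φ` that is localized
at the origin: functionals that vanish on `R^ℓ 𝔄(r) R^ℓ`, for some `r > 0`, vanish on `B`. -/
def PointLike (l : ℕ) (B : 𝓗 →L[ℂ] 𝓗) : Prop :=
  ∀ τ ∈ NormalClosure 𝓗, ∀ r > 0,
    (∀ A ∈ N.algR r, τ (N.resolvent ^ l * A * N.resolvent ^ l) = 0) → τ B = 0

variable {N}

theorem PointLike.star {l : ℕ} {B : 𝓗 →L[ℂ] 𝓗} (h : N.PointLike l B) : N.PointLike l (star B) := by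
  intro τ hτ r hr hA
  have hR : Star.star (N.resolvent ^ l) = N.resolvent ^ l := (N.resolvent_selfAdjoint.pow l).star_eq
  have h1 : conjF τ ∈ NormalClosure 𝓗 := by
    have hc : Continuous (conjF : StrongDual ℂ (𝓗 →L[ℂ] 𝓗) → StrongDual ℂ (𝓗 →L[ℂ] 𝓗)) := by
      refine continuous_iff_continuousAt.2 fun σ => ?_
      rw [ContinuousAt, tendsto_iff_norm_sub_tendsto_zero]
      have h2 : Tendsto (fun σ' => ‖σ' - σ‖) (𝓝 σ) (𝓝 0) :=
        tendsto_iff_norm_sub_tendsto_zero.1 tendsto_id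
      refine squeeze_zero (fun _ => norm_nonneg _) (fun σ' => ?_) h2
      have e : conjF σ' - conjF σ = conjF (σ' - σ) := by
        ext A; simp [conjF_apply]
      rw [e]
      exact norm_conjF_le _
    exact map_mem_closure hc hτ fun σ hσ => conjF_mem hσ
  have h2 := h (conjF τ) h1 r hr fun A hAr => by
    rw [conjF_apply, star_mul, star_mul, hR, ← mul_assoc, hA _ (star_mem hAr), map_zero]
  rw [conjF_apply] at h2
  simpa using h2

theorem IsReduced.star {l : ℕ} {φ : N.CDual} {B : 𝓗 →L[ℂ] 𝓗} (h : N.IsReduced l φ B) :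
    N.IsReduced l (N.conjD φ) (star B) := by
  intro σ τ hτ
  have h1 := h ⟨conjF σ.1, N.conjF_smooth σ.2⟩ (conjF τ) (N.isLift_conjF hτ)
  have h2 : (N.conjD φ).1 σ = conj (φ.1 ⟨conjF σ.1, N.conjF_smooth σ.2⟩) := rfl
  rw [h2, h1, conjF_apply, Complex.conj_conj]

theorem isLift_pow_le {l l' : ℕ} (h : l ≤ l') {σ τ : StrongDual ℂ (𝓗 →L[ℂ] 𝓗)}
    (hτ : N.IsLift l' σ τ) : N.IsLift l σ
      (sandwich (N.resolvent ^ (l' - l)) (N.resolvent ^ (l' - l)) τ) := by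
  refine ⟨sandwich_mem _ _ hτ.1, ?_⟩
  rw [hτ.2]
  ext A
  simp only [sandwich_apply]
  congr 1
  conv_lhs => rw [← Nat.sub_add_cancel h, pow_add]
  conv_lhs => enter [2]; rw [← pow_add, add_comm, pow_add]
  simp only [mul_assoc]

theorem exists_bound_of_le {ψ : N.Smooth →ₗ[ℂ] StrongDual ℂ (𝓗 →L[ℂ] 𝓗)} {l : ℕ} {C : ℝ}
    (h : ∀ (σ : N.Smooth) (τ : StrongDual ℂ (𝓗 →L[ℂ] 𝓗)), N.IsLift l σ τ → ‖ψ σ‖ ≤ C * ‖τ‖)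
    {l' : ℕ} (hl : l ≤ l') : ∃ C', 0 ≤ C' ∧ ∀ (σ : N.Smooth) (τ : StrongDual ℂ (𝓗 →L[ℂ] 𝓗)),
      N.IsLift l' σ τ → ‖ψ σ‖ ≤ C' * ‖τ‖ := by
  refine ⟨|C| * (‖N.resolvent ^ (l' - l)‖ * ‖N.resolvent ^ (l' - l)‖), by positivity,
    fun σ τ hτ => ?_⟩
  calc ‖ψ σ‖ ≤ C * ‖sandwich (N.resolvent ^ (l' - l)) (N.resolvent ^ (l' - l)) τ‖ :=
        h σ _ (isLift_pow_le hl hτ)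
    _ ≤ |C| * (‖N.resolvent ^ (l' - l)‖ * ‖N.resolvent ^ (l' - l)‖ * ‖τ‖) := by
        gcongr
        · exact le_abs_self C
        · exact norm_sandwich_le _ _ _
    _ = _ := by ring

theorem HasResolvent.mem_closure_lifts (hR : N.HasResolvent) (l : ℕ)
    {τ : StrongDual ℂ (𝓗 →L[ℂ] 𝓗)} (hτ : τ ∈ NormalClosure 𝓗) :
    τ ∈ closure {τ' | ∃ σ : N.Smooth, N.IsLift l σ τ'} := by
  have h1 : (Normal 𝓗 : Set (StrongDual ℂ (𝓗 →L[ℂ] 𝓗))) ⊆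
      closure {τ' | ∃ σ : N.Smooth, N.IsLift l σ τ'} := fun τ' hτ' => by
    refine mem_closure_of_tendsto (hR.cutoff_lift_tendsto hτ') ?_
    filter_upwards [self_mem_nhdsWithin] with a ha
    exact ⟨⟨_, hR.cutoff_smooth (sandwich_mem (N.resolvent ^ l) (N.resolvent ^ l) hτ') ha⟩,
      hR.isLift_cutoff ⟨hτ', rfl⟩ a⟩
  exact closure_minimal h1 isClosed_closure hτ

/-- A functional in the norm closure need not be the lift of a smooth one, but it is a limit of such
lifts. The values of `ψ` on these form a Cauchy sequence in a finite-dimensional, hence closed,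
range, so the limit is again a value of `ψ`, and the approximation estimate passes to the limit. -/
theorem HasResolvent.exists_extension (hR : N.HasResolvent) {γ : ℝ}
    {ψ : N.Smooth →ₗ[ℂ] StrongDual ℂ (𝓗 →L[ℂ] 𝓗)} [FiniteDimensional ℂ (LinearMap.range ψ)]
    {l : ℕ} {C : ℝ}
    (hC : ∀ (σ : N.Smooth) (τ : StrongDual ℂ (𝓗 →L[ℂ] 𝓗)), N.IsLift l σ τ → ‖ψ σ‖ ≤ C * ‖τ‖)
    (happ : ∀ ε > 0, ∀ᶠ r : ℝ in 𝓝[>] 0, ∀ A ∈ N.algR r,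
      ∀ (σ : N.Smooth) (τ : StrongDual ℂ (𝓗 →L[ℂ] 𝓗)), N.IsLift l σ τ →
      ‖σ.1 A - ψ σ A‖ ≤ ε * r ^ γ * ‖τ‖ * ‖A‖)
    {φ : N.CDual} {A₀ B : 𝓗 →L[ℂ] 𝓗} (hφ : ∀ σ : N.Smooth, φ.1 σ = ψ σ A₀)
    (hB : N.IsReduced l φ B)
    {τ : StrongDual ℂ (𝓗 →L[ℂ] 𝓗)} (hτ : τ ∈ NormalClosure 𝓗) :
    ∃ σ₁ : N.Smooth, ψ σ₁ A₀ = τ B ∧ ∀ ε > 0, ∀ᶠ r : ℝ in 𝓝[>] 0, ∀ A ∈ N.algR r,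
      ‖τ (N.resolvent ^ l * A * N.resolvent ^ l) - ψ σ₁ A‖ ≤ ε * r ^ γ * ‖τ‖ * ‖A‖ := by
  obtain ⟨τn, hmem, hlim⟩ := mem_closure_iff_seq_limit.1 (hR.mem_closure_lifts l hτ)
  choose σn hσn using hmem
  have hcauchy : CauchySeq fun n => ψ (σn n) := by
    have h0 : CauchySeq τn := hlim.cauchySeq
    rw [Metric.cauchySeq_iff] at h0 ⊢
    intro ε hε
    obtain ⟨n₀, hn₀⟩ := h0 (ε / (|C| + 1)) (by positivity)
    refine ⟨n₀, fun i hi j hj => ?_⟩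
    have h1 := hn₀ i hi j hj
    rw [dist_eq_norm] at h1 ⊢
    rw [← map_sub]
    have h2 : ‖ψ (σn i - σn j)‖ ≤ C * ‖τn i - τn j‖ := hC _ _ ((hσn i).sub (hσn j))
    have h3 : (|C| + 1) * ‖τn i - τn j‖ < ε := by
      rw [mul_comm]; exact (lt_div_iff₀ (by positivity)).1 h1
    have h4 : C * ‖τn i - τn j‖ ≤ (|C| + 1) * ‖τn i - τn j‖ := by
      gcongr; linarith [le_abs_self C]
    linarith
  obtain ⟨ρ, hρ⟩ := cauchySeq_tendsto_of_complete hcauchy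
  have hρm : ρ ∈ LinearMap.range ψ :=
    (Submodule.closed_of_finiteDimensional (LinearMap.range ψ)).mem_of_tendsto hρ
      (Eventually.of_forall fun n => ⟨σn n, rfl⟩)
  obtain ⟨σ₁, rfl⟩ := hρm
  have heval : ∀ A, Tendsto (fun n => ψ (σn n) A) atTop (𝓝 (ψ σ₁ A)) := fun A =>
    ((ContinuousLinearMap.apply ℂ ℂ A).continuous.tendsto _).comp hρ
  have heval' : ∀ A, Tendsto (fun n => τn n A) atTop (𝓝 (τ A)) := fun A =>
    ((ContinuousLinearMap.apply ℂ ℂ A).continuous.tendsto _).comp hlim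
  refine ⟨σ₁, ?_, fun ε hε => ?_⟩
  · refine tendsto_nhds_unique (heval A₀) ((heval' B).congr fun n => ?_)
    rw [← hφ, hB _ _ (hσn n)]
  · filter_upwards [happ ε hε] with r hr A hA
    refine le_of_tendsto_of_tendsto' (((heval' _).sub (heval A)).norm)
      ((hlim.norm.const_mul (ε * r ^ γ)).mul_const ‖A‖) fun n => ?_
    have h1 := hr A hA (σn n) (τn n) (hσn n)
    rwa [(hσn n).2, sandwich_apply] at h1

/-- Suppose `τ` vanishes on `R^l 𝔄(r₀) R^l` but not on `B`. Then the value `ρ` of `ψ` that belongs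
to `τ` is negligible on small algebras, and subtracting a suitable rank-one map with values in the
span of `ρ` gives an approximating map of smaller rank, against minimality. -/
theorem HasResolvent.pointLike_of_mem_phi (hR : N.HasResolvent) {γ : ℝ} {φ : N.CDual}
    (hφ : φ ∈ N.Phi γ) : ∃ l₀ : ℕ, ∀ l ≥ l₀, ∀ B, N.IsReduced l φ B → N.PointLike l B := by
  obtain ⟨ψ, ⟨hnorm, ⟨lψ, C, hC⟩, hfin, l₀, happ⟩, hmin, A₀, hA₀⟩ := hφ
  refine ⟨max lψ l₀, fun l hl B hB τ hτ r₀ hr₀ hvan => ?_⟩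
  by_contra hne
  obtain ⟨C₁, hC₁, hC₁'⟩ := exists_bound_of_le hC ((le_max_left _ _).trans hl)
  obtain ⟨σ₁, hσ₁, happ₁⟩ := hR.exists_extension hC₁' (happ l ((le_max_right _ _).trans hl))
    hA₀ hB hτ
  obtain ⟨α, hα⟩ : ∃ α, α = τ B := ⟨_, rfl⟩
  rw [← hα] at hne hσ₁
  obtain ⟨ρ, hρ⟩ : ∃ ρ, ρ = ψ σ₁ := ⟨_, rfl⟩
  rw [← hρ] at hσ₁
  -- The coefficient is chosen so that all values of `ψ'` vanish at `A₀`, whereas `ρ(A₀) = α ≠ 0`: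
  -- the vector `ρ` drops out of the range.
  obtain ⟨ψ', hψ'⟩ : ∃ ψ' : N.Smooth →ₗ[ℂ] StrongDual ℂ (𝓗 →L[ℂ] 𝓗),
      ∀ σ, ψ' σ = ψ σ - (α⁻¹ * φ.1 σ) • ρ :=
    ⟨ψ - (α⁻¹ • φ.1).smulRight ρ, fun σ => rfl⟩
  have hle : LinearMap.range ψ' ≤ LinearMap.range ψ := by
    rintro _ ⟨σ, rfl⟩
    rw [hψ', hρ]
    exact Submodule.sub_mem _ ⟨σ, rfl⟩ (Submodule.smul_mem _ _ ⟨σ₁, rfl⟩)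
  have hlt : LinearMap.range ψ' < LinearMap.range ψ := by
    refine lt_of_le_of_ne hle fun he => hne ?_
    have h1 : ρ ∈ LinearMap.range ψ' := by rw [he, hρ]; exact ⟨σ₁, rfl⟩
    obtain ⟨σ, hσ⟩ := h1
    have h2 : ψ' σ A₀ = 0 := by
      rw [hψ', sub_apply, smul_apply, hσ₁, hA₀ σ, smul_eq_mul]
      field_simp
      simp
    rw [← hσ₁, ← hσ, h2]
  have h1 : N.IsApproximating γ ψ' := by
    refine ⟨fun σ => ?_, ?_, Submodule.finiteDimensional_of_le hle, ?_⟩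
    · rw [hψ', hρ]
      exact Submodule.sub_mem _ (hnorm _) (Submodule.smul_mem _ _ (hnorm _))
    · refine ⟨l, C₁ + ‖α⁻¹‖ * (C₁ * ‖A₀‖) * ‖ρ‖, fun σ τ' hτ' => ?_⟩
      have h2 := hC₁' σ τ' hτ'
      have h3 : ‖φ.1 σ‖ ≤ C₁ * ‖τ'‖ * ‖A₀‖ := by
        rw [hA₀]
        exact ((ψ σ).le_opNorm A₀).trans (by gcongr)
      rw [hψ']
      calc _ ≤ ‖ψ σ‖ + ‖(α⁻¹ * φ.1 σ) • ρ‖ := norm_sub_le _ _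
        _ ≤ C₁ * ‖τ'‖ + ‖α⁻¹‖ * (C₁ * ‖τ'‖ * ‖A₀‖) * ‖ρ‖ := by
            rw [norm_smul, norm_mul]
            gcongr
        _ = _ := by ring
    · refine ⟨max l₀ lψ, fun l' hl' ε hε => ?_⟩
      obtain ⟨C₂, hC₂, hC₂'⟩ := exists_bound_of_le hC ((le_max_right _ _).trans hl')
      have e1 := happ l' ((le_max_left _ _).trans hl') (ε / 2) (by positivity)
      have e2 := happ₁ (ε / 2 / (‖α⁻¹‖ * (C₂ * ‖A₀‖) * ‖τ‖ + 1)) (by positivity)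
      filter_upwards [e1, e2, Ioo_mem_nhdsGT hr₀] with r hr1 hr2 hr A hA σ τ' hτ'
      have b1 := hr1 A hA σ τ' hτ'
      have b2 := hr2 A hA
      -- Here the localization enters: `τ` does not contribute on `𝔄(r)` for `r < r₀`, so the
      -- approximation estimate for `τ` becomes a bound of order `r^γ` on `ρ` itself.
      rw [hvan A (N.algR_mono hr.2.le hA), zero_sub, norm_neg, ← hρ] at b2
      have hrpos : 0 ≤ r ^ γ := Real.rpow_nonneg hr.1.le _
      have b3 : ‖φ.1 σ‖ ≤ C₂ * ‖τ'‖ * ‖A₀‖ := by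
        rw [hA₀]
        exact ((ψ σ).le_opNorm A₀).trans (by gcongr; exact hC₂' σ τ' hτ')
      rw [hψ', sub_apply, smul_apply, smul_eq_mul]
      obtain ⟨D, hD⟩ : ∃ D, D = ‖α⁻¹‖ * (C₂ * ‖A₀‖) * ‖τ‖ := ⟨_, rfl⟩
      have hD0 : 0 ≤ D := by rw [hD]; positivity
      rw [← hD] at b2
      calc ‖σ.1 A - (ψ σ A - α⁻¹ * φ.1 σ * ρ A)‖ = ‖(σ.1 A - ψ σ A) + α⁻¹ * φ.1 σ * ρ A‖ := by
            congr 1; ring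
        _ ≤ ‖σ.1 A - ψ σ A‖ + ‖α⁻¹ * φ.1 σ * ρ A‖ := norm_add_le _ _
        _ ≤ ε / 2 * r ^ γ * ‖τ'‖ * ‖A‖ +
            ‖α⁻¹‖ * (C₂ * ‖τ'‖ * ‖A₀‖) * (ε / 2 / (D + 1) * r ^ γ * ‖τ‖ * ‖A‖) := by
            rw [norm_mul, norm_mul]
            gcongr
        _ = ε / 2 * r ^ γ * ‖τ'‖ * ‖A‖ + (D / (D + 1)) * (ε / 2 * r ^ γ * ‖τ'‖ * ‖A‖) := by
            rw [hD]; ring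
        _ ≤ ε / 2 * r ^ γ * ‖τ'‖ * ‖A‖ + 1 * (ε / 2 * r ^ γ * ‖τ'‖ * ‖A‖) := by
            gcongr
            rw [div_le_one (by positivity)]
            linarith
        _ = _ := by ring
  exact absurd (hmin ψ' h1) (not_le.2 (Submodule.finrank_lt_finrank_of_lt hlt))

theorem HasResolvent.exists_pointLike (hR : N.HasResolvent) {φ : N.CDual} (hφ : φ ∈ N.Fields) :
    ∃ l₀ : ℕ, ∀ l ≥ l₀, ∃ B, N.IsReduced l φ B ∧ N.PointLike l B := by
  obtain ⟨γ, -, hφ⟩ := hφ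
  obtain ⟨l₀, h⟩ := hR.pointLike_of_mem_phi hφ
  obtain ⟨l₁, C, hC⟩ := φ.2
  refine ⟨max l₀ l₁, fun l hl => ?_⟩
  obtain ⟨C', -, hC'⟩ := hC.mono ((le_max_right l₀ l₁).trans hl)
  obtain ⟨B, hB⟩ := N.exists_isReduced hC'
  exact ⟨B, hB, h l ((le_max_left l₀ l₁).trans hl) B hB⟩

/-- Pointlike fields vanish on functionals that vanish on some local algebra `𝔄(r)`. -/
theorem HasResolvent.field_eq_zero (hR : N.HasResolvent) {φ : N.CDual} (hφ : φ ∈ N.Fields)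
    {σ : N.Smooth} {r : ℝ} (hr : 0 < r) (h : ∀ A ∈ N.algR r, σ.1 A = 0) : φ.1 σ = 0 := by
  obtain ⟨l, hl⟩ := hR.exists_pointLike hφ
  obtain ⟨B, hB, hP⟩ := hl l le_rfl
  obtain ⟨τ, hτ⟩ := N.mem_smooth.1 σ.2 l
  rw [hB σ τ hτ]
  refine hP τ (Submodule.le_topologicalClosure _ hτ.1) r hr fun A hA => ?_
  have := h A hA
  rwa [hτ.2, sandwich_apply] at this

end LocalNet
end
end DilQFT

/-! ### Functionals defined by boundary values, and an exchange of limits. -/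

namespace DilQFT

noncomputable section

theorem Submodule.integral_mem_of_isClosed {G : Type*} [NormedAddCommGroup G] [NormedSpace ℂ G]
    [CompleteSpace G] {S : Submodule ℂ G} (hS : IsClosed (S : Set G)) {F : ℝ → G}
    (hF : MeasureTheory.Integrable F) (h : ∀ t, F t ∈ S) : ∫ t, F t ∈ S := by
  have : IsClosed (S : Set G) := hS
  have h1 := S.mkQL.integral_comp_comm hF
  have h2 : ∀ t, S.mkQL (F t) = 0 := fun t => (Submodule.Quotient.mk_eq_zero S).2 (h t)
  simp only [h2, MeasureTheory.integral_zero] at h1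
  exact (Submodule.Quotient.mk_eq_zero S).1 h1.symm

section BanachAlgebra

variable {𝔸 : Type*} [NormedRing 𝔸] [NormedAlgebra ℂ 𝔸] [CompleteSpace 𝔸]

/-- The boundary value is taken in norm in `G`, not pointwise; for a dual space `G` the limit
functional thus remains in a closed subspace `S` such as `NormalClosure 𝓗`. -/
theorem exists_bilinear_limit {G : Type*} [NormedAddCommGroup G] [NormedSpace ℂ G]
    [CompleteSpace G] {S : Submodule ℂ G} (hS : IsClosed (S : Set G))
    (Φ : 𝔸 →L[ℂ] 𝔸 →L[ℂ] G) (Ψ : 𝔸 →L[ℂ] 𝔸 →L[ℂ] 𝔸) (hΦ : ∀ v y, Φ v y ∈ S)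
    {f : ℝ → ℂ} {V W : ℝ → 𝔸} {X : ℂ → 𝔸} {m : ℕ} {C : ℝ} (hC : 0 ≤ C)
    (hf : ContDiff ℝ (m + 1 : ℕ) f) (hfs : HasCompactSupport f) (hV : ContDiff ℝ (m + 1 : ℕ) V)
    (hW : ContDiff ℝ (m + 1 : ℕ) W) (hX : DifferentiableOn ℂ X {z | z.im < 0})
    (hb : ∀ z : ℂ, -1 ≤ z.im → z.im < 0 → ‖X z‖ * |z.im| ^ m ≤ C) :
    ∃ I₀ ∈ S, Tendsto (fun y : ℝ => ∫ t : ℝ, f t • Φ (V t) (Ψ (W t) (X (t - y * Complex.I))))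
      (𝓝[>] 0) (𝓝 I₀) ∧ ∀ y : ℝ, 0 < y → MeasureTheory.Integrable
        fun t : ℝ => f t • Φ (V t) (Ψ (W t) (X (t - y * Complex.I))) := by
  have h1 : ContDiff ℝ (m + 1 : ℕ) fun t => Φ (V t) := (Φ.restrictScalars ℝ).contDiff.comp hV
  have h2 : ContDiff ℝ (m + 1 : ℕ) fun t => Ψ (W t) := (Ψ.restrictScalars ℝ).contDiff.comp hW
  have hb2 : ContDiff ℝ (m + 1 : ℕ) (fun q : (𝔸 →L[ℂ] G) × (𝔸 →L[ℂ] 𝔸) => q.1.comp q.2) :=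
    (isBoundedBilinearMap_comp (𝕜 := ℂ) (E := 𝔸) (F := 𝔸) (G := G)).contDiff.restrict_scalars ℝ
  obtain ⟨P, hP⟩ : ∃ P : ℝ → 𝔸 →L[ℂ] G, P = fun t => f t • (Φ (V t)).comp (Ψ (W t)) := ⟨_, rfl⟩
  have hPa : ∀ t x, P t x = f t • Φ (V t) (Ψ (W t) x) := fun t x => by rw [hP]; rfl
  have hPc : ContDiff ℝ (m + 1 : ℕ) P := by
    rw [hP]; exact hf.smul (hb2.comp (h1.prodMk h2))
  have hPs : HasCompactSupport P := hfs.mono fun t ht h => ht (by rw [hP]; simp [h])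
  obtain ⟨A, hA⟩ := exists_iteratedDeriv_bound (m + 1) P
  obtain ⟨c, -, hc⟩ := exists_boundary_limit (E := 𝔸) (G := G) m
  obtain ⟨I₀, hI₀, -, -⟩ := hc P X A C hC hPc hPs hX hA (fun t _ x hx => by
    have him : ((t : ℂ) - x * Complex.I).im = -x := by simp
    have h1 := hb (t - x * Complex.I) (by rw [him]; linarith [hx.2]) (by rw [him]; linarith [hx.1])
    rwa [him, abs_neg, abs_of_pos hx.1] at h1)
  have hint : ∀ y : ℝ, 0 < y → MeasureTheory.Integrable
      fun t : ℝ => P t (X (t - y * Complex.I)) := fun y hy =>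
    integrable_clm_apply hPc.continuous hPs (continuous_shift hX.continuousOn hy)
  simp only [hPa] at hI₀ hint
  refine ⟨I₀, hS.mem_of_tendsto hI₀ ?_, hI₀, hint⟩
  filter_upwards [self_mem_nhdsWithin] with y hy
  exact Submodule.integral_mem_of_isClosed hS (hint y hy) fun t => S.smul_mem _ (hΦ _ _)

/-- The functional `A ↦ τ(a A b)`. -/
def biMul (τ : StrongDual ℂ 𝔸) : 𝔸 →L[ℂ] 𝔸 →L[ℂ] StrongDual ℂ 𝔸 :=
  (ContinuousLinearMap.compL ℂ 𝔸 (𝔸 →L[ℂ] 𝔸) (𝔸 →L[ℂ] ℂ)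
    (ContinuousLinearMap.compL ℂ 𝔸 𝔸 ℂ τ)).comp (ContinuousLinearMap.mulLeftRight ℂ 𝔸)

/-- With the right-hand factor frozen, the boundary value depends on the left operator `B` through a
single functional in `S`, to which the localization of `B` can be applied. -/
theorem exists_left_functional {S : Submodule ℂ (StrongDual ℂ 𝔸)}
    (hS : IsClosed (S : Set (StrongDual ℂ 𝔸))) {τ : StrongDual ℂ 𝔸}
    (hτ : ∀ a b, τ.comp (ContinuousLinearMap.mulLeftRight ℂ 𝔸 a b) ∈ S)
    {f : ℝ → ℂ} {V W : ℝ → 𝔸} {X : ℂ → 𝔸} {m : ℕ} {C : ℝ} (hC : 0 ≤ C)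
    (hf : ContDiff ℝ (m + 1 : ℕ) f) (hfs : HasCompactSupport f) (hV : ContDiff ℝ (m + 1 : ℕ) V)
    (hW : ContDiff ℝ (m + 1 : ℕ) W) (hX : DifferentiableOn ℂ X {z | z.im < 0})
    (hb : ∀ z : ℂ, -1 ≤ z.im → z.im < 0 → ‖X z‖ * |z.im| ^ m ≤ C) :
    ∃ θ ∈ S, ∀ B, Tendsto (fun y : ℝ => τ (∫ t : ℝ,
      sandwichCurve f V W t (B * X (t - y * Complex.I)))) (𝓝[>] 0) (𝓝 (θ B)) := by
  obtain ⟨θ, hθ, hlim, hint⟩ := exists_bilinear_limit hS (biMul τ)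
    (ContinuousLinearMap.mul ℂ 𝔸).flip (fun v y => hτ v y) hC hf hfs hV hW hX hb
  refine ⟨θ, hθ, fun B => ?_⟩
  have h1 := ((ContinuousLinearMap.apply ℂ ℂ B).continuous.tendsto θ).comp hlim
  refine h1.congr' ?_
  filter_upwards [self_mem_nhdsWithin] with y hy
  have hi : MeasureTheory.Integrable fun t : ℝ =>
      sandwichCurve f V W t (B * X (t - y * Complex.I)) :=
    integrable_clm_apply (contDiff_sandwichCurve hf hV hW).continuous
      (hasCompactSupport_sandwichCurve hfs V W)
      (continuous_const.mul (continuous_shift hX.continuousOn hy))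
  rw [← τ.integral_comp_comm hi]
  simp only [Function.comp_def]
  rw [← (ContinuousLinearMap.apply ℂ ℂ B).integral_comp_comm (hint y hy)]
  congr 1
  ext t
  simp only [sandwichCurve_apply, map_smul]
  congr 1
  change τ (V t * B * (X (t - y * Complex.I) * W t)) = _
  simp only [mul_assoc]

theorem exists_right_functional {S : Submodule ℂ (StrongDual ℂ 𝔸)}
    (hS : IsClosed (S : Set (StrongDual ℂ 𝔸))) {τ : StrongDual ℂ 𝔸}
    (hτ : ∀ a b, τ.comp (ContinuousLinearMap.mulLeftRight ℂ 𝔸 a b) ∈ S)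
    {f : ℝ → ℂ} {V W : ℝ → 𝔸} {X : ℂ → 𝔸} {m : ℕ} {C : ℝ} (hC : 0 ≤ C)
    (hf : ContDiff ℝ (m + 1 : ℕ) f) (hfs : HasCompactSupport f) (hV : ContDiff ℝ (m + 1 : ℕ) V)
    (hW : ContDiff ℝ (m + 1 : ℕ) W) (hX : DifferentiableOn ℂ X {z | z.im < 0})
    (hb : ∀ z : ℂ, -1 ≤ z.im → z.im < 0 → ‖X z‖ * |z.im| ^ m ≤ C) :
    ∃ θ ∈ S, ∀ B, Tendsto (fun y : ℝ => τ (∫ t : ℝ,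
      sandwichCurve f V W t (X (t - y * Complex.I) * B))) (𝓝[>] 0) (𝓝 (θ B)) := by
  obtain ⟨θ, hθ, hlim, hint⟩ := exists_bilinear_limit hS (biMul τ).flip
    (ContinuousLinearMap.mul ℂ 𝔸) (fun v y => hτ y v) hC hf hfs hW hV hX hb
  refine ⟨θ, hθ, fun B => ?_⟩
  have h1 := ((ContinuousLinearMap.apply ℂ ℂ B).continuous.tendsto θ).comp hlim
  refine h1.congr' ?_
  filter_upwards [self_mem_nhdsWithin] with y hy
  have hi : MeasureTheory.Integrable fun t : ℝ =>
      sandwichCurve f V W t (X (t - y * Complex.I) * B) :=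
    integrable_clm_apply (contDiff_sandwichCurve hf hV hW).continuous
      (hasCompactSupport_sandwichCurve hfs V W)
      ((continuous_shift hX.continuousOn hy).mul continuous_const)
  rw [← τ.integral_comp_comm hi]
  simp only [Function.comp_def]
  rw [← (ContinuousLinearMap.apply ℂ ℂ B).integral_comp_comm (hint y hy)]
  congr 1
  ext t
  simp only [sandwichCurve_apply, map_smul]
  congr 1
  change τ (V t * X (t - y * Complex.I) * B * W t) = _
  simp only [mul_assoc]

end BanachAlgebra

/-- The kernel `K` is singular at the real line while `g` tends to `0` only pointwise, so dominated
convergence does not apply directly. It does for the shifted kernel `K(· - iε)`, whose limit is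
therefore `0`. Since the rate `c √η` is uniform in `ε`, the bound survives `ε → 0` at fixed `η`, and
then `η → 0` is harmless. -/
theorem tendsto_zero_of_uniform {f : ℝ → ℂ} (hf : Continuous f) (hfs : HasCompactSupport f)
    {K : ℂ → ℂ} (hK : ContinuousOn K {z | z.im < 0}) {m : ℕ} {C : ℝ}
    (hKb : ∀ z : ℂ, -1 ≤ z.im → z.im < 0 → ‖K z‖ * |z.im| ^ m ≤ C)
    {g : ℝ → ℝ → ℂ} (hgc : ∀ η > 0, Continuous fun t => g t η) {D : ℝ}
    (hgb : ∀ η ∈ Set.Ioc (0 : ℝ) 1, ∀ t, ‖g t η‖ ≤ D)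
    (hg0 : ∀ t, f t ≠ 0 → Tendsto (g t) (𝓝[>] 0) (𝓝 0)) {c : ℝ}
    (h : ∀ ε ∈ Set.Ioo (0 : ℝ) (1 / 2), ∃ L : ℂ,
      Tendsto (fun η : ℝ => ∫ t : ℝ, f t * (K (t - η * Complex.I - ε * Complex.I) * g t η))
        (𝓝[>] 0) (𝓝 L) ∧
      ∀ η ∈ Set.Ioc (0 : ℝ) (1 / 2),
        ‖(∫ t : ℝ, f t * (K (t - η * Complex.I - ε * Complex.I) * g t η)) - L‖ ≤ c * √η) :
    Tendsto (fun η : ℝ => ∫ t : ℝ, f t * (K (t - η * Complex.I) * g t η)) (𝓝[>] 0) (𝓝 0) := by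
  have hD : 0 ≤ D := (norm_nonneg _).trans (hgb 1 ⟨one_pos, le_rfl⟩ 0)
  have hC : 0 ≤ C := le_trans (by positivity) (hKb (-Complex.I) (by simp) (by simp))
  have hfi : MeasureTheory.Integrable fun t => ‖f t‖ := (hf.integrable_of_hasCompactSupport hfs).norm
  have hKb' : ∀ (t η ε δ : ℝ), 0 < δ → δ ≤ η + ε → η + ε ≤ 1 →
      ‖K (t - η * Complex.I - ε * Complex.I)‖ ≤ C / δ ^ m := by
    intro t η ε δ hδ h1 h2
    have him : ((t : ℂ) - η * Complex.I - ε * Complex.I).im = -(η + ε) := by simp; ring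
    have h3 := hKb (t - η * Complex.I - ε * Complex.I) (by rw [him]; linarith) (by rw [him]; linarith)
    rw [him, abs_neg, abs_of_pos (by linarith)] at h3
    rw [le_div_iff₀ (by positivity)]
    refine le_trans ?_ h3
    gcongr
  have hKc : ∀ η ε : ℝ, 0 < η + ε →
      Continuous fun t : ℝ => K (t - η * Complex.I - ε * Complex.I) := fun η ε h => by
    refine hK.comp_continuous (by fun_prop) fun t => ?_
    show ((t : ℂ) - η * Complex.I - ε * Complex.I).im < 0
    simp; linarith
  have step1 : ∀ ε ∈ Set.Ioo (0 : ℝ) (1 / 2), ∀ η ∈ Set.Ioc (0 : ℝ) (1 / 2),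
      ‖∫ t : ℝ, f t * (K (t - η * Complex.I - ε * Complex.I) * g t η)‖ ≤ c * √η := by
    intro ε hε η hη
    obtain ⟨L, hL, hLb⟩ := h ε hε
    have hL0 : Tendsto (fun η : ℝ => ∫ t : ℝ, f t * (K (t - η * Complex.I - ε * Complex.I) * g t η))
        (𝓝[>] 0) (𝓝 (∫ _ : ℝ, 0)) := by
      refine MeasureTheory.tendsto_integral_filter_of_dominated_convergence
        (fun t => ‖f t‖ * (C / ε ^ m * D)) ?_ ?_ (hfi.mul_const _) ?_
      · filter_upwards [self_mem_nhdsWithin] with y hy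
        have hy : 0 < y := hy
        exact (hf.mul ((hKc y ε (by linarith [hε.1])).mul (hgc y hy))).aestronglyMeasurable
      · filter_upwards [Ioo_mem_nhdsGT (show (0 : ℝ) < 1 / 2 by norm_num)] with y hy
        refine Eventually.of_forall fun t => ?_
        rw [norm_mul, norm_mul]
        have h1 := hKb' t y ε ε hε.1 (by linarith [hy.1]) (by linarith [hy.2, hε.2])
        have h2 := hgb y ⟨hy.1, by linarith [hy.2]⟩ t
        have h3 := hε.1
        gcongr
      · refine Eventually.of_forall fun t => ?_
        by_cases hft : f t = 0
        · simp [hft]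
        · have hz : Tendsto (fun y => ‖f t‖ * (C / ε ^ m * ‖g t y‖)) (𝓝[>] 0) (𝓝 0) := by
            simpa using ((hg0 t hft).norm.const_mul (C / ε ^ m)).const_mul ‖f t‖
          refine squeeze_zero_norm' ?_ hz
          filter_upwards [Ioo_mem_nhdsGT (show (0 : ℝ) < 1 / 2 by norm_num)] with y hy
          rw [norm_mul, norm_mul]
          have h1 := hKb' t y ε ε hε.1 (by linarith [hy.1]) (by linarith [hy.2, hε.2])
          gcongr
    rw [MeasureTheory.integral_zero] at hL0
    have := tendsto_nhds_unique hL hL0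
    subst this
    simpa using hLb η hη
  have step2 : ∀ η ∈ Set.Ioc (0 : ℝ) (1 / 2),
      ‖∫ t : ℝ, f t * (K (t - η * Complex.I) * g t η)‖ ≤ c * √η := by
    intro η hη
    have hη0 := hη.1
    have hlim : Tendsto (fun ε : ℝ => ∫ t : ℝ, f t * (K (t - η * Complex.I - ε * Complex.I) * g t η))
        (𝓝[>] 0) (𝓝 (∫ t : ℝ, f t * (K (t - η * Complex.I) * g t η))) := by
      refine MeasureTheory.tendsto_integral_filter_of_dominated_convergence
        (fun t => ‖f t‖ * (C / η ^ m * D)) ?_ ?_ (hfi.mul_const _) ?_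
      · filter_upwards [self_mem_nhdsWithin] with y hy
        have hy : 0 < y := hy
        exact (hf.mul ((hKc η y (by linarith)).mul (hgc η hη0))).aestronglyMeasurable
      · filter_upwards [Ioo_mem_nhdsGT (show (0 : ℝ) < 1 / 2 by norm_num)] with y hy
        refine Eventually.of_forall fun t => ?_
        rw [norm_mul, norm_mul]
        have h1 := hKb' t η y η hη0 (by linarith [hy.1]) (by linarith [hy.2, hη.2])
        have h2 := hgb η ⟨hη0, by linarith [hη.2]⟩ t
        gcongr
      · refine Eventually.of_forall fun t => ?_
        refine Tendsto.const_mul _ (Tendsto.mul_const _ ?_)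
        have hc : ContinuousAt K (t - η * Complex.I) :=
          hK.continuousAt ((isOpen_lt Complex.continuous_im continuous_const).mem_nhds
            (by simpa using hη0))
        have hs : Tendsto (fun ε : ℝ => (t : ℂ) - η * Complex.I - ε * Complex.I) (𝓝[>] 0)
            (𝓝 (t - η * Complex.I)) := by
          have : Continuous fun ε : ℝ => (t : ℂ) - η * Complex.I - ε * Complex.I := by fun_prop
          have h := (this.tendsto 0).mono_left (nhdsWithin_le_nhds (s := Set.Ioi 0))
          simpa using h
        exact hc.tendsto.comp hs
    refine le_of_tendsto hlim.norm ?_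
    filter_upwards [Ioo_mem_nhdsGT (show (0 : ℝ) < 1 / 2 by norm_num)] with ε hε
    exact step1 ε hε η hη
  have hsq : Tendsto (fun η : ℝ => c * √η) (𝓝[>] 0) (𝓝 0) := by
    have : Continuous fun η : ℝ => c * √η := by fun_prop
    have h := (this.tendsto 0).mono_left (nhdsWithin_le_nhds (s := Set.Ioi 0))
    simpa using h
  refine squeeze_zero_norm' ?_ hsq
  filter_upwards [Ioc_mem_nhdsGT (show (0 : ℝ) < 1 / 2 by norm_num)] with η hη
  exact step2 η hη

end
end DilQFT

/-! ### Locality of the products. -/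

namespace DilQFT

noncomputable section

theorem contDiff_nat (f : TestFn) (n : ℕ) : ContDiff ℝ n f.1 :=
  f.2.1.of_le (by exact_mod_cast le_top)

namespace LocalNet

variable {s : ℕ} {𝓗 : Type*} [NormedAddCommGroup 𝓗] [InnerProductSpace ℂ 𝓗] [CompleteSpace 𝓗]
variable {N : LocalNet s 𝓗}

theorem conj_timeU_mem {r r' : ℝ} {A : 𝓗 →L[ℂ] 𝓗} (hA : A ∈ N.algR r) {t : ℝ}
    (h : r + |t| ≤ r') : N.timeU t * A * N.timeU (-t) ∈ N.algR r' := by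
  have hc := N.covariance (doubleCone s r) (isRegion_doubleCone s r) (Pi.single 0 t) 1 isLorentz_one
  have hmem : N.timeU t * A * N.timeU (-t) ∈
      (N.alg ((fun y => (1 : LMatrix s).mulVec y + Pi.single 0 t) '' doubleCone s r) :
        Set (𝓗 →L[ℂ] 𝓗)) := by
    rw [← hc, ← star_timeU]
    exact ⟨A, hA, rfl⟩
  simp only [Matrix.one_mulVec] at hmem
  refine N.isotony _ _ ?_ (isRegion_doubleCone s r') ?_ _ hmem
  · refine ⟨(Homeomorph.addRight (Pi.single 0 t : Mink s)).isOpenMap _ (isRegion_doubleCone s r).1, ?_⟩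
    have := (isRegion_doubleCone s r).2.add (Bornology.isBounded_singleton (x := (Pi.single 0 t : Mink s)))
    rwa [Set.add_singleton] at this
  · rintro _ ⟨y, hy, rfl⟩
    have hy : |y 0| + √(∑ i : Fin s, y i.succ ^ 2) < r := hy
    show |y 0 + (Pi.single 0 t : Mink s) 0| +
      √(∑ i : Fin s, (y i.succ + (Pi.single 0 t : Mink s) i.succ) ^ 2) < r'
    have e : ∀ i : Fin s, (Pi.single 0 t : Mink s) i.succ = 0 := fun i => by simp
    simp only [e, add_zero, Pi.single_eq_same]
    linarith [abs_add_le (y 0) t]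

variable (N) in
/-- `w ↦ K(w) B exp(-iwH) (1 + H)^(2ℓ) B'`. -/
def kernTerm (l : ℕ) (K : ℂ → ℂ) (B B' : 𝓗 →L[ℂ] 𝓗) (w : ℂ) : 𝓗 →L[ℂ] 𝓗 :=
  K w • (B * N.expR (-(2 * l : ℕ)) (Complex.I * w) * B')

theorem kernTerm_eq (l : ℕ) (K : ℂ → ℂ) (B B' : 𝓗 →L[ℂ] 𝓗) :
    N.kernTerm l K B B' = N.kernSum l (fun _ : Fin 1 => K) (fun _ => B) (fun _ => B') := by
  ext1 w
  simp [kernTerm, kernSum]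

theorem kernTerm_left (l : ℕ) (K : ℂ → ℂ) (B B' : 𝓗 →L[ℂ] 𝓗) (w : ℂ) :
    N.kernTerm l K B B' w = B * N.kernTerm l K 1 B' w := by
  simp only [kernTerm, mul_smul_comm, one_mul, mul_assoc]

theorem kernTerm_right (l : ℕ) (K : ℂ → ℂ) (B B' : 𝓗 →L[ℂ] 𝓗) (w : ℂ) :
    N.kernTerm l K B B' w = N.kernTerm l K B 1 w * B' := by
  simp only [kernTerm, smul_mul_assoc, mul_one]

variable (hR : N.HasResolvent)
include hR

theorem HasResolvent.differentiableOn_kernTerm (l : ℕ) {K : ℂ → ℂ}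
    (hK : DifferentiableOn ℂ K {z | z.im < 0}) (B B' : 𝓗 →L[ℂ] 𝓗) :
    DifferentiableOn ℂ (N.kernTerm l K B B') {z | z.im < 0} := by
  rw [kernTerm_eq]
  exact hR.differentiableOn_kernSum l (fun _ => hK) _ _

theorem HasResolvent.norm_kernTerm_le (l : ℕ) {K : ℂ → ℂ} {m : ℕ} {C : ℝ} (B B' : 𝓗 →L[ℂ] 𝓗)
    {w : ℂ} (hK : ‖K w‖ * |w.im| ^ m ≤ C) (h1 : -1 ≤ w.im) (h2 : w.im < 0) :
    ‖N.kernTerm l K B B' w‖ * |w.im| ^ (m + 2 * l) ≤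
      C * ((2 * l).factorial * Real.exp 1) * (‖B‖ * ‖B'‖) := by
  rw [kernTerm_eq]
  simpa using hR.norm_kernSum_le l (fun _ : Fin 1 => B) (fun _ => B') (fun _ => hK) h1 h2

theorem HasResolvent.norm_expR_zero_le {v : ℂ} (h0 : 0 < v.re) (h1 : v.re ≤ 1) :
    ‖N.expR 0 v‖ ≤ Real.exp 1 := by
  simpa using hR.norm_expR_le 0 h0 h1

/-- Without resolvents the damped evolution converges only strongly. On the range of `R³` this is
norm continuity up to the boundary; density and the uniform bound `e` do the rest. -/
theorem HasResolvent.expR_zero_tendsto (t : ℝ) (y : 𝓗) :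
    Tendsto (fun η : ℝ => N.expR 0 (Complex.I * (t - η * Complex.I)) y) (𝓝[>] 0)
      (𝓝 (N.timeU (-t) y)) := by
  have hre : ∀ η : ℝ, (Complex.I * (t - η * Complex.I)).re = η := fun η => by simp
  have hdense : DenseRange (N.resolvent ^ 3 : 𝓗 →L[ℂ] 𝓗) := by
    have h1 : DenseRange (N.resolvent : 𝓗 → 𝓗) := hR.dense_range
    have h2 := (h1.comp h1 N.resolvent.continuous).comp h1
      (N.resolvent.continuous.comp N.resolvent.continuous)
    have e : ((N.resolvent ^ 3 : 𝓗 →L[ℂ] 𝓗) : 𝓗 → 𝓗) =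
        (N.resolvent ∘ N.resolvent) ∘ N.resolvent := by
      ext x; simp [pow_succ]
    rw [e]; exact h2
  have hlim3 : Tendsto (fun η : ℝ => N.expR 3 (Complex.I * (t - η * Complex.I))) (𝓝[>] 0)
      (𝓝 (N.timeU (-t) * N.resolvent ^ 3)) := by
    have e : N.timeU (-t) * N.resolvent ^ 3 = N.expR 3 (Complex.I * (t - (0 : ℝ) * Complex.I)) := by
      rw [hR.timeU_eq_expR le_rfl]
      congr 1
      push_cast; ring
    rw [e]
    have hc := (hR.hasDerivWithinAt_expR (k := 3) le_rfl
      (v := Complex.I * (t - (0 : ℝ) * Complex.I)) (by rw [hre])).continuousWithinAt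
    refine hc.tendsto.comp (tendsto_nhdsWithin_iff.2 ⟨?_, ?_⟩)
    · have : Continuous fun η : ℝ => Complex.I * ((t : ℂ) - η * Complex.I) := by fun_prop
      exact (this.tendsto 0).mono_left nhdsWithin_le_nhds
    · filter_upwards [self_mem_nhdsWithin] with η hη
      have hη : 0 < η := hη
      show 0 ≤ (Complex.I * (t - η * Complex.I)).re
      rw [hre]; exact hη.le
  rw [Metric.tendsto_nhds]
  intro δ hδ
  have he := Real.exp_pos 1
  obtain ⟨x, hx⟩ := hdense.exists_dist_lt y (show 0 < δ / (2 * (Real.exp 1 + 1)) by positivity)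
  have h4 : Tendsto (fun η : ℝ => N.expR 3 (Complex.I * (t - η * Complex.I)) x) (𝓝[>] 0)
      (𝓝 ((N.timeU (-t) * N.resolvent ^ 3) x)) :=
    ((ContinuousLinearMap.apply ℂ 𝓗 x).continuous.tendsto _).comp hlim3
  have h5 := (Metric.tendsto_nhds.1 h4) (δ / 2) (by positivity)
  filter_upwards [h5, Ioo_mem_nhdsGT one_pos] with η h6 hη
  have h7 : N.expR 3 (Complex.I * (t - η * Complex.I)) x =
      N.expR 0 (Complex.I * (t - η * Complex.I)) ((N.resolvent ^ 3 : 𝓗 →L[ℂ] 𝓗) x) := by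
    have h8 := hR.expR_mul_pow (k := 0) (v := Complex.I * (t - η * Complex.I))
      ⟨by rw [hre]; exact hη.1.le, Or.inl (by rw [hre]; exact hη.1)⟩ 3
    rw [show (0 : ℤ) + (3 : ℕ) = 3 by norm_num] at h8
    rw [← h8]; rfl
  obtain ⟨z, hz⟩ : ∃ z, z = (N.resolvent ^ 3 : 𝓗 →L[ℂ] 𝓗) x := ⟨_, rfl⟩
  rw [h7, show (N.timeU (-t) * N.resolvent ^ 3) x = N.timeU (-t) ((N.resolvent ^ 3 : 𝓗 →L[ℂ] 𝓗) x) from rfl,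
    ← hz] at h6
  rw [← hz] at hx
  obtain ⟨F, hF⟩ : ∃ F, F = N.expR 0 (Complex.I * (t - η * Complex.I)) := ⟨_, rfl⟩
  have hFn : ‖F‖ ≤ Real.exp 1 := by
    rw [hF]; exact hR.norm_expR_zero_le (by rw [hre]; exact hη.1) (by rw [hre]; exact hη.2.le)
  rw [← hF] at h6 ⊢
  rw [dist_eq_norm] at h6 hx ⊢
  have e : F y - N.timeU (-t) y = F (y - z) + (F z - N.timeU (-t) z) - N.timeU (-t) (y - z) := by
    rw [map_sub, map_sub]; abel
  have hx' : (Real.exp 1 + 1) * ‖y - z‖ < δ / 2 := by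
    rw [lt_div_iff₀ (by positivity)] at hx
    linarith
  have h9 : ‖F (y - z)‖ ≤ Real.exp 1 * ‖y - z‖ := (F.le_opNorm _).trans (by gcongr)
  rw [e]
  calc _ ≤ ‖F (y - z) + (F z - N.timeU (-t) z)‖ + ‖N.timeU (-t) (y - z)‖ := norm_sub_le _ _
    _ ≤ (‖F (y - z)‖ + ‖F z - N.timeU (-t) z‖) + ‖y - z‖ := by
        gcongr
        · exact norm_add_le _ _
        · exact (N.norm_timeU_apply _ _).le
    _ < δ := by linarith

theorem HasResolvent.pow_mul_expR_mul_pow (l : ℕ) {v : ℂ} (hv : 0 < v.re) :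
    N.resolvent ^ l * N.expR (-(2 * l : ℕ)) v * N.resolvent ^ l = N.expR 0 v := by
  rw [hR.pow_mul_expR ⟨hv.le, Or.inl hv⟩, hR.expR_mul_pow ⟨hv.le, Or.inl hv⟩]
  congr 1
  push_cast; ring

theorem HasResolvent.kernTerm_integral {m l M : ℕ} (hM : m + 5 ≤ M) (f : TestFn) {K : ℂ → ℂ}
    (hK : DifferentiableOn ℂ K {z | z.im < 0}) (B B' : 𝓗 →L[ℂ] 𝓗)
    (τ : StrongDual ℂ (𝓗 →L[ℂ] 𝓗)) {η : ℝ} (hη : 0 < η) :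
    τ (∫ t : ℝ, sandwichCurve f.1 (fun t => N.flow M (t / 2)) (fun t => N.flow M (t / 2)) t
        (N.kernTerm l K B B' (t - η * Complex.I))) =
      ∫ t : ℝ, f.1 t * (K (t - η * Complex.I) * τ (N.flow M (t / 2) *
        (B * N.expR (-(2 * l : ℕ)) (Complex.I * (t - η * Complex.I)) * B') * N.flow M (t / 2))) := by
  have hfc : ContDiff ℝ (m + 1 : ℕ) f.1 := contDiff_nat f _
  have hflow : ContDiff ℝ (m + 1 : ℕ) fun t => N.flow M (t / 2) := hR.contDiff_flow_half (by omega)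
  have hi := integrable_clm_apply (contDiff_sandwichCurve hfc hflow hflow).continuous
    (hasCompactSupport_sandwichCurve f.2.2 _ _)
    (continuous_shift (hR.differentiableOn_kernTerm l hK B B').continuousOn hη)
  rw [← τ.integral_comp_comm hi]
  congr 1
  ext t
  rw [sandwichCurve_apply, kernTerm, map_smul, mul_smul_comm, smul_mul_assoc, map_smul]
  rfl

theorem HasResolvent.norm_pow_le (n : ℕ) : ‖N.resolvent ^ n‖ ≤ 1 := by
  rw [← hR.funR_pow]
  refine hR.norm_funR_le zero_le_one fun x hx => ?_
  rw [norm_pow, Complex.norm_real, Real.norm_of_nonneg hx.1]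
  exact pow_le_one₀ hx.1 hx.2

/-- If `B` and `B'` come from bounded operators, their inner resolvents cancel `(1 + H)^(2l)`, and
only the bounded damped evolution remains between `A` and `A'`. -/
theorem HasResolvent.flow_local {l M : ℕ} (A A' : 𝓗 →L[ℂ] 𝓗) (t : ℝ) {v : ℂ} (hv : 0 < v.re) :
    N.flow M t * ((N.resolvent ^ l * A * N.resolvent ^ l) * N.expR (-(2 * l : ℕ)) v *
        (N.resolvent ^ l * A' * N.resolvent ^ l)) * N.flow M t =
      (N.resolvent ^ (M + l) * N.timeU t) * A * N.expR 0 v * A' *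
        (N.timeU t * N.resolvent ^ (M + l)) := by
  have e1 : N.flow M t * N.resolvent ^ l = N.resolvent ^ (M + l) * N.timeU t := by
    rw [flow, mul_assoc, ← pow_add]
    exact (hR.timeU_commute_pow t _).eq
  have e2 : N.resolvent ^ l * N.flow M t = N.timeU t * N.resolvent ^ (M + l) := by
    rw [flow, ← mul_assoc, ← (hR.timeU_commute_pow t l).eq, mul_assoc, ← pow_add, add_comm]
  rw [← e1, ← e2, ← hR.pow_mul_expR_mul_pow l hv]
  simp only [mul_assoc]

/-- For bounded local operators the integrand without the kernel tends pointwise to `σ` evaluated on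
an operator in `𝔄(1)`, which is `0`; `tendsto_zero_of_uniform` deals with the singular kernel. -/
theorem HasResolvent.local_pair {K : Kern} {mK : ℕ} {CK : ℝ}
    (hK : ∀ z : ℂ, -1 ≤ z.im → z.im < 0 → ‖K.1 z‖ * |z.im| ^ mK ≤ CK) {l M : ℕ}
    (hM : mK + 2 * l + 5 ≤ M) {f : TestFn} (hf : SupportedIn f 1) {σ : N.Smooth}
    (hσ : ∀ A ∈ N.algR 1, σ.1 A = 0) {τ : StrongDual ℂ (𝓗 →L[ℂ] 𝓗)} (hτ : N.IsLift (M + l) σ τ)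
    {A A' : 𝓗 →L[ℂ] 𝓗} (hA : A ∈ N.algR (1 / 4)) (hA' : A' ∈ N.algR (1 / 4)) :
    Tendsto (fun η : ℝ => τ (∫ t : ℝ,
      sandwichCurve f.1 (fun t => N.flow M (t / 2)) (fun t => N.flow M (t / 2)) t
        (N.kernTerm l K.1 (N.resolvent ^ l * A * N.resolvent ^ l)
          (N.resolvent ^ l * A' * N.resolvent ^ l) (t - η * Complex.I)))) (𝓝[>] 0) (𝓝 0) := by
  obtain ⟨B, hB⟩ : ∃ B, B = N.resolvent ^ l * A * N.resolvent ^ l := ⟨_, rfl⟩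
  obtain ⟨B', hB'⟩ : ∃ B', B' = N.resolvent ^ l * A' * N.resolvent ^ l := ⟨_, rfl⟩
  rw [← hB, ← hB']
  have hKd := Kern.differentiableOn K
  have hre : ∀ t η : ℝ, (Complex.I * (t - η * Complex.I)).re = η := fun t η => by simp
  obtain ⟨g, hg⟩ : ∃ g : ℝ → ℝ → ℂ, g = fun (t η : ℝ) => τ (N.flow M (t / 2) *
      (B * N.expR (-(2 * l : ℕ)) (Complex.I * (t - η * Complex.I)) * B') * N.flow M (t / 2)) :=
    ⟨_, rfl⟩
  have hflow : ContDiff ℝ (mK + 2 * l + 1 : ℕ) fun t => N.flow M (t / 2) :=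
    hR.contDiff_flow_half (by omega)
  have hfc : ContDiff ℝ (mK + 2 * l + 1 : ℕ) f.1 := contDiff_nat f _
  have hgloc : ∀ t η : ℝ, 0 < η → g t η = τ ((N.resolvent ^ (M + l) * N.timeU (t / 2)) * A *
      N.expR 0 (Complex.I * (t - η * Complex.I)) * A' *
        (N.timeU (t / 2) * N.resolvent ^ (M + l))) := fun t η hη => by
    rw [hg, hB, hB']
    simp only
    rw [hR.flow_local A A' (t / 2) (by rw [hre]; exact hη)]
  have hgc : ∀ η > 0, Continuous fun t => g t η := by
    intro η hη
    have h1 := (hR.differentiableOn_kernTerm l (K := fun _ => 1) (differentiableOn_const 1) B B').continuousOn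
    have h2 := continuous_shift h1 hη
    have h3 := τ.continuous.comp ((hflow.continuous.mul h2).mul hflow.continuous)
    rw [hg]
    refine h3.congr fun t => ?_
    simp [kernTerm]
  have hgb : ∀ η ∈ Set.Ioc (0 : ℝ) 1, ∀ t, ‖g t η‖ ≤ ‖τ‖ * (‖A‖ * Real.exp 1 * ‖A'‖) := by
    intro η hη t
    rw [hgloc t η hη.1]
    refine (τ.le_opNorm _).trans ?_
    gcongr
    have n1 : ‖N.resolvent ^ (M + l) * N.timeU (t / 2)‖ ≤ 1 :=
      (norm_mul_le _ _).trans (mul_le_one₀ (hR.norm_pow_le _) (norm_nonneg _) (N.norm_timeU_le _))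
    have n2 : ‖N.timeU (t / 2) * N.resolvent ^ (M + l)‖ ≤ 1 :=
      (norm_mul_le _ _).trans (mul_le_one₀ (N.norm_timeU_le _) (norm_nonneg _) (hR.norm_pow_le _))
    have n3 := hR.norm_expR_zero_le (v := Complex.I * (t - η * Complex.I)) (by rw [hre]; exact hη.1)
      (by rw [hre]; exact hη.2)
    calc _ ≤ ‖N.resolvent ^ (M + l) * N.timeU (t / 2)‖ * ‖A‖ *
          ‖N.expR 0 (Complex.I * (t - η * Complex.I))‖ * ‖A'‖ *
          ‖N.timeU (t / 2) * N.resolvent ^ (M + l)‖ := by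
          refine (norm_mul_le _ _).trans ?_
          gcongr
          refine (norm_mul_le _ _).trans ?_
          gcongr
          refine (norm_mul_le _ _).trans ?_
          gcongr
          exact norm_mul_le _ _
      _ ≤ 1 * ‖A‖ * Real.exp 1 * ‖A'‖ * 1 := by gcongr
      _ = _ := by ring
  have hg0 : ∀ t, f.1 t ≠ 0 → Tendsto (g t) (𝓝[>] 0) (𝓝 0) := by
    intro t ht
    have htabs : |t| < 1 := abs_lt.2 (hf (subset_tsupport _ ht))
    have hvan : τ ((N.resolvent ^ (M + l) * N.timeU (t / 2)) * A * N.timeU (-t) * A' *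
        (N.timeU (t / 2) * N.resolvent ^ (M + l))) = 0 := by
      -- The translation `U(-t)` in the middle is divided evenly: the factors are moved by `t/2` and
      -- `-t/2`, and `1/4 + |t|/2 < 1`.
      have m1 : N.timeU (t / 2) * A * N.timeU (-(t / 2)) ∈ N.algR 1 :=
        conj_timeU_mem hA (by rw [abs_div, abs_two]; linarith)
      have m2 : N.timeU (-(t / 2)) * A' * N.timeU (- -(t / 2)) ∈ N.algR 1 :=
        conj_timeU_mem hA' (by rw [abs_neg, abs_div, abs_two]; linarith)
      have h1 := hσ _ (mul_mem m1 m2)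
      rw [hτ.2, sandwich_apply] at h1
      rw [← h1]
      congr 1
      have e : N.timeU (-t) = N.timeU (-(t / 2)) * N.timeU (-(t / 2)) := by
        rw [← timeU_add]; congr 1; ring
      rw [e, neg_neg]
      simp only [mul_assoc]
    rw [← hvan]
    have hlim : Tendsto (fun η : ℝ => τ ((N.resolvent ^ (M + l) * N.timeU (t / 2)) * A *
        N.expR 0 (Complex.I * (t - η * Complex.I)) * A' *
        (N.timeU (t / 2) * N.resolvent ^ (M + l)))) (𝓝[>] 0)
        (𝓝 (τ ((N.resolvent ^ (M + l) * N.timeU (t / 2)) * A * N.timeU (-t) * A' *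
          (N.timeU (t / 2) * N.resolvent ^ (M + l))))) := by
      obtain ⟨S, hS⟩ : ∃ S, S = (N.resolvent ^ (M + l) * N.timeU (t / 2)) * A := ⟨_, rfl⟩
      obtain ⟨S', hS'⟩ : ∃ S', S' = A' * (N.timeU (t / 2) * N.resolvent ^ (M + l)) := ⟨_, rfl⟩
      have hn := sandwich_mem S S' hτ.1
      have h2 := IsNormal.tendsto (τ := sandwich S S' τ) hn (L := 𝓝[>] (0 : ℝ))
        (A := fun η : ℝ => N.expR 0 (Complex.I * (t - η * Complex.I))) (A₀ := N.timeU (-t))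
        (C := Real.exp 1) (by
          filter_upwards [Ioo_mem_nhdsGT one_pos] with η hη
          exact hR.norm_expR_zero_le (by rw [hre]; exact hη.1) (by rw [hre]; exact hη.2.le))
        (hR.expR_zero_tendsto t)
      simp only [sandwich_apply, hS, hS'] at h2
      simpa only [mul_assoc] using h2
    refine hlim.congr' ?_
    filter_upwards [self_mem_nhdsWithin] with η hη
    exact (hgloc t η hη).symm
  obtain ⟨G, hG⟩ : ∃ G, G = sandwichCurve f.1 (fun t => N.flow M (t / 2)) (fun t => N.flow M (t / 2)) :=
    ⟨_, rfl⟩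
  have hGc : ContDiff ℝ (mK + 2 * l + 1 : ℕ) G := by
    rw [hG]; exact contDiff_sandwichCurve hfc hflow hflow
  have hGs : HasCompactSupport G := by rw [hG]; exact hasCompactSupport_sandwichCurve f.2.2 _ _
  obtain ⟨a, ha⟩ := exists_iteratedDeriv_bound (mK + 2 * l + 1) G
  obtain ⟨c, -, hc⟩ := exists_boundary_limit (E := 𝓗 →L[ℂ] 𝓗) (G := 𝓗 →L[ℂ] 𝓗) (mK + 2 * l)
  have hCK : 0 ≤ CK := le_trans (by positivity) (hK (-Complex.I) (by simp) (by simp))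
  have hmain := tendsto_zero_of_uniform f.2.1.continuous f.2.2 hKd.continuousOn hK hgc hgb hg0
    (c := ‖τ‖ * (c * (a * (CK * ((2 * l).factorial * Real.exp 1) * (‖B‖ * ‖B'‖))))) ?_
  · refine hmain.congr' ?_
    filter_upwards [self_mem_nhdsWithin] with η hη
    rw [hR.kernTerm_integral (m := mK + 2 * l) hM f hKd B B' τ hη, hg]
  -- A shift away from the real line only improves the growth bound, so the rate has the same
  -- constants for all `K(· - iε)`.
  · intro ε hε
    have hKεd : DifferentiableOn ℂ (fun w => K.1 (w - ε * Complex.I)) {z | z.im < 0} := by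
      refine hKd.comp (by fun_prop) fun w hw => ?_
      have hw : w.im < 0 := hw
      show (w - ε * Complex.I).im < 0
      simp; linarith [hε.1]
    obtain ⟨I₀, hI₀, hI₁, -⟩ := hc G (N.kernTerm l (fun w => K.1 (w - ε * Complex.I)) B B') a
      (CK * ((2 * l).factorial * Real.exp 1) * (‖B‖ * ‖B'‖)) (by positivity) hGc hGs
      (hR.differentiableOn_kernTerm l hKεd B B') ha (fun t _ x hx => by
        have him : ((t : ℂ) - x * Complex.I).im = -x := by simp
        have him2 : ((t : ℂ) - x * Complex.I - ε * Complex.I).im = -(x + ε) := by simp; ring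
        have h1 := hK (t - x * Complex.I - ε * Complex.I)
          (by rw [him2]; linarith [hx.2, hε.2]) (by rw [him2]; linarith [hx.1, hε.1])
        have h2 := hR.norm_kernTerm_le l (K := fun w => K.1 (w - ε * Complex.I)) (m := mK) (C := CK)
          B B' (w := t - x * Complex.I) (by
            refine le_trans ?_ h1
            rw [him, him2, abs_neg, abs_neg, abs_of_pos hx.1, abs_of_pos (by linarith [hx.1, hε.1])]
            have := hx.1
            gcongr
            linarith [hε.1]) (by rw [him]; linarith [hx.2]) (by rw [him]; linarith [hx.1])
        rwa [him, abs_neg, abs_of_pos hx.1] at h2)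
    have hk : ∀ η : ℝ, 0 < η → (∫ t : ℝ, f.1 t * (K.1 (t - η * Complex.I - ε * Complex.I) * g t η)) =
        τ (∫ t : ℝ, G t (N.kernTerm l (fun w => K.1 (w - ε * Complex.I)) B B' (t - η * Complex.I))) :=
      fun η hη => by
        rw [hG, hR.kernTerm_integral (m := mK + 2 * l) hM f hKεd B B' τ hη, hg]
    refine ⟨τ I₀, ?_, fun η hη => ?_⟩
    · refine ((τ.continuous.tendsto I₀).comp hI₀).congr' ?_
      filter_upwards [self_mem_nhdsWithin] with η hη
      exact (hk η hη).symm
    · rw [hk η hη.1, ← map_sub]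
      refine (τ.le_opNorm _).trans ?_
      rw [mul_assoc]
      gcongr
      exact hI₁ η hη

/-- Localization is used twice, once in each factor: with `A` local on the left, the vanishing
passes from local `A'` to `B'`; then, with `B'` on the right, it passes from `A` to `B`. The
functionals involved are norm limits of normal ones. -/
theorem HasResolvent.pointLike_pair {K : Kern} {mK : ℕ} {CK : ℝ}
    (hK : ∀ z : ℂ, -1 ≤ z.im → z.im < 0 → ‖K.1 z‖ * |z.im| ^ mK ≤ CK) {l M : ℕ}
    (hM : mK + 2 * l + 5 ≤ M) {f : TestFn} (hf : SupportedIn f 1) {σ : N.Smooth}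
    (hσ : ∀ A ∈ N.algR 1, σ.1 A = 0) {τ : StrongDual ℂ (𝓗 →L[ℂ] 𝓗)} (hτ : N.IsLift (M + l) σ τ)
    {B B' : 𝓗 →L[ℂ] 𝓗} (hB : N.PointLike l B) (hB' : N.PointLike l B') :
    Tendsto (fun η : ℝ => τ (∫ t : ℝ,
      sandwichCurve f.1 (fun t => N.flow M (t / 2)) (fun t => N.flow M (t / 2)) t
        (N.kernTerm l K.1 B B' (t - η * Complex.I)))) (𝓝[>] 0) (𝓝 0) := by
  have hKd := Kern.differentiableOn K
  have hCK : 0 ≤ CK := le_trans (by positivity) (hK (-Complex.I) (by simp) (by simp))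
  have hflow : ContDiff ℝ (mK + 2 * l + 1 : ℕ) fun t => N.flow M (t / 2) :=
    hR.contDiff_flow_half (by omega)
  have hfc : ContDiff ℝ (mK + 2 * l + 1 : ℕ) f.1 := contDiff_nat f _
  have hcl : IsClosed (NormalClosure 𝓗 : Set (StrongDual ℂ (𝓗 →L[ℂ] 𝓗))) :=
    Submodule.isClosed_topologicalClosure _
  have hmem : ∀ a b, τ.comp (ContinuousLinearMap.mulLeftRight ℂ (𝓗 →L[ℂ] 𝓗) a b) ∈
      NormalClosure 𝓗 := fun a b => Submodule.le_topologicalClosure _ (sandwich_mem a b hτ.1)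
  have hbd : ∀ (S S' : 𝓗 →L[ℂ] 𝓗) (z : ℂ), -1 ≤ z.im → z.im < 0 →
      ‖N.kernTerm l K.1 S S' z‖ * |z.im| ^ (mK + 2 * l) ≤
        CK * ((2 * l).factorial * Real.exp 1) * (‖S‖ * ‖S'‖) := fun S S' z h1 h2 =>
    hR.norm_kernTerm_le l S S' (hK z h1 h2) h1 h2
  have step : ∀ A ∈ N.algR (1 / 4), Tendsto (fun η : ℝ => τ (∫ t : ℝ,
      sandwichCurve f.1 (fun t => N.flow M (t / 2)) (fun t => N.flow M (t / 2)) t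
        (N.kernTerm l K.1 (N.resolvent ^ l * A * N.resolvent ^ l) B' (t - η * Complex.I))))
      (𝓝[>] 0) (𝓝 0) := by
    intro A hA
    obtain ⟨θ, hθ, hlim⟩ := exists_right_functional hcl hmem (by positivity) hfc f.2.2 hflow hflow
      (hR.differentiableOn_kernTerm l hKd (N.resolvent ^ l * A * N.resolvent ^ l) 1) (hbd _ 1)
    have h1 : θ B' = 0 := hB' θ hθ (1 / 4) (by norm_num) fun A' hA' => by
      have h2 := hR.local_pair hK hM hf hσ hτ hA hA'
      have h3 := hlim (N.resolvent ^ l * A' * N.resolvent ^ l)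
      simp only [← kernTerm_right] at h3
      exact tendsto_nhds_unique h3 h2
    have h3 := hlim B'
    simp only [← kernTerm_right] at h3
    rwa [h1] at h3
  obtain ⟨θ, hθ, hlim⟩ := exists_left_functional hcl hmem (by positivity) hfc f.2.2 hflow hflow
    (hR.differentiableOn_kernTerm l hKd 1 B') (hbd 1 _)
  have h1 : θ B = 0 := hB θ hθ (1 / 4) (by norm_num) fun A hA => by
    have h3 := hlim (N.resolvent ^ l * A * N.resolvent ^ l)
    simp only [← kernTerm_left] at h3
    exact tendsto_nhds_unique h3 (step A hA)
  have h3 := hlim B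
  simp only [← kernTerm_left] at h3
  rwa [h1] at h3

end LocalNet
end
end DilQFT

/-! ### Rank-one projectors, dilation covariance and homogeneity. -/

namespace DilQFT

noncomputable section

/-- `χ(a) = χ(√a)²` is positive, so `x ↦ log χ(e^x)` is an additive map. Continuity at a single
point makes it continuous, hence linear. -/
theorem exists_rpow_of_multiplicative {χ : ℝ → ℝ} (hmul : ∀ a b, 0 < a → 0 < b → χ (a * b) = χ a * χ b)
    (hne : ∀ a, 0 < a → χ a ≠ 0) {a₀ : ℝ} (ha₀ : 0 < a₀) (hc : ContinuousAt χ a₀) :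
    ∃ β : ℝ, ∀ a, 0 < a → χ a = a ^ β := by
  have hpos : ∀ a, 0 < a → 0 < χ a := fun a ha => by
    have h1 := hmul (√a) (√a) (Real.sqrt_pos.2 ha) (Real.sqrt_pos.2 ha)
    rw [Real.mul_self_sqrt ha.le] at h1
    rw [h1]
    exact mul_self_pos.2 (hne _ (Real.sqrt_pos.2 ha))
  let h : ℝ →+ ℝ := AddMonoidHom.mk' (fun x => Real.log (χ (Real.exp x))) fun x y => by
    rw [Real.exp_add, hmul _ _ (Real.exp_pos x) (Real.exp_pos y),
      Real.log_mul (hne _ (Real.exp_pos x)) (hne _ (Real.exp_pos y))]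
  have hh : ∀ x, h x = Real.log (χ (Real.exp x)) := fun x => rfl
  have hcont : Continuous h := by
    refine continuous_of_continuousAt_zero h ?_
    have h1 : ContinuousAt (fun x => Real.log (χ (Real.exp x * a₀)) - Real.log (χ a₀)) 0 := by
      have h2 : ContinuousAt (fun x => Real.exp x * a₀) 0 := by fun_prop
      have h3 : ContinuousAt χ (Real.exp 0 * a₀) := by simpa using hc
      have h4 : χ (Real.exp 0 * a₀) ≠ 0 := by simpa using hne a₀ ha₀
      exact ((ContinuousAt.comp (f := fun x => Real.exp x * a₀) h3 h2).log h4).sub continuousAt_const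
    refine h1.congr (Eventually.of_forall fun x => ?_)
    simp only [hh]
    rw [hmul _ _ (Real.exp_pos x) ha₀, Real.log_mul (hne _ (Real.exp_pos x)) (hne _ ha₀)]
    ring
  refine ⟨h 1, fun a ha => ?_⟩
  have h1 := map_real_smul h hcont (Real.log a) 1
  rw [smul_eq_mul, mul_one, hh, Real.exp_log ha, smul_eq_mul] at h1
  rw [Real.rpow_def_of_pos ha, ← h1, Real.exp_log (hpos a ha)]

theorem exists_range_generator {V : Type*} [AddCommGroup V] [Module ℂ V] (p : V →ₗ[ℂ] V)
    (h : Module.finrank ℂ (LinearMap.range p) = 1) :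
    ∃ v ∈ LinearMap.range p, v ≠ 0 ∧ ∀ x, ∃ c : ℂ, c • v = p x := by
  obtain ⟨v, hv0, hv⟩ := finrank_eq_one_iff'.1 h
  refine ⟨v, v.2, fun h => hv0 (Subtype.ext h), fun x => ?_⟩
  obtain ⟨c, hc⟩ := hv ⟨p x, x, rfl⟩
  exact ⟨c, congrArg Subtype.val hc⟩

/-- The coefficient of `p` along a generator `v` of the range is continuous in the topology of
evaluations, hence an evaluation at a vector of the predual. Normalizing at a point where `v` does
not vanish and using `p v = v` gives the form stated. -/
theorem exists_rank_one_form {V : Type*} [AddCommGroup V] [Module ℂ V]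
    (D : Submodule ℂ (Module.Dual ℂ V)) (p : D →ₗ[ℂ] D)
    (hcont : Continuous[TopologicalSpace.induced (fun (φ : D) (x : V) => φ.1 x) inferInstance,
      TopologicalSpace.induced (fun (φ : D) (x : V) => φ.1 x) inferInstance] p)
    (hidem : ∀ φ, p (p φ) = p φ) (hp1 : Module.finrank ℂ (LinearMap.range p) = 1) :
    ∃ (φ₀ : D) (x₀ : V), p φ₀ = φ₀ ∧ φ₀.1 x₀ = 1 ∧ ∀ φ, p φ = φ.1 x₀ • φ₀ := by
  obtain ⟨v, hvr, hv0, hv⟩ := exists_range_generator p hp1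
  have hvne : v.1 ≠ 0 := fun h => hv0 (Subtype.ext h)
  obtain ⟨x₁, hx₁⟩ : ∃ x, v.1 x ≠ 0 := by
    by_contra! h
    exact hvne (LinearMap.ext h)
  obtain ⟨u, hu⟩ := hvr
  have hpv : p v = v := by rw [← hu, hidem]
  have hspan : ∀ φ, p φ = ((v.1 x₁)⁻¹ * (p φ).1 x₁) • v := fun φ => by
    obtain ⟨c, hc⟩ := hv φ
    have h1 : (p φ).1 x₁ = c * v.1 x₁ := by rw [← hc]; rfl
    rw [h1, mul_comm c, inv_mul_cancel_left₀ hx₁, hc]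
  let Λ : D →ₗ[ℂ] ℂ := (v.1 x₁)⁻¹ • ((LinearMap.applyₗ x₁) ∘ₗ D.subtype ∘ₗ p)
  have hΛ : ∀ φ, Λ φ = (v.1 x₁)⁻¹ * (p φ).1 x₁ := fun φ => rfl
  have hcont : Continuous[TopologicalSpace.induced (fun (φ : D) (x : V) => φ.1 x) inferInstance,
      inferInstance] Λ := by
    let _ : TopologicalSpace D :=
      TopologicalSpace.induced (fun (φ : D) (x : V) => φ.1 x) inferInstance
    have h1 : Continuous p := hcont
    have h2 : Continuous fun φ : D => φ.1 x₁ := (continuous_apply x₁).comp continuous_induced_dom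
    exact (h2.comp h1).const_smul ((v.1 x₁)⁻¹)
  obtain ⟨x₀, hx₀⟩ := LinearMap.dualEmbedding_surjective D.subtype
    ({ toLinearMap := Λ, cont := hcont } : StrongDual ℂ (WeakBilin D.subtype))
  have hx₀' : ∀ φ : D, φ.1 x₀ = Λ φ := fun φ =>
    congrArg (fun F : StrongDual ℂ (WeakBilin D.subtype) => F φ) hx₀
  refine ⟨v, x₀, hpv, ?_, fun φ => ?_⟩
  · rw [hx₀', hΛ, hpv, inv_mul_cancel₀ hx₁]
  · rw [hx₀', hΛ, ← hspan]

namespace LocalNet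

variable {s : ℕ} {𝓗 : Type*} [NormedAddCommGroup 𝓗] [InnerProductSpace ℂ 𝓗] [CompleteSpace 𝓗]
variable {N : LocalNet s 𝓗}

theorem HasResolvent.exists_reduced_product (hR : N.HasResolvent) {P : N.Product}
    (hP : P ∈ N.PositiveProducts) :
    ∃ (n : ℕ) (K : Fin n → Kern) (φ φ' : Fin n → N.CDual) (l : ℕ) (B B' : Fin n → 𝓗 →L[ℂ] 𝓗),
      P = ∑ j, K j ⊗ₜ[ℂ] (φ j ⊗ₜ[ℂ] φ' j) ∧
      (∀ j, N.IsReduced l (φ j) (B j)) ∧ (∀ j, N.IsReduced l (φ' j) (B' j)) ∧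
      (∀ j, N.PointLike l (B j)) ∧ (∀ j, N.PointLike l (B' j)) := by
  obtain ⟨n, K, φ, -, hφ, rfl⟩ := hP
  choose l hl using fun j => hR.exists_pointLike (hφ j)
  have hle : ∀ j, l j ≤ ∑ j, l j := fun j =>
    Finset.single_le_sum (fun _ _ => Nat.zero_le _) (Finset.mem_univ j)
  choose B hB hBp using fun j => hl j _ (hle j)
  exact ⟨n, K, fun j => N.conjD (φ j), φ, _, fun j => star (B j), B, rfl, fun j => (hB j).star, hB,
    fun j => (hBp j).star, hBp⟩

theorem kernSum_eq {n : ℕ} (l : ℕ) (K : Fin n → ℂ → ℂ) (B B' : Fin n → 𝓗 →L[ℂ] 𝓗) (w : ℂ) :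
    N.kernSum l K B B' w = ∑ j, N.kernTerm l (K j) (B j) (B' j) w := rfl

/-- The formula for products on smooth functionals reduces the claim to single terms, which
`pointLike_pair` treats; conjugate fields are pointlike because local algebras are closed under the
adjoint. -/
theorem HasResolvent.product_local (hR : N.HasResolvent) {P : N.Product}
    (hP : P ∈ N.PositiveProducts) {T : TestFn →ₗ[ℂ] N.CDual} (hT : N.IsProductDistribution P T)
    {f : TestFn} (hf : SupportedIn f 1) {σ : N.Smooth} (hσ : ∀ A ∈ N.algR 1, σ.1 A = 0) :
    (T f).1 σ = 0 := by
  obtain ⟨n, K, φ, φ', l, B, B', hPe, hB, hB', hBp, hBp'⟩ := hR.exists_reduced_product hP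
  obtain ⟨mK, CK, hCK, hK⟩ := Kern.exists_bound K
  obtain ⟨M₀, hM₀⟩ := hR.smoothed_product hT hPe hB hB'
  obtain ⟨M, hM1, hM2⟩ : ∃ M, M₀ ≤ M ∧ mK + 2 * l + 5 ≤ M :=
    ⟨max M₀ (mK + 2 * l + 5), le_max_left _ _, le_max_right _ _⟩
  obtain ⟨τ, hτ⟩ := N.mem_smooth.1 σ.2 (M + l)
  refine tendsto_nhds_unique (hM₀ M hM1 f σ τ hτ) ?_
  have h1 := tendsto_finsetSum (Finset.univ : Finset (Fin n)) fun j _ =>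
    hR.pointLike_pair (hK j) hM2 hf hσ hτ (hBp j) (hBp' j)
  rw [Finset.sum_const_zero] at h1
  refine h1.congr' ?_
  have hflow : ContDiff ℝ (mK + 2 * l + 1 : ℕ) fun t => N.flow M (t / 2) :=
    hR.contDiff_flow_half (by omega)
  filter_upwards [self_mem_nhdsWithin] with η hη
  have hi : ∀ j, MeasureTheory.Integrable fun t : ℝ =>
      sandwichCurve f.1 (fun t => N.flow M (t / 2)) (fun t => N.flow M (t / 2)) t
        (N.kernTerm l (K j).1 (B j) (B' j) (t - η * Complex.I)) := fun j =>
    integrable_clm_apply (contDiff_sandwichCurve (contDiff_nat f _) hflow hflow).continuous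
      (hasCompactSupport_sandwichCurve f.2.2 _ _)
      (continuous_shift (hR.differentiableOn_kernTerm l (Kern.differentiableOn (K j))
        (B j) (B' j)).continuousOn hη)
  rw [← map_sum, ← MeasureTheory.integral_finsetSum _ fun j _ => hi j]
  congr 2
  ext1 t
  rw [kernSum_eq, map_sum]

/-- The operator function `X` and its order of growth are fixed once and for all, while the
coefficient `g` becomes as smooth as desired by spending more resolvents of `σ`. This makes Taylor
expansions of `g` to any order available. -/
theorem HasResolvent.exists_representation (hR : N.HasResolvent) {P : N.Product}
    (hP : P ∈ N.PositiveProducts) {T : TestFn →ₗ[ℂ] N.CDual} (hT : N.IsProductDistribution P T)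
    (σ : N.Smooth) :
    ∃ (m : ℕ) (C : ℝ) (X : ℂ → 𝓗 →L[ℂ] 𝓗), 0 ≤ C ∧ DifferentiableOn ℂ X {z | z.im < 0} ∧
      (∀ z : ℂ, -1 ≤ z.im → z.im < 0 → ‖X z‖ * |z.im| ^ m ≤ C) ∧
      ∀ n : ℕ, ∃ g : ℝ → StrongDual ℂ (𝓗 →L[ℂ] 𝓗), ContDiff ℝ n g ∧ ∀ f : TestFn,
        Tendsto (fun η : ℝ => ∫ t : ℝ, f.1 t * g t (X (t - η * Complex.I))) (𝓝[>] 0)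
          (𝓝 ((T f).1 σ)) := by
  obtain ⟨n, K, φ, φ', l, B, B', hPe, hB, hB', hBp, hBp'⟩ := hR.exists_reduced_product hP
  obtain ⟨mK, CK, hCK, hK⟩ := Kern.exists_bound K
  obtain ⟨M₀, hM₀⟩ := hR.smoothed_product hT hPe hB hB'
  have hXd := hR.differentiableOn_kernSum l (fun j => Kern.differentiableOn (K j)) B B'
  refine ⟨mK + 2 * l, CK * ((2 * l).factorial * Real.exp 1) * ∑ j, ‖B j‖ * ‖B' j‖,
    N.kernSum l (fun j => (K j).1) B B',
    mul_nonneg (by positivity) (Finset.sum_nonneg fun _ _ => by positivity), hXd,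
    fun z h1 h2 => hR.norm_kernSum_le l B B' (fun j => hK j z h1 h2) h1 h2, fun k => ?_⟩
  obtain ⟨M, hM1, hM2⟩ : ∃ M, M₀ ≤ M ∧ k + 5 ≤ M :=
    ⟨max M₀ (k + 5), le_max_left _ _, le_max_right _ _⟩
  obtain ⟨τ, hτ⟩ := N.mem_smooth.1 σ.2 (M + l)
  have hflow : ContDiff ℝ (k : ℕ) fun t => N.flow M (t / 2) := hR.contDiff_flow_half (by omega)
  obtain ⟨Q, hQ⟩ : ∃ Q, Q = fun t =>
      ContinuousLinearMap.mulLeftRight ℂ (𝓗 →L[ℂ] 𝓗) (N.flow M (t / 2)) (N.flow M (t / 2)) :=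
    ⟨_, rfl⟩
  have hQc : ContDiff ℝ k Q := by
    rw [hQ]; exact contDiff_mulLeftRight hflow hflow
  obtain ⟨L, hL⟩ : ∃ L, L = ContinuousLinearMap.compL ℂ (𝓗 →L[ℂ] 𝓗) (𝓗 →L[ℂ] 𝓗) ℂ τ := ⟨_, rfl⟩
  have hLQ : ContDiff ℝ k fun t => L (Q t) := (L.restrictScalars ℝ).contDiff.comp hQc
  have hLQa : ∀ t x, L (Q t) x = τ (N.flow M (t / 2) * x * N.flow M (t / 2)) := fun t x => by
    rw [hL, hQ]; rfl
  refine ⟨fun t => L (Q t), hLQ, fun f => ?_⟩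
  refine (hM₀ M hM1 f σ τ hτ).congr' ?_
  filter_upwards [self_mem_nhdsWithin] with η hη
  have hi : MeasureTheory.Integrable fun t : ℝ =>
      sandwichCurve f.1 (fun t => N.flow M (t / 2)) (fun t => N.flow M (t / 2)) t
        (N.kernSum l (fun j => (K j).1) B B' (t - η * Complex.I)) :=
    integrable_clm_apply (contDiff_sandwichCurve (n := k) (contDiff_nat f _) hflow hflow).continuous
      (hasCompactSupport_sandwichCurve f.2.2 _ _)
      (continuous_shift hXd.continuousOn hη)
  rw [← τ.integral_comp_comm hi]
  congr 1
  ext1 t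
  rw [hLQa, sandwichCurve_apply, map_smul, smul_eq_mul]

/-- A projector of rank one that is continuous in the weak-* topology. -/
theorem IsFieldProjector.exists_eq {p : N.CDual →ₗ[ℂ] N.CDual} (hp : N.IsFieldProjector p)
    (hp1 : Module.finrank ℂ (LinearMap.range p) = 1) :
    ∃ (φ₀ : N.CDual) (σ₀ : N.Smooth), p φ₀ = φ₀ ∧ φ₀.1 σ₀ = 1 ∧ ∀ φ, p φ = φ.1 σ₀ • φ₀ :=
  exists_rank_one_form (V := N.Smooth) N.CDual p hp.continuous hp.idempotent hp1

end LocalNet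

namespace Dilations

variable {s : ℕ} {𝓗 : Type*} [NormedAddCommGroup 𝓗] [InnerProductSpace ℂ 𝓗] [CompleteSpace 𝓗]
variable {N : LocalNet s 𝓗} (Δ : Dilations N)

theorem op_mul {a b : ℝ} (ha : 0 < a) (hb : 0 < b) : Δ.op (a * b) = Δ.op a * Δ.op b :=
  congrArg (fun u : unitary (𝓗 →L[ℂ] 𝓗) => (u : 𝓗 →L[ℂ] 𝓗)) (Δ.D_mul a b ha hb)

theorem op_one : Δ.op 1 = 1 := by
  have h := Δ.D_mul 1 1 one_pos one_pos
  rw [mul_one] at h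
  have h1 : Δ.D 1 = 1 := mul_eq_left.1 h.symm
  simp [op, h1]

theorem star_op {a : ℝ} (ha : 0 < a) : star (Δ.op a) = Δ.op a⁻¹ := by
  have h1 : Δ.op a * Δ.op a⁻¹ = 1 := by
    rw [← Δ.op_mul ha (inv_pos.2 ha), mul_inv_cancel₀ ha.ne', op_one]
  calc star (Δ.op a) = star (Δ.op a) * (Δ.op a * Δ.op a⁻¹) := by rw [h1, mul_one]
    _ = _ := by rw [← mul_assoc, star_op_mul, one_mul]

theorem actOp_mul {a b : ℝ} (ha : 0 < a) (hb : 0 < b) (A : 𝓗 →L[ℂ] 𝓗) :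
    Δ.actOp (a * b) A = Δ.actOp a (Δ.actOp b A) := by
  simp only [actOp, Δ.op_mul ha hb, star_mul, mul_assoc]

theorem actOp_one (A : 𝓗 →L[ℂ] 𝓗) : Δ.actOp 1 A = A := by
  simp [actOp, op_one]

theorem actSmooth_apply {a : ℝ} (ha : 0 < a) (σ : N.Smooth) (A : 𝓗 →L[ℂ] 𝓗) :
    (Δ.actSmooth a ha σ).1 A = σ.1 (Δ.actOp a A) := rfl

theorem act_apply {a : ℝ} (ha : 0 < a) (φ : N.CDual) (σ : N.Smooth) :
    (Δ.act a ha φ).1 σ = φ.1 (Δ.actSmooth a ha σ) := rfl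

theorem act_act {a b : ℝ} (ha : 0 < a) (hb : 0 < b) (φ : N.CDual) :
    Δ.act a ha (Δ.act b hb φ) = Δ.act (a * b) (mul_pos ha hb) φ := by
  refine Subtype.ext (LinearMap.ext fun σ => ?_)
  rw [act_apply, act_apply, act_apply]
  congr 1
  refine Subtype.ext (ContinuousLinearMap.ext fun A => ?_)
  rw [actSmooth_apply, actSmooth_apply, actSmooth_apply, Δ.actOp_mul ha hb]

theorem act_one (φ : N.CDual) : Δ.act 1 one_pos φ = φ := by
  refine Subtype.ext (LinearMap.ext fun σ => ?_)
  rw [act_apply]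
  congr 1
  refine Subtype.ext (ContinuousLinearMap.ext fun A => ?_)
  rw [actSmooth_apply, actOp_one]

theorem act_smul {a : ℝ} (ha : 0 < a) (c : ℂ) (φ : N.CDual) :
    Δ.act a ha (c • φ) = c • Δ.act a ha φ := rfl

theorem act_congr {a b : ℝ} (h : a = b) (ha : 0 < a) (hb : 0 < b) (φ : N.CDual) :
    Δ.act a ha φ = Δ.act b hb φ := by
  subst h; rfl

theorem conjD_act {a : ℝ} (ha : 0 < a) (φ : N.CDual) :
    N.conjD (Δ.act a ha φ) = Δ.act a ha (N.conjD φ) := by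
  refine Subtype.ext (LinearMap.ext fun σ => ?_)
  show conj (φ.1 _) = conj (φ.1 _)
  congr 2
  refine Subtype.ext (ContinuousLinearMap.ext fun A => ?_)
  show conjF σ.1 (Δ.actOp a A) = conjF (Δ.actF a σ.1) A
  simp only [conjF_apply, actF_apply, actOp, star_mul, star_star, mul_assoc]

theorem conjD_smul (d : ℂ) (φ : N.CDual) : N.conjD (d • φ) = conj d • N.conjD φ :=
  Subtype.ext (LinearMap.ext fun _ => map_mul (starRingEnd ℂ) d _)

theorem conjD_zero : N.conjD 0 = 0 :=
  Subtype.ext (LinearMap.ext fun _ => map_zero (starRingEnd ℂ))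

theorem conjF_conjF (σ : StrongDual ℂ (𝓗 →L[ℂ] 𝓗)) : conjF (conjF σ) = σ := by
  ext A
  rw [conjF_apply, conjF_apply, star_star, Complex.conj_conj]

theorem conjD_conjD (φ : N.CDual) : N.conjD (N.conjD φ) = φ := by
  refine Subtype.ext (LinearMap.ext fun σ => ?_)
  have h1 : (⟨conjF (conjF σ.1), N.conjF_smooth (N.conjF_smooth σ.2)⟩ : N.Smooth) = σ :=
    Subtype.ext (conjF_conjF σ.1)
  show conj (conj (φ.1 _)) = _
  rw [Complex.conj_conj, h1]

/-- The conjugated operators are bounded and strongly continuous in `a`, which suffices for normal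
functionals. -/
theorem continuousAt_actOp (σ : N.Smooth) (A : 𝓗 →L[ℂ] 𝓗) {a₀ : ℝ} (ha₀ : 0 < a₀) :
    ContinuousAt (fun a => σ.1 (Δ.actOp a A)) a₀ := by
  obtain ⟨τ, hτ⟩ := N.mem_smooth.1 σ.2 0
  have hn : IsNormal σ.1 := by rw [hτ.2]; exact sandwich_mem _ _ hτ.1
  have hle : ∀ a, ‖Δ.op a‖ ≤ 1 := fun a => by
    rcases subsingleton_or_nontrivial 𝓗 with h | h
    · have : Δ.op a = 0 := Subsingleton.elim _ _
      rw [this]; simp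
    · exact (CStarRing.norm_coe_unitary (Δ.D a)).le
  refine IsNormal.tendsto hn (C := ‖A‖) (Eventually.of_forall fun a => ?_) fun x => ?_
  · calc ‖Δ.actOp a A‖ ≤ ‖Δ.op a‖ * ‖A‖ * ‖star (Δ.op a)‖ :=
          (norm_mul_le _ _).trans (by gcongr; exact norm_mul_le _ _)
      _ ≤ 1 * ‖A‖ * 1 := by
          gcongr
          · exact hle a
          · rw [norm_star]; exact hle a
      _ = _ := by ring
  · have hc : ∀ y, ContinuousAt (fun a => Δ.op a y) a₀ := fun y =>
      (Δ.D_continuous y).continuousAt (Ioi_mem_nhds ha₀)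
    have hc' : ContinuousAt (fun a => Δ.op a⁻¹ x) a₀ := by
      have h1 : ContinuousAt (fun a => Δ.op a x) a₀⁻¹ :=
        (Δ.D_continuous x).continuousAt (Ioi_mem_nhds (inv_pos.2 ha₀))
      exact ContinuousAt.comp (f := fun a : ℝ => a⁻¹) h1 (continuousAt_inv₀ ha₀.ne')
    obtain ⟨z, hz⟩ : ∃ z, z = A (Δ.op a₀⁻¹ x) := ⟨_, rfl⟩
    have h2 : ContinuousAt (fun a => A (Δ.op a⁻¹ x)) a₀ := A.continuous.continuousAt.comp hc'
    have h3 : Tendsto (fun a => Δ.op a (A (Δ.op a⁻¹ x))) (𝓝 a₀) (𝓝 (Δ.op a₀ z)) := by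
      rw [tendsto_iff_norm_sub_tendsto_zero]
      have h4 : Tendsto (fun a => ‖A (Δ.op a⁻¹ x) - z‖ + ‖Δ.op a z - Δ.op a₀ z‖) (𝓝 a₀) (𝓝 0) := by
        have e1 := tendsto_iff_norm_sub_tendsto_zero.1 h2.tendsto
        have e2 := tendsto_iff_norm_sub_tendsto_zero.1 (hc z).tendsto
        rw [← hz] at e1
        simpa using e1.add e2
      refine squeeze_zero (fun _ => norm_nonneg _) (fun a => ?_) h4
      have e : Δ.op a (A (Δ.op a⁻¹ x)) - Δ.op a₀ z =
          Δ.op a (A (Δ.op a⁻¹ x) - z) + (Δ.op a z - Δ.op a₀ z) := by rw [map_sub]; abel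
      rw [e]
      refine (norm_add_le _ _).trans ?_
      gcongr
      exact ((Δ.op a).le_opNorm _).trans (mul_le_of_le_one_left (norm_nonneg _) (hle a))
    have e0 : Δ.actOp a₀ A x = Δ.op a₀ z := by
      rw [actOp, Δ.star_op ha₀, hz]; rfl
    rw [e0]
    refine h3.congr' ?_
    filter_upwards [Ioi_mem_nhds ha₀] with a ha
    rw [actOp, Δ.star_op ha]; rfl

theorem eq_of_smul_eq {φ₀ : N.CDual} {σ₀ : N.Smooth} (hφσ : φ₀.1 σ₀ = 1) {c d : ℂ}
    (h : c • φ₀ = d • φ₀) : c = d := by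
  have h1 := congrArg (fun φ : N.CDual => φ.1 σ₀) h
  have h2 : c * φ₀.1 σ₀ = d * φ₀.1 σ₀ := h1
  simpa [hφσ] using h2

/-- Hermiticity of `p` forces `φ₀^*` to be a nonzero multiple of `φ₀`. Conjugation commutes with
dilations, so the eigenvalue equals its complex conjugate. -/
theorem covariance_real {p : N.CDual →ₗ[ℂ] N.CDual}
    (hp : N.IsFieldProjector p) {φ₀ : N.CDual} {σ₀ : N.Smooth}
    (hpφ : p φ₀ = φ₀) (hφσ : φ₀.1 σ₀ = 1) (hpe : ∀ φ, p φ = φ.1 σ₀ • φ₀) {χ : ℂ} {a : ℝ}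
    (ha : 0 < a) (hall : Δ.act a ha φ₀ = χ • φ₀) : χ = (χ.re : ℂ) := by
  have h1 : N.conjD φ₀ = (N.conjD φ₀).1 σ₀ • φ₀ := by
    rw [← hpe, hp.hermitean, hpφ]
  obtain ⟨c, hc⟩ : ∃ c, c = (N.conjD φ₀).1 σ₀ := ⟨_, rfl⟩
  rw [← hc] at h1
  have hc0 : c ≠ 0 := fun h0 => by
    have h2 := conjD_conjD φ₀
    rw [h1, h0, zero_smul, conjD_zero] at h2
    rw [← h2] at hφσ
    exact zero_ne_one hφσ
  have h2 := Δ.conjD_act ha φ₀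
  rw [hall, conjD_smul, h1, act_smul, hall, smul_smul, smul_smul] at h2
  have h3 := eq_of_smul_eq hφσ h2
  have h4 : conj (χ) = χ := mul_right_cancel₀ hc0 (h3.trans (mul_comm _ _))
  exact (Complex.conj_eq_iff_re.1 h4).symm

theorem exists_character {φ₀ : N.CDual} {σ₀ : N.Smooth} (hφσ : φ₀.1 σ₀ = 1)
    (hle : ∀ (a : ℝ) (ha : 0 < a), a ≤ 1 → ∃ c : ℂ, Δ.act a ha φ₀ = c • φ₀) :
    ∃ χ : ℝ → ℂ, ∀ (a : ℝ) (ha : 0 < a), Δ.act a ha φ₀ = χ a • φ₀ := by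
  have hall : ∀ (a : ℝ) (ha : 0 < a), ∃ c : ℂ, Δ.act a ha φ₀ = c • φ₀ := by
    intro a ha
    rcases le_total a 1 with h | h
    · exact hle a ha h
    · obtain ⟨c, h1⟩ := hle a⁻¹ (inv_pos.2 ha) (inv_le_one_of_one_le₀ h)
      have h2 := congrArg (Δ.act a ha) h1
      rw [act_act, Δ.act_congr (mul_inv_cancel₀ ha.ne') _ one_pos, act_one, act_smul] at h2
      have h3 : c ≠ 0 := fun h0 => by
        rw [h0, zero_smul] at h2
        rw [h2] at hφσ
        exact zero_ne_one hφσ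
      refine ⟨c⁻¹, ?_⟩
      conv_rhs => rw [h2]
      rw [inv_smul_smul₀ h3]
  choose c hc using hall
  exact ⟨fun a => if ha : 0 < a then c a ha else 0, fun a ha => by
    rw [hc a ha]
    congr 1
    exact (dif_pos ha).symm⟩

/-- Multiplicativity comes from the group law of the dilations. Continuity is read off from `χ(a) =
σ₀(δ_a A₀) / σ₀(A₀)`, which is known only for `a ≤ 1`; hence the choice of the interior point `1/2`.
-/
theorem character_eq_rpow {φ₀ : N.CDual} {σ₀ : N.Smooth} {A₀ : 𝓗 →L[ℂ] 𝓗} (hA₀ : A₀ ∈ N.algR 1)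
    (hA₀ne : σ₀.1 A₀ ≠ 0) (hφσ : φ₀.1 σ₀ = 1) {χ : ℝ → ℂ}
    (hreal : ∀ a, 0 < a → χ a = ((χ a).re : ℂ))
    (hall : ∀ (a : ℝ) (ha : 0 < a), Δ.act a ha φ₀ = χ a • φ₀)
    (key : ∀ (a : ℝ) (ha : 0 < a), a ≤ 1 → ∀ A ∈ N.algR 1,
      σ₀.1 (Δ.actOp a A) • φ₀ = σ₀.1 A • Δ.act a ha φ₀) :
    ∃ β : ℝ, (∀ (a : ℝ) (ha : 0 < a), Δ.act a ha φ₀ = ((a ^ β : ℝ) : ℂ) • φ₀) ∧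
      ∀ a : ℝ, 0 < a → a ≤ 1 → ∀ A ∈ N.algR 1,
        σ₀.1 (Δ.actOp a A) = ((a ^ β : ℝ) : ℂ) * σ₀.1 A := by
  have hne : ∀ c d : ℂ, c • φ₀ = d • φ₀ → c = d := fun c d h => eq_of_smul_eq hφσ h
  have hmul : ∀ a b, 0 < a → 0 < b → χ (a * b) = χ a * χ b := by
    intro a b ha hb
    refine hne _ _ ?_
    rw [← hall _ (mul_pos ha hb), ← Δ.act_act ha hb, hall b hb, act_smul, hall a ha, smul_smul,
      mul_comm]
  have hone : χ 1 = 1 := by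
    refine hne _ _ ?_
    rw [← hall 1 one_pos, act_one, one_smul]
  have hχne : ∀ a, 0 < a → χ a ≠ 0 := fun a ha h0 => by
    have := hmul a a⁻¹ ha (inv_pos.2 ha)
    rw [mul_inv_cancel₀ ha.ne', hone, h0, zero_mul] at this
    exact one_ne_zero this
  have hform : ∀ a, 0 < a → a ≤ 1 → χ a = (σ₀.1 A₀)⁻¹ * σ₀.1 (Δ.actOp a A₀) := by
    intro a ha ha1
    have h1 := key a ha ha1 A₀ hA₀
    rw [hall a ha, smul_smul] at h1
    have h2 := hne _ _ h1
    rw [h2, inv_mul_cancel_left₀ hA₀ne]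
  obtain ⟨β, hβ⟩ := exists_rpow_of_multiplicative (χ := fun a => (χ a).re)
    (fun a b ha hb => by
      show (χ (a * b)).re = _
      rw [hmul a b ha hb, hreal a ha, hreal b hb, ← Complex.ofReal_mul]
      simp only [Complex.ofReal_re])
    (fun a ha h0 => hχne a ha (by rw [hreal a ha]; exact_mod_cast h0))
    (a₀ := 1 / 2) (by norm_num) (by
      have h1 : ContinuousAt (fun a => ((σ₀.1 A₀)⁻¹ * σ₀.1 (Δ.actOp a A₀)).re) (1 / 2) :=
        Complex.continuous_re.continuousAt.comp
          (continuousAt_const.mul (Δ.continuousAt_actOp σ₀ A₀ (by norm_num)))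
      refine h1.congr ?_
      filter_upwards [Ioo_mem_nhds (show (0 : ℝ) < 1 / 2 by norm_num) (show (1 / 2 : ℝ) < 1 by norm_num)]
        with a ha
      rw [hform a ha.1 ha.2.le])
  have hχβ : ∀ a, 0 < a → χ a = ((a ^ β : ℝ) : ℂ) := fun a ha => by
    rw [hreal a ha]
    exact congrArg _ (hβ a ha)
  refine ⟨β, fun a ha => by rw [hall a ha, hχβ a ha], fun a ha ha1 A hA => ?_⟩
  have h1 := key a ha ha1 A hA
  rw [hall a ha, smul_smul, hχβ a ha] at h1
  rw [hne _ _ h1, mul_comm]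

/-- As `φ₀` is localized at the origin and `φ₀(σ₀) = 1`, some `A₀` in `𝔄(1)` has `σ₀(A₀) ≠ 0`.
Covariance of `p` at `A₀` shows that `φ₀` is an eigenvector; at general `A` it then gives the
homogeneity of `σ₀` on `𝔄(1)`. -/
theorem exists_covariant (hR : N.HasResolvent) {p : N.CDual →ₗ[ℂ] N.CDual}
    (hp : N.IsFieldProjector p) (hcp : Δ.ProjectorCovariant p) {φ₀ : N.CDual} {σ₀ : N.Smooth}
    (hpφ : p φ₀ = φ₀) (hφσ : φ₀.1 σ₀ = 1) (hpe : ∀ φ, p φ = φ.1 σ₀ • φ₀) :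
    ∃ β : ℝ, (∀ (a : ℝ) (ha : 0 < a), Δ.act a ha φ₀ = ((a ^ β : ℝ) : ℂ) • φ₀) ∧
      ∀ a : ℝ, 0 < a → a ≤ 1 → ∀ A ∈ N.algR 1,
        σ₀.1 (Δ.actOp a A) = ((a ^ β : ℝ) : ℂ) * σ₀.1 A := by
  have hfield : φ₀ ∈ N.Fields := hpφ ▸ hp.image φ₀
  obtain ⟨A₀, hA₀, hA₀ne⟩ : ∃ A ∈ N.algR 1, σ₀.1 A ≠ 0 := by
    by_contra! h
    have := hR.field_eq_zero hfield one_pos h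
    rw [hφσ] at this
    exact one_ne_zero this
  have key : ∀ (a : ℝ) (ha : 0 < a), a ≤ 1 → ∀ A ∈ N.algR 1,
      σ₀.1 (Δ.actOp a A) • φ₀ = σ₀.1 A • Δ.act a ha φ₀ := by
    intro a ha ha1 A hA
    have h1 := hcp a ha ha1 A hA
    rw [act_ofOp, hpe, hpe] at h1
    have h2 : σ₀.1 (Δ.actOp a A) • Δ.act a⁻¹ (inv_pos.2 ha) φ₀ = σ₀.1 A • φ₀ := h1
    have h3 := congrArg (Δ.act a ha) h2
    rw [act_smul, act_smul, act_act, Δ.act_congr (mul_inv_cancel₀ ha.ne') _ one_pos, act_one] at h3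
    exact h3
  have hle : ∀ (a : ℝ) (ha : 0 < a), a ≤ 1 → ∃ c : ℂ, Δ.act a ha φ₀ = c • φ₀ := by
    intro a ha ha1
    refine ⟨(σ₀.1 A₀)⁻¹ * σ₀.1 (Δ.actOp a A₀), ?_⟩
    rw [mul_smul, key a ha ha1 A₀ hA₀, inv_smul_smul₀ hA₀ne]
  obtain ⟨χ, hall⟩ := Δ.exists_character hφσ hle
  refine Δ.character_eq_rpow hA₀ hA₀ne hφσ (fun a ha => ?_) hall key
  exact Δ.covariance_real hp hpφ hφσ hpe ha (hall a ha)

/-- The functional `σ₀ ∘ δ_a - a^β₀ σ₀` vanishes on `𝔄(1)`, so by locality it annihilates the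
product smeared with `f`. Covariance of the product supplies the other power of `a`. -/
theorem product_rescale (hR : N.HasResolvent) {P : N.Product} (hP : P ∈ N.PositiveProducts)
    {T : TestFn →ₗ[ℂ] N.CDual} (hT : N.IsProductDistribution P T) {β β₀ : ℝ}
    (hcov : ∀ (a : ℝ) (ha : 0 < a) (f : TestFn),
      Δ.act a ha (T f) = ((a ^ β : ℝ) : ℂ) • T (rescale a ha f)) {σ₀ : N.Smooth}
    (hσ₀ : ∀ a : ℝ, 0 < a → a ≤ 1 → ∀ A ∈ N.algR 1,
        σ₀.1 (Δ.actOp a A) = ((a ^ β₀ : ℝ) : ℂ) * σ₀.1 A)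
    {a : ℝ} (ha : 0 < a) (ha1 : a ≤ 1) {f : TestFn} (hf : SupportedIn f 1) :
    (T (rescale a ha f)).1 σ₀ = ((a ^ (β₀ - β) : ℝ) : ℂ) * (T f).1 σ₀ := by
  have h1 := hR.product_local hP hT hf
    (σ := Δ.actSmooth a ha σ₀ - ((a ^ β₀ : ℝ) : ℂ) • σ₀) fun A hA => by
      show (Δ.actSmooth a ha σ₀).1 A - ((a ^ β₀ : ℝ) : ℂ) * σ₀.1 A = 0
      rw [actSmooth_apply, hσ₀ a ha ha1 A hA, sub_self]
  have h0 := ((T f).1.map_sub (Δ.actSmooth a ha σ₀) (((a ^ β₀ : ℝ) : ℂ) • σ₀)).symm.trans h1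
  rw [(T f).1.map_smul, ← Δ.act_apply ha, hcov a ha f, sub_eq_zero] at h0
  have h2 : ((a ^ β : ℝ) : ℂ) * (T (rescale a ha f)).1 σ₀ = ((a ^ β₀ : ℝ) : ℂ) * (T f).1 σ₀ := h0
  have h3 : ((a ^ β : ℝ) : ℂ) ≠ 0 := by exact_mod_cast (Real.rpow_pos_of_pos ha β).ne'
  refine mul_left_cancel₀ h3 (h2.trans ?_)
  rw [← mul_assoc, ← Complex.ofReal_mul, ← Real.rpow_add ha]
  congr 3
  ring

end Dilations
end
end DilQFT

/-! ### Taylor expansion of the coefficients, and scalar boundary values. -/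

namespace DilQFT

noncomputable section

section Taylor

/-- The polynomial arises by integrating the one for `g'`. All derivatives of the remainder have to
be controlled, since existence of boundary values consumes derivatives of the coefficient. -/
theorem exists_taylor_remainder {F : Type*} [NormedAddCommGroup F] [NormedSpace ℝ F] (N : ℕ) :
    ∀ g : ℝ → F, ContDiff ℝ N g → ∃ (c : ℕ → F) (C : ℝ), 0 ≤ C ∧
      ∀ n ≤ N, ∀ u : ℝ, |u| ≤ 1 →
        ‖iteratedDeriv n (fun t => g t - ∑ k ∈ Finset.range N, t ^ k • c k) u‖ ≤
          C * |u| ^ (N - n) := by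
  induction N with
  | zero =>
    intro g hg
    obtain ⟨C, hC⟩ := (isCompact_Icc (a := (-1 : ℝ)) (b := 1)).exists_bound_of_continuousOn
      hg.continuous.continuousOn
    refine ⟨0, |C|, abs_nonneg _, fun n hn u hu => ?_⟩
    obtain rfl : n = 0 := by omega
    simpa using (hC u (abs_le.1 hu)).trans (le_abs_self C)
  | succ N ih =>
    intro g hg
    have hd : Differentiable ℝ g := hg.differentiable (by simp)
    have hg' : ContDiff ℝ N (deriv g) := by
      have : ContDiff ℝ ((N : WithTop ℕ∞) + 1) g := by exact_mod_cast hg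
      exact (contDiff_succ_iff_deriv.1 this).2.2
    obtain ⟨c, C, hC, h⟩ := ih (deriv g) hg'
    set c' : ℕ → F := fun k => Nat.casesOn k (g 0) fun j => ((j : ℝ) + 1)⁻¹ • c j with hc'
    have hder : ∀ t : ℝ, HasDerivAt
        (fun t => g t - ∑ k ∈ Finset.range (N + 1), t ^ k • c' k)
        (deriv g t - ∑ k ∈ Finset.range N, t ^ k • c k) t := by
      intro t
      have h1 : HasDerivAt (fun t : ℝ => ∑ k ∈ Finset.range (N + 1), t ^ k • c' k)
          (∑ k ∈ Finset.range (N + 1), ((k : ℝ) * t ^ (k - 1)) • c' k) t :=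
        HasDerivAt.fun_sum fun k _ => (hasDerivAt_pow k t).smul_const (c' k)
      refine ((hd t).hasDerivAt.sub h1).congr_deriv ?_
      rw [Finset.sum_range_succ']
      congr 1
      simp only [Nat.cast_zero, zero_mul, zero_smul, add_zero]
      refine Finset.sum_congr rfl fun k _ => ?_
      have : ((k : ℝ) + 1) ≠ 0 := by positivity
      simp only [hc', smul_smul, Nat.add_sub_cancel, Nat.cast_add, Nat.cast_one]
      congr 1
      field_simp
    refine ⟨c', C, hC, fun n hn u hu => ?_⟩
    cases n with
    | succ n =>
      rw [iteratedDeriv_succ', show deriv (fun t => g t - ∑ k ∈ Finset.range (N + 1), t ^ k • c' k) =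
        fun t => deriv g t - ∑ k ∈ Finset.range N, t ^ k • c k from funext fun t => (hder t).deriv]
      simpa using h n (by omega) u hu
    | zero =>
      have h0 : g 0 - ∑ k ∈ Finset.range (N + 1), (0 : ℝ) ^ k • c' k = 0 := by
        simp only [Finset.sum_range_succ']
        simp [hc']
      have h1 := Convex.norm_image_sub_le_of_norm_hasDerivWithin_le
        (f := fun t => g t - ∑ k ∈ Finset.range (N + 1), t ^ k • c' k)
        (C := C * |u| ^ N) (s := Set.Icc (-|u|) |u|) (x := 0) (y := u)
        (fun t _ => (hder t).hasDerivWithinAt)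
        (fun t ht => by
          have ht' : |t| ≤ |u| := abs_le.2 ht
          have := h 0 (by omega) t (ht'.trans hu)
          simp only [iteratedDeriv_zero, Nat.sub_zero] at this
          exact this.trans (by gcongr)) (convex_Icc _ _) ⟨by simp, by simp⟩
        ⟨neg_abs_le u, le_abs_self u⟩
      rw [h0] at h1
      simp only [sub_zero, Real.norm_eq_abs] at h1
      rw [iteratedDeriv_zero, Nat.sub_zero, pow_succ, ← mul_assoc]
      exact h1

end Taylor

section Pairing

theorem contDiff_smulRight {f : ℝ → ℂ} {n : ℕ} (hf : ContDiff ℝ n f) :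
    ContDiff ℝ n fun t => f t • ContinuousLinearMap.id ℂ ℂ := hf.smul contDiff_const

/-- Quantitative existence of boundary values near a fixed test function. -/
theorem exists_pairing_bound (f : TestFn) (m : ℕ) : ∃ c : ℝ, 0 ≤ c ∧ ∀ (F : ℂ → ℂ) (C : ℝ), 0 ≤ C →
    DifferentiableOn ℂ F {z | z.im < 0} →
    (∀ t ∈ tsupport f.1, ∀ x ∈ Set.Ioc (0 : ℝ) (1 / 2), ‖F (t - x * Complex.I)‖ * x ^ m ≤ C) →
    ∃ b : ℂ, BoundaryValue F f.1 b ∧ ∀ y ∈ Set.Ioc (0 : ℝ) (1 / 2),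
      ‖(∫ t : ℝ, f.1 t * F (t - y * Complex.I)) - b‖ ≤ c * C * √y := by
  obtain ⟨c, hc, H⟩ := exists_boundary_limit (E := ℂ) (G := ℂ) m
  obtain ⟨A, hA⟩ := exists_iteratedDeriv_bound (m + 1)
    fun t => f.1 t • ContinuousLinearMap.id ℂ ℂ
  have hA0 : 0 ≤ A := (MeasureTheory.integral_nonneg fun _ => norm_nonneg _).trans (hA 0 (by omega))
  refine ⟨c * A, by positivity, fun F C hC hF hb => ?_⟩
  have hs : tsupport (fun t => f.1 t • ContinuousLinearMap.id ℂ ℂ) ⊆ tsupport f.1 :=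
    closure_mono fun t ht h => ht (ContinuousLinearMap.ext fun z => by
      show f.1 t * z = 0
      rw [h, zero_mul])
  obtain ⟨b, h1, h2, -⟩ := H (fun t => f.1 t • ContinuousLinearMap.id ℂ ℂ) F A C hC
    (contDiff_smulRight (contDiff_nat f _))
    (f.2.2.of_isClosed_subset (isClosed_tsupport _) hs) hF hA
    (fun t ht => hb t (hs ht))
  exact ⟨b, h1, fun y hy => by have := h2 y hy; rwa [← mul_assoc] at this⟩

/-- Analytic in the lower half plane, with polynomial growth of order `m` at the real line. -/
def HasGrowth (m : ℕ) (F : ℂ → ℂ) : Prop :=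
  DifferentiableOn ℂ F {z | z.im < 0} ∧
    ∀ R : ℝ, ∃ C : ℝ, ∀ z : ℂ, |z.re| ≤ R → -1 ≤ z.im → z.im < 0 → ‖F z‖ * |z.im| ^ m ≤ C

theorem HasGrowth.id_mul {m : ℕ} {F : ℂ → ℂ} (h : HasGrowth m F) :
    HasGrowth m fun z => z * F z := by
  refine ⟨differentiableOn_id.fun_mul h.1, fun R => ?_⟩
  obtain ⟨C, hC⟩ := h.2 R
  refine ⟨(R + 1) * C, fun z h1 h2 h3 => ?_⟩
  have h4 : ‖z‖ ≤ R + 1 :=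
    (Complex.norm_le_abs_re_add_abs_im z).trans (add_le_add h1 (by rw [abs_of_neg h3]; linarith))
  rw [norm_mul, mul_assoc]
  exact mul_le_mul h4 (hC z h1 h2 h3) (by positivity) ((norm_nonneg _).trans h4)

theorem HasGrowth.pow_mul {m : ℕ} {F : ℂ → ℂ} (h : HasGrowth m F) (k : ℕ) :
    HasGrowth m fun z => z ^ k * F z := by
  induction k with
  | zero => simpa using h
  | succ k ih =>
    have := ih.id_mul
    simpa only [pow_succ', mul_assoc] using this

theorem exists_abs_bound (f : TestFn) : ∃ R : ℝ, ∀ t ∈ tsupport f.1, |t| ≤ R := by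
  obtain ⟨R, hR⟩ := f.2.2.isCompact.isBounded.exists_norm_le
  exact ⟨R, hR⟩

theorem HasGrowth.exists_boundaryValue {m : ℕ} {F : ℂ → ℂ} (h : HasGrowth m F) (f : TestFn) :
    ∃ b, BoundaryValue F f.1 b := by
  obtain ⟨R, hR⟩ := exists_abs_bound f
  obtain ⟨C, hC⟩ := h.2 R
  obtain ⟨c, -, H⟩ := exists_pairing_bound f m
  obtain ⟨b, hb, -⟩ := H F |C| (abs_nonneg _) h.1 fun t ht x hx => by
    have := hC (t - x * Complex.I) (by simpa using hR t ht) (by simp; linarith [hx.2])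
      (by simpa using hx.1)
    simp only [Complex.sub_im, Complex.ofReal_im, Complex.mul_im, Complex.ofReal_re, Complex.I_im,
      Complex.I_re, mul_one, mul_zero, add_zero, zero_sub, abs_neg, abs_of_pos hx.1] at this
    exact this.trans (le_abs_self C)
  exact ⟨b, hb⟩

theorem integrable_pairing (f : TestFn) {F : ℂ → ℂ} (hF : DifferentiableOn ℂ F {z | z.im < 0})
    {y : ℝ} (hy : 0 < y) :
    MeasureTheory.Integrable fun t : ℝ => f.1 t * F (t - y * Complex.I) :=
  (f.2.1.continuous.mul (continuous_shift hF.continuousOn hy)).integrable_of_hasCompactSupport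
    f.2.2.mul_right

/-- Multiplication of a test function by the coordinate. -/
def mulCoord (f : TestFn) : TestFn :=
  ⟨fun t => (t : ℂ) * f.1 t, (Complex.ofRealCLM.contDiff).mul f.2.1, f.2.2.mul_left⟩

/-- Real powers may be replaced by complex ones in the limit. With `z = t - iy` one has `t^(k+1) -
z^(k+1) = t (t^k - z^k) + iy z^k`: the first term is covered by induction with the test function `t
f(t)`, the second is `y` times a convergent pairing. -/
theorem tendsto_integral_pow_sub (k : ℕ) : ∀ {m : ℕ} {F : ℂ → ℂ}, HasGrowth m F → ∀ f : TestFn,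
    Tendsto (fun y : ℝ => ∫ t : ℝ, f.1 t * (((t : ℂ) ^ k - (t - y * Complex.I) ^ k) *
      F (t - y * Complex.I))) (𝓝[>] 0) (𝓝 0) := by
  induction k with
  | zero => intro m F _ f; simp
  | succ k ih =>
    intro m F h f
    obtain ⟨b, hb⟩ := (h.pow_mul k).exists_boundaryValue f
    have h1 := ih h (mulCoord f)
    have h2 : Tendsto (fun y : ℝ => (y : ℂ) * Complex.I) (𝓝[>] 0) (𝓝 0) := by
      have : Continuous fun y : ℝ => (y : ℂ) * Complex.I := by fun_prop
      simpa using (this.tendsto 0).mono_left nhdsWithin_le_nhds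
    have h3 := h1.add (h2.mul hb)
    rw [zero_mul, add_zero] at h3
    refine h3.congr' ?_
    filter_upwards [self_mem_nhdsWithin] with y hy
    have hy : 0 < y := hy
    rw [← MeasureTheory.integral_const_mul, ← MeasureTheory.integral_add]
    · refine MeasureTheory.integral_congr_ae (Eventually.of_forall fun t => ?_)
      simp only [mulCoord]
      ring
    · exact (((mulCoord f).2.1.continuous.mul (((Complex.continuous_ofReal.pow k).sub
        ((Complex.continuous_ofReal.sub continuous_const).pow k)).mul
        (continuous_shift h.1.continuousOn hy)))).integrable_of_hasCompactSupport
        (mulCoord f).2.2.mul_right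
    · exact (integrable_pairing f (h.pow_mul k).1 hy).const_mul _

end Pairing
end
end DilQFT

/-! ### Scaling of remainders and growth bounds. -/

namespace DilQFT

noncomputable section

section Scaling

theorem tsupport_iteratedDeriv_subset' {F : Type*} [NormedAddCommGroup F] [NormedSpace ℝ F]
    (f : ℝ → F) (n : ℕ) : tsupport (iteratedDeriv n f) ⊆ tsupport f := by
  induction n with
  | zero => simp
  | succ n ih =>
    rw [iteratedDeriv_succ]
    exact tsupport_deriv_subset.trans ih

theorem SupportedIn.abs_le_one {f : TestFn} (hf : SupportedIn f 1) {t : ℝ} (ht : t ∈ tsupport f.1) :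
    |t| ≤ 1 := abs_le.2 ⟨(hf ht).1.le, (hf ht).2.le⟩

/-- By the Leibniz rule: `j` derivatives of `r(a t)` produce `a^j`, and the corresponding derivative
of `r` is at most `C |a t|^(N - j)`. For `|t| ≤ 1` every order therefore carries the full power
`a^N`. -/
theorem exists_remainder_bound {F : Type*} [NormedAddCommGroup F] [NormedSpace ℂ F]
    {f : TestFn} (hf : SupportedIn f 1) {m N : ℕ} (hmN : m + 1 ≤ N) {r : ℝ → F}
    (hr : ContDiff ℝ N r) {C : ℝ} (hC : 0 ≤ C)
    (hb : ∀ n ≤ N, ∀ u : ℝ, |u| ≤ 1 → ‖iteratedDeriv n r u‖ ≤ C * |u| ^ (N - n)) :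
    ∃ A : ℝ, 0 ≤ A ∧ ∀ a : ℝ, 0 < a → a ≤ 1 → ∀ n ≤ m + 1,
      ∫ t : ℝ, ‖iteratedDeriv n (fun t => f.1 t • r (a * t)) t‖ ≤ A * a ^ N := by
  set h : ℕ → ℝ → ℝ := fun n t => ∑ i ∈ Finset.range (n + 1),
    (n.choose i : ℝ) * ‖iteratedDeriv i f.1 t‖ with hh
  have hcont : ∀ i, Continuous (iteratedDeriv i f.1) := fun i =>
    (contDiff_nat f i).continuous_iteratedDeriv i le_rfl
  have hs : ∀ i, HasCompactSupport (iteratedDeriv i f.1) := fun i =>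
    f.2.2.of_isClosed_subset (isClosed_tsupport _) (tsupport_iteratedDeriv_subset' f.1 i)
  have hi : ∀ n, MeasureTheory.Integrable (h n) := fun n =>
    MeasureTheory.integrable_finsetSum _ fun i _ =>
      ((hcont i).norm.integrable_of_hasCompactSupport (hs i).norm).const_mul _
  have hpos : ∀ n, 0 ≤ ∫ t, h n t := fun n =>
    MeasureTheory.integral_nonneg fun t => Finset.sum_nonneg fun i _ => by positivity
  refine ⟨C * ∑ n ∈ Finset.range (m + 2), ∫ t, h n t,
    mul_nonneg hC (Finset.sum_nonneg fun n _ => hpos n), fun a ha ha1 n hn => ?_⟩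
  have hra : ContDiff ℝ N fun t => r (a * t) := hr.comp (contDiff_const.mul contDiff_id)
  have key : ∀ t, ‖iteratedDeriv n (fun t => f.1 t • r (a * t)) t‖ ≤ C * a ^ N * h n t := by
    intro t
    rw [← norm_iteratedFDeriv_eq_norm_iteratedDeriv]
    refine (norm_iteratedFDeriv_smul_le (contDiff_nat f N) hra t
      (by exact_mod_cast hn.trans hmN)).trans ?_
    rw [hh]
    simp only
    rw [Finset.mul_sum]
    refine Finset.sum_le_sum fun i hi' => ?_
    rw [norm_iteratedFDeriv_eq_norm_iteratedDeriv, norm_iteratedFDeriv_eq_norm_iteratedDeriv]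
    have hi2 : i ≤ n := by have := Finset.mem_range.1 hi'; omega
    by_cases ht : t ∈ tsupport f.1
    · have ht1 := hf.abs_le_one ht
      have hat : |a * t| ≤ 1 := by
        rw [abs_mul, abs_of_pos ha]
        exact mul_le_one₀ ha1 (abs_nonneg t) ht1
      have e : iteratedDeriv (n - i) (fun t => r (a * t)) t =
          a ^ (n - i) • iteratedDeriv (n - i) r (a * t) :=
        congrFun (iteratedDeriv_comp_const_smul (hr.of_le (by exact_mod_cast (by omega))) a) t
      have h1 : ‖iteratedDeriv (n - i) (fun t => r (a * t)) t‖ ≤ C * a ^ N := by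
        rw [e, norm_smul, norm_pow, Real.norm_eq_abs, abs_of_pos ha]
        calc a ^ (n - i) * ‖iteratedDeriv (n - i) r (a * t)‖
            ≤ a ^ (n - i) * (C * |a * t| ^ (N - (n - i))) := by
              gcongr; exact hb _ (by omega) _ hat
          _ ≤ a ^ (n - i) * (C * a ^ (N - (n - i))) := by
              gcongr
              rw [abs_mul, abs_of_pos ha]
              exact mul_le_of_le_one_right ha.le ht1
          _ = C * (a ^ (n - i) * a ^ (N - (n - i))) := by ring
          _ = C * a ^ N := by rw [← pow_add]; congr 2; omega
      calc _ ≤ (n.choose i : ℝ) * ‖iteratedDeriv i f.1 t‖ * (C * a ^ N) := by gcongr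
        _ = _ := by ring
    · have : iteratedDeriv i f.1 t = 0 :=
        image_eq_zero_of_notMem_tsupport fun h' => ht (tsupport_iteratedDeriv_subset' f.1 i h')
      rw [this]
      simp
  calc ∫ t : ℝ, ‖iteratedDeriv n (fun t => f.1 t • r (a * t)) t‖
      ≤ ∫ t, C * a ^ N * h n t :=
        MeasureTheory.integral_mono_of_nonneg (Eventually.of_forall fun t => norm_nonneg _)
          ((hi n).const_mul _) (Eventually.of_forall key)
    _ = C * (∫ t, h n t) * a ^ N := by rw [MeasureTheory.integral_const_mul]; ring
    _ ≤ _ := by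
      gcongr
      exact Finset.single_le_sum (f := fun n => ∫ t, h n t) (fun n _ => hpos n)
        (Finset.mem_range.2 (by omega))

theorem scale_mem {a : ℝ} (ha : 0 < a) {z : ℂ} (hz : z.im < 0) : ((a : ℂ) * z).im < 0 := by
  simpa using mul_neg_of_pos_of_neg ha hz

theorem differentiableOn_scale {E : Type*} [NormedAddCommGroup E] [NormedSpace ℂ E] {X : ℂ → E}
    (hX : DifferentiableOn ℂ X {z | z.im < 0}) {a : ℝ} (ha : 0 < a) :
    DifferentiableOn ℂ (fun z => X (a * z)) {z | z.im < 0} :=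
  hX.comp (differentiableOn_id.const_mul (a : ℂ)) fun _ hz => scale_mem ha hz

theorem scale_bound {x C a : ℝ} {m : ℕ} {z : ℂ} (ha : 0 < a)
    (h : x * |((a : ℂ) * z).im| ^ m ≤ C) : x * |z.im| ^ m ≤ C * (a ^ m)⁻¹ := by
  have e : ((a : ℂ) * z).im = a * z.im := by simp
  rw [e, abs_mul, abs_of_pos ha, mul_pow] at h
  rw [← div_eq_mul_inv, le_div_iff₀ (pow_pos ha m)]
  calc _ = x * (a ^ m * |z.im| ^ m) := by ring
    _ ≤ C := h

end Scaling
end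
end DilQFT

/-! ### Analytic approximation of a homogeneous functional. -/

namespace DilQFT

noncomputable section

section Approximation

variable {E : Type*} [NormedAddCommGroup E] [NormedSpace ℂ E]

/-- The analytic part of the Taylor expansion. -/
def taylorPart (X : ℂ → E) (c : ℕ → StrongDual ℂ E) (N : ℕ) (z : ℂ) : ℂ :=
  ∑ k ∈ Finset.range N, z ^ k * c k (X z)

theorem differentiableOn_taylorPart {X : ℂ → E} (hX : DifferentiableOn ℂ X {z | z.im < 0})
    (c : ℕ → StrongDual ℂ E) (N : ℕ) :
    DifferentiableOn ℂ (taylorPart X c N) {z | z.im < 0} :=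
  DifferentiableOn.fun_sum fun k _ =>
    (differentiableOn_id.pow k).fun_mul ((c k).differentiable.comp_differentiableOn hX)

theorem exists_taylorPart_bound {X : ℂ → E} {m : ℕ} {C : ℝ} (hC : 0 ≤ C)
    (hb : ∀ z : ℂ, -1 ≤ z.im → z.im < 0 → ‖X z‖ * |z.im| ^ m ≤ C)
    (c : ℕ → StrongDual ℂ E) (N : ℕ) : ∃ D : ℝ, 0 ≤ D ∧
      ∀ z : ℂ, ‖z‖ ≤ 2 → -1 ≤ z.im → z.im < 0 → ‖taylorPart X c N z‖ * |z.im| ^ m ≤ D := by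
  refine ⟨∑ k ∈ Finset.range N, 2 ^ k * (‖c k‖ * C),
    Finset.sum_nonneg fun k _ => by positivity, fun z h1 h2 h3 => ?_⟩
  calc ‖taylorPart X c N z‖ * |z.im| ^ m
      ≤ (∑ k ∈ Finset.range N, ‖z ^ k * c k (X z)‖) * |z.im| ^ m := by
        gcongr; exact norm_sum_le _ _
    _ = ∑ k ∈ Finset.range N, ‖z‖ ^ k * (‖c k (X z)‖ * |z.im| ^ m) := by
        rw [Finset.sum_mul]
        refine Finset.sum_congr rfl fun k _ => ?_
        rw [norm_mul, norm_pow, mul_assoc]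
    _ ≤ _ := by
        refine Finset.sum_le_sum fun k _ => ?_
        have : ‖c k (X z)‖ * |z.im| ^ m ≤ ‖c k‖ * C :=
          calc _ ≤ ‖c k‖ * ‖X z‖ * |z.im| ^ m := by gcongr; exact (c k).le_opNorm _
            _ = ‖c k‖ * (‖X z‖ * |z.im| ^ m) := by ring
            _ ≤ _ := by gcongr; exact hb z h2 h3
        gcongr

theorem integral_rescale (f : TestFn) {a : ℝ} (ha : 0 < a) (G : ℝ → ℂ) :
    ∫ t : ℝ, (rescale a ha f).1 t * G t = ∫ t : ℝ, f.1 t * G (a * t) := by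
  have h := MeasureTheory.Measure.integral_comp_mul_left
    (fun t => (rescale a ha f).1 t * G t) a
  rw [abs_of_pos (inv_pos.2 ha)] at h
  have e : ∀ x, (rescale a ha f).1 (a * x) * G (a * x) = (a⁻¹ : ℝ) • (f.1 x * G (a * x)) := by
    intro x
    show ((a : ℂ)⁻¹ * f.1 (a⁻¹ * (a * x))) * G (a * x) = _
    rw [inv_mul_cancel_left₀ ha.ne', Complex.real_smul, Complex.ofReal_inv, mul_assoc]
  simp only [e] at h
  rw [MeasureTheory.integral_smul] at h
  exact (smul_right_injective ℂ (inv_ne_zero ha.ne') h).symm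

theorem tendsto_scaled {X : ℂ → E} {g : ℝ → StrongDual ℂ E} {T₀ : TestFn → ℂ}
    (hg : ∀ f : TestFn, Tendsto (fun η : ℝ => ∫ t : ℝ, f.1 t * g t (X (t - η * Complex.I)))
      (𝓝[>] 0) (𝓝 (T₀ f))) (f : TestFn) {a : ℝ} (ha : 0 < a) :
    Tendsto (fun y : ℝ => ∫ t : ℝ, f.1 t * g (a * t) (X (a * (t - y * Complex.I))))
      (𝓝[>] 0) (𝓝 (T₀ (rescale a ha f))) := by
  have h1 : Tendsto (fun y : ℝ => a * y) (𝓝[>] 0) (𝓝[>] 0) := by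
    refine tendsto_nhdsWithin_iff.2 ⟨?_, ?_⟩
    · have : Continuous fun y : ℝ => a * y := by fun_prop
      simpa using (this.tendsto 0).mono_left nhdsWithin_le_nhds
    · filter_upwards [self_mem_nhdsWithin] with y hy using mul_pos ha hy
  refine ((hg (rescale a ha f)).comp h1).congr fun y => ?_
  simp only [Function.comp]
  rw [integral_rescale f ha fun t => g t (X (t - (a * y : ℝ) * Complex.I))]
  refine MeasureTheory.integral_congr_ae (Eventually.of_forall fun t => ?_)
  simp only
  congr 3
  push_cast
  ring

theorem hasGrowth_scaled {X : ℂ → E} {m : ℕ} {C : ℝ} (hX : DifferentiableOn ℂ X {z | z.im < 0})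
    (hb : ∀ z : ℂ, -1 ≤ z.im → z.im < 0 → ‖X z‖ * |z.im| ^ m ≤ C) (c : StrongDual ℂ E)
    {a : ℝ} (ha : 0 < a) (ha1 : a ≤ 1) : HasGrowth m fun z => c (X (a * z)) := by
  refine ⟨c.differentiable.comp_differentiableOn (differentiableOn_scale hX ha), fun R =>
    ⟨‖c‖ * (C * (a ^ m)⁻¹), fun z _ h2 h3 => ?_⟩⟩
  have h4 : ‖X (a * z)‖ * |z.im| ^ m ≤ C * (a ^ m)⁻¹ :=
    scale_bound ha (hb (a * z) (by
      have : ((a : ℂ) * z).im = a * z.im := by simp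
      rw [this]; nlinarith) (scale_mem ha h3))
  calc _ ≤ ‖c‖ * ‖X (a * z)‖ * |z.im| ^ m := by gcongr; exact c.le_opNorm _
    _ = ‖c‖ * (‖X (a * z)‖ * |z.im| ^ m) := by ring
    _ ≤ _ := by gcongr

theorem shift_im (t x : ℝ) : ((t : ℂ) - x * Complex.I).im = -x := by simp

theorem scaled_shift_bound {G : Type*} [NormedAddCommGroup G] {X : ℂ → G} {m : ℕ} {C : ℝ}
    (hb : ∀ z : ℂ, ‖z‖ ≤ 2 → -1 ≤ z.im → z.im < 0 → ‖X z‖ * |z.im| ^ m ≤ C)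
    {a : ℝ} (ha : 0 < a) (ha1 : a ≤ 1) {t x : ℝ} (ht : |t| ≤ 1) (hx : x ∈ Set.Ioc (0 : ℝ) (1 / 2)) :
    ‖X (a * (t - x * Complex.I))‖ * x ^ m ≤ C * (a ^ m)⁻¹ := by
  have e : ((a : ℂ) * (t - x * Complex.I)).im = -(a * x) := by
    simp
  have hax : 0 < a * x := mul_pos ha hx.1
  have h1 : ‖(t : ℂ) - x * Complex.I‖ ≤ 2 := by
    refine (norm_sub_le _ _).trans ?_
    rw [norm_mul, Complex.norm_I, mul_one, Complex.norm_real, Complex.norm_real, Real.norm_eq_abs,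
      Real.norm_eq_abs, abs_of_pos hx.1]
    linarith [hx.2]
  have h2 : ‖(a : ℂ) * (t - x * Complex.I)‖ ≤ 2 := by
    rw [norm_mul, Complex.norm_real, Real.norm_eq_abs, abs_of_pos ha]
    exact (mul_le_of_le_one_left (norm_nonneg _) ha1).trans h1
  have h3 := scale_bound ha (hb _ h2 (by rw [e]; nlinarith [hx.2]) (by rw [e]; linarith))
  rwa [shift_im, abs_neg, abs_of_pos hx.1] at h3

/-- The coefficient `g` is split into its Taylor polynomial and a remainder, and `t^k` is replaced
by `(t - iy)^k` to make the main term analytic. The last sum is the resulting error, which vanishes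
as `y → 0`. -/
theorem boundary_difference {X : ℂ → E} {c : ℕ → StrongDual ℂ E} {N : ℕ} {g : ℝ → StrongDual ℂ E}
    (hg : Continuous g) (hX : DifferentiableOn ℂ X {z | z.im < 0}) (f : TestFn) {a : ℝ} (ha : 0 < a)
    {y : ℝ} (hy : 0 < y) :
    ∫ t : ℝ, f.1 t * g (a * t) (X (a * (t - y * Complex.I))) =
      (∫ t : ℝ, f.1 t * taylorPart X c N (a * (t - y * Complex.I))) +
      (∫ t : ℝ, (f.1 t • (g (a * t) - ∑ k ∈ Finset.range N, (a * t) ^ k • c k))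
        (X (a * (t - y * Complex.I)))) +
      ∑ k ∈ Finset.range N, (a : ℂ) ^ k * ∫ t : ℝ, f.1 t *
        (((t : ℂ) ^ k - (t - y * Complex.I) ^ k) * c k (X (a * (t - y * Complex.I)))) := by
  have hXa : Continuous fun t : ℝ => X (a * (t - y * Complex.I)) :=
    continuous_shift (differentiableOn_scale hX ha).continuousOn hy
  have hfc := f.2.1.continuous
  have i1 : MeasureTheory.Integrable fun t : ℝ =>
      f.1 t * taylorPart X c N (a * (t - y * Complex.I)) :=
    integrable_pairing f (differentiableOn_scale (differentiableOn_taylorPart hX c N) ha) hy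
  have hga : Continuous fun t : ℝ => g (a * t) - ∑ k ∈ Finset.range N, (a * t) ^ k • c k :=
    (hg.comp (by fun_prop)).sub (continuous_finsetSum _ fun k _ => by fun_prop)
  have i2 : MeasureTheory.Integrable fun t : ℝ =>
      (f.1 t • (g (a * t) - ∑ k ∈ Finset.range N, (a * t) ^ k • c k))
        (X (a * (t - y * Complex.I))) :=
    (hfc.mul (hga.clm_apply hXa)).integrable_of_hasCompactSupport f.2.2.mul_right
  have i3 : ∀ k, MeasureTheory.Integrable fun t : ℝ => f.1 t *
        (((t : ℂ) ^ k - (t - y * Complex.I) ^ k) * c k (X (a * (t - y * Complex.I)))) := fun k =>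
    (hfc.mul (((Complex.continuous_ofReal.pow k).sub
        ((Complex.continuous_ofReal.sub continuous_const).pow k)).mul
        ((c k).continuous.comp hXa))).integrable_of_hasCompactSupport f.2.2.mul_right
  have i12 : MeasureTheory.Integrable fun t : ℝ =>
      f.1 t * taylorPart X c N (a * (t - y * Complex.I)) +
      (f.1 t • (g (a * t) - ∑ k ∈ Finset.range N, (a * t) ^ k • c k))
        (X (a * (t - y * Complex.I))) := i1.add i2
  simp only [← MeasureTheory.integral_const_mul]
  rw [← MeasureTheory.integral_finsetSum _ fun k _ => (i3 k).const_mul _,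
    ← MeasureTheory.integral_add i1 i2,
    ← MeasureTheory.integral_add i12 (MeasureTheory.integrable_finsetSum _ fun k _ =>
      (i3 k).const_mul _)]
  refine MeasureTheory.integral_congr_ae (Eventually.of_forall fun t => ?_)
  simp only [taylorPart, smul_apply, sub_apply, sum_apply, smul_eq_mul, Complex.real_smul]
  rw [mul_sub (f.1 t), Finset.mul_sum _ _ (f.1 t), Finset.mul_sum _ _ (f.1 t)]
  have : ∑ k ∈ Finset.range N, (a : ℂ) ^ k * (f.1 t *
        (((t : ℂ) ^ k - (t - y * Complex.I) ^ k) * c k (X (a * (t - y * Complex.I))))) =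
      ∑ k ∈ Finset.range N, f.1 t * (((a * t : ℝ) ^ k : ℝ) * c k (X (a * (t - y * Complex.I)))) -
      ∑ k ∈ Finset.range N, f.1 t * ((a * (t - y * Complex.I)) ^ k *
        c k (X (a * (t - y * Complex.I)))) := by
    rw [← Finset.sum_sub_distrib]
    refine Finset.sum_congr rfl fun k _ => ?_
    push_cast
    rw [mul_pow, mul_pow]
    ring
  rw [this]
  ring

/-- At scale `a` the boundary value of the analytic part differs from `T₀(f_a) = a^κ T₀(f)` by the
remainder only. The second error is the distance to the boundary value at height `y`, where
rescaling has worsened the growth constant by `a^(-m)`. -/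
theorem exists_scaling_approximation [CompleteSpace E] {X : ℂ → E} {m : ℕ} {C : ℝ} (hC : 0 ≤ C)
    (hX : DifferentiableOn ℂ X {z | z.im < 0})
    (hb : ∀ z : ℂ, -1 ≤ z.im → z.im < 0 → ‖X z‖ * |z.im| ^ m ≤ C) {T₀ : TestFn → ℂ}
    (hg : ∀ n : ℕ, ∃ g : ℝ → StrongDual ℂ E, ContDiff ℝ n g ∧ ∀ f : TestFn,
      Tendsto (fun η : ℝ => ∫ t : ℝ, f.1 t * g t (X (t - η * Complex.I))) (𝓝[>] 0) (𝓝 (T₀ f)))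
    {κ : ℝ} (hκ : ∀ (a : ℝ) (ha : 0 < a), a ≤ 1 → ∀ f : TestFn, SupportedIn f 1 →
      T₀ (rescale a ha f) = ((a ^ κ : ℝ) : ℂ) * T₀ f) (p : ℕ) :
    ∃ (S : ℂ → ℂ) (D : ℝ), 0 ≤ D ∧ DifferentiableOn ℂ S {z | z.im < 0} ∧
      (∀ z : ℂ, ‖z‖ ≤ 2 → -1 ≤ z.im → z.im < 0 → ‖S z‖ * |z.im| ^ m ≤ D) ∧
      ∀ f : TestFn, SupportedIn f 1 → ∃ K : ℝ, 0 ≤ K ∧ ∀ a y : ℝ, 0 < a → a ≤ 1 → 0 < y →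
        y ≤ 1 / 2 → ‖(∫ t : ℝ, f.1 t * S (a * (t - y * Complex.I))) - ((a ^ κ : ℝ) : ℂ) * T₀ f‖ ≤
          K * (a ^ p + (a ^ m)⁻¹ * √y) := by
  -- The remainder contributes `a^N · a^(-m) = a^(p+1)`, and `N ≥ m + 1` derivatives are available
  -- for its boundary value.
  obtain ⟨N, hN⟩ : ∃ N, N = m + 1 + p := ⟨_, rfl⟩
  obtain ⟨g, hgc, hgT⟩ := hg N
  obtain ⟨c, C₁, hC₁, hrem⟩ := exists_taylor_remainder N g hgc
  obtain ⟨D, hD, hS⟩ := exists_taylorPart_bound hC hb c N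
  have hSd := differentiableOn_taylorPart hX c N
  refine ⟨taylorPart X c N, D, hD, hSd, hS, fun f hf => ?_⟩
  have hrc : ContDiff ℝ N fun t => g t - ∑ k ∈ Finset.range N, t ^ k • c k :=
    hgc.sub (ContDiff.sum fun k _ => (contDiff_id.pow k).smul contDiff_const)
  obtain ⟨A, hA, hAb⟩ := exists_remainder_bound hf (m := m) (by omega) hrc hC₁ hrem
  obtain ⟨c₁, hc₁, H₁⟩ := exists_boundary_limit (E := E) (G := ℂ) m
  obtain ⟨c₂, hc₂, H₂⟩ := exists_pairing_bound f m
  refine ⟨(c₁ + 2 ^ m) * (A * C) + c₂ * D, by positivity, fun a y ha ha1 hy hy1 => ?_⟩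
  have hE : 0 < a ^ m := pow_pos ha m
  obtain ⟨b, hbv, hrate⟩ := H₂ (fun z => taylorPart X c N (a * z)) (D * (a ^ m)⁻¹) (by positivity)
    (differentiableOn_scale hSd ha)
    (fun t ht x hx => scaled_shift_bound hS ha ha1 (hf.abs_le_one ht) hx)
  obtain ⟨I₀, hI₀, -, hI₀b⟩ := H₁
    (fun t => f.1 t • (g (a * t) - ∑ k ∈ Finset.range N, (a * t) ^ k • c k))
    (fun z => X (a * z)) (A * a ^ N) (C * (a ^ m)⁻¹) (by positivity)
    ((contDiff_nat f _).smul ((hrc.comp (contDiff_const.mul contDiff_id)).of_le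
      (by exact_mod_cast (by omega))))
    (f.2.2.smul_right) (differentiableOn_scale hX ha) (hAb a ha ha1)
    (fun t ht x hx => scaled_shift_bound (fun z _ => hb z) ha ha1
      (hf.abs_le_one (closure_mono (Function.support_smul_subset_left _ _) ht)) hx)
  have h3 : ∀ k, Tendsto (fun y : ℝ => (a : ℂ) ^ k * ∫ t : ℝ, f.1 t *
      (((t : ℂ) ^ k - (t - y * Complex.I) ^ k) * c k (X (a * (t - y * Complex.I)))))
      (𝓝[>] 0) (𝓝 0) := fun k => by
    simpa using (tendsto_integral_pow_sub k (hasGrowth_scaled hX hb (c k) ha ha1) f).const_mul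
      ((a : ℂ) ^ k)
  have h4 := (hbv.add hI₀).add (tendsto_finsetSum (Finset.range N) fun k _ => h3 k)
  have h5 := tendsto_scaled hgT f ha
  have h6 : T₀ (rescale a ha f) = b + I₀ := by
    refine tendsto_nhds_unique h5 ?_
    rw [Finset.sum_const_zero, add_zero] at h4
    refine h4.congr' ?_
    filter_upwards [self_mem_nhdsWithin] with y hy
    exact (boundary_difference hgc.continuous hX f ha hy).symm
  rw [hκ a ha ha1 f hf] at h6
  have h7 : ‖I₀‖ ≤ (c₁ + 2 ^ m) * (A * C) * a ^ p := by
    refine hI₀b.trans ?_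
    have e : a ^ N * (a ^ m)⁻¹ = a * a ^ p := by
      rw [hN, pow_add, pow_add, pow_one]
      field_simp
    calc (c₁ + 2 ^ m) * (A * a ^ N * (C * (a ^ m)⁻¹))
        = (c₁ + 2 ^ m) * (A * C) * (a ^ N * (a ^ m)⁻¹) := by ring
      _ = (c₁ + 2 ^ m) * (A * C) * (a * a ^ p) := by rw [e]
      _ ≤ _ := by
        gcongr
        exact mul_le_of_le_one_left (by positivity) ha1
  have h8 := hrate y ⟨hy, hy1⟩
  have h9 : 0 ≤ (c₁ + 2 ^ m) * (A * C) := by positivity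
  rw [h6, ← sub_sub]
  refine (norm_sub_le _ _).trans ?_
  calc _ ≤ c₂ * (D * (a ^ m)⁻¹) * √y + (c₁ + 2 ^ m) * (A * C) * a ^ p := add_le_add h8 h7
    _ = (c₁ + 2 ^ m) * (A * C) * a ^ p + c₂ * D * ((a ^ m)⁻¹ * √y) := by ring
    _ ≤ ((c₁ + 2 ^ m) * (A * C) + c₂ * D) * a ^ p +
        ((c₁ + 2 ^ m) * (A * C) + c₂ * D) * ((a ^ m)⁻¹ * √y) := by
      gcongr
      · exact le_add_of_nonneg_right (by positivity)
      · exact le_add_of_nonneg_left h9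
    _ = _ := by ring

end Approximation
end
end DilQFT

/-! ### Averages over dilations. -/

namespace DilQFT

noncomputable section

section Smear

/-- The average `∫ ρ(v) S(v z - iy) dv` over dilations. -/
def smear (S : ℂ → ℂ) (ρ : TestFn) (y : ℝ) (z : ℂ) : ℂ :=
  ∫ v : ℝ, ρ.1 v * S (v * z - y * Complex.I)

variable {S : ℂ → ℂ} {ρ : TestFn}

theorem smear_im (v y : ℝ) (z : ℂ) : ((v : ℂ) * z - y * Complex.I).im = v * z.im - y := by simp

theorem smear_im_neg {v y : ℝ} {z : ℂ} (hv : v ∈ Set.Icc (1 / 4 : ℝ) (1 / 2)) (hy : 0 ≤ y)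
    (hz : z.im < 2 * y) : ((v : ℂ) * z - y * Complex.I).im < 0 := by
  rw [smear_im]
  rcases lt_or_ge z.im 0 with h | h
  · nlinarith [hv.1]
  · nlinarith [hv.2]

theorem continuous_smear_integrand {Y : ℂ → ℂ} (hY : ContinuousOn Y {z | z.im < 0})
    (hρ : tsupport ρ.1 ⊆ Set.Icc (1 / 4 : ℝ) (1 / 2)) {y : ℝ} (hy : 0 ≤ y) {z : ℂ}
    (hz : z.im < 2 * y) : Continuous fun v : ℝ => ρ.1 v * Y (v * z - y * Complex.I) := by
  refine continuous_of_tsupport fun v hv => ?_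
  have hv' : v ∈ Set.Icc (1 / 4 : ℝ) (1 / 2) := hρ (closure_mono
    (Function.support_mul_subset_left _ _) hv)
  have h1 : ContinuousAt Y ((v : ℂ) * z - y * Complex.I) :=
    hY.continuousAt ((isOpen_lt Complex.continuous_im continuous_const).mem_nhds
      (smear_im_neg hv' hy hz))
  exact ρ.2.1.continuous.continuousAt.mul
    (ContinuousAt.comp (f := fun v : ℝ => (v : ℂ) * z - y * Complex.I) h1 (by fun_prop))

theorem integrable_smear_integrand {Y : ℂ → ℂ} (hY : ContinuousOn Y {z | z.im < 0})
    (hρ : tsupport ρ.1 ⊆ Set.Icc (1 / 4 : ℝ) (1 / 2)) {y : ℝ} (hy : 0 ≤ y) {z : ℂ}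
    (hz : z.im < 2 * y) :
    MeasureTheory.Integrable fun v : ℝ => ρ.1 v * Y (v * z - y * Complex.I) :=
  (continuous_smear_integrand hY hρ hy hz).integrable_of_hasCompactSupport ρ.2.2.mul_right

/-- Because `v ≤ 1/2`, the points `v z - iy` stay in the lower half plane for `Im z < 2y`. For `y >
0` the average is analytic across the real axis, so the maximum principle can use its values there.
-/
theorem differentiableOn_smear (hS : DifferentiableOn ℂ S {z | z.im < 0})
    (hρ : tsupport ρ.1 ⊆ Set.Icc (1 / 4 : ℝ) (1 / 2)) {y : ℝ} (hy : 0 ≤ y) :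
    DifferentiableOn ℂ (smear S ρ y) {z | z.im < 2 * y} := by
  intro z₀ hz₀
  have hopen : IsOpen {z : ℂ | z.im < 2 * y} := isOpen_lt Complex.continuous_im continuous_const
  have hopen0 : IsOpen {z : ℂ | z.im < 0} := isOpen_lt Complex.continuous_im continuous_const
  obtain ⟨r, hr, hball⟩ := Metric.nhds_basis_closedBall.mem_iff.1 (hopen.mem_nhds hz₀)
  have hS' : ContinuousOn (deriv S) {z | z.im < 0} := (hS.deriv hopen0).continuousOn
  have hcont : ContinuousOn (fun q : ℝ × ℂ =>
      ρ.1 q.1 * (q.1 * deriv S (q.1 * q.2 - y * Complex.I)))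
      (tsupport ρ.1 ×ˢ Metric.closedBall z₀ r) := by
    refine (ρ.2.1.continuous.comp continuous_fst).continuousOn.mul
      ((Complex.continuous_ofReal.comp continuous_fst).continuousOn.mul
        (hS'.comp (Continuous.continuousOn (by fun_prop)) fun q hq =>
          smear_im_neg (hρ hq.1) hy (hball hq.2)))
  obtain ⟨B, hB⟩ := (ρ.2.2.isCompact.prod (isCompact_closedBall z₀ r)).exists_bound_of_continuousOn
    hcont
  refine (hasDerivAt_integral_of_dominated_loc_of_deriv_le
    (F := fun z v => ρ.1 v * S (v * z - y * Complex.I))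
    (F' := fun z v => ρ.1 v * (v * deriv S (v * z - y * Complex.I)))
    (bound := (tsupport ρ.1).indicator fun _ => B) (s := Metric.closedBall z₀ r)
    (Metric.closedBall_mem_nhds z₀ hr) ?_ ?_ ?_ ?_ ?_
    ?_).2.differentiableAt.differentiableWithinAt
  · filter_upwards [Metric.closedBall_mem_nhds z₀ hr] with z hz
    exact (continuous_smear_integrand hS.continuousOn hρ hy (hball hz)).aestronglyMeasurable
  · exact integrable_smear_integrand hS.continuousOn hρ hy hz₀
  · have := (Complex.continuous_ofReal.mul (continuous_smear_integrand hS' hρ hy hz₀))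
    refine (this.congr fun v => ?_).aestronglyMeasurable
    simp only [Pi.mul_apply]
    ring
  · refine Eventually.of_forall fun v z hz => ?_
    by_cases hv : v ∈ tsupport ρ.1
    · rw [Set.indicator_of_mem hv]
      exact hB (v, z) ⟨hv, hz⟩
    · rw [Set.indicator_of_notMem hv, image_eq_zero_of_notMem_tsupport hv]
      simp
  · exact (MeasureTheory.integrable_indicator_iff ρ.2.2.measurableSet).2
      (MeasureTheory.integrableOn_const ρ.2.2.measure_lt_top.ne)
  · refine Eventually.of_forall fun v z hz => ?_
    by_cases hv : v ∈ tsupport ρ.1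
    · have h1 : HasDerivAt S (deriv S (v * z - y * Complex.I)) (v * z - y * Complex.I) :=
        (hS.differentiableAt (hopen0.mem_nhds (smear_im_neg (hρ hv) hy (hball hz)))).hasDerivAt
      have h2 : HasDerivAt (fun z : ℂ => (v : ℂ) * z - y * Complex.I) v z := by
        simpa using ((hasDerivAt_id z).const_mul (v : ℂ)).sub_const (y * Complex.I)
      have h3 := (HasDerivAt.comp z h1 h2).const_mul (ρ.1 v)
      refine h3.congr_deriv ?_
      ring
    · rw [image_eq_zero_of_notMem_tsupport hv]
      simpa using hasDerivAt_const z (0 : ℂ)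

/-- The factor `4^m` reflects `v ≥ 1/4`: the average does not approach the real line by more than
this factor. -/
theorem smear_point_bound {m : ℕ} {D : ℝ}
    (hb : ∀ z : ℂ, ‖z‖ ≤ 2 → -1 ≤ z.im → z.im < 0 → ‖S z‖ * |z.im| ^ m ≤ D)
    {v y : ℝ} {z : ℂ} (hv : v ∈ Set.Icc (1 / 4 : ℝ) (1 / 2)) (hy : 0 ≤ y) (hy1 : y ≤ 1 / 2)
    (hz : ‖z‖ ≤ 1) (hz0 : z.im < 0) :
    ‖S (v * z - y * Complex.I)‖ * |z.im| ^ m ≤ 4 ^ m * D := by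
  have h0 : |z.im| ≤ 1 := (Complex.abs_im_le_norm z).trans hz
  have h1 : ‖(v : ℂ) * z - y * Complex.I‖ ≤ 2 := by
    refine (norm_sub_le _ _).trans ?_
    rw [norm_mul, norm_mul, Complex.norm_I, mul_one, Complex.norm_real, Complex.norm_real,
      Real.norm_eq_abs, Real.norm_eq_abs, abs_of_nonneg hy, abs_of_pos (by linarith [hv.1])]
    nlinarith [hv.1, hv.2, norm_nonneg z]
  have h2 := smear_im v y z
  have h3 := smear_im_neg hv hy (z := z) (by linarith)
  have h4 := hb _ h1 (by rw [h2]; nlinarith [hv.1, hv.2, abs_le.1 h0]) h3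
  have h5 : |z.im| ≤ 4 * |((v : ℂ) * z - y * Complex.I).im| := by
    rw [abs_of_neg h3, abs_of_neg hz0, h2]
    nlinarith [hv.1]
  calc _ ≤ ‖S (v * z - y * Complex.I)‖ * (4 * |((v : ℂ) * z - y * Complex.I).im|) ^ m := by gcongr
    _ = 4 ^ m * (‖S (v * z - y * Complex.I)‖ * |((v : ℂ) * z - y * Complex.I).im| ^ m) := by
      rw [mul_pow]; ring
    _ ≤ _ := by gcongr

theorem norm_smear_le {m : ℕ} {D : ℝ}
    (hb : ∀ z : ℂ, ‖z‖ ≤ 2 → -1 ≤ z.im → z.im < 0 → ‖S z‖ * |z.im| ^ m ≤ D)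
    (hρ : tsupport ρ.1 ⊆ Set.Icc (1 / 4 : ℝ) (1 / 2)) {y : ℝ} (hy : 0 ≤ y) (hy1 : y ≤ 1 / 2) {z : ℂ}
    (hz : ‖z‖ ≤ 1) (hz0 : z.im < 0) :
    ‖smear S ρ y z‖ * |z.im| ^ m ≤ (∫ v, ‖ρ.1 v‖) * (4 ^ m * D) := by
  have hzm : 0 < |z.im| ^ m := pow_pos (abs_pos.2 hz0.ne) m
  rw [← le_div_iff₀ hzm, mul_div_assoc, ← MeasureTheory.integral_mul_const]
  refine MeasureTheory.norm_integral_le_of_norm_le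
    ((ρ.2.1.continuous.norm.integrable_of_hasCompactSupport ρ.2.2.norm).mul_const _)
    (Eventually.of_forall fun v => ?_)
  rw [norm_mul]
  by_cases hv : v ∈ tsupport ρ.1
  · gcongr
    rw [le_div_iff₀ hzm]
    exact smear_point_bound hb (hρ hv) hy hy1 hz hz0
  · rw [image_eq_zero_of_notMem_tsupport hv]
    simp

theorem tendsto_smear (hS : DifferentiableOn ℂ S {z | z.im < 0}) {m : ℕ} {D : ℝ}
    (hb : ∀ z : ℂ, ‖z‖ ≤ 2 → -1 ≤ z.im → z.im < 0 → ‖S z‖ * |z.im| ^ m ≤ D)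
    (hρ : tsupport ρ.1 ⊆ Set.Icc (1 / 4 : ℝ) (1 / 2)) {z : ℂ} (hz : ‖z‖ ≤ 1) (hz0 : z.im < 0) :
    Tendsto (fun y => smear S ρ y z) (𝓝[>] 0) (𝓝 (smear S ρ 0 z)) := by
  have hzm : 0 < |z.im| ^ m := pow_pos (abs_pos.2 hz0.ne) m
  refine MeasureTheory.tendsto_integral_filter_of_dominated_convergence
    (fun v => ‖ρ.1 v‖ * (4 ^ m * D / |z.im| ^ m)) ?_ ?_ ?_ ?_
  · filter_upwards [self_mem_nhdsWithin] with y hy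
    have hy : 0 < y := hy
    exact (continuous_smear_integrand hS.continuousOn hρ hy.le (by linarith)).aestronglyMeasurable
  · filter_upwards [Ioc_mem_nhdsGT (show (0 : ℝ) < 1 / 2 by norm_num)] with y hy
    refine Eventually.of_forall fun v => ?_
    rw [norm_mul]
    by_cases hv : v ∈ tsupport ρ.1
    · gcongr
      rw [le_div_iff₀ hzm]
      exact smear_point_bound hb (hρ hv) hy.1.le hy.2 hz hz0
    · rw [image_eq_zero_of_notMem_tsupport hv]
      simp
  · exact (ρ.2.1.continuous.norm.integrable_of_hasCompactSupport ρ.2.2.norm).mul_const _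
  · refine Eventually.of_forall fun v => ?_
    by_cases hv : v ∈ tsupport ρ.1
    · have h1 : ContinuousAt S ((v : ℂ) * z - (0 : ℝ) * Complex.I) :=
        hS.continuousOn.continuousAt ((isOpen_lt Complex.continuous_im continuous_const).mem_nhds
          (smear_im_neg (hρ hv) le_rfl (by linarith)))
      have h2 : ContinuousAt (fun y : ℝ => ρ.1 v * S (v * z - y * Complex.I)) 0 :=
        continuousAt_const.mul
          (ContinuousAt.comp (f := fun y : ℝ => (v : ℂ) * z - y * Complex.I) h1 (by fun_prop))
      exact h2.tendsto.mono_left nhdsWithin_le_nhds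
    · rw [image_eq_zero_of_notMem_tsupport hv]
      simp

/-- The reflected test function `t ↦ f(-t)`. -/
def reflect (f : TestFn) : TestFn :=
  ⟨fun t => f.1 (-t), f.2.1.comp contDiff_neg, f.2.2.comp_homeomorph (Homeomorph.neg ℝ)⟩

theorem tsupport_reflect (f : TestFn) {t : ℝ} (ht : t ∈ tsupport (reflect f).1) :
    -t ∈ tsupport f.1 := by
  have : tsupport (reflect f).1 ⊆ Neg.neg ⁻¹' tsupport f.1 :=
    closure_minimal (fun t ht => subset_tsupport _ ht) ((isClosed_tsupport _).preimage continuous_neg)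
  exact this ht

/-- At a real point `x` the average is a pairing of `S` with the test function `ρ`, reflected if `x
< 0`, at scale `|x|` and height `y / |x|`. The weak estimate thus becomes pointwise. The coefficient
`w` depends on the sign of `x` only. -/
theorem smear_real_bound {m p : ℕ} {κ : ℝ} {T₀ : TestFn → ℂ}
    (hap : ∀ f : TestFn, SupportedIn f 1 → ∃ K : ℝ, 0 ≤ K ∧ ∀ a y : ℝ, 0 < a → a ≤ 1 → 0 < y →
        y ≤ 1 / 2 → ‖(∫ t : ℝ, f.1 t * S (a * (t - y * Complex.I))) - ((a ^ κ : ℝ) : ℂ) * T₀ f‖ ≤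
          K * (a ^ p + (a ^ m)⁻¹ * √y))
    (hρ : tsupport ρ.1 ⊆ Set.Icc (1 / 4 : ℝ) (1 / 2)) :
    ∃ (K : ℝ) (w : ℝ → ℂ), 0 ≤ K ∧ (∀ a x : ℝ, 0 < a → w (a * x) = w x) ∧
      ∀ x y : ℝ, x ≠ 0 → |x| ≤ 1 → 0 < y → y ≤ |x| / 2 →
        ‖smear S ρ y x - ((|x| ^ κ : ℝ) : ℂ) * w x‖ ≤ K * (|x| ^ p + (|x| ^ m)⁻¹ * √(y / |x|)) := by
  have hρ1 : SupportedIn ρ 1 := fun t ht => ⟨by linarith [(hρ ht).1], by linarith [(hρ ht).2]⟩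
  have hρ2 : SupportedIn (reflect ρ) 1 := fun t ht => by
    have := hρ (tsupport_reflect ρ ht)
    exact ⟨by linarith [this.2], by linarith [this.1]⟩
  obtain ⟨K₁, hK₁, H₁⟩ := hap ρ hρ1
  obtain ⟨K₂, hK₂, H₂⟩ := hap (reflect ρ) hρ2
  refine ⟨K₁ + K₂, fun x => if 0 < x then T₀ ρ else T₀ (reflect ρ), by positivity, fun a x ha => ?_,
    fun x y hx hx1 hy hyx => ?_⟩
  · simp [ha]
  · have hx0 : 0 < |x| := abs_pos.2 hx
    have hq : y / |x| ≤ 1 / 2 := by rw [div_le_iff₀ hx0]; linarith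
    have hpos : 0 ≤ |x| ^ p + (|x| ^ m)⁻¹ * √(y / |x|) := by positivity
    rcases lt_or_gt_of_ne hx with h | h
    · have e : smear S ρ y x =
          ∫ t : ℝ, (reflect ρ).1 t * S ((|x| : ℝ) * (t - (y / |x| : ℝ) * Complex.I)) := by
        rw [smear, ← MeasureTheory.integral_neg_eq_self]
        refine MeasureTheory.integral_congr_ae (Eventually.of_forall fun t => ?_)
        simp only [reflect]
        congr 2
        have : ((|x| : ℝ) : ℂ) * ((y / |x| : ℝ) : ℂ) = y := by
          rw [← Complex.ofReal_mul, mul_div_cancel₀ y hx0.ne']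
        rw [mul_sub, ← mul_assoc ((|x| : ℝ) : ℂ) ((y / |x| : ℝ) : ℂ), this, abs_of_neg h]
        push_cast
        ring
      rw [e]
      simp only [if_neg h.not_gt]
      refine (H₂ |x| (y / |x|) hx0 hx1 (by positivity) hq).trans ?_
      gcongr
      linarith
    · have e : smear S ρ y x =
          ∫ t : ℝ, ρ.1 t * S ((|x| : ℝ) * (t - (y / |x| : ℝ) * Complex.I)) := by
        refine MeasureTheory.integral_congr_ae (Eventually.of_forall fun t => ?_)
        simp only
        congr 2
        have : ((|x| : ℝ) : ℂ) * ((y / |x| : ℝ) : ℂ) = y := by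
          rw [← Complex.ofReal_mul, mul_div_cancel₀ y hx0.ne']
        rw [mul_sub, ← mul_assoc ((|x| : ℝ) : ℂ) ((y / |x| : ℝ) : ℂ), this, abs_of_pos h]
        ring
      rw [e]
      simp only [if_pos h]
      refine (H₁ |x| (y / |x|) hx0 hx1 (by positivity) hq).trans ?_
      gcongr
      linarith

end Smear
end
end DilQFT

/-! ### A Phragmén–Lindelöf estimate on half annuli. -/

namespace DilQFT

noncomputable section

section PhragmenLindelof

/-- The branch of `(iz)^{-1/2}` on the lower half plane. -/
def invSqrt (z : ℂ) : ℂ := Complex.exp (-(Complex.log (Complex.I * z) / 2))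

theorem I_mul_mem_slitPlane {z : ℂ} (hz : z ≠ 0) (hz0 : z.im ≤ 0) :
    Complex.I * z ∈ Complex.slitPlane := by
  rw [Complex.mem_slitPlane_iff]
  have h1 : (Complex.I * z).re = -z.im := by simp
  have h2 : (Complex.I * z).im = z.re := by simp
  rw [h1, h2]
  rcases hz0.lt_or_eq with h | h
  · left; linarith
  · right
    intro h'
    exact hz (Complex.ext h' h)

/-- In the closed lower half plane `|arg(iz)| ≤ π/2`; the root halves the argument, and the cosine
of an angle below `π/3` is at least `1/2`. -/
theorem le_re_invSqrt {z : ℂ} (hz : z ≠ 0) (hz0 : z.im ≤ 0) :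
    (√‖z‖)⁻¹ / 2 ≤ (invSqrt z).re := by
  have h1 : 0 ≤ (Complex.I * z).re := by simpa using hz0
  have h2 := Complex.abs_arg_le_pi_div_two_iff.2 h1
  have hn : 0 < ‖z‖ := norm_pos_iff.2 hz
  rw [invSqrt, Complex.exp_re]
  have h3 : (-(Complex.log (Complex.I * z) / 2)).re = -(Real.log ‖z‖ / 2) := by
    simp [Complex.log_re]
  have h4 : (-(Complex.log (Complex.I * z) / 2)).im = -(Complex.arg (Complex.I * z) / 2) := by
    simp [Complex.log_im]
  rw [h3, h4, Real.cos_neg, Real.exp_neg, ← Real.log_sqrt hn.le, Real.exp_log (Real.sqrt_pos.2 hn),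
    div_eq_mul_inv]
  refine mul_le_mul_of_nonneg_left ?_ (by positivity)
  have h5 : Real.cos (Real.pi / 3) ≤ Real.cos |Complex.arg (Complex.I * z) / 2| := by
    refine Real.cos_le_cos_of_nonneg_of_le_pi (abs_nonneg _) (by linarith [Real.pi_pos]) ?_
    rw [abs_div, abs_two]
    linarith [Real.pi_pos]
  rw [Real.cos_abs, Real.cos_pi_div_three] at h5
  linarith

/-- On the circle `r² = z · conj z`. The zeros of `r² - z²` at `±r` thus compensate exactly the
growth in `1 / |Im z|` towards the real axis. -/
theorem norm_sq_sub_sq {r : ℝ} {z : ℂ} (hz : ‖z‖ = r) : ‖(r : ℂ) ^ 2 - z ^ 2‖ = 2 * r * |z.im| := by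
  have h1 : (r : ℂ) ^ 2 = z * conj z := by rw [Complex.mul_conj, Complex.normSq_eq_norm_sq, hz]; simp
  have h2 : (r : ℂ) ^ 2 - z ^ 2 = z * (-(2 * z.im : ℝ) * Complex.I) := by
    rw [h1, sq, ← mul_sub]
    congr 1
    apply Complex.ext <;> simp
    ring
  rw [h2, norm_mul, norm_mul, Complex.norm_I, hz, norm_neg, Complex.norm_real, Real.norm_eq_abs,
    abs_mul, abs_two]
  ring

theorem inv_pow_mul_exp_le {s : ℝ} (hs : 0 < s) (p : ℕ) :
    (((s ^ 4) ^ p)⁻¹) * Real.exp (-(s⁻¹ / 2)) ≤ 2 ^ (4 * p) * (4 * p).factorial := by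
  have h1 := Real.pow_div_factorial_le_exp (s⁻¹ / 2) (by positivity) (4 * p)
  have hf : (0 : ℝ) < (4 * p).factorial := by exact_mod_cast Nat.factorial_pos _
  rw [div_le_iff₀ hf, div_pow, inv_pow, div_le_iff₀ (by positivity)] at h1
  rw [Real.exp_neg, ← pow_mul, ← div_eq_mul_inv, div_le_iff₀ (Real.exp_pos _)]
  linarith

/-- The open half annulus `r < |z| < 1`, `Im z < 0`. -/
def halfAnnulus (r : ℝ) : Set ℂ := {z | r < ‖z‖ ∧ ‖z‖ < 1 ∧ z.im < 0}

theorem isOpen_halfAnnulus (r : ℝ) : IsOpen (halfAnnulus r) :=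
  (isOpen_lt continuous_const continuous_norm).inter
    ((isOpen_lt continuous_norm continuous_const).inter
      (isOpen_lt Complex.continuous_im continuous_const))

theorem closure_halfAnnulus_subset (r : ℝ) :
    closure (halfAnnulus r) ⊆ {z | r ≤ ‖z‖ ∧ ‖z‖ ≤ 1 ∧ z.im ≤ 0} :=
  closure_minimal (fun _ hz => ⟨hz.1.le, hz.2.1.le, hz.2.2.le⟩)
    ((isClosed_le continuous_const continuous_norm).inter
      ((isClosed_le continuous_norm continuous_const).inter
        (isClosed_le Complex.continuous_im continuous_const)))

/-- The maximum principle for an auxiliary function bounded on the whole boundary by a constant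
independent of `s`. The factors `(1 - z²)^m` and `(r² - z²)^m` tame the two arcs, and `z^(-p)` uses
the decay on the real axis. On the inner arc `z^(-p)` is large, but with `r = s⁴` the damping
`exp(-s (iz)^(-1/2))` is at most `exp(-1/(2s))` there and wins, whereas at fixed `z` it disappears
as `s → 0`. -/
theorem phragmenLindelof_halfAnnulus {m p : ℕ} {B s η : ℝ} (hB : 0 ≤ B) (hs : 0 < s) (hη : 0 < η)
    {q : ℂ → ℂ} (hq : DifferentiableOn ℂ q {z | z.im < η})
    (hreal : ∀ x : ℝ, s ^ 4 ≤ |x| → |x| ≤ 1 → ‖q x‖ ≤ B * |x| ^ p)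
    (hb : ∀ z : ℂ, ‖z‖ ≤ 1 → z.im < 0 → ‖q z‖ * |z.im| ^ m ≤ B)
    {z : ℂ} (hz : z ∈ halfAnnulus (s ^ 4)) :
    ‖q z‖ * ‖1 - z ^ 2‖ ^ m * ‖((s ^ 4 : ℝ) : ℂ) ^ 2 - z ^ 2‖ ^ m * (‖z‖ ^ p)⁻¹ *
      Real.exp (-(s * (invSqrt z).re)) ≤ B * 4 ^ m * (2 ^ (4 * p) * (4 * p).factorial) := by
  obtain ⟨r, hr⟩ : ∃ r, r = s ^ 4 := ⟨_, rfl⟩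
  rw [← hr] at hz hreal ⊢
  have hr0 : 0 < r := hr ▸ pow_pos hs 4
  have hr1 : r < 1 := hz.1.trans hz.2.1
  set M : ℝ := 2 ^ (4 * p) * (4 * p).factorial with hM
  have hM1 : 1 ≤ M := by
    have h1 : (1 : ℝ) ≤ 2 ^ (4 * p) := one_le_pow₀ (by norm_num)
    have h2 : (1 : ℝ) ≤ (4 * p).factorial := by exact_mod_cast Nat.factorial_pos _
    exact one_le_mul_of_one_le_of_one_le h1 h2
  set h : ℂ → ℂ := fun z => q z * (1 - z ^ 2) ^ m * ((r : ℂ) ^ 2 - z ^ 2) ^ m * (z ^ p)⁻¹ *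
    Complex.exp (-(s * invSqrt z)) with hh
  have hnorm : ∀ z, ‖h z‖ = ‖q z‖ * ‖1 - z ^ 2‖ ^ m * ‖(r : ℂ) ^ 2 - z ^ 2‖ ^ m * (‖z‖ ^ p)⁻¹ *
      Real.exp (-(s * (invSqrt z).re)) := fun z => by
    rw [hh]
    simp only [norm_mul, norm_pow, norm_inv, Complex.norm_exp]
    congr 2
    simp
  have hdiff : ∀ z : ℂ, z ≠ 0 → z.im ≤ 0 → DifferentiableAt ℂ h z := fun z hz hz0 => by
    have h1 : DifferentiableAt ℂ q z := hq.differentiableAt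
      ((isOpen_lt Complex.continuous_im continuous_const).mem_nhds (show z.im < η by linarith))
    have h2 : DifferentiableAt ℂ invSqrt z :=
      (((differentiableAt_id.const_mul Complex.I).clog (I_mul_mem_slitPlane hz hz0)).div_const
        2).neg.cexp
    have h3 : DifferentiableAt ℂ (fun z : ℂ => (z ^ p)⁻¹) z :=
      (differentiableAt_id.pow p).inv (pow_ne_zero p hz)
    have h4 : DifferentiableAt ℂ (fun z : ℂ => (1 - z ^ 2) ^ m) z := by fun_prop
    have h5 : DifferentiableAt ℂ (fun z : ℂ => ((r : ℂ) ^ 2 - z ^ 2) ^ m) z := by fun_prop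
    exact ((((h1.mul h4).mul h5).mul h3).mul ((h2.const_mul (s : ℂ)).neg.cexp))
  have hcl := closure_halfAnnulus_subset r
  have hne : ∀ z ∈ closure (halfAnnulus r), z ≠ 0 := fun z hz h0 => by
    have := (hcl hz).1
    rw [h0, norm_zero] at this
    linarith
  have hdc : DiffContOnCl ℂ h (halfAnnulus r) :=
    ⟨fun z hz => (hdiff z (hne z (subset_closure hz)) hz.2.2.le).differentiableWithinAt,
      fun z hz => (hdiff z (hne z hz) (hcl hz).2.2).continuousAt.continuousWithinAt⟩
  have hbdd : Bornology.IsBounded (halfAnnulus r) :=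
    Metric.isBounded_ball.subset (fun z hz => by simpa using hz.2.1 : halfAnnulus r ⊆ Metric.ball 0 1)
  rw [← hnorm]
  refine Complex.norm_le_of_forall_mem_frontier_norm_le hbdd hdc (fun z hz => ?_) (subset_closure hz)
  have hzc := hcl (frontier_subset_closure hz)
  have hz0 := hne z (frontier_subset_closure hz)
  have hzn : 0 < ‖z‖ := norm_pos_iff.2 hz0
  have hzout : z ∉ halfAnnulus r := by
    rw [(isOpen_halfAnnulus r).frontier_eq] at hz
    exact hz.2
  have hsq : ‖z ^ 2‖ ≤ 1 := by rw [norm_pow]; exact pow_le_one₀ (norm_nonneg _) hzc.2.1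
  have hf1 : ‖1 - z ^ 2‖ ≤ 2 := (norm_sub_le _ _).trans (by rw [norm_one]; linarith)
  have hf2 : ‖(r : ℂ) ^ 2 - z ^ 2‖ ≤ 2 := by
    refine (norm_sub_le _ _).trans ?_
    have : ‖(r : ℂ) ^ 2‖ ≤ 1 := by
      rw [norm_pow, Complex.norm_real, Real.norm_eq_abs, abs_of_pos hr0]
      exact pow_le_one₀ hr0.le hr1.le
    linarith
  have hre := le_re_invSqrt hz0 hzc.2.2
  have hre0 : 0 ≤ (invSqrt z).re := le_trans (by positivity) hre
  have hexp : Real.exp (-(s * (invSqrt z).re)) ≤ 1 := by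
    rw [Real.exp_le_one_iff]
    nlinarith
  have h4 : (4 : ℝ) ^ m = 2 ^ m * 2 ^ m := by rw [← mul_pow]; norm_num
  rw [hnorm]
  rcases hzc.2.2.lt_or_eq with him | him
  · by_cases hz1 : ‖z‖ = 1
    · have e := norm_sq_sub_sq hz1
      rw [Complex.ofReal_one, one_pow] at e
      have h6 : ‖q z‖ * ‖1 - z ^ 2‖ ^ m ≤ B * 2 ^ m := by
        rw [e, mul_pow, mul_one]
        calc _ = (‖q z‖ * |z.im| ^ m) * 2 ^ m := by ring
          _ ≤ _ := by gcongr; exact hb z hzc.2.1 him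
      rw [hz1, one_pow, inv_one, mul_one]
      calc ‖q z‖ * ‖1 - z ^ 2‖ ^ m * ‖(r : ℂ) ^ 2 - z ^ 2‖ ^ m * Real.exp (-(s * (invSqrt z).re))
          ≤ (B * 2 ^ m) * 2 ^ m * 1 := by gcongr
        _ = B * 4 ^ m * 1 := by rw [h4]; ring
        _ ≤ _ := by gcongr
    · have hzr : ‖z‖ = r := by
        by_contra hne'
        exact hzout ⟨lt_of_le_of_ne hzc.1 (Ne.symm hne'), lt_of_le_of_ne hzc.2.1 hz1, him⟩
      have h6 : ‖q z‖ * ‖(r : ℂ) ^ 2 - z ^ 2‖ ^ m ≤ B * 2 ^ m := by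
        rw [norm_sq_sub_sq hzr, mul_pow, mul_pow]
        calc _ = (‖q z‖ * |z.im| ^ m) * (2 ^ m * r ^ m) := by ring
          _ ≤ B * (2 ^ m * 1) := by
            gcongr
            · exact hb z hzc.2.1 him
            · exact pow_le_one₀ hr0.le hr1.le
          _ = _ := by ring
      -- The inner radius is `s⁴`, so `s |z|^(-1/2) = s⁻¹` on this arc.
      have h7 : (‖z‖ ^ p)⁻¹ * Real.exp (-(s * (invSqrt z).re)) ≤ M := by
        refine le_trans ?_ (inv_pow_mul_exp_le hs p)
        rw [hzr, hr]
        gcongr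
        have e : √‖z‖ = s ^ 2 := by
          rw [hzr, hr, show s ^ 4 = (s ^ 2) ^ 2 by ring, Real.sqrt_sq (by positivity)]
        rw [e] at hre
        calc s⁻¹ / 2 = s * ((s ^ 2)⁻¹ / 2) := by field_simp
          _ ≤ _ := by gcongr
      calc ‖q z‖ * ‖1 - z ^ 2‖ ^ m * ‖(r : ℂ) ^ 2 - z ^ 2‖ ^ m * (‖z‖ ^ p)⁻¹ *
            Real.exp (-(s * (invSqrt z).re))
          = (‖q z‖ * ‖(r : ℂ) ^ 2 - z ^ 2‖ ^ m) * ‖1 - z ^ 2‖ ^ m *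
            ((‖z‖ ^ p)⁻¹ * Real.exp (-(s * (invSqrt z).re))) := by ring
        _ ≤ (B * 2 ^ m) * 2 ^ m * M := by gcongr
        _ = _ := by rw [h4]; ring
  · have hx : z = (z.re : ℂ) := Complex.ext rfl (by simpa using him)
    have hxn : ‖z‖ = |z.re| := by
      conv_lhs => rw [hx]
      rw [Complex.norm_real, Real.norm_eq_abs]
    have h6 : ‖q z‖ * (‖z‖ ^ p)⁻¹ ≤ B := by
      have := hreal z.re (hxn ▸ hzc.1) (hxn ▸ hzc.2.1)
      rw [← hx, ← hxn] at this
      rw [← div_eq_mul_inv, div_le_iff₀ (pow_pos hzn p)]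
      exact this
    calc ‖q z‖ * ‖1 - z ^ 2‖ ^ m * ‖(r : ℂ) ^ 2 - z ^ 2‖ ^ m * (‖z‖ ^ p)⁻¹ *
            Real.exp (-(s * (invSqrt z).re))
        = (‖q z‖ * (‖z‖ ^ p)⁻¹) * ‖1 - z ^ 2‖ ^ m * ‖(r : ℂ) ^ 2 - z ^ 2‖ ^ m *
            Real.exp (-(s * (invSqrt z).re)) := by ring
      _ ≤ B * 2 ^ m * 2 ^ m * 1 := by gcongr
      _ = B * 4 ^ m * 1 := by rw [h4]; ring
      _ ≤ _ := by gcongr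

end PhragmenLindelof
end
end DilQFT

/-! ### The defect of homogeneity. -/

namespace DilQFT

noncomputable section

section Defect

variable {S : ℂ → ℂ} {ρ : TestFn}

theorem sqrt_rate {r a x : ℝ} {m p : ℕ} (hr : 0 < r) (ha : 0 < a) (hx : a * r ≤ x) :
    (x ^ m)⁻¹ * √(a * r / 2 * (a ^ m * r ^ (m + p)) ^ 2 / x) ≤ r ^ p := by
  have har : 0 < a * r := mul_pos ha hr
  have hx0 : 0 < x := har.trans_le hx
  have h1 : √(a * r / 2 * (a ^ m * r ^ (m + p)) ^ 2 / x) ≤ a ^ m * r ^ (m + p) := by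
    refine Real.sqrt_le_iff.2 ⟨by positivity, ?_⟩
    rw [div_le_iff₀ hx0, mul_comm]
    refine mul_le_mul_of_nonneg_left (by linarith) (by positivity)
  have h2 : (x ^ m)⁻¹ ≤ ((a * r) ^ m)⁻¹ := by gcongr
  calc _ ≤ ((a * r) ^ m)⁻¹ * (a ^ m * r ^ (m + p)) := by gcongr
    _ = r ^ p := by
      rw [mul_pow, pow_add]
      field_simp

/-- The leading terms at `a x` and `x` cancel because `w` is scale invariant. The height is so small
that the errors with square roots, at distance `|x|` as well as `a |x|`, are at most `r^p ≤ |x|^p`.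
-/
theorem smear_real_defect {m p : ℕ} {κ K : ℝ} {w : ℝ → ℂ} (hK : 0 ≤ K)
    (hw : ∀ a x : ℝ, 0 < a → w (a * x) = w x)
    (hb : ∀ x y : ℝ, x ≠ 0 → |x| ≤ 1 → 0 < y → y ≤ |x| / 2 →
        ‖smear S ρ y x - ((|x| ^ κ : ℝ) : ℂ) * w x‖ ≤ K * (|x| ^ p + (|x| ^ m)⁻¹ * √(y / |x|)))
    {a r x : ℝ} (ha : 0 < a) (ha1 : a ≤ 1) (hr : 0 < r) (hr1 : r ≤ 1) (hx : r ≤ |x|) (hx1 : |x| ≤ 1) :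
    ‖smear S ρ (a * r / 2 * (a ^ m * r ^ (m + p)) ^ 2) (a * x) -
      ((a ^ κ : ℝ) : ℂ) * smear S ρ (a * r / 2 * (a ^ m * r ^ (m + p)) ^ 2) x‖ ≤
      2 * K * (1 + a ^ κ) * |x| ^ p := by
  obtain ⟨y, hy⟩ : ∃ y, y = a * r / 2 * (a ^ m * r ^ (m + p)) ^ 2 := ⟨_, rfl⟩
  have hy0 : 0 < y := by rw [hy]; positivity
  have hy1 : y ≤ a * r / 2 := by
    rw [hy]
    refine mul_le_of_le_one_right (by positivity) (pow_le_one₀ (by positivity) ?_)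
    exact mul_le_one₀ (pow_le_one₀ ha.le ha1) (by positivity) (pow_le_one₀ hr.le hr1)
  have hx0 : 0 < |x| := hr.trans_le hx
  have hxne : x ≠ 0 := abs_pos.1 hx0
  have hax : |a * x| = a * |x| := by rw [abs_mul, abs_of_pos ha]
  have e1 : ∀ x', |x| ^ p ≥ 0 → a * r ≤ x' → (x' ^ m)⁻¹ * √(y / x') ≤ |x| ^ p := fun x' _ h => by
    rw [hy]
    exact (sqrt_rate hr ha h).trans (by gcongr)
  have h1 := hb (a * x) y (mul_ne_zero ha.ne' hxne) (by rw [hax]; exact mul_le_one₀ ha1 hx0.le hx1)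
    hy0 (by rw [hax]; nlinarith)
  have h2 := hb x y hxne hx1 hy0 (by nlinarith)
  rw [hw a x ha, hax, Real.mul_rpow ha.le hx0.le] at h1
  have h3 : a * |x| ≤ |x| := mul_le_of_le_one_left hx0.le ha1
  have h1' : K * ((a * |x|) ^ p + ((a * |x|) ^ m)⁻¹ * √(y / (a * |x|))) ≤ 2 * K * |x| ^ p := by
    have := e1 (a * |x|) (by positivity) (by gcongr)
    have h4 : (a * |x|) ^ p ≤ |x| ^ p := by gcongr
    nlinarith
  have h2' : K * (|x| ^ p + (|x| ^ m)⁻¹ * √(y / |x|)) ≤ 2 * K * |x| ^ p := by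
    have := e1 |x| (by positivity) (by nlinarith)
    nlinarith
  rw [← hy]
  have haκ : 0 ≤ a ^ κ := Real.rpow_nonneg ha.le κ
  have e : smear S ρ y (a * x) - ((a ^ κ : ℝ) : ℂ) * smear S ρ y x =
      (smear S ρ y ((a * x : ℝ) : ℂ) - ((a ^ κ * |x| ^ κ : ℝ) : ℂ) * w x) -
      ((a ^ κ : ℝ) : ℂ) * (smear S ρ y x - ((|x| ^ κ : ℝ) : ℂ) * w x) := by
    push_cast
    ring
  rw [e]
  refine (norm_sub_le _ _).trans ?_
  rw [norm_mul, Complex.norm_real, Real.norm_eq_abs, abs_of_nonneg haκ]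
  calc _ ≤ 2 * K * |x| ^ p + a ^ κ * (2 * K * |x| ^ p) :=
        add_le_add (h1.trans h1') (mul_le_mul_of_nonneg_left (h2.trans h2') haκ)
    _ = _ := by ring

/-- The defect is small of order `p` on the real axis and has polynomial growth inside; the estimate
on half annuli transports the smallness to the interior. The inner radius and the height tend to `0`
together. -/
theorem smear_defect_bound {m n : ℕ} {κ K D : ℝ} {w : ℝ → ℂ} (hK : 0 ≤ K) (hD : 0 ≤ D)
    (hS : DifferentiableOn ℂ S {z | z.im < 0})
    (hSb : ∀ z : ℂ, ‖z‖ ≤ 2 → -1 ≤ z.im → z.im < 0 → ‖S z‖ * |z.im| ^ m ≤ D)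
    (hρ : tsupport ρ.1 ⊆ Set.Icc (1 / 4 : ℝ) (1 / 2))
    (hw : ∀ a x : ℝ, 0 < a → w (a * x) = w x)
    (hb : ∀ x y : ℝ, x ≠ 0 → |x| ≤ 1 → 0 < y → y ≤ |x| / 2 →
        ‖smear S ρ y x - ((|x| ^ κ : ℝ) : ℂ) * w x‖ ≤
          K * (|x| ^ (2 * m + n) + (|x| ^ m)⁻¹ * √(y / |x|)))
    {a : ℝ} (ha : 0 < a) (ha1 : a ≤ 1) : ∃ C : ℝ, 0 ≤ C ∧ ∀ z : ℂ, ‖z‖ < 1 / 2 → z.im < 0 →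
      ‖smear S ρ 0 (a * z) - ((a ^ κ : ℝ) : ℂ) * smear S ρ 0 z‖ ≤ C * ‖z‖ ^ n := by
  -- As `s → 0` the factor `|r² - z²|^m` tends to `|z|^(2m)` and uses up `2m` of the powers of
  -- `|z|`.
  obtain ⟨p, hp⟩ : ∃ p, p = 2 * m + n := ⟨_, rfl⟩
  rw [← hp] at hb
  have haκ : 0 ≤ a ^ κ := Real.rpow_nonneg ha.le κ
  obtain ⟨M₁, hM₁⟩ : ∃ M₁, M₁ = (∫ v, ‖ρ.1 v‖) * (4 ^ m * D) := ⟨_, rfl⟩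
  have hM₁0 : 0 ≤ M₁ := by
    rw [hM₁]
    exact mul_nonneg (MeasureTheory.integral_nonneg fun _ => norm_nonneg _) (by positivity)
  obtain ⟨B, hB⟩ : ∃ B, B = 2 * K * (1 + a ^ κ) + (M₁ * (a ^ m)⁻¹ + a ^ κ * M₁) := ⟨_, rfl⟩
  have hB1 : 0 ≤ 2 * K * (1 + a ^ κ) := by positivity
  have hB2 : 0 ≤ M₁ * (a ^ m)⁻¹ + a ^ κ * M₁ := by positivity
  have hB0 : 0 ≤ B := by rw [hB]; positivity
  obtain ⟨L, hL⟩ : ∃ L : ℝ, L = B * 4 ^ m * (2 ^ (4 * p) * (4 * p).factorial) := ⟨_, rfl⟩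
  have hL0 : 0 ≤ L := by rw [hL]; positivity
  refine ⟨2 ^ m * L, by positivity, fun z hz hz0 => ?_⟩
  have hzne : z ≠ 0 := fun h => by simp [h] at hz0
  have hzn : 0 < ‖z‖ := norm_pos_iff.2 hzne
  -- The height of `smear_real_defect` for the inner radius `r = s⁴`.
  obtain ⟨Y, hY⟩ : ∃ Y : ℝ → ℝ, Y = fun s => a * s ^ 4 / 2 * (a ^ m * (s ^ 4) ^ (m + p)) ^ 2 :=
    ⟨_, rfl⟩
  have hYs : ∀ s, Y s = a * s ^ 4 / 2 * (a ^ m * (s ^ 4) ^ (m + p)) ^ 2 := fun s => by rw [hY]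
  have hYpos : ∀ s, 0 < s → 0 < Y s := fun s hs => by rw [hYs]; positivity
  have hYle : ∀ s, 0 < s → s ≤ 1 → Y s ≤ 1 / 2 := fun s hs hs1 => by
    have h4 : s ^ 4 ≤ 1 := pow_le_one₀ hs.le hs1
    have h5 : (a ^ m * (s ^ 4) ^ (m + p)) ^ 2 ≤ 1 := pow_le_one₀ (by positivity)
      (mul_le_one₀ (pow_le_one₀ ha.le ha1) (by positivity) (pow_le_one₀ (by positivity) h4))
    rw [hYs]
    calc _ ≤ a * s ^ 4 / 2 * 1 := by gcongr
      _ ≤ 1 * 1 / 2 * 1 := by gcongr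
      _ = _ := by norm_num
  have hYt : Tendsto Y (𝓝[>] 0) (𝓝[>] 0) := by
    refine tendsto_nhdsWithin_iff.2 ⟨?_, ?_⟩
    · have hc : Continuous Y := by rw [hY]; fun_prop
      have h0 : Y 0 = 0 := by rw [hYs]; simp
      have := (hc.tendsto 0).mono_left (nhdsWithin_le_nhds (s := Set.Ioi 0))
      rwa [h0] at this
    · filter_upwards [self_mem_nhdsWithin] with s hs using hYpos s hs
  have haz : ‖(a : ℂ) * z‖ ≤ ‖z‖ := by
    rw [norm_mul, Complex.norm_real, Real.norm_eq_abs, abs_of_pos ha]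
    exact mul_le_of_le_one_left (norm_nonneg _) ha1
  have key : ∀ s : ℝ, 0 < s → s ≤ 1 → s ^ 4 < ‖z‖ →
      ‖smear S ρ (Y s) (a * z) - ((a ^ κ : ℝ) : ℂ) * smear S ρ (Y s) z‖ * ‖1 - z ^ 2‖ ^ m *
      ‖((s ^ 4 : ℝ) : ℂ) ^ 2 - z ^ 2‖ ^ m * (‖z‖ ^ p)⁻¹ * Real.exp (-(s * (invSqrt z).re)) ≤ L := by
    intro s hs hs1 hsz
    rw [hL]
    refine phragmenLindelof_halfAnnulus
      (q := fun z => smear S ρ (Y s) (a * z) - ((a ^ κ : ℝ) : ℂ) * smear S ρ (Y s) z)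
      (η := 2 * Y s) hB0 hs (by linarith [hYpos s hs]) ?_ ?_ ?_ ⟨hsz, by linarith, hz0⟩
    · have hd := differentiableOn_smear hS hρ (hYpos s hs).le
      refine (hd.comp (differentiableOn_id.const_mul (a : ℂ)) fun z hz => ?_).sub
        (hd.const_mul _)
      show ((a : ℂ) * z).im < 2 * Y s
      have hz' : z.im < 2 * Y s := hz
      have e : ((a : ℂ) * z).im = a * z.im := by simp
      rw [e]
      have := hYpos s hs
      rcases le_or_gt z.im 0 with h | h <;> nlinarith
    · intro x hx hx1
      have := smear_real_defect hK hw hb ha ha1 (pow_pos hs 4) (pow_le_one₀ hs.le hs1) hx hx1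
      rw [← hYs] at this
      refine this.trans ?_
      rw [hB]
      gcongr
      linarith
    · intro z hz hz0
      have e : |((a : ℂ) * z).im| = a * |z.im| := by
        rw [show ((a : ℂ) * z).im = a * z.im by simp, abs_mul, abs_of_pos ha]
      have haz : ‖(a : ℂ) * z‖ ≤ ‖z‖ := by
        rw [norm_mul, Complex.norm_real, Real.norm_eq_abs, abs_of_pos ha]
        exact mul_le_of_le_one_left (norm_nonneg _) ha1
      have h1 := norm_smear_le hSb hρ (hYpos s hs).le (hYle s hs hs1) (haz.trans hz)
        (scale_mem ha hz0)
      have h2 := norm_smear_le hSb hρ (hYpos s hs).le (hYle s hs hs1) hz hz0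
      rw [← hM₁] at h1 h2
      have h1' := scale_bound ha h1
      calc _ ≤ (‖smear S ρ (Y s) (a * z)‖ + a ^ κ * ‖smear S ρ (Y s) z‖) * |z.im| ^ m := by
            gcongr
            refine (norm_sub_le _ _).trans ?_
            rw [norm_mul, Complex.norm_real, Real.norm_eq_abs, abs_of_nonneg haκ]
        _ = ‖smear S ρ (Y s) (a * z)‖ * |z.im| ^ m +
            a ^ κ * (‖smear S ρ (Y s) z‖ * |z.im| ^ m) := by ring
        _ ≤ M₁ * (a ^ m)⁻¹ + a ^ κ * M₁ := by gcongr
        _ ≤ B := by rw [hB]; linarith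
  have ht1 := (tendsto_smear hS hSb hρ (haz.trans (by linarith)) (scale_mem ha hz0)).comp hYt
  have ht2 := (tendsto_smear hS hSb hρ (by linarith : ‖z‖ ≤ 1) hz0).comp hYt
  have ht3 : Tendsto (fun s : ℝ => ‖((s ^ 4 : ℝ) : ℂ) ^ 2 - z ^ 2‖ ^ m * (‖z‖ ^ p)⁻¹ *
      Real.exp (-(s * (invSqrt z).re))) (𝓝[>] 0) (𝓝 ((‖z‖ ^ 2) ^ m * (‖z‖ ^ p)⁻¹)) := by
    have hc : Continuous (fun s : ℝ => ‖((s ^ 4 : ℝ) : ℂ) ^ 2 - z ^ 2‖ ^ m * (‖z‖ ^ p)⁻¹ *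
      Real.exp (-(s * (invSqrt z).re))) := by fun_prop
    simpa using (hc.tendsto 0).mono_left (nhdsWithin_le_nhds (s := Set.Ioi 0))
  have ht := (((ht1.sub (ht2.const_mul ((a ^ κ : ℝ) : ℂ))).norm).mul_const (‖1 - z ^ 2‖ ^ m)).mul ht3
  have hlim : ‖smear S ρ 0 (a * z) - ((a ^ κ : ℝ) : ℂ) * smear S ρ 0 z‖ * ‖1 - z ^ 2‖ ^ m *
      ((‖z‖ ^ 2) ^ m * (‖z‖ ^ p)⁻¹) ≤ L := by
    refine le_of_tendsto ht ?_
    have hs4 : ∀ᶠ s : ℝ in 𝓝[>] 0, s ^ 4 < ‖z‖ := by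
      have hc : Continuous fun s : ℝ => s ^ 4 := by fun_prop
      have := (hc.tendsto 0).mono_left (nhdsWithin_le_nhds (s := Set.Ioi 0))
      exact this.eventually (gt_mem_nhds (by simpa using hzn))
    filter_upwards [hs4, Ioc_mem_nhdsGT (show (0 : ℝ) < 1 by norm_num)] with s h1 h2
    refine le_trans (le_of_eq ?_) (key s h2.1 h2.2 h1)
    simp only [Function.comp]
    ring
  have hlow : (1 / 2 : ℝ) ≤ ‖1 - z ^ 2‖ := by
    have h1 := norm_sub_norm_le (1 : ℂ) (z ^ 2)
    rw [norm_one, norm_pow] at h1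
    nlinarith
  have e2 : (‖z‖ ^ 2) ^ m * (‖z‖ ^ p)⁻¹ = (‖z‖ ^ n)⁻¹ := by
    rw [hp, pow_add, pow_mul]
    field_simp
  rw [e2, ← div_eq_mul_inv, div_le_iff₀ (pow_pos hzn n)] at hlim
  have h5 : (1 : ℝ) ≤ 2 ^ m * ‖1 - z ^ 2‖ ^ m := by
    rw [← mul_pow]
    exact one_le_pow₀ (by linarith)
  calc _ ≤ ‖smear S ρ 0 (a * z) - ((a ^ κ : ℝ) : ℂ) * smear S ρ 0 z‖ *
        (2 ^ m * ‖1 - z ^ 2‖ ^ m) := le_mul_of_one_le_right (norm_nonneg _) h5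
    _ = 2 ^ m * (‖smear S ρ 0 (a * z) - ((a ^ κ : ℝ) : ℂ) * smear S ρ 0 z‖ *
        ‖1 - z ^ 2‖ ^ m) := by ring
    _ ≤ 2 ^ m * (L * ‖z‖ ^ n) := by gcongr
    _ = _ := by ring

end Defect

/-! ### Approximately scale-invariant analytic functions. -/

section ScaleInvariance

/-- The open lower half disc of radius `1/2`. -/
def halfDisc : Set ℂ := {z | ‖z‖ < 1 / 2 ∧ z.im < 0}

theorem isOpen_halfDisc : IsOpen halfDisc :=
  (isOpen_lt continuous_norm continuous_const).inter (isOpen_lt Complex.continuous_im continuous_const)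

theorem isPreconnected_halfDisc : IsPreconnected halfDisc := by
  have h : halfDisc = Metric.ball 0 (1 / 2) ∩ {z | z.im < 0} := by
    ext z
    simp [halfDisc]
  rw [h]
  refine ((convex_ball _ _).inter ?_).isPreconnected
  exact convex_halfSpace_lt (f := Complex.im) Complex.imLm.isLinear 0

theorem scale_mem_halfDisc {a : ℝ} (ha : 0 < a) (ha1 : a ≤ 1) {z : ℂ} (hz : z ∈ halfDisc) :
    (a : ℂ) * z ∈ halfDisc := by
  refine ⟨?_, scale_mem ha hz.2⟩
  rw [norm_mul, Complex.norm_real, Real.norm_eq_abs, abs_of_pos ha]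
  exact (mul_le_of_le_one_left (norm_nonneg _) ha1).trans_lt hz.1

/-- Differentiating `v(az) = v(z)` at `a = 1` gives `z v'(z) = 0`. Only `a < 1` is available, so a
one-sided derivative is used. -/
theorem eq_const_of_scale_invariant {v : ℂ → ℂ} (hv : DifferentiableOn ℂ v halfDisc)
    (hinv : ∀ a : ℝ, 0 < a → a < 1 → ∀ z ∈ halfDisc, v (a * z) = v z) :
    ∃ c : ℂ, ∀ z ∈ halfDisc, v z = c := by
  refine isOpen_halfDisc.exists_is_const_of_deriv_eq_zero isPreconnected_halfDisc hv fun z hz => ?_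
  have hzne : z ≠ 0 := fun h => by have := hz.2; simp [h] at this
  have h1 : HasDerivAt v (deriv v z) (((1 : ℝ) : ℂ) * z) := by
    simpa using (hv.differentiableAt (isOpen_halfDisc.mem_nhds hz)).hasDerivAt
  have h2 : HasDerivAt (fun a : ℝ => (a : ℂ) * z) z 1 := by
    simpa using (Complex.ofRealCLM.hasDerivAt (x := (1 : ℝ))).mul_const z
  have h3 : HasDerivWithinAt (fun a : ℝ => v ((a : ℂ) * z)) (z • deriv v z) (Set.Iio 1) 1 :=
    (HasDerivAt.scomp (1 : ℝ) h1 h2).hasDerivWithinAt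
  have h4 : HasDerivWithinAt (fun a : ℝ => v ((a : ℂ) * z)) 0 (Set.Iio 1) 1 := by
    refine (hasDerivWithinAt_const (1 : ℝ) (Set.Iio 1) (v z)).congr_of_eventuallyEq ?_ (by simp)
    filter_upwards [Ioo_mem_nhdsLT (show (0 : ℝ) < 1 by norm_num)] with a ha
    exact hinv a ha.1 ha.2 z hz
  have h5 := (uniqueDiffWithinAt_Iio (1 : ℝ)).eq_deriv _ h3 h4
  exact (smul_eq_zero.1 h5).resolve_left hzne

/-- Along `z, z/2, z/4, …` the increments of `u` are summable, uniformly on the half disc. The limit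
is analytic and scale invariant, hence constant, and the geometric series gives the rate. -/
theorem exists_const_of_scaling_bound {u : ℂ → ℂ} {n : ℕ} (hn : 1 ≤ n)
    (hu : DifferentiableOn ℂ u halfDisc)
    (h : ∀ a : ℝ, 0 < a → a < 1 → ∃ C : ℝ, 0 ≤ C ∧ ∀ z ∈ halfDisc, ‖u (a * z) - u z‖ ≤ C * ‖z‖ ^ n) :
    ∃ (c : ℂ) (K : ℝ), 0 ≤ K ∧ ∀ z ∈ halfDisc, ‖u z - c‖ ≤ K * ‖z‖ ^ n := by
  obtain ⟨C, hC, hCb⟩ := h (1 / 2) (by norm_num) (by norm_num)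
  have hmem : ∀ (j : ℕ) {z : ℂ}, z ∈ halfDisc → (((1 / 2 : ℝ) ^ j : ℝ) : ℂ) * z ∈ halfDisc :=
    fun j z hz => scale_mem_halfDisc (by positivity) (pow_le_one₀ (by norm_num) (by norm_num)) hz
  have hnorm : ∀ (j : ℕ) {z : ℂ}, ‖(((1 / 2 : ℝ) ^ j : ℝ) : ℂ) * z‖ = (1 / 2) ^ j * ‖z‖ :=
    fun j z => by
      rw [norm_mul, Complex.norm_real, Real.norm_eq_abs, abs_of_pos (by positivity)]
  have hpow : ∀ (j : ℕ) {z : ℂ}, z ∈ halfDisc →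
      ‖(((1 / 2 : ℝ) ^ j : ℝ) : ℂ) * z‖ ^ n ≤ ‖z‖ ^ n * (1 / 2) ^ j := fun j z hz => by
    rw [hnorm, mul_pow, mul_comm]
    gcongr
    rw [← pow_mul]
    exact pow_le_pow_of_le_one (by norm_num) (by norm_num) (Nat.le_mul_of_pos_right j hn)
  obtain ⟨a, ha⟩ : ∃ a : ℕ → ℂ → ℂ, a = fun j z => u ((((1 / 2 : ℝ) ^ j : ℝ) : ℂ) * z) := ⟨_, rfl⟩
  have haj : ∀ j z, a j z = u ((((1 / 2 : ℝ) ^ j : ℝ) : ℂ) * z) := fun j z => by rw [ha]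
  have hstep : ∀ z ∈ halfDisc, ∀ j, dist (a j z) (a (j + 1) z) ≤ C * ‖z‖ ^ n * (1 / 2) ^ j := by
    intro z hz j
    rw [dist_comm, dist_eq_norm, haj, haj]
    have e : (((1 / 2 : ℝ) ^ (j + 1) : ℝ) : ℂ) * z =
        ((1 / 2 : ℝ) : ℂ) * ((((1 / 2 : ℝ) ^ j : ℝ) : ℂ) * z) := by
      rw [pow_succ']; push_cast; ring
    rw [e]
    refine (hCb _ (hmem j hz)).trans ?_
    rw [mul_assoc]
    exact mul_le_mul_of_nonneg_left (hpow j hz) hC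
  have hex : ∀ z, ∃ l, z ∈ halfDisc → Tendsto (fun j => a j z) atTop (𝓝 l) := by
    intro z
    by_cases hz : z ∈ halfDisc
    · obtain ⟨l, hl⟩ := cauchySeq_tendsto_of_complete
        (cauchySeq_of_le_geometric (1 / 2) _ (by norm_num) (hstep z hz))
      exact ⟨l, fun _ => hl⟩
    · exact ⟨0, fun h => absurd h hz⟩
  choose v hv using hex
  have hdist : ∀ z ∈ halfDisc, ∀ j, dist (a j z) (v z) ≤ C * ‖z‖ ^ n * (1 / 2) ^ j / (1 - 1 / 2) :=
    fun z hz j => dist_le_of_le_geometric_of_tendsto (1 / 2) _ (by norm_num) (hstep z hz) (hv z hz) j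
  have hunif : TendstoUniformlyOn a v atTop halfDisc := by
    rw [Metric.tendstoUniformlyOn_iff]
    intro ε hε
    have h0 : Tendsto (fun j : ℕ => C * (1 / 2 : ℝ) ^ j / (1 - 1 / 2)) atTop (𝓝 0) := by
      have := ((tendsto_pow_atTop_nhds_zero_of_lt_one (r := (1 / 2 : ℝ)) (by norm_num)
        (by norm_num)).const_mul C).div_const (1 - 1 / 2)
      simpa using this
    filter_upwards [h0.eventually (gt_mem_nhds hε)] with j hj z hz
    rw [dist_comm]
    refine (hdist z hz j).trans_lt (lt_of_le_of_lt ?_ hj)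
    have : ‖z‖ ^ n ≤ 1 := pow_le_one₀ (norm_nonneg _) (by linarith [hz.1])
    have h2 : (0 : ℝ) ≤ 1 - 1 / 2 := by norm_num
    gcongr
    exact mul_le_of_le_one_right hC this
  have hadiff : ∀ j, DifferentiableOn ℂ (a j) halfDisc := fun j => by
    rw [ha]
    exact hu.comp (differentiableOn_id.const_mul _) fun z hz => hmem j hz
  have hvdiff : DifferentiableOn ℂ v halfDisc :=
    hunif.tendstoLocallyUniformlyOn.differentiableOn (Eventually.of_forall hadiff) isOpen_halfDisc
  obtain ⟨c, hc⟩ := eq_const_of_scale_invariant hvdiff fun b hb hb1 z hz => by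
    obtain ⟨C', hC', hCb'⟩ := h b hb hb1
    have h1 := (hv _ (scale_mem_halfDisc hb hb1.le hz)).sub (hv z hz)
    have h2 : Tendsto (fun j => a j (b * z) - a j z) atTop (𝓝 0) := by
      have h0 : Tendsto (fun j : ℕ => C' * (‖z‖ ^ n * (1 / 2 : ℝ) ^ j)) atTop (𝓝 0) := by
        have := ((tendsto_pow_atTop_nhds_zero_of_lt_one (r := (1 / 2 : ℝ)) (by norm_num)
          (by norm_num)).const_mul (‖z‖ ^ n)).const_mul C'
        simpa using this
      refine squeeze_zero_norm (fun j => ?_) h0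
      rw [haj, haj]
      have e : (((1 / 2 : ℝ) ^ j : ℝ) : ℂ) * (b * z) = b * ((((1 / 2 : ℝ) ^ j : ℝ) : ℂ) * z) := by
        ring
      rw [e]
      exact (hCb' _ (hmem j hz)).trans (mul_le_mul_of_nonneg_left (hpow j hz) hC')
    exact sub_eq_zero.1 (tendsto_nhds_unique h1 h2)
  refine ⟨c, 2 * C, by positivity, fun z hz => ?_⟩
  have h1 := hdist z hz 0
  rw [haj, hc z hz, dist_eq_norm, pow_zero, Complex.ofReal_one, one_mul] at h1
  refine h1.trans (le_of_eq ?_)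
  ring

end ScaleInvariance
end
end DilQFT

/-! ### Powers of `iz`, and asymptotics of the averages. -/

namespace DilQFT

noncomputable section

section Power

theorem I_mul_ne_zero {z : ℂ} (hz : z.im < 0) : Complex.I * z ≠ 0 :=
  mul_ne_zero Complex.I_ne_zero fun h => by simp [h] at hz

theorem norm_I_mul_cpow (κ : ℝ) {z : ℂ} (hz : z.im < 0) :
    ‖(Complex.I * z) ^ (κ : ℂ)‖ = ‖z‖ ^ κ := by
  rw [Complex.norm_cpow_of_ne_zero (I_mul_ne_zero hz)]
  simp

theorem I_mul_scale_cpow (κ : ℝ) {a : ℝ} (ha : 0 < a) {z : ℂ} (hz : z.im < 0) :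
    (Complex.I * (a * z)) ^ (κ : ℂ) = ((a ^ κ : ℝ) : ℂ) * (Complex.I * z) ^ (κ : ℂ) := by
  have h0 := I_mul_ne_zero hz
  rw [show Complex.I * (a * z) = a * (Complex.I * z) by ring, Complex.cpow_def_of_ne_zero
    (mul_ne_zero (by exact_mod_cast ha.ne') h0), Complex.cpow_def_of_ne_zero h0,
    Complex.log_ofReal_mul ha h0, add_mul, Complex.exp_add, Real.rpow_def_of_pos ha]
  push_cast
  rfl

theorem differentiableOn_I_mul_cpow (κ : ℝ) :
    DifferentiableOn ℂ (fun z => (Complex.I * z) ^ (κ : ℂ)) {z | z.im < 0} := fun z hz => by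
  have hz' : z.im < 0 := hz
  exact ((differentiableAt_id.const_mul Complex.I).cpow_const
    (I_mul_mem_slitPlane (fun h => by simp [h] at hz') hz'.le)).differentiableWithinAt

theorem rpow_mul_pow_le {κ x : ℝ} {k : ℕ} (hk : |κ| ≤ k) (hx : 0 < x) {R : ℝ} (hxR : x ≤ R) :
    x ^ κ * x ^ k ≤ R ^ (κ + k) := by
  rw [← Real.rpow_natCast, ← Real.rpow_add hx]
  exact Real.rpow_le_rpow hx.le hxR (by linarith [neg_abs_le κ])

theorem hasGrowth_I_mul_cpow {κ : ℝ} {k : ℕ} (hk : |κ| ≤ k) :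
    HasGrowth k fun z => (Complex.I * z) ^ (κ : ℂ) := by
  refine ⟨differentiableOn_I_mul_cpow κ, fun R => ⟨(R + 1) ^ (κ + k), fun z h1 h2 h3 => ?_⟩⟩
  have hz : 0 < ‖z‖ := norm_pos_iff.2 fun h => by simp [h] at h3
  have h4 : ‖z‖ ≤ R + 1 :=
    (Complex.norm_le_abs_re_add_abs_im z).trans (add_le_add h1 (by rw [abs_of_neg h3]; linarith))
  rw [norm_I_mul_cpow κ h3]
  refine le_trans ?_ (rpow_mul_pow_le hk hz h4)
  gcongr
  exact Complex.abs_im_le_norm z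

end Power

section Bump

/-- A nonnegative test function supported in `[1/4, 1/2]`. -/
def dilationBump : ContDiffBump (3 / 8 : ℝ) := ⟨1 / 16, 1 / 8, by norm_num, by norm_num⟩

def dilationCutoff : TestFn :=
  ⟨fun t => (dilationBump t : ℂ), Complex.ofRealCLM.contDiff.comp dilationBump.contDiff,
    dilationBump.hasCompactSupport.comp_left (g := fun x : ℝ => (x : ℂ)) Complex.ofReal_zero⟩

theorem tsupport_dilationBump : tsupport dilationBump = Set.Icc (1 / 4 : ℝ) (1 / 2) := by
  rw [dilationBump.tsupport_eq, Real.closedBall_eq_Icc]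
  norm_num [dilationBump]

theorem tsupport_dilationCutoff : tsupport dilationCutoff.1 ⊆ Set.Icc (1 / 4 : ℝ) (1 / 2) := by
  rw [← tsupport_dilationBump]
  exact closure_mono fun t ht h => ht (by simp [dilationCutoff, h])

theorem continuous_mul_rpow {g : ℝ → ℝ} (hg : Continuous g)
    (hs : tsupport g ⊆ Set.Icc (1 / 4 : ℝ) (1 / 2)) (κ : ℝ) : Continuous fun v => g v * v ^ κ := by
  refine continuous_of_tsupport fun v hv => ?_
  have hv' := hs (closure_mono (Function.support_mul_subset_left _ _) hv)
  exact hg.continuousAt.mul (Real.continuousAt_rpow_const v κ (Or.inl (by linarith [hv'.1])))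

/-- This moment is the factor by which averaging multiplies a homogeneous function of degree `κ`; it
has to be divided out in the end. -/
theorem dilationCutoff_moment (κ : ℝ) :
    MeasureTheory.Integrable (fun v : ℝ => dilationCutoff.1 v * ((v ^ κ : ℝ) : ℂ)) ∧
      ∫ v : ℝ, dilationCutoff.1 v * ((v ^ κ : ℝ) : ℂ) ≠ 0 := by
  have hc := continuous_mul_rpow dilationBump.continuous tsupport_dilationBump.le κ
  have hcs : HasCompactSupport fun v => dilationBump v * v ^ κ :=
    dilationBump.hasCompactSupport.mul_right
  have e : (fun v : ℝ => dilationCutoff.1 v * ((v ^ κ : ℝ) : ℂ)) =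
      fun v => ((dilationBump v * v ^ κ : ℝ) : ℂ) := by
    funext v
    simp [dilationCutoff]
  have hpos : 0 < ∫ v, dilationBump v * v ^ κ := by
    refine hc.integral_pos_of_hasCompactSupport_nonneg_nonzero hcs (fun v => ?_) (x := 3 / 8) ?_
    · by_cases hv : v ∈ tsupport dilationBump
      · rw [tsupport_dilationBump] at hv
        exact mul_nonneg dilationBump.nonneg (Real.rpow_nonneg (by linarith [hv.1]) κ)
      · simp [image_eq_zero_of_notMem_tsupport hv]
    · rw [dilationBump.one_of_mem_closedBall (by simp [dilationBump]), one_mul]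
      exact (Real.rpow_pos_of_pos (by norm_num) κ).ne'
  rw [e]
  refine ⟨(hc.integrable_of_hasCompactSupport hcs).ofReal, ?_⟩
  rw [integral_complex_ofReal]
  exact_mod_cast hpos.ne'

end Bump

section Conclusion

variable {S : ℂ → ℂ} {ρ : TestFn}

/-- The function `(iz)^(-κ)` times the average is nearly scale invariant, hence nearly constant. Of
the order `k + 1 + k` of the defect, the last `k` compensates `|z|^(-κ)`, and `k + 1` remains. -/
theorem smear_zero_asymptotics {m k : ℕ} {κ K D : ℝ} {w : ℝ → ℂ} (hk : |κ| ≤ k) (hK : 0 ≤ K)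
    (hD : 0 ≤ D) (hS : DifferentiableOn ℂ S {z | z.im < 0})
    (hSb : ∀ z : ℂ, ‖z‖ ≤ 2 → -1 ≤ z.im → z.im < 0 → ‖S z‖ * |z.im| ^ m ≤ D)
    (hρ : tsupport ρ.1 ⊆ Set.Icc (1 / 4 : ℝ) (1 / 2))
    (hw : ∀ a x : ℝ, 0 < a → w (a * x) = w x)
    (hb : ∀ x y : ℝ, x ≠ 0 → |x| ≤ 1 → 0 < y → y ≤ |x| / 2 →
        ‖smear S ρ y x - ((|x| ^ κ : ℝ) : ℂ) * w x‖ ≤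
          K * (|x| ^ (2 * m + (k + 1 + k)) + (|x| ^ m)⁻¹ * √(y / |x|))) :
    ∃ (c : ℂ) (M : ℝ), 0 ≤ M ∧ ∀ z ∈ halfDisc,
      ‖smear S ρ 0 z - c * (Complex.I * z) ^ (κ : ℂ)‖ ≤ M * (‖z‖ ^ κ * ‖z‖ ^ (k + 1)) := by
  have hdiff : DifferentiableOn ℂ (smear S ρ 0) {z | z.im < 0} := by
    simpa using differentiableOn_smear hS hρ le_rfl
  obtain ⟨c, M, hM, H⟩ := exists_const_of_scaling_bound
    (u := fun z => (Complex.I * z) ^ ((-κ : ℝ) : ℂ) * smear S ρ 0 z) (n := k + 1) (by omega)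
    (((differentiableOn_I_mul_cpow (-κ)).mul hdiff).mono fun z hz => hz.2)
    fun a ha ha1 => by
      obtain ⟨C, hC, hCb⟩ := smear_defect_bound hK hD hS hSb hρ hw hb ha ha1.le
      refine ⟨a ^ (-κ) * C, by positivity, fun z hz => ?_⟩
      have hzn : 0 < ‖z‖ := norm_pos_iff.2 fun h => by have := hz.2; simp [h] at this
      have haκ : ((a ^ (-κ) : ℝ) : ℂ) * ((a ^ κ : ℝ) : ℂ) = 1 := by
        rw [← Complex.ofReal_mul, ← Real.rpow_add ha, neg_add_cancel, Real.rpow_zero,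
          Complex.ofReal_one]
      rw [I_mul_scale_cpow (-κ) ha hz.2]
      have e : ((a ^ (-κ) : ℝ) : ℂ) * (Complex.I * z) ^ ((-κ : ℝ) : ℂ) * smear S ρ 0 (a * z) -
          (Complex.I * z) ^ ((-κ : ℝ) : ℂ) * smear S ρ 0 z =
          ((a ^ (-κ) : ℝ) : ℂ) * ((Complex.I * z) ^ ((-κ : ℝ) : ℂ) *
            (smear S ρ 0 (a * z) - ((a ^ κ : ℝ) : ℂ) * smear S ρ 0 z)) := by
        linear_combination (Complex.I * z) ^ ((-κ : ℝ) : ℂ) * smear S ρ 0 z * haκ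
      rw [e, norm_mul, norm_mul, norm_I_mul_cpow _ hz.2, Complex.norm_real, Real.norm_eq_abs,
        abs_of_pos (Real.rpow_pos_of_pos ha _), mul_assoc]
      refine mul_le_mul_of_nonneg_left ?_ (Real.rpow_nonneg ha.le _)
      have h1 : ‖z‖ ^ (-κ) * ‖z‖ ^ k ≤ 1 := by
        have := rpow_mul_pow_le (κ := -κ) (by rwa [abs_neg]) hzn (R := 1) (by linarith [hz.1])
        rwa [Real.one_rpow] at this
      calc _ ≤ ‖z‖ ^ (-κ) * (C * ‖z‖ ^ (k + 1 + k)) := by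
            gcongr; exact hCb z hz.1 hz.2
        _ = C * ‖z‖ ^ (k + 1) * (‖z‖ ^ (-κ) * ‖z‖ ^ k) := by rw [pow_add _ (k + 1) k]; ring
        _ ≤ C * ‖z‖ ^ (k + 1) * 1 := by gcongr
        _ = _ := mul_one _
  refine ⟨c, M, hM, fun z hz => ?_⟩
  have h1 : (Complex.I * z) ^ (κ : ℂ) * (Complex.I * z) ^ ((-κ : ℝ) : ℂ) = 1 := by
    rw [Complex.ofReal_neg, Complex.cpow_neg]
    refine mul_inv_cancel₀ ?_
    rw [Complex.cpow_def_of_ne_zero (I_mul_ne_zero hz.2)]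
    exact Complex.exp_ne_zero _
  have e : smear S ρ 0 z - c * (Complex.I * z) ^ (κ : ℂ) = (Complex.I * z) ^ (κ : ℂ) *
      ((Complex.I * z) ^ ((-κ : ℝ) : ℂ) * smear S ρ 0 z - c) := by
    linear_combination -(smear S ρ 0 z) * h1
  rw [e, norm_mul, norm_I_mul_cpow κ hz.2]
  calc _ ≤ ‖z‖ ^ κ * (M * ‖z‖ ^ (k + 1)) := by gcongr; exact H z hz
    _ = _ := by ring

theorem continuous_double_integrand (hS : DifferentiableOn ℂ S {z | z.im < 0})
    (hρ : tsupport ρ.1 ⊆ Set.Icc (1 / 4 : ℝ) (1 / 2)) (f : TestFn) {a y : ℝ} (ha : 0 < a)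
    (hy : 0 < y) :
    Continuous (Function.uncurry fun t v : ℝ =>
      f.1 t * (ρ.1 v * S (v * (a * (t - y * Complex.I))))) := by
  refine continuous_of_tsupport fun q hq => ?_
  have hq2 : q.2 ∈ tsupport ρ.1 := by
    have h1 : tsupport (Function.uncurry fun t v : ℝ =>
      f.1 t * (ρ.1 v * S (v * (a * (t - y * Complex.I))))) ⊆ Prod.snd ⁻¹' tsupport ρ.1 := by
      refine closure_minimal (fun q hq => subset_tsupport _ fun h => hq ?_)
        ((isClosed_tsupport _).preimage continuous_snd)
      simp [Function.uncurry, h]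
    exact h1 hq
  have hpos : 0 < q.2 := by linarith [(hρ hq2).1]
  have h1 : ContinuousAt S (q.2 * (a * (q.1 - y * Complex.I))) := by
    refine hS.continuousOn.continuousAt ((isOpen_lt Complex.continuous_im
      continuous_const).mem_nhds (scale_mem hpos (scale_mem ha ?_)))
    simpa using hy
  exact (f.2.1.continuous.comp continuous_fst).continuousAt.mul
    ((ρ.2.1.continuous.comp continuous_snd).continuousAt.mul
      (ContinuousAt.comp (f := fun q : ℝ × ℝ => (q.2 : ℂ) * (a * (q.1 - y * Complex.I))) h1
        (by fun_prop)))

theorem integral_mul_smear (hS : DifferentiableOn ℂ S {z | z.im < 0})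
    (hρ : tsupport ρ.1 ⊆ Set.Icc (1 / 4 : ℝ) (1 / 2)) (f : TestFn) {a y : ℝ} (ha : 0 < a)
    (hy : 0 < y) :
    MeasureTheory.Integrable (fun v : ℝ =>
      ρ.1 v * ∫ t : ℝ, f.1 t * S ((a * v : ℝ) * (t - y * Complex.I))) ∧
    ∫ t : ℝ, f.1 t * smear S ρ 0 (a * (t - y * Complex.I)) =
      ∫ v : ℝ, ρ.1 v * ∫ t : ℝ, f.1 t * S ((a * v : ℝ) * (t - y * Complex.I)) := by
  have hc := continuous_double_integrand hS hρ f ha hy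
  have hcs : HasCompactSupport (Function.uncurry fun t v : ℝ =>
      f.1 t * (ρ.1 v * S (v * (a * (t - y * Complex.I))))) := by
    refine HasCompactSupport.intro (f.2.2.isCompact.prod ρ.2.2.isCompact) fun q hq => ?_
    by_cases h1 : q.1 ∈ tsupport f.1
    · have h2 : q.2 ∉ tsupport ρ.1 := fun h2 => hq ⟨h1, h2⟩
      simp [Function.uncurry, image_eq_zero_of_notMem_tsupport h2]
    · simp [Function.uncurry, image_eq_zero_of_notMem_tsupport h1]
  have e : ∀ v : ℝ, ∫ t : ℝ, f.1 t * (ρ.1 v * S (v * (a * (t - y * Complex.I)))) =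
      ρ.1 v * ∫ t : ℝ, f.1 t * S ((a * v : ℝ) * (t - y * Complex.I)) := fun v => by
    rw [← MeasureTheory.integral_const_mul]
    refine MeasureTheory.integral_congr_ae (Eventually.of_forall fun t => ?_)
    simp only
    rw [show (v : ℂ) * (a * (t - y * Complex.I)) = (a * v : ℝ) * (t - y * Complex.I) by
      push_cast; ring]
    ring
  have hi := hc.integrable_of_hasCompactSupport hcs (μ := MeasureTheory.volume.prod
    MeasureTheory.volume)
  refine ⟨hi.integral_prod_right.congr (Eventually.of_forall e), ?_⟩
  calc _ = ∫ t : ℝ, ∫ v : ℝ, f.1 t * (ρ.1 v * S (v * (a * (t - y * Complex.I)))) := by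
        refine MeasureTheory.integral_congr_ae (Eventually.of_forall fun t => ?_)
        simp only [smear]
        rw [← MeasureTheory.integral_const_mul]
        simp
    _ = ∫ v : ℝ, ∫ t : ℝ, f.1 t * (ρ.1 v * S (v * (a * (t - y * Complex.I)))) :=
        MeasureTheory.integral_integral_swap_of_hasCompactSupport hc hcs
    _ = _ := MeasureTheory.integral_congr_ae (Eventually.of_forall e)

/-- By Fubini the pairing with the average is the average of pairings of `S` at the scales `a v`,
each close to `(a v)^κ T₀(f)`. The factor `4^m` comes from `v ≥ 1/4`. -/
theorem integral_mul_smear_bound {m p : ℕ} {κ K : ℝ} {τ : ℂ} (hK : 0 ≤ K)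
    (hS : DifferentiableOn ℂ S {z | z.im < 0})
    (hρ : tsupport ρ.1 ⊆ Set.Icc (1 / 4 : ℝ) (1 / 2)) {f : TestFn}
    (hρi : MeasureTheory.Integrable (fun v : ℝ => ρ.1 v * ((v ^ κ : ℝ) : ℂ)))
    (hap : ∀ a y : ℝ, 0 < a → a ≤ 1 → 0 < y → y ≤ 1 / 2 →
      ‖(∫ t : ℝ, f.1 t * S (a * (t - y * Complex.I))) - ((a ^ κ : ℝ) : ℂ) * τ‖ ≤
          K * (a ^ p + (a ^ m)⁻¹ * √y)) {a y : ℝ} (ha : 0 < a) (ha1 : a ≤ 1) (hy : 0 < y)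
    (hy1 : y ≤ 1 / 2) :
    ‖(∫ t : ℝ, f.1 t * smear S ρ 0 (a * (t - y * Complex.I))) -
      ((a ^ κ : ℝ) : ℂ) * τ * ∫ v : ℝ, ρ.1 v * ((v ^ κ : ℝ) : ℂ)‖ ≤
      (∫ v, ‖ρ.1 v‖) * (K * (a ^ p + 4 ^ m * (a ^ m)⁻¹ * √y)) := by
  obtain ⟨h1, h2⟩ := integral_mul_smear hS hρ f ha hy
  rw [h2, ← MeasureTheory.integral_const_mul, ← MeasureTheory.integral_sub h1 (hρi.const_mul _),
    ← MeasureTheory.integral_mul_const]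
  refine MeasureTheory.norm_integral_le_of_norm_le
    ((ρ.2.1.continuous.norm.integrable_of_hasCompactSupport ρ.2.2.norm).mul_const _)
    (Eventually.of_forall fun v => ?_)
  by_cases hv : v ∈ tsupport ρ.1
  · have hv' := hρ hv
    have hv0 : 0 < v := by linarith [hv'.1]
    have hv1 : v ≤ 1 := by linarith [hv'.2]
    have h3 := hap (a * v) y (mul_pos ha hv0) (mul_le_one₀ ha1 hv0.le hv1) hy hy1
    rw [Real.mul_rpow ha.le hv0.le, Complex.ofReal_mul (a ^ κ)] at h3
    have e : ρ.1 v * (∫ t : ℝ, f.1 t * S ((a * v : ℝ) * (t - y * Complex.I))) -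
        ((a ^ κ : ℝ) : ℂ) * τ * (ρ.1 v * ((v ^ κ : ℝ) : ℂ)) =
        ρ.1 v * ((∫ t : ℝ, f.1 t * S ((a * v : ℝ) * (t - y * Complex.I))) -
          ((a ^ κ : ℝ) : ℂ) * ((v ^ κ : ℝ) : ℂ) * τ) := by ring
    rw [e, norm_mul]
    refine mul_le_mul_of_nonneg_left (h3.trans ?_) (norm_nonneg _)
    have h4 : ((a * v) ^ m)⁻¹ ≤ 4 ^ m * (a ^ m)⁻¹ := by
      rw [mul_pow, mul_inv, mul_comm]
      gcongr
      rw [← inv_pow]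
      gcongr
      rw [inv_le_comm₀ hv0 (by norm_num)]
      linarith [hv'.1]
    have h5 : (a * v) ^ p ≤ a ^ p := by
      gcongr
      exact mul_le_of_le_one_right ha.le hv1
    gcongr
  · rw [image_eq_zero_of_notMem_tsupport hv]
    simp

end Conclusion
end
end DilQFT

/-! ### Homogeneous functionals as boundary values. -/

namespace DilQFT

noncomputable section

section HomogeneousBoundaryValue

theorem norm_shift_le {t y : ℝ} (ht : |t| ≤ 1) (hy : 0 < y) (hy1 : y ≤ 1 / 2) :
    ‖(t : ℂ) - y * Complex.I‖ ≤ 3 / 2 := by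
  refine (norm_sub_le _ _).trans ?_
  rw [norm_mul, Complex.norm_I, mul_one, Complex.norm_real, Complex.norm_real, Real.norm_eq_abs,
    Real.norm_eq_abs, abs_of_pos hy]
  linarith

/-- At `z = a ζ` the main term scales like `a^κ` and the error gains at least one more power of `a`.
Since `|κ| ≤ k`, the factor `|ζ|^(κ + k)` is bounded, so the estimate is uniform in the height even
for negative `κ`. -/
theorem norm_pairing_sub_le {F : ℂ → ℂ} {c : ℂ} {M κ : ℝ} {k : ℕ} (hk : |κ| ≤ k) (hM : 0 ≤ M)
    (hF : DifferentiableOn ℂ F {z | z.im < 0})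
    (h : ∀ z ∈ halfDisc, ‖F z - c * (Complex.I * z) ^ (κ : ℂ)‖ ≤ M * (‖z‖ ^ κ * ‖z‖ ^ (k + 1)))
    {f : TestFn} (hf : SupportedIn f 1) {a y : ℝ} (ha : 0 < a) (ha1 : a ≤ 1 / 4) (hy : 0 < y)
    (hy1 : y ≤ 1 / 2) :
    ‖(∫ t : ℝ, f.1 t * F (a * (t - y * Complex.I))) -
      ((a ^ κ : ℝ) : ℂ) * (c * ∫ t : ℝ, f.1 t * (Complex.I * (t - y * Complex.I)) ^ (κ : ℂ))‖ ≤
      (∫ t, ‖f.1 t‖) * (M * (2 : ℝ) ^ (κ + k) * 2) * (a ^ κ * a) := by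
  have i1 := integrable_pairing f (differentiableOn_scale hF ha) hy
  have i2 := integrable_pairing f (differentiableOn_I_mul_cpow κ) hy
  rw [← MeasureTheory.integral_const_mul, ← MeasureTheory.integral_const_mul,
    ← MeasureTheory.integral_sub i1 ((i2.const_mul _).const_mul _), mul_assoc,
    ← MeasureTheory.integral_mul_const]
  refine MeasureTheory.norm_integral_le_of_norm_le
    ((f.2.1.continuous.norm.integrable_of_hasCompactSupport f.2.2.norm).mul_const _)
    (Eventually.of_forall fun t => ?_)
  by_cases ht : t ∈ tsupport f.1
  · obtain ⟨ζ, hζ⟩ : ∃ ζ : ℂ, ζ = t - y * Complex.I := ⟨_, rfl⟩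
    have hn := norm_shift_le (hf.abs_le_one ht) hy hy1
    have him : ((t : ℂ) - y * Complex.I).im < 0 := by simpa using hy
    rw [← hζ] at hn him ⊢
    have hpos : 0 < ‖ζ‖ := norm_pos_iff.2 fun h => by simp [h] at him
    have haz : ‖(a : ℂ) * ζ‖ = a * ‖ζ‖ := by
      rw [norm_mul, Complex.norm_real, Real.norm_eq_abs, abs_of_pos ha]
    have h1 := h (a * ζ) ⟨by rw [haz]; nlinarith, scale_mem ha him⟩
    rw [I_mul_scale_cpow κ ha him, haz, Real.mul_rpow ha.le hpos.le, mul_pow] at h1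
    have e : f.1 t * F (a * ζ) - ((a ^ κ : ℝ) : ℂ) * (c * (f.1 t * (Complex.I * ζ) ^ (κ : ℂ))) =
        f.1 t * (F (a * ζ) - c * (((a ^ κ : ℝ) : ℂ) * (Complex.I * ζ) ^ (κ : ℂ))) := by ring
    rw [e, norm_mul]
    refine mul_le_mul_of_nonneg_left (h1.trans ?_) (norm_nonneg _)
    have h2 := rpow_mul_pow_le hk hpos (by linarith : ‖ζ‖ ≤ 2)
    have h3 : a ^ (k + 1) ≤ a := by
      rw [pow_succ]
      exact mul_le_of_le_one_left ha.le (pow_le_one₀ ha.le (by linarith))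
    calc M * (a ^ κ * ‖ζ‖ ^ κ * (a ^ (k + 1) * ‖ζ‖ ^ (k + 1)))
        = M * (‖ζ‖ ^ κ * ‖ζ‖ ^ k) * ‖ζ‖ * (a ^ κ * a ^ (k + 1)) := by ring
      _ ≤ M * (2 : ℝ) ^ (κ + k) * 2 * (a ^ κ * a) := by
        gcongr
        linarith
  · rw [image_eq_zero_of_notMem_tsupport ht]
    simp

/-- A functional which is homogeneous under dilations and locally a boundary value of an analytic
function up to smooth operator-valued coefficients is a multiple of `(i(t - i0))^κ`. -/
theorem exists_homogeneous_boundaryValue {E : Type*} [NormedAddCommGroup E] [NormedSpace ℂ E]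
    [CompleteSpace E] {X : ℂ → E} {m : ℕ} {C : ℝ} (hC : 0 ≤ C)
    (hX : DifferentiableOn ℂ X {z | z.im < 0})
    (hb : ∀ z : ℂ, -1 ≤ z.im → z.im < 0 → ‖X z‖ * |z.im| ^ m ≤ C) {T₀ : TestFn → ℂ}
    (hg : ∀ n : ℕ, ∃ g : ℝ → StrongDual ℂ E, ContDiff ℝ n g ∧ ∀ f : TestFn,
      Tendsto (fun η : ℝ => ∫ t : ℝ, f.1 t * g t (X (t - η * Complex.I))) (𝓝[>] 0) (𝓝 (T₀ f)))
    {κ : ℝ} (hκ : ∀ (a : ℝ) (ha : 0 < a), a ≤ 1 → ∀ f : TestFn, SupportedIn f 1 →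
      T₀ (rescale a ha f) = ((a ^ κ : ℝ) : ℂ) * T₀ f) :
    ∃ c : ℂ, ∀ f : TestFn, SupportedIn f 1 → ∃ b : ℂ,
      BoundaryValue (fun z => (Complex.I * z) ^ (κ : ℂ)) f.1 b ∧ T₀ f = c * b := by
  obtain ⟨k, hk⟩ := exists_nat_ge |κ|
  obtain ⟨S, D, hD, hS, hSb, hap⟩ := exists_scaling_approximation hC hX hb hg hκ
    (2 * m + (k + 1 + k))
  have hρ := tsupport_dilationCutoff
  obtain ⟨hρi, hρ0⟩ := dilationCutoff_moment κ
  obtain ⟨K, w, hK, hw, hreal⟩ := smear_real_bound hap hρ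
  obtain ⟨c, M, hM, hasym⟩ := smear_zero_asymptotics hk hK hD hS hSb hρ hw hreal
  have hsm : DifferentiableOn ℂ (smear S dilationCutoff 0) {z | z.im < 0} := by
    simpa using differentiableOn_smear hS hρ le_rfl
  obtain ⟨q, hq⟩ : ∃ q, q = ∫ v : ℝ, dilationCutoff.1 v * ((v ^ κ : ℝ) : ℂ) := ⟨_, rfl⟩
  rw [← hq] at hρ0
  refine ⟨c / q, fun f hf => ?_⟩
  obtain ⟨b, hbv⟩ := (hasGrowth_I_mul_cpow hk).exists_boundaryValue f
  refine ⟨b, hbv, ?_⟩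
  obtain ⟨Kf, hKf, hapf⟩ := hap f hf
  obtain ⟨L₁, hL₁⟩ : ∃ L₁, L₁ = (∫ t, ‖f.1 t‖) * (M * (2 : ℝ) ^ (κ + k) * 2) := ⟨_, rfl⟩
  obtain ⟨L₂, hL₂⟩ : ∃ L₂, L₂ = (∫ v, ‖dilationCutoff.1 v‖) * Kf := ⟨_, rfl⟩
  have hL₂0 : 0 ≤ L₂ := by
    rw [hL₂]
    exact mul_nonneg (MeasureTheory.integral_nonneg fun _ => norm_nonneg _) hKf
  -- The same pairing of `f` with the average at scale `a` is close to `a^κ c b` by the asymptotics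
  -- and to `a^κ T₀(f) q` by the averaging. First `y → 0` removes `a^(-m) √y`; division by `a^κ`
  -- then leaves an error of order `a`.
  have key : ∀ a ∈ Set.Ioc (0 : ℝ) (1 / 4), ‖c * b - T₀ f * q‖ ≤ (L₁ + L₂) * a := by
    intro a ha
    have haκ : 0 < a ^ κ := Real.rpow_pos_of_pos ha.1 κ
    have h1 : ∀ y ∈ Set.Ioc (0 : ℝ) (1 / 2),
        ‖((a ^ κ : ℝ) : ℂ) * (c * ∫ t : ℝ, f.1 t * (Complex.I * (t - y * Complex.I)) ^ (κ : ℂ)) -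
          ((a ^ κ : ℝ) : ℂ) * T₀ f * q‖ ≤ L₁ * (a ^ κ * a) +
          L₂ * (a ^ (2 * m + (k + 1 + k)) + 4 ^ m * (a ^ m)⁻¹ * √y) := by
      intro y hy
      have h2 := norm_pairing_sub_le hk hM hsm hasym hf ha.1 ha.2 hy.1 hy.2
      have h3 := integral_mul_smear_bound hKf hS hρ hρi hapf ha.1 (by linarith [ha.2]) hy.1 hy.2
      rw [← hL₁, norm_sub_rev] at h2
      rw [← hq, ← mul_assoc, ← hL₂] at h3
      exact (norm_sub_le_norm_sub_add_norm_sub _ _ _).trans (add_le_add h2 h3)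
    have h4 : Tendsto (fun y : ℝ => L₁ * (a ^ κ * a) +
          L₂ * (a ^ (2 * m + (k + 1 + k)) + 4 ^ m * (a ^ m)⁻¹ * √y)) (𝓝[>] 0)
          (𝓝 (L₁ * (a ^ κ * a) + L₂ * a ^ (2 * m + (k + 1 + k)))) := by
      have hc : Continuous (fun y : ℝ => L₁ * (a ^ κ * a) +
          L₂ * (a ^ (2 * m + (k + 1 + k)) + 4 ^ m * (a ^ m)⁻¹ * √y)) := by fun_prop
      simpa using (hc.tendsto 0).mono_left (nhdsWithin_le_nhds (s := Set.Ioi 0))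
    have hbv' : Tendsto (fun y : ℝ => ∫ t : ℝ, f.1 t * (Complex.I * (t - y * Complex.I)) ^ (κ : ℂ))
      (𝓝[>] 0) (𝓝 b) := hbv
    have h5 := le_of_tendsto_of_tendsto
      ((((hbv'.const_mul c).const_mul ((a ^ κ : ℝ) : ℂ)).sub_const
        (((a ^ κ : ℝ) : ℂ) * T₀ f * q)).norm) h4
      (by filter_upwards [Ioc_mem_nhdsGT (show (0 : ℝ) < 1 / 2 by norm_num)] with y hy using h1 y hy)
    have h6 : a ^ (2 * m + (k + 1 + k)) ≤ a ^ κ * a := by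
      have h7 : a ^ k ≤ a ^ κ := by
        rw [← Real.rpow_natCast]
        exact Real.rpow_le_rpow_of_exponent_ge ha.1 (by linarith [ha.2])
          ((le_abs_self κ).trans hk)
      calc a ^ (2 * m + (k + 1 + k)) ≤ a ^ (k + 1) :=
            pow_le_pow_of_le_one ha.1.le (by linarith [ha.2]) (by omega)
        _ = a ^ k * a := pow_succ _ _
        _ ≤ _ := by have := ha.1; gcongr
    have h8 : ‖((a ^ κ : ℝ) : ℂ) * (c * b) - ((a ^ κ : ℝ) : ℂ) * T₀ f * q‖ =
        a ^ κ * ‖c * b - T₀ f * q‖ := by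
      rw [mul_assoc, ← mul_sub, norm_mul, Complex.norm_real, Real.norm_eq_abs, abs_of_pos haκ]
    rw [h8] at h5
    refine le_of_mul_le_mul_left ?_ haκ
    calc _ ≤ L₁ * (a ^ κ * a) + L₂ * a ^ (2 * m + (k + 1 + k)) := h5
      _ ≤ L₁ * (a ^ κ * a) + L₂ * (a ^ κ * a) := by gcongr
      _ = _ := by ring
  have hzero : ‖c * b - T₀ f * q‖ ≤ 0 := by
    have ht : Tendsto (fun a : ℝ => (L₁ + L₂) * a) (𝓝[>] 0) (𝓝 0) := by
      have hc : Continuous fun a : ℝ => (L₁ + L₂) * a := by fun_prop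
      simpa using (hc.tendsto 0).mono_left (nhdsWithin_le_nhds (s := Set.Ioi 0))
    refine ge_of_tendsto ht ?_
    filter_upwards [Ioc_mem_nhdsGT (show (0 : ℝ) < 1 / 4 by norm_num)] with a ha using key a ha
  rw [norm_le_zero_iff, sub_eq_zero] at hzero
  field_simp
  rw [hzero]

end HomogeneousBoundaryValue
end
end DilQFT

/-! ### Conclusion. -/

namespace DilQFT

noncomputable section

variable {s : ℕ} {𝓗 : Type*} [NormedAddCommGroup 𝓗] [InnerProductSpace ℂ 𝓗] [CompleteSpace 𝓗]
  {N : LocalNet s 𝓗}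

/-- A smooth functional has the form `τ(R · R)`, so for `R = 0` there are no nonzero ones and the
dual space is trivial. -/
theorem LocalNet.finrank_range_ne_one_of_resolvent_eq_zero (hR : N.resolvent = 0)
    (p : N.CDual →ₗ[ℂ] N.CDual) : Module.finrank ℂ (LinearMap.range p) ≠ 1 := by
  have hσ : ∀ σ : N.Smooth, σ = 0 := fun σ => by
    obtain ⟨τ, -, hτ⟩ := (N.mem_smooth.1 σ.2) 1
    refine Subtype.ext (hτ.trans ?_)
    ext A
    rw [hR, pow_one]
    show τ (0 * A * 0) = 0
    simp
  have hp : p = 0 := by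
    refine LinearMap.ext fun φ => Subtype.ext (LinearMap.ext fun σ => ?_)
    rw [hσ σ, (p φ).1.map_zero, (((0 : N.CDual →ₗ[ℂ] N.CDual) φ).1).map_zero]
  rw [hp, LinearMap.range_zero, finrank_bot]
  exact zero_ne_one

theorem boundaryValue_cpow_zero (f : TestFn) :
    BoundaryValue (fun z => (Complex.I * z) ^ ((0 : ℝ) : ℂ)) f.1 (∫ t : ℝ, f.1 t) := by
  simp [BoundaryValue]

theorem Dilations.projected_product (Δ : Dilations N) (hR : N.HasResolvent) {P : N.Product}
    (hP : P ∈ N.PositiveProducts) {T : TestFn →ₗ[ℂ] N.CDual} (hT : N.IsProductDistribution P T)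
    {β : ℝ} (hcov : ∀ (a : ℝ) (ha : 0 < a) (f : TestFn),
      Δ.act a ha (T f) = ((a ^ β : ℝ) : ℂ) • T (rescale a ha f))
    {p : N.CDual →ₗ[ℂ] N.CDual} (hp : N.IsFieldProjector p)
    (hp1 : Module.finrank ℂ (LinearMap.range p) = 1) (hcp : Δ.ProjectorCovariant p) :
    ∃ φ ∈ N.Fields, Δ.FieldCovariant φ ∧ ∃ β : ℝ, ∀ f : TestFn, SupportedIn f 1 →
      ∃ c : ℂ, BoundaryValue (fun z => (Complex.I * z) ^ (β : ℂ)) f.1 c ∧ p (T f) = c • φ := by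
  obtain ⟨φ₀, σ₀, hpφ, hφσ, hpe⟩ := hp.exists_eq hp1
  obtain ⟨β₀, hβ₀, hσ₀⟩ := Δ.exists_covariant hR hp hcp hpφ hφσ hpe
  obtain ⟨m, C, X, hC, hX, hb, hg⟩ := hR.exists_representation hP hT σ₀
  obtain ⟨c, hc⟩ := exists_homogeneous_boundaryValue (T₀ := fun f => (T f).1 σ₀) hC hX hb hg
    (κ := β₀ - β) fun a ha ha1 f hf => Δ.product_rescale hR hP hT hcov hσ₀ ha ha1 hf
  -- The multiple of `φ₀` is a field because it lies in the image of `p`; no linear structure of the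
  -- set of fields is required.
  have hfield : p (c • φ₀) = c • φ₀ := by rw [map_smul, hpφ]
  refine ⟨c • φ₀, hfield ▸ hp.image _, ⟨β₀, fun a ha => ?_⟩, β₀ - β, fun f hf => ?_⟩
  · rw [Δ.act_smul, hβ₀ a ha, smul_comm]
  · obtain ⟨b, hbv, hTb⟩ := hc f hf
    refine ⟨b, hbv, ?_⟩
    rw [hpe, smul_smul, mul_comm b c]
    exact congrArg (· • φ₀) hTb

end
end DilQFT

theorem mainTheorem6 {s : ℕ} {𝓗 : Type*} [NormedAddCommGroup 𝓗] [InnerProductSpace ℂ 𝓗]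
    [CompleteSpace 𝓗] (N : DilQFT.LocalNet s 𝓗) (hN : N.MicroscopicPhaseSpace)
    (Δ : DilQFT.Dilations N)
    (P : N.Product) (hP : P ∈ N.PositiveProducts) (hcP : Δ.ProductCovariant P)
    (p : N.CDual →ₗ[ℂ] N.CDual) (hp : N.IsFieldProjector p)
    (hp1 : Module.finrank ℂ (LinearMap.range p) = 1) (hcp : Δ.ProjectorCovariant p) :
    ∃ φ ∈ N.Fields, Δ.FieldCovariant φ ∧ ∃ β : ℝ,
      ∀ f : DilQFT.TestFn, DilQFT.SupportedIn f 1 →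
        ∃ c : ℂ, DilQFT.BoundaryValue (fun z => (Complex.I * z) ^ (β : ℂ)) f.1 c ∧
          p (N.opd P f) = c • φ := by
  rcases N.hasResolvent_or with hR | hR
  · by_cases h : ∃ T, N.IsProductDistribution P T
    · obtain ⟨β, hcov⟩ := hcP
      have hT : N.IsProductDistribution P (N.opd P) := by
        rw [DilQFT.LocalNet.opd, dif_pos h]
        exact h.choose_spec
      exact Δ.projected_product hR hP hT hcov hp hp1 hcp
    -- Default value of `opd` when no distribution belongs to `P`: both sides vanish for the field
    -- `0`, which is a value of `p`, with exponent `0`.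
    · have h0 : N.opd P = 0 := by rw [DilQFT.LocalNet.opd, dif_neg h]
      refine ⟨0, map_zero p ▸ hp.image 0, ⟨0, fun a ha => ?_⟩, 0, fun f _ =>
        ⟨_, DilQFT.boundaryValue_cpow_zero f, ?_⟩⟩
      · have := Δ.act_smul ha (0 : ℂ) 0
        simpa using this
      · rw [h0, LinearMap.zero_apply, map_zero, smul_zero]
  · exact absurd hp1 (DilQFT.LocalNet.finrank_range_ne_one_of_resolvent_eq_zero hR p)
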